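/- **Setting.** Fix integers $d,q_s,q_t\ge 1$, pairwise distinct reference nodes $\tau_0,\dots,\tau_{q_t}\in(0,1]$ and constants $K,\delta_\Omega,\delta_U>0$, $r<\min\{\delta_\Omega,\delta_U\}$. Consider a time slab $I=(t_0,t_1]$, $\Delta t=t_1-t_0>0$, with nodes $t_i:=t_0+\tau_i\Delta t$ ($i=0,\dots,q_t$) and nodal basis $\ell_i$ of $\mathcal P^{q_t}(I)$, and a finite conforming simplicial mesh $\mathcal T_h$ of closed elements with union $\tilde\Omega\subset\mathbb R^d$ and mesh size $h=\max_T \operatorname{diam} T$, which is shape regular and quasi-uniform: each $T$ contains a ball of radius $h/K$. Let $\phi,\phi_h:\tilde\Omega\times I\to\mathbb R$ and, for a regularity index $\ell$ chosen below, assume: 1. $\phi$ is continuous; $\Omega(t)=\{x\in\tilde\Omega:\phi(x,t)<0\}$ satisfies $|x-y|>\delta_\Omega$ for $x\in\partial\tilde\Omega$, $y\in\partial\Omega(t)$. With $U(t)=\{x\in\operatorname{int}\tilde\Omega:\operatorname{dist}(x,\partial\Omega(t))<\delta_U\}$, on $U=\bigcup_{t\in I}U(t)\times\{t\}$ the function $\phi$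 is $C^\ell$ with all derivatives of order $\le\ell$ bounded by $K$, $|\nabla\phi|\ge K^{-1}$, and $K^{-1}|\epsilon-\tilde\epsilon|\le|\phi(x+\epsilon\nabla\phi(x,t),t)-\phi(x+\tilde\epsilon\nabla\phi(x,t),t)|\le K|\epsilon-\tilde\epsilon|$ whenever $x\in U(t)$, $|\epsilon|,|\tilde\epsilon|\le K^{-1}$ and both displaced points lie in $U(t)$. ($\nabla,D$ are spatial derivatives.) 2. $\phi_h\in W_h^{q_s}\otimes\mathcal P^{q_t}(I)$, where $W_h^k$ is the space of continuous functions on $\tilde\Omega$ that are polynomials of degree $\le k$ on each element, and $$\|D^{m_s}\partial_t^{m_t}(\phi-\phi_h)\|_{\infty,T\times I}\le K(h^{q_s+1-m_s}+\Delta t^{q_t+1-m_t}),\quad (m_s,m_t)\in\{0,\dots,q_s+1\}\times\{0,1\}\cup\{0\}\times\{0,\dots,q_t+1\},$$ for all $T$ with $T\times I\subset U$. Let $\phi^{\rm lin}(\cdot,t)$ be the piecewise linear nodal interpolant of $\phi_h(\cdot,t)$ and $\Omega^{\rm lin}(t)=\{x\in\tilde\Omega:\phi^{\rm lin}(x,t)<0\}$.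 Every point of $\partial\Omega^{\rm lin}(t)$, $t\in I$, has distance at most $r$ to a point of $\partial\Omega(t)$. The *cut elements* are those meeting $\partial\Omega^{\rm lin}(t)$ for some $t\in I$. One of two cases is considered. * *Finite element blending:* $\ell=q_s+q_t+2$, $\Delta t\le Kh$, $b\equiv0$, and the active elements $\mathcal T^\Gamma$ are the cut elements. * *Smooth blending:* $\ell=\max\{q_s,q_t\}+2$, and for some $0<w_b<\min\{\delta_\Omega,\delta_U\}$ and $\epsilon_0>0$: $\Delta t^{q_t+1}\le Kh^{1+\epsilon_0}$; $b:\tilde\Omega\times I\to[0,1]$ is $C^\ell$ on $\operatorname{int}\tilde\Omega\times I$ with derivatives of order $\le\ell$ bounded by $K$; $b=0$ on cut elements for all $t\in I$; $b(x,t)=1$ if $x$ has distance more than $w_b$ to $\partial\Omega^{\rm lin}(t)$. Active are the elements $T$ with $b(x,t)<1$ for some $x\in T$, $t\in I$. Let $\Omega^\Gamma$ be the union of the active elements. **Ideal mapping.** For $x\in\Omega^\Gamma$, $t\in I$ let $d(x,t)$ be the number $\alpha$ of smallest absolute value with $x+\alpha\nabla\phi(x,t)\in\tilde\Omega$ and $\phi(x+\alpha\nabla\phi(x,t),t)=(1-b)\phi^{\rm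 lin}(x,t)+b\,\phi(x,t)$, $b=b(x,t)$; set $\Psi^\Gamma(x,t)=x+d(x,t)\nabla\phi(x,t)$. **Discrete mapping.** Let $P_h$ be the Oswald-type interpolation on $\Omega^\Gamma$: from an elementwise given function it produces the continuous piecewise polynomial function of degree $q_s$ whose value at each Lagrange node is the average of the values from all active elements sharing the node. For $T\in\mathcal T^\Gamma$ let $\phi_{h,i}=\phi_h(\cdot,t_i)$, $\mathcal E_T\phi_{h,i}$ the polynomial extension of $\phi_{h,i}|_T$, and on $T$ let $G_{h,i}=\nabla\phi_{h,i}|_T$ or (for all $T$, $i$) $G_{h,i}=P_h\nabla\phi_{h,i}$. For $x\in T$ let $d_{h,i}(x)$ be the number $\alpha$ of smallest absolute value with $\mathcal E_T\phi_{h,i}(x+\alpha G_{h,i}(x))=(1-b)\phi^{\rm lin}(x,t_i)+b\,\phi_{h,i}(x)$, $b=b(x,t_i)$, and $\Psi^\Gamma_{h,i}=\mathrm{id}+d_{h,i}G_{h,i}$ on $T$. Set $\Theta_h^\Gamma(x,t)=\sum_{i=0}^{q_t}\ell_i(t)(P_h\Psi^\Gamma_{h,i})(x)$. **Extension.** $\Psi$,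 $\Theta_h$ are obtained from $\Psi^\Gamma$, $\Theta_h^\Gamma$ by extension to $\tilde\Omega\times I$. Smooth blending: by the identity $x$ outside $\Omega^\Gamma$. Finite element blending: on a non-active $T$, a map $P=P(\cdot,t)$ is extended by $\mathrm{id}+\mathcal E_T(P-\mathrm{id})$, where $\mathcal E_T w=\sum_{j=0}^{d-1}\sum_F L_F(w-w_{j-1})$, the inner sum being over the $j$-dimensional faces $F$ of $T$ contained in $\Omega^\Gamma$ and $w_{j-1}$ denoting the part of the sum from faces of dimension $<j$ ($w_{-1}=0$), with $$L_Fg=\sum_{l=1}^{q_s}\omega^l\,(\Lambda_lg-\Lambda_{l-1}g)\circ Z+\omega^{q_s+1}(g-\Lambda_{q_s}g)\circ Z .$$ Here $\omega=\sum_{v\in F}\lambda_v$ is the sum of the barycentric coordinates of $T$ over the vertices $v$ of $F$, $Z=\omega^{-1}\sum_{v\in F}\lambda_v v$ is the projection to $F$, $\Lambda_l$ is the Lagrange interpolation of degree $l$ on $F$ for $l\geq 1$, and $\Lambda_0:=0$. Lagrange nodes of degree $k$ are the points with barycentric coordinates in $\frac1k\mathbb Z_{\ge0}$. (Elements not touching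 $\Omega^\Gamma$ are left fixed.) **Theorem.** There are $C,\eta>0$, depending only on $d,q_s,q_t,(\tau_i),K,\delta_\Omega,\delta_U,r$ (and, for the smooth blending, on $w_b,\epsilon_0$), such that for all data as above with $h\le\eta$ and $\Delta t\le\eta$ the mappings $\Psi,\Theta_h$ are differentiable in $t$ on $\tilde\Omega\times I$ and differentiable in $x$ in the interior of every element for every $t\in I$, and $$\|\Theta_h-\Psi\|_{\infty,\tilde\Omega\times I}+\Delta t\,\|\partial_t\Theta_h-\partial_t\Psi\|_{\infty,\tilde\Omega\times I}\le C\,(h^{q_s+1}+\Delta t^{q_t+1}).$$ For the smooth blending, $$\sup_{t\in I}\|\nabla\Theta_h(\cdot,t)-\nabla\Psi(\cdot,t)\|_{\infty}\le C\,(h^{q_s}+\Delta t^{q_t+1}).$$ For the finite element blending, $$h\,\sup_{t\in I}\|\nabla\Theta_h(\cdot,t)-\nabla\Psi(\cdot,t)\|_{\infty}\le C\,(h^{q_s+1}+\Delta t^{q_t+1}),\qquad \sup_{t\in I}\|\nabla\Theta_h(\cdot,t)-\nabla\Psi(\cdot,t)\|_{\infty}\le C\,(h^{q_s}+\Delta t^{q_t}).$$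 The gradient norms are taken over the interiors of all elements. -/

import Mathlib

noncomputable section

open Set Finset
open scoped BigOperators Classical

/-- The spatial Euclidean space `ℝ^d`. -/
abbrev Pt (d : ℕ) : Type := EuclideanSpace ℝ (Fin d)

/-! ## Simplices, Lagrange interpolation -/

/-- A nondegenerate `d`-simplex, given by its `d + 1` affinely independent vertices; `T.coord v` is
the barycentric coordinate of the vertex number `v`, an affine function on all of `ℝ^d`. -/
abbrev Cell (d : ℕ) : Type := AffineBasis (Fin (d + 1)) ℝ (Pt d)

namespace Cell

variable {d : ℕ} {F : Type*} [AddCommGroup F] [Module ℝ F]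

/-- The closed simplex. -/
def body (T : Cell d) : Set (Pt d) := convexHull ℝ (Set.range T)

/-- The closed face spanned by the vertices with numbers in `σ`. -/
def face (T : Cell d) (σ : Finset (Fin (d + 1))) : Set (Pt d) := convexHull ℝ (T '' (σ : Set (Fin (d + 1))))

/-- The point of the principal lattice of order `k` with barycentric coordinates `α / k`. -/
def node (T : Cell d) (k : ℕ) (α : Fin (d + 1) → ℕ) : Pt d :=
  ∑ v, ((α v : ℝ) / (k : ℝ)) • T v

/-- The Lagrange basis polynomial of degree `k` belonging to the lattice point `α` (`∑ α = k`),
as a polynomial on all of `ℝ^d`. -/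
def shape (T : Cell d) (k : ℕ) (α : Fin (d + 1) → ℕ) (x : Pt d) : ℝ :=
  ∏ v, ∏ m ∈ Finset.range (α v), ((k : ℝ) * T.coord v x - (m : ℝ)) / ((m : ℝ) + 1)

/-- Nodal interpolation of degree `k` on `T`. If `f` is on `T` a polynomial of degree at most
`k`, then `T.interp k f` is its polynomial extension to all of `ℝ^d`. -/
def interp (T : Cell d) (k : ℕ) (f : Pt d → F) (x : Pt d) : F :=
  ∑ α ∈ Finset.piAntidiag (Finset.univ : Finset (Fin (d + 1))) k,
    T.shape k α x • f (T.node k α)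

/-- Nodal interpolation of degree `l` on the face `σ`, with the convention that it is zero for
`l = 0`. -/
def faceInterp (T : Cell d) (σ : Finset (Fin (d + 1))) (l : ℕ) (f : Pt d → F) (x : Pt d) : F :=
  if l = 0 then 0 else ∑ α ∈ Finset.piAntidiag σ l, T.shape l α x • f (T.node l α)

/-- The weight of the face `σ`: sum of the barycentric coordinates of its vertices. -/
def weight (T : Cell d) (σ : Finset (Fin (d + 1))) (x : Pt d) : ℝ := ∑ v ∈ σ, T.coord v x

/-- The projection of the simplex to the face `σ`, defined where the weight is nonzero. -/
def proj (T : Cell d) (σ : Finset (Fin (d + 1))) (x : Pt d) : Pt d :=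
  (T.weight σ x)⁻¹ • ∑ v ∈ σ, T.coord v x • T v

/-- Lifting of a function `g` given on the face `σ` (and zero on the boundary of the face) to the
simplex: `∑_{l=1}^k ω^l (Λ_l g - Λ_{l-1} g) ∘ Z + ω^{k+1} (g - Λ_k g) ∘ Z`. For a face of positive
dimension the term `l = 1` vanishes; for a vertex only this term is present, and it is the linear
hat function times the value of `g`. -/
def lift (k : ℕ) (T : Cell d) (σ : Finset (Fin (d + 1))) (g : Pt d → F) (x : Pt d) : F :=
  (∑ l ∈ Finset.Icc 1 k, T.weight σ x ^ l •
      (T.faceInterp σ l g (T.proj σ x) - T.faceInterp σ (l - 1) g (T.proj σ x)))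
    + T.weight σ x ^ (k + 1) • (g (T.proj σ x) - T.faceInterp σ k g (T.proj σ x))

/-- Extension into `T` of the values of `w` on those faces of `T` that lie in the set `Γ`:
first the vertices, then the corrections from the edges, then those from the two-dimensional
faces, and so on, up to faces with `j` vertices. -/
def blend (k : ℕ) (T : Cell d) (Γ : Set (Pt d)) (w : Pt d → F) : ℕ → Pt d → F
  | 0 => fun _ => 0
  | j + 1 => fun x => blend k T Γ w j x +
      ∑ σ ∈ (Finset.univ : Finset (Finset (Fin (d + 1)))).filter
          (fun σ => σ.card = j + 1 ∧ T.face σ ⊆ Γ),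
        T.lift k σ (fun y => w y - blend k T Γ w j y) x

end Cell

/-! ## Meshes and finite element functions -/

/-- A finite conforming simplicial mesh: two elements meet in their common face, and distinct
elements have distinct vertex sets. -/
structure Mesh (d : ℕ) where
  card : ℕ
  cell : Fin card → Cell d
  vertices_injective : Function.Injective fun T => Set.range (cell T)
  conforming : ∀ T T', (cell T).body ∩ (cell T').body =
    convexHull ℝ (Set.range (cell T) ∩ Set.range (cell T'))

namespace Mesh

variable {d : ℕ} (M : Mesh d)

/-- The closed element number `T`. -/
def elem (T : Fin M.card) : Set (Pt d) := (M.cell T).body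

/-- The union of a family of elements. -/
def region (A : Set (Fin M.card)) : Set (Pt d) := ⋃ T ∈ A, M.elem T

/-- The (closed, polyhedral) background domain. -/
def domain : Set (Pt d) := M.region Set.univ

/-- The mesh size: the largest diameter of an element. -/
def size : ℝ := ⨆ T, Metric.diam (M.elem T)

/-- Shape regularity and quasi-uniformity with constant `K`: every element contains a ball of
radius `h / K`. -/
def QuasiUniform (K : ℝ) : Prop := ∀ T, ∃ c, Metric.ball c (M.size / K) ⊆ M.elem T

/-- Continuous functions on the background domain that are polynomials of degree at most `k` on
every element. -/
def IsFE (k : ℕ) (v : Pt d → ℝ) : Prop :=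
  ContinuousOn v M.domain ∧
    ∀ T, ∃ p : MvPolynomial (Fin d) ℝ, p.totalDegree ≤ k ∧
      ∀ x ∈ M.elem T, v x = MvPolynomial.eval (fun i => x i) p

/-- The continuous piecewise linear nodal interpolant on the background domain. -/
def linInterp (v : Pt d → ℝ) (x : Pt d) : ℝ :=
  if hx : ∃ T, x ∈ M.elem T then (M.cell hx.choose).interp 1 v x else 0

/-- The elements of `A` having `z` among their finite element nodes of order `k`. -/
def nodeStar (k : ℕ) (A : Set (Fin M.card)) (z : Pt d) : Finset (Fin M.card) :=
  (Finset.univ : Finset (Fin M.card)).filter fun T => T ∈ A ∧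
    ∃ α ∈ Finset.piAntidiag (Finset.univ : Finset (Fin (d + 1))) k, (M.cell T).node k α = z

/-- Local average at `z` of an elementwise given function `w` over the elements of `A` sharing the
node `z`. -/
def nodeAverage (k : ℕ) (A : Set (Fin M.card)) (w : Fin M.card → Pt d → Pt d) (z : Pt d) : Pt d :=
  ((M.nodeStar k A z).card : ℝ)⁻¹ • ∑ T ∈ M.nodeStar k A z, w T z

/-- The Oswald-type averaged interpolation of order `k` of an elementwise given function `w`: the
continuous finite element function on the region of `A` whose nodal values are the averages. -/
def oswald (k : ℕ) (A : Set (Fin M.card)) (w : Fin M.card → Pt d → Pt d) (x : Pt d) : Pt d :=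
  if hx : ∃ T, T ∈ A ∧ x ∈ M.elem T then
    (M.cell hx.choose).interp k (M.nodeAverage k A w) x else x

/-- Finite element blending of a map `P` given on the region of the active elements `A`: outside of
that region it is the identity plus the extension of the face values of `P - id`. (On elements that
do not touch the region of `A` there are no such faces, and the result is the identity.) -/
def extendFE (k : ℕ) (A : Set (Fin M.card)) (P : Pt d → Pt d) (x : Pt d) : Pt d :=
  if x ∈ M.region A then P x
  else if hx : ∃ T, x ∈ M.elem T then
    x + (M.cell hx.choose).blend k (M.region A) (fun y => P y - y) d x
  else x

/-- Trivial extension by the identity outside of the region of the active elements. -/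
def extendId (A : Set (Fin M.card)) (P : Pt d → Pt d) (x : Pt d) : Pt d :=
  if x ∈ M.region A then P x else x

end Mesh

/-! ## The data on one time slab -/

/-- A time slab `(t₀, t₁]` with a mesh, a level set function `φ` and a discrete level set function
`φh`. -/
structure Slab (d : ℕ) where
  mesh : Mesh d
  t₀ : ℝ
  t₁ : ℝ
  φ : Pt d → ℝ → ℝ
  φh : Pt d → ℝ → ℝ

/-- The two choices of the discrete search direction: the elementwise gradient of the discrete level
set function, or its Oswald-type average. -/
inductive SearchDirection
  | gradient
  | averaged

/-- The number of smallest absolute value with the property `P`. -/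
def smallest (P : ℝ → Prop) : ℝ :=
  if h : ∃ α, P α ∧ ∀ β, P β → |α| ≤ |β| then h.choose else 0

namespace Slab

variable {d : ℕ} (S : Slab d)

/-- The time interval. -/
def I : Set ℝ := Set.Ioc S.t₀ S.t₁

/-- The time step size. -/
def dt : ℝ := S.t₁ - S.t₀

/-- The mesh size. -/
def h : ℝ := S.mesh.size

/-- The exact domain at time `t`. -/
def Ω (t : ℝ) : Set (Pt d) := {x | x ∈ S.mesh.domain ∧ S.φ x t < 0}

/-- The spatial neighbourhood of width `δ` of the boundary of the exact domain at time `t`. -/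
def U (δ : ℝ) (t : ℝ) : Set (Pt d) :=
  {x | x ∈ interior S.mesh.domain ∧ ∃ y ∈ frontier (S.Ω t), dist x y < δ}

/-- The space-time neighbourhood. -/
def Ust (δ : ℝ) : Set (Pt d × ℝ) := {p | p.2 ∈ S.I ∧ p.1 ∈ S.U δ p.2}

/-- The elements contained in the neighbourhood for all times of the slab. -/
def meshU (δ : ℝ) : Set (Fin S.mesh.card) := {T | ∀ t ∈ S.I, S.mesh.elem T ⊆ S.U δ t}

/-- The level set function that is piecewise linear in space. -/
def φlin (x : Pt d) (t : ℝ) : ℝ := S.mesh.linInterp (fun y => S.φh y t) x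

/-- The domain described by the piecewise linear level set function. -/
def Ωlin (t : ℝ) : Set (Pt d) := {x | x ∈ S.mesh.domain ∧ S.φlin x t < 0}

/-- The cut elements. -/
def cut : Set (Fin S.mesh.card) :=
  {T | ∃ t ∈ S.I, (frontier (S.Ωlin t) ∩ S.mesh.elem T).Nonempty}

/-- The elements on which the blending function is somewhere smaller than one. -/
def unblended (b : Pt d → ℝ → ℝ) : Set (Fin S.mesh.card) :=
  {T | ∃ t ∈ S.I, ∃ x ∈ S.mesh.elem T, b x t < 1}

/-! ### Assumptions -/

/-- The assumptions on the geometry, with regularity index `ℓ`. Here `K` bounds all constants. -/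
structure GeometryAssumption (ℓ : ℕ) (K δΩ δU : ℝ) : Prop where
  time : S.t₀ < S.t₁
  quasiUniform : S.mesh.QuasiUniform K
  separated : ∀ t ∈ S.I, ∀ x ∈ frontier S.mesh.domain, ∀ y ∈ frontier (S.Ω t), δΩ < dist x y
  continuous : ContinuousOn (Function.uncurry S.φ) (S.mesh.domain ×ˢ S.I)
  smooth : ContDiffOn ℝ ℓ (Function.uncurry S.φ) (S.Ust δU)
  bounded : ∀ k ≤ ℓ, ∀ p ∈ S.Ust δU,
    ‖iteratedFDerivWithin ℝ k (Function.uncurry S.φ) (S.Ust δU) p‖ ≤ K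
  gradient_lower : ∀ p ∈ S.Ust δU, K⁻¹ ≤ ‖gradient (fun y => S.φ y p.2) p.1‖
  /-- the weak signed distance property, for displacements that stay in the neighbourhood -/
  signedDistance : ∀ t ∈ S.I, ∀ x ∈ S.U δU t, ∀ ε ε' : ℝ, |ε| ≤ K⁻¹ → |ε'| ≤ K⁻¹ →
    x + ε • gradient (fun y => S.φ y t) x ∈ S.U δU t →
    x + ε' • gradient (fun y => S.φ y t) x ∈ S.U δU t →
    K⁻¹ * |ε - ε'| ≤ |S.φ (x + ε • gradient (fun y => S.φ y t) x) t
        - S.φ (x + ε' • gradient (fun y => S.φ y t) x) t| ∧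
    |S.φ (x + ε • gradient (fun y => S.φ y t) x) t
        - S.φ (x + ε' • gradient (fun y => S.φ y t) x) t| ≤ K * |ε - ε'|

/-- The assumptions on the discrete level set function: it belongs to the tensor product finite
element space of order `(qs, qt)`, it approximates `φ` on the elements of the neighbourhood,
and its piecewise linear interface has distance at most `r` to the exact one. -/
structure DiscreteAssumption (qs qt : ℕ) (K δU r : ℝ) : Prop where
  tensor : ∃ c : Fin (qt + 1) → Pt d → ℝ, (∀ i, S.mesh.IsFE qs (c i)) ∧
    ∀ x ∈ S.mesh.domain, ∀ t ∈ S.I, S.φh x t = ∑ i, c i x * t ^ (i : ℕ)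
  accurate : ∀ ms mt : ℕ, ((ms ≤ qs + 1 ∧ mt ≤ 1) ∨ (ms = 0 ∧ mt ≤ qt + 1)) →
    ∀ T ∈ S.meshU δU, ∀ x ∈ interior (S.mesh.elem T), ∀ t ∈ S.I,
      ‖iteratedFDeriv ℝ ms
          (fun y => iteratedDerivWithin mt (fun s => S.φ y s - S.φh y s) S.I t) x‖
        ≤ K * (S.h ^ (qs + 1 - ms) + S.dt ^ (qt + 1 - mt))
  interface : ∀ t ∈ S.I, ∀ x ∈ frontier (S.Ωlin t), ∃ y ∈ frontier (S.Ω t), dist x y ≤ r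

/-- The assumptions on the blending function in the case of the smooth blending with width `w`. -/
structure BlendingAssumption (ℓ : ℕ) (K w : ℝ) (b : Pt d → ℝ → ℝ) : Prop where
  range : ∀ x ∈ S.mesh.domain, ∀ t ∈ S.I, b x t ∈ Set.Icc (0 : ℝ) 1
  smooth : ContDiffOn ℝ ℓ (Function.uncurry b) (interior S.mesh.domain ×ˢ S.I)
  bounded : ∀ k ≤ ℓ, ∀ p ∈ interior S.mesh.domain ×ˢ S.I,
    ‖iteratedFDerivWithin ℝ k (Function.uncurry b) (interior S.mesh.domain ×ˢ S.I) p‖ ≤ K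
  zero_on_cut : ∀ x ∈ S.mesh.region S.cut, ∀ t ∈ S.I, b x t = 0
  one_away : ∀ t ∈ S.I, ∀ x ∈ S.mesh.domain,
    (∀ y ∈ frontier (S.Ωlin t), w < dist x y) → b x t = 1

/-! ### The ideal mapping on the active elements -/

/-- The distance function of the ideal mapping. -/
def distΓ (b : Pt d → ℝ → ℝ) (x : Pt d) (t : ℝ) : ℝ :=
  smallest fun α => x + α • gradient (fun y => S.φ y t) x ∈ S.mesh.domain ∧
    S.φ (x + α • gradient (fun y => S.φ y t) x) t
      = (1 - b x t) * S.φlin x t + b x t * S.φ x t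

/-- The ideal mapping on the active elements. -/
def ΨΓ (b : Pt d → ℝ → ℝ) (x : Pt d) (t : ℝ) : Pt d :=
  x + S.distΓ b x t • gradient (fun y => S.φ y t) x

/-! ### The discrete mapping on the active elements -/

/-- The time nodes, images of the reference nodes `τ` in `(0, 1]`. -/
def timeNode {qt : ℕ} (τ : Fin (qt + 1) → ℝ) (i : Fin (qt + 1)) : ℝ := S.t₀ + S.dt * τ i

/-- The nodal basis of the polynomials of degree at most `qt` in time. -/
def timeBasis {qt : ℕ} (τ : Fin (qt + 1) → ℝ) (i : Fin (qt + 1)) (t : ℝ) : ℝ :=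
  (Lagrange.basis Finset.univ (S.timeNode τ) i).eval t

/-- The polynomial extension of the discrete level set function at time `t` from the element `T`. -/
def φhExt (qs : ℕ) (T : Fin S.mesh.card) (t : ℝ) : Pt d → ℝ :=
  (S.mesh.cell T).interp qs fun y => S.φh y t

/-- The discrete search direction at time `t` on the element `T`. -/
def Gh (qs : ℕ) (g : SearchDirection) (A : Set (Fin S.mesh.card)) (t : ℝ)
    (T : Fin S.mesh.card) (x : Pt d) : Pt d :=
  match g with
  | .gradient => _root_.gradient (S.φhExt qs T t) x
  | .averaged => S.mesh.oswald qs A (fun T' => _root_.gradient (S.φhExt qs T' t)) x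

/-- The discrete distance function at time `t` on the element `T`. -/
def distH (qs : ℕ) (g : SearchDirection) (A : Set (Fin S.mesh.card)) (b : Pt d → ℝ → ℝ) (t : ℝ)
    (T : Fin S.mesh.card) (x : Pt d) : ℝ :=
  smallest fun α => S.φhExt qs T t (x + α • S.Gh qs g A t T x)
    = (1 - b x t) * S.φlin x t + b x t * S.φh x t

/-- The elementwise discrete mapping at time `t`. -/
def ΨhΓ (qs : ℕ) (g : SearchDirection) (A : Set (Fin S.mesh.card)) (b : Pt d → ℝ → ℝ) (t : ℝ)
    (T : Fin S.mesh.card) (x : Pt d) : Pt d :=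
  x + S.distH qs g A b t T x • S.Gh qs g A t T x

/-- The discrete mapping on the active elements `A`, continuous in space by averaging and a
polynomial in time. -/
def ΘΓ (qs : ℕ) {qt : ℕ} (τ : Fin (qt + 1) → ℝ) (g : SearchDirection)
    (A : Set (Fin S.mesh.card)) (b : Pt d → ℝ → ℝ) (x : Pt d) (t : ℝ) : Pt d :=
  ∑ i, S.timeBasis τ i t • S.mesh.oswald qs A (S.ΨhΓ qs g A b (S.timeNode τ i)) x

/-! ### Global mappings -/

/-- The ideal mapping, smooth blending. -/
def ΨSmooth (b : Pt d → ℝ → ℝ) (x : Pt d) (t : ℝ) : Pt d :=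
  S.mesh.extendId (S.unblended b) (fun y => S.ΨΓ b y t) x

/-- The discrete mapping, smooth blending. -/
def ΘSmooth (qs : ℕ) {qt : ℕ} (τ : Fin (qt + 1) → ℝ) (g : SearchDirection)
    (b : Pt d → ℝ → ℝ) (x : Pt d) (t : ℝ) : Pt d :=
  S.mesh.extendId (S.unblended b) (fun y => S.ΘΓ qs τ g (S.unblended b) b y t) x

/-- The ideal mapping, finite element blending. -/
def ΨFE (qs : ℕ) (x : Pt d) (t : ℝ) : Pt d :=
  S.mesh.extendFE qs S.cut (fun y => S.ΨΓ (fun _ _ => 0) y t) x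

/-- The discrete mapping, finite element blending. -/
def ΘFE (qs : ℕ) {qt : ℕ} (τ : Fin (qt + 1) → ℝ) (g : SearchDirection) (x : Pt d) (t : ℝ) : Pt d :=
  S.mesh.extendFE qs S.cut (fun y => S.ΘΓ qs τ g S.cut (fun _ _ => 0) y t) x

/-! ### Error bounds -/

/-- `Θ` and `Ψ` have time derivatives on the whole space-time slab, and
`‖Θ - Ψ‖_∞ + Δt ‖∂ₜΘ - ∂ₜΨ‖_∞ ≤ R` there (the two suprema are taken independently). -/
def SupBound (Θ Ψ : Pt d → ℝ → Pt d) (R : ℝ) : Prop :=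
  (∀ x ∈ S.mesh.domain, ∀ t ∈ S.I,
    DifferentiableWithinAt ℝ (Θ x) S.I t ∧ DifferentiableWithinAt ℝ (Ψ x) S.I t) ∧
  ∀ x ∈ S.mesh.domain, ∀ t ∈ S.I, ∀ y ∈ S.mesh.domain, ∀ s ∈ S.I,
    ‖Θ x t - Ψ x t‖ + S.dt * ‖derivWithin (Θ y) S.I s - derivWithin (Ψ y) S.I s‖ ≤ R

/-- For all times of the slab, `Θ` and `Ψ` are differentiable in space inside every element, and
there `c * ‖∇Θ - ∇Ψ‖ ≤ R`. -/
def GradBound (c : ℝ) (Θ Ψ : Pt d → ℝ → Pt d) (R : ℝ) : Prop :=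
  ∀ t ∈ S.I, ∀ T, ∀ x ∈ interior (S.mesh.elem T),
    DifferentiableAt ℝ (fun y => Θ y t) x ∧ DifferentiableAt ℝ (fun y => Ψ y t) x ∧
    c * ‖fderiv ℝ (fun y => Θ y t) x - fderiv ℝ (fun y => Ψ y t) x‖ ≤ R

end Slab

end

/-! ### Calculus of functions with explicitly bounded derivatives -/

section BoundedDerivatives

set_option maxSynthPendingDepth 3

open Set Filter Topology

/-! Write `err₀ = h^(qs+1) + Δt^(qt+1)` and `err₁ = h^qs + Δt^(qt+1)`. For small `h` and `Δt` every
active element lies, for all times of the slab, well inside the neighbourhood where `φ` is smooth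
(`signs_persist`, `activeElem_of_dist_le`, `exists_interface_close`). There the ideal mapping is `x
+ V(x, t, σ)`, where `V` moves `x` along `∇φ(x, t)` until `φ` has changed by the shift `σ = (1 -
b)(φlin - φ)`. An implicit function theorem with explicit bounds (`BddDerivOn.implicit`) shows that
`V` has bounded derivatives on a domain independent of the mesh.

The shift is not uniformly smooth, because `φlin` interpolates `φh`. Interpolating `φ` instead gives
`smoothShift`. The remainder has size `err₀`, spatial slope `err₁` and time derivative `err₀ / Δt`,
and `V` passes these orders on (`exists_ideal_error`). For the smooth part the usual interpolation
estimates in space and time hold; they rest on the reproduction of polynomials, which for the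
lattice of a simplex is a Chu-Vandermonde identity. One point needs care: the spatial gradient of
`V` contains second derivatives of `φ` and so has one time derivative too few for interpolation of
full order. The terms concerned carry the displacement, which is `O(h^2)`, and `h^2 Δt^m ≤ err₁`
(`ActiveElem.sq_mul_dt_pow_le`).

At a Lagrange node the discrete displacement is compared with the exact one by linearizing both
level set equations (`SearchPair.norm_displacement_sub_le`). Up to `O(h err₁)` they differ by
`leadingError = (1 - b)(φ - φh) ∇φ / |∇φ|^2`. This term does not depend on the element, so the
averaging in `P_h` does no harm, and its values at two nodes of one element differ by `O(h err₁)`.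
The slope of an interpolant is controlled by differences of nodal values, so the gradient error on
the active elements is `err₁`, where nodal errors of size `err₀` alone would only give `err₀ / h`.
All this is collected in `exists_element_error`.

Outside the active region the smooth blending uses the identity. For the finite element blending,
the extension is a linear combination of values on the active faces, with weights of bounded total
size that do not depend on the map (`IsEvaluation`); this carries over values and time derivatives.
For gradients, the projection to a face has a derivative that grows like the reciprocal of the
weight `ω` of the face, but it always occurs next to a positive power of `ω`. Induction over the
dimension of the faces gives the bound `C (ε₀ / h + ε₁)` from errors `ε₀` of the values and `ε₁` of
the gradients (`Cell.Regular.exists_blend_deriv`). The term `err₀ / h` is the source of the weaker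
gradient estimate in that case; `Δt ≤ K h` turns it into `h^qs + Δt^qt`. -/

/-- `f` has `n` derivatives within `s` which, like `f` itself, are bounded by `C` on `s`. -/
def BddDerivOn {E : Type} [NormedAddCommGroup E] [NormedSpace ℝ E] (s : Set E) :
    ℕ → ∀ {F : Type} [NormedAddCommGroup F] [NormedSpace ℝ F], ℝ → (E → F) → Prop
  | 0, _, _, _, C, f => ∀ x ∈ s, ‖f x‖ ≤ C
  | n + 1, F, _, _, C, f => (∀ x ∈ s, ‖f x‖ ≤ C) ∧ ∃ f' : E → (E →L[ℝ] F),
      (∀ x ∈ s, HasFDerivWithinAt f (f' x) s x) ∧ BddDerivOn s n C f'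

/-- The derivatives of `f` of the orders from `1` to `n` within `s` are bounded by `C` on `s`. -/
def DerivBddOn {E : Type} [NormedAddCommGroup E] [NormedSpace ℝ E] (s : Set E) :
    ℕ → ∀ {F : Type} [NormedAddCommGroup F] [NormedSpace ℝ F], ℝ → (E → F) → Prop
  | 0, _, _, _, _, _ => True
  | n + 1, F, _, _, C, f => ∃ f' : E → (E →L[ℝ] F),
      (∀ x ∈ s, HasFDerivWithinAt f (f' x) s x) ∧ BddDerivOn s n C f'

namespace BddDerivOn

variable {E F G H : Type} [NormedAddCommGroup E] [NormedSpace ℝ E] [NormedAddCommGroup F]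
  [NormedSpace ℝ F] [NormedAddCommGroup G] [NormedSpace ℝ G] [NormedAddCommGroup H]
  [NormedSpace ℝ H] {s t : Set E} {n m : ℕ} {C C₁ C₂ : ℝ} {f g : E → F}

theorem bound (h : BddDerivOn s n C f) {x : E} (hx : x ∈ s) : ‖f x‖ ≤ C := by
  cases n with
  | zero => exact h x hx
  | succ n => exact h.1 x hx

theorem mono_const (h : BddDerivOn s n C₁ f) (hC : C₁ ≤ C₂) : BddDerivOn s n C₂ f := by
  induction n generalizing F with
  | zero => exact fun x hx => (h x hx).trans hC
  | succ n ih =>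
    obtain ⟨h0, f', hf', h'⟩ := h
    exact ⟨fun x hx => (h0 x hx).trans hC, f', hf', ih h'⟩

theorem mono_set (h : BddDerivOn s n C f) (hts : t ⊆ s) : BddDerivOn t n C f := by
  induction n generalizing F with
  | zero => exact fun x hx => h x (hts hx)
  | succ n ih =>
    obtain ⟨h0, f', hf', h'⟩ := h
    exact ⟨fun x hx => h0 x (hts hx), f', fun x hx => (hf' x (hts hx)).mono hts, ih h'⟩

theorem of_succ (h : BddDerivOn s (n + 1) C f) : BddDerivOn s n C f := by
  induction n generalizing F with
  | zero => exact h.1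
  | succ n ih =>
    obtain ⟨h0, f', hf', h'⟩ := h
    exact ⟨h0, f', hf', ih h'⟩

theorem mono_order (h : BddDerivOn s n C f) (hmn : m ≤ n) : BddDerivOn s m C f := by
  induction n, hmn using Nat.le_induction with
  | base => exact h
  | succ n _ ih => exact ih h.of_succ

theorem congr (h : BddDerivOn s n C f) (hfg : ∀ x ∈ s, g x = f x) : BddDerivOn s n C g := by
  cases n with
  | zero => exact fun x hx => by rw [hfg x hx]; exact h x hx
  | succ n =>
    obtain ⟨h0, f', hf', h'⟩ := h
    exact ⟨fun x hx => by rw [hfg x hx]; exact h0 x hx, f',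
      fun x hx => (hf' x hx).congr hfg (hfg x hx), h'⟩

theorem add (hf : BddDerivOn s n C₁ f) (hg : BddDerivOn s n C₂ g) :
    BddDerivOn s n (C₁ + C₂) (fun x => f x + g x) := by
  induction n generalizing F with
  | zero => exact fun x hx => norm_add_le_of_le (hf x hx) (hg x hx)
  | succ n ih =>
    obtain ⟨h0, f', hf', h'⟩ := hf
    obtain ⟨k0, g', hg', k'⟩ := hg
    exact ⟨fun x hx => norm_add_le_of_le (h0 x hx) (k0 x hx), _,
      fun x hx => (hf' x hx).add (hg' x hx), ih h' k'⟩

/-- The derivative of `L ∘ f` is `f'` followed by post-composition with `L`, an operator of norm at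
most `‖L‖`. Hence one and the same factor `A` serves for all orders. -/
theorem clm_comp (L : F →L[ℝ] G) {A : ℝ} (hL : ‖L‖ ≤ A) (hf : BddDerivOn s n C f) :
    BddDerivOn s n (A * C) (fun x => L (f x)) := by
  have key : ∀ x ∈ s, ‖L (f x)‖ ≤ A * C := fun x hx =>
    (L.le_opNorm _).trans (mul_le_mul hL (hf.bound hx) (norm_nonneg _) ((norm_nonneg _).trans hL))
  induction n generalizing F G with
  | zero => exact key
  | succ n ih =>
    obtain ⟨h0, f', hf', h'⟩ := hf
    refine ⟨key, _, fun x hx => L.hasFDerivAt.comp_hasFDerivWithinAt x (hf' x hx), ?_⟩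
    have hL' : ‖ContinuousLinearMap.compL ℝ E F G L‖ ≤ A :=
      (ContinuousLinearMap.le_opNorm _ _).trans
        ((mul_le_mul_of_nonneg_right (ContinuousLinearMap.norm_compL_le ℝ E F G)
          (norm_nonneg _)).trans (by simpa using hL))
    refine ih (ContinuousLinearMap.compL ℝ E F G L) hL' h' fun x hx => ?_
    exact ((ContinuousLinearMap.compL ℝ E F G L).le_opNorm _).trans
      (mul_le_mul hL' (h'.bound hx) (norm_nonneg _) ((norm_nonneg _).trans hL))

theorem derivBddOn (hf : BddDerivOn s n C f) : DerivBddOn s n C f := by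
  cases n with
  | zero => trivial
  | succ n => exact hf.2

theorem _root_.DerivBddOn.of_succ (hf : DerivBddOn s (n + 1) C f) : DerivBddOn s n C f := by
  cases n with
  | zero => trivial
  | succ n =>
    obtain ⟨f', hf', h'⟩ := hf
    exact ⟨f', hf', h'.of_succ⟩

theorem _root_.DerivBddOn.add (hf : DerivBddOn s n C₁ f) (hg : DerivBddOn s n C₂ g) :
    DerivBddOn s n (C₁ + C₂) (fun x => f x + g x) := by
  cases n with
  | zero => trivial
  | succ n =>
    obtain ⟨f', hf', h'⟩ := hf
    obtain ⟨g', hg', k'⟩ := hg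
    exact ⟨_, fun x hx => (hf' x hx).add (hg' x hx), h'.add k'⟩

theorem _root_.DerivBddOn.clm_comp (L : F →L[ℝ] G) {A : ℝ} (hL : ‖L‖ ≤ A)
    (hf : DerivBddOn s n C f) : DerivBddOn s n (A * C) (fun x => L (f x)) := by
  cases n with
  | zero => trivial
  | succ n =>
    obtain ⟨f', hf', h'⟩ := hf
    refine ⟨_, fun x hx => L.hasFDerivAt.comp_hasFDerivWithinAt x (hf' x hx), ?_⟩
    have hL' : ‖ContinuousLinearMap.compL ℝ E F G L‖ ≤ A :=
      (ContinuousLinearMap.le_opNorm _ _).trans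
        ((mul_le_mul_of_nonneg_right (ContinuousLinearMap.norm_compL_le ℝ E F G)
          (norm_nonneg _)).trans (by simpa using hL))
    exact h'.clm_comp _ hL'

theorem _root_.DerivBddOn.prodMk {g : E → G} (hf : DerivBddOn s n C₁ f)
    (hg : DerivBddOn s n C₂ g) : DerivBddOn s n (C₁ + C₂) (fun x => (f x, g x)) := by
  have h1 := hf.clm_comp (ContinuousLinearMap.inl ℝ F G) (ContinuousLinearMap.norm_inl_le_one ℝ F G)
  have h2 := hg.clm_comp (ContinuousLinearMap.inr ℝ F G) (ContinuousLinearMap.norm_inr_le_one ℝ F G)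
  have := h1.add h2
  simpa using this

theorem neg (hf : BddDerivOn s n C f) : BddDerivOn s n C (fun x => -f x) := by
  have := hf.clm_comp (-(ContinuousLinearMap.id ℝ F)) (A := 1)
    (by rw [norm_neg]; exact ContinuousLinearMap.norm_id_le)
  simpa using this

theorem sub (hf : BddDerivOn s n C₁ f) (hg : BddDerivOn s n C₂ g) :
    BddDerivOn s n (C₁ + C₂) (fun x => f x - g x) := by
  simpa [sub_eq_add_neg] using hf.add hg.neg

theorem const (c : F) (hc : ‖c‖ ≤ C) : BddDerivOn s n C (fun _ => c) := by
  induction n generalizing F with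
  | zero => exact fun _ _ => hc
  | succ n ih =>
    exact ⟨fun _ _ => hc, fun _ => 0, fun x _ => hasFDerivWithinAt_const c x s,
      ih 0 (by simpa using (norm_nonneg _).trans hc)⟩

theorem clm (L : E →L[ℝ] F) (hL : ‖L‖ ≤ C) (hb : ∀ x ∈ s, ‖L x‖ ≤ C) :
    BddDerivOn s n C (fun x => L x) := by
  cases n with
  | zero => exact hb
  | succ n => exact ⟨hb, fun _ => L, fun x _ => L.hasFDerivWithinAt, const L hL⟩

theorem _root_.DerivBddOn.clm (L : E →L[ℝ] F) (hL : ‖L‖ ≤ C) :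
    DerivBddOn s n C (fun x => L x) := by
  cases n with
  | zero => trivial
  | succ n => exact ⟨fun _ => L, fun x _ => L.hasFDerivWithinAt, const L hL⟩

theorem _root_.DerivBddOn.id : DerivBddOn s n 1 (fun x : E => x) :=
  DerivBddOn.clm (ContinuousLinearMap.id ℝ E) ContinuousLinearMap.norm_id_le

theorem _root_.DerivBddOn.const (c : F) : DerivBddOn s n 0 (fun _ : E => c) := by
  cases n with
  | zero => trivial
  | succ n => exact ⟨fun _ => 0, fun x _ => hasFDerivWithinAt_const c x s, BddDerivOn.const _ (by simp)⟩

/-- The Leibniz rule produces two bilinear expressions of the same kind in each differentiation,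
whence the factor `2 ^ n`. Smoothness of scalar multiples, products and compositions of operators
all reduce to this case. -/
theorem bilin (B : F →L[ℝ] G →L[ℝ] H) {A : ℝ} (hB : ‖B‖ ≤ A) {g : E → G}
    (hf : BddDerivOn s n C₁ f) (hg : BddDerivOn s n C₂ g) :
    BddDerivOn s n (2 ^ n * (A * C₁ * C₂)) (fun x => B (f x) (g x)) := by
  have key0 : ∀ x ∈ s, ‖B (f x) (g x)‖ ≤ A * C₁ * C₂ := fun x hx => by
    have h1 := hf.bound hx
    have h2 := hg.bound hx
    have hA := (norm_nonneg _).trans hB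
    calc ‖B (f x) (g x)‖ ≤ ‖B‖ * ‖f x‖ * ‖g x‖ := B.le_opNorm₂ _ _
      _ ≤ A * C₁ * C₂ := by
        have := (norm_nonneg _).trans h1
        gcongr
  have key : ∀ x ∈ s, ‖B (f x) (g x)‖ ≤ 2 ^ n * (A * C₁ * C₂) := fun x hx => by
    have h0 := key0 x hx
    have h1 : (1 : ℝ) ≤ 2 ^ n := one_le_pow₀ (by norm_num)
    nlinarith [norm_nonneg (B (f x) (g x))]
  clear key0
  induction n generalizing F G H with
  | zero => exact key
  | succ n ih =>
    refine ⟨key, ?_⟩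
    have hf0 := hf.of_succ
    have hg0 := hg.of_succ
    obtain ⟨-, f', hf', h'⟩ := hf
    obtain ⟨-, g', hg', k'⟩ := hg
    refine ⟨_, fun x hx => B.hasFDerivWithinAt_of_bilinear (hf' x hx) (hg' x hx), ?_⟩
    have b1 : ‖B.precompR E‖ ≤ A := (B.norm_precompR_le E).trans hB
    have b2 : ‖B.precompL E‖ ≤ A := (B.norm_precompL_le E).trans hB
    have aux : ∀ {F' G' H' : Type} [NormedAddCommGroup F'] [NormedSpace ℝ F']
        [NormedAddCommGroup G'] [NormedSpace ℝ G'] [NormedAddCommGroup H'] [NormedSpace ℝ H']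
        (B' : F' →L[ℝ] G' →L[ℝ] H') {f₁ : E → F'} {g₁ : E → G'}, ‖B'‖ ≤ A →
        BddDerivOn s n C₁ f₁ → BddDerivOn s n C₂ g₁ →
        ∀ x ∈ s, ‖B' (f₁ x) (g₁ x)‖ ≤ 2 ^ n * (A * C₁ * C₂) := by
      intro F' G' H' _ _ _ _ _ _ B' f₁ g₁ hB' h1 h2 x hx
      have h3 := h1.bound hx
      have h4 := h2.bound hx
      have hA := (norm_nonneg _).trans hB'
      have h5 : ‖B' (f₁ x) (g₁ x)‖ ≤ A * C₁ * C₂ := by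
        calc ‖B' (f₁ x) (g₁ x)‖ ≤ ‖B'‖ * ‖f₁ x‖ * ‖g₁ x‖ := B'.le_opNorm₂ _ _
          _ ≤ A * C₁ * C₂ := by
            have := (norm_nonneg _).trans h3
            gcongr
      have h1 : (1 : ℝ) ≤ 2 ^ n := one_le_pow₀ (by norm_num)
      nlinarith [norm_nonneg (B' (f₁ x) (g₁ x))]
    have e1 := ih (B.precompR E) b1 hf0 k' (aux _ b1 hf0 k')
    have e2 := ih (B.precompL E) b2 h' hg0 (aux _ b2 h' hg0)
    refine (e1.add e2).mono_const (le_of_eq (by ring))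

/-- The constant in the chain rule `BddDerivOn.comp`. -/
def compConst : ℕ → ℝ → ℝ → ℝ
  | 0, C₁, _ => C₁
  | n + 1, C₁, C₂ => max C₁ (2 ^ n * (1 * compConst n C₁ C₂ * C₂))

/-- Only derivatives of the inner function enter the chain rule, so no bound for its values is
needed. This matters because the inner functions contain the space and time coordinates themselves.
-/
theorem comp_derivBddOn {u : Set F} {g : F → G} (hg : BddDerivOn u n C₁ g)
    (hf : DerivBddOn s n C₂ f) (hst : ∀ x ∈ s, f x ∈ u) :
    BddDerivOn s n (compConst n C₁ C₂) (fun x => g (f x)) := by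
  induction n generalizing G with
  | zero => exact fun x hx => hg _ (hst x hx)
  | succ n ih =>
    refine ⟨fun x hx => (hg.bound (hst x hx)).trans (le_max_left _ _), ?_⟩
    have hf0 := hf.of_succ
    obtain ⟨f', hf', h'⟩ := hf
    obtain ⟨-, g', hg', k'⟩ := hg
    refine ⟨_, fun x hx => (hg' _ (hst x hx)).comp x (hf' x hx) hst, ?_⟩
    have := (ih k' hf0).bilin (ContinuousLinearMap.compL ℝ E F G)
      (ContinuousLinearMap.norm_compL_le ℝ E F G) h'
    exact this.mono_const (le_max_right _ _)

theorem smul {a : E → ℝ} (ha : BddDerivOn s n C₁ a) (hf : BddDerivOn s n C₂ f) :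
    BddDerivOn s n (2 ^ n * (C₁ * C₂)) (fun x => a x • f x) := by
  have := ha.bilin (ContinuousLinearMap.lsmul ℝ ℝ : ℝ →L[ℝ] F →L[ℝ] F)
    ContinuousLinearMap.opNorm_lsmul_le hf
  simpa using this

theorem mul {a b : E → ℝ} (ha : BddDerivOn s n C₁ a) (hb : BddDerivOn s n C₂ b) :
    BddDerivOn s n (2 ^ n * (C₁ * C₂)) (fun x => a x * b x) := ha.smul hb

/-- The constant in `BddDerivOn.inv`. -/
noncomputable def invConst (c C : ℝ) : ℕ → ℝ
  | 0 => c⁻¹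
  | n + 1 => max c⁻¹ (2 ^ n * (2 ^ n * (invConst c C n * invConst c C n) * C))

/-- The derivative `-a⁻² a'` contains `a⁻¹` only undifferentiated, so bounds for `n` derivatives of
`a⁻¹` give bounds for `n + 1`. -/
theorem inv {a : E → ℝ} {c : ℝ} (hc : 0 < c) (ha : BddDerivOn s n C a) (hac : ∀ x ∈ s, c ≤ a x) :
    BddDerivOn s n (invConst c C n) (fun x => (a x)⁻¹) := by
  have key : ∀ x ∈ s, ‖(a x)⁻¹‖ ≤ c⁻¹ := fun x hx => by
    have := hac x hx
    rw [Real.norm_of_nonneg (inv_nonneg.2 (hc.le.trans this))]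
    exact inv_anti₀ hc this
  induction n with
  | zero => exact key
  | succ n ih =>
    have i0 := ih ha.of_succ
    obtain ⟨-, f', hf', h'⟩ := ha
    refine ⟨fun x hx => (key x hx).trans (le_max_left _ _),
      fun x => -(((a x)⁻¹ * (a x)⁻¹) • f' x), fun x hx => ?_, ?_⟩
    · have h0 : a x ≠ 0 := (hc.trans_le (hac x hx)).ne'
      have := (hasDerivAt_inv h0).comp_hasFDerivWithinAt x (hf' x hx)
      refine this.congr_fderiv ?_
      ext v
      simp only [smul_apply, neg_apply, smul_eq_mul]
      field_simp
    · exact (((i0.mul i0).smul h').neg).mono_const (le_max_right _ _)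

/-- The constant in `BddDerivOn.of_hasFDerivWithinAt`. -/
def odeConst (C : ℝ) : ℕ → ℝ
  | 0 => C
  | n + 1 => max C (compConst n C (1 + odeConst C n))

/-- A bounded solution of the differential equation `D' p = X (p, D p)` inherits bounds for
its derivatives from `X`. -/
theorem of_hasFDerivWithinAt {u : Set (E × F)}
    {X : E × F → (E →L[ℝ] F)} {D : E → F} (hX : BddDerivOn u n C X)
    (hu : ∀ p ∈ s, (p, D p) ∈ u) (hD0 : ∀ p ∈ s, ‖D p‖ ≤ C)
    (hD : ∀ p ∈ s, HasFDerivWithinAt D (X (p, D p)) s p) :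
    BddDerivOn s (n + 1) (odeConst C (n + 1)) D := by
  induction n with
  | zero =>
    refine ⟨fun p hp => (hD0 p hp).trans (le_max_left _ _), _, hD, fun p hp => ?_⟩
    exact (hX _ (hu p hp)).trans (le_max_left _ _)
  | succ n ih =>
    have h1 := ih hX.of_succ
    refine ⟨fun p hp => (hD0 p hp).trans (le_max_left _ _), _, hD, ?_⟩
    -- Bootstrapping: `D' = X(·, D)` has as many bounded derivatives as are already known for `D`,
    -- so every round gains one order.
    have h2 := hX.comp_derivBddOn (DerivBddOn.id.prodMk h1.derivBddOn) hu
    exact h2.mono_const (le_max_right _ _)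

/-- The entrance for the hypotheses, which are stated with `iteratedFDerivWithin`. The bound of
order `k + 1` for `f` is the bound of order `k` for `fderivWithin ℝ f s`. -/
theorem of_contDiffOn {N : ℕ} (hs : UniqueDiffOn ℝ s) (hf : ContDiffOn ℝ N f s) (hn : n ≤ N)
    (hb : ∀ k ≤ n, ∀ x ∈ s, ‖iteratedFDerivWithin ℝ k f s x‖ ≤ C) : BddDerivOn s n C f := by
  have h0 : ∀ x ∈ s, ‖f x‖ ≤ C := fun x hx => by
    simpa using hb 0 (Nat.zero_le _) x hx
  induction n generalizing F N with
  | zero => exact h0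
  | succ n ih =>
    obtain ⟨N, rfl⟩ : ∃ N', N = N' + 1 := ⟨N - 1, by omega⟩
    refine ⟨h0, fderivWithin ℝ f s, fun x hx => ?_, ?_⟩
    · exact ((hf.differentiableOn (by simp)) x hx).hasFDerivWithinAt
    · refine ih (N := N) (hf.fderivWithin hs (by norm_cast)) (by omega) (fun k hk x hx => ?_)
        fun x hx => ?_
      · rw [norm_iteratedFDerivWithin_fderivWithin hs hx]
        exact hb (k + 1) (by omega) x hx
      · rw [← norm_iteratedFDerivWithin_zero (𝕜 := ℝ) (f := fderivWithin ℝ f s) (s := s),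
          norm_iteratedFDerivWithin_fderivWithin hs hx]
        exact hb 1 (by omega) x hx

/-- Taylor expansion: the polynomial is given by its homogeneous parts. -/
theorem exists_taylor (hs : Convex ℝ s) (hf : BddDerivOn s (n + 1) C f) {x : E} (hx : x ∈ s) :
    ∃ M : ∀ j : ℕ, ContinuousMultilinearMap ℝ (fun _ : Fin j => E) F, (∀ j, ‖M j‖ ≤ C) ∧ ∀ y ∈ s,
      ‖f y - ∑ j ∈ Finset.range (n + 1), M j (fun _ => y - x)‖ ≤ C * ‖y - x‖ ^ (n + 1) := by
  induction n generalizing F with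
  | zero =>
    have hf0 := hf
    obtain ⟨-, f', hf', h'⟩ := hf
    refine ⟨fun j => match j with
      | 0 => ContinuousMultilinearMap.constOfIsEmpty ℝ _ (f x)
      | _ + 1 => 0, fun j => ?_, fun y hy => ?_⟩
    · have h0 := hf0.bound hx
      cases j with
      | zero => simpa using h0
      | succ j => simpa using (norm_nonneg _).trans h0
    simpa using hs.norm_image_sub_le_of_norm_hasFDerivWithin_le hf' (fun z hz => h' z hz) hx hy
  | succ n ih =>
    have hf0 := hf
    obtain ⟨-, f', hf', h'⟩ := hf
    obtain ⟨M, hM0, hM⟩ := ih h'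
    -- The homogeneous part of degree `j + 1` is the one of degree `j` of the derivative divided by
    -- `j + 1`. These multilinear maps are not symmetrized, as only their diagonals are used.
    refine ⟨fun j => match j with
      | 0 => ContinuousMultilinearMap.constOfIsEmpty ℝ _ (f x)
      | j + 1 => ((j : ℝ) + 1)⁻¹ • (M j).uncurryRight, fun j => ?_, fun y hy => ?_⟩
    · cases j with
      | zero => simpa using hf0.bound hx
      | succ j =>
        rw [norm_smul, ContinuousMultilinearMap.uncurryRight_norm, Real.norm_of_nonneg (by positivity)]
        exact (mul_le_of_le_one_left (norm_nonneg _) (inv_le_one_of_one_le₀ (by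
          linarith [(Nat.cast_nonneg j : (0 : ℝ) ≤ j)]))).trans (hM0 j)
    set v := y - x with hv
    have hseg : ∀ r ∈ Icc (0 : ℝ) 1, x + r • v ∈ s := fun r hr =>
      hs.add_smul_sub_mem hx hy hr
    -- The expansion of `f'` is integrated along the segment: `P` is an antiderivative of the Taylor
    -- polynomial of `f'` in the direction `v`, and the mean value inequality is applied to the
    -- difference.
    let P : ℝ → F := fun r => f x + ∑ j ∈ Finset.range (n + 1),
      (r ^ (j + 1) * ((j : ℝ) + 1)⁻¹) • M j (fun _ => v) v
    have hder : ∀ r ∈ Icc (0 : ℝ) 1, HasDerivWithinAt (fun r => f (x + r • v) - P r)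
        (f' (x + r • v) v - (∑ j ∈ Finset.range (n + 1), M j (fun _ => (x + r • v) - x)) v)
        (Icc 0 1) r := by
      intro r hr
      have h1 : HasDerivWithinAt (fun r : ℝ => f (x + r • v)) (f' (x + r • v) v) (Icc 0 1) r := by
        have h2 : HasDerivWithinAt (fun r : ℝ => x + r • v) v (Icc 0 1) r := by
          simpa using ((hasDerivWithinAt_id r (Icc 0 1)).smul_const v).const_add x
        exact (hf' _ (hseg r hr)).comp_hasDerivWithinAt r h2 hseg
      have h3 : HasDerivWithinAt P ((∑ j ∈ Finset.range (n + 1),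
          M j (fun _ => (x + r • v) - x)) v) (Icc 0 1) r := by
        have h4 : HasDerivWithinAt P (∑ j ∈ Finset.range (n + 1),
            ((((j : ℝ) + 1) * r ^ j) * ((j : ℝ) + 1)⁻¹) • M j (fun _ => v) v) (Icc 0 1) r := by
          refine HasDerivWithinAt.const_add (f x) (HasDerivWithinAt.fun_sum fun j _ => ?_)
          refine HasDerivWithinAt.smul_const (HasDerivWithinAt.mul_const ?_ _) _
          simpa using (hasDerivAt_pow (j + 1) r).hasDerivWithinAt
        convert h4 using 1
        rw [sum_apply]
        refine Finset.sum_congr rfl fun j _ => ?_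
        have h5 : (fun _ : Fin j => (x + r • v) - x) = fun _ => r • v := by
          funext; simp
        rw [h5]
        have h6 := (M j).map_smul_univ (fun _ => r) (fun _ => v)
        rw [h6]
        have : ((j : ℝ) + 1) ≠ 0 := by positivity
        simp only [Finset.prod_const, Finset.card_univ, Fintype.card_fin, smul_apply]
        congr 1
        field_simp
      exact h1.sub h3
    have hbd : ∀ r ∈ Icc (0 : ℝ) 1, ‖f' (x + r • v) v -
        (∑ j ∈ Finset.range (n + 1), M j (fun _ => (x + r • v) - x)) v‖ ≤ C * ‖v‖ ^ (n + 1 + 1) := by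
      intro r hr
      rw [← sub_apply]
      refine (ContinuousLinearMap.le_opNorm _ _).trans ?_
      have h1 := hM _ (hseg r hr)
      have hC : 0 ≤ C := (norm_nonneg _).trans (h'.bound hx)
      have h2 : ‖x + r • v - x‖ ≤ ‖v‖ := by
        rw [add_sub_cancel_left, norm_smul, Real.norm_of_nonneg hr.1]
        exact mul_le_of_le_one_left (norm_nonneg _) hr.2
      calc _ ≤ (C * ‖x + r • v - x‖ ^ (n + 1)) * ‖v‖ := by gcongr
        _ ≤ (C * ‖v‖ ^ (n + 1)) * ‖v‖ := by gcongr
        _ = _ := by ring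
    have := (convex_Icc (0 : ℝ) 1).norm_image_sub_le_of_norm_hasDerivWithin_le hder hbd
      (left_mem_Icc.2 zero_le_one) (right_mem_Icc.2 zero_le_one)
    have e : (f (x + (1 : ℝ) • v) - P 1) - (f (x + (0 : ℝ) • v) - P 0) =
        f y - ∑ j ∈ Finset.range (n + 1 + 1), (match (motive := ∀ j : ℕ, ContinuousMultilinearMap ℝ
          (fun _ : Fin j => E) F) j with
      | 0 => ContinuousMultilinearMap.constOfIsEmpty ℝ _ (f x)
      | j + 1 => ((j : ℝ) + 1)⁻¹ • (M j).uncurryRight) (fun _ => v) := by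
      have hP0 : P 0 = f x := by simp [P]
      rw [hP0, Finset.sum_range_succ']
      have hP1 : P 1 = (∑ j ∈ Finset.range (n + 1), (((j : ℝ) + 1)⁻¹ • (M j).uncurryRight)
          (fun _ => v)) + f x := by
        simp only [P]
        rw [add_comm]
        congr 1
        refine Finset.sum_congr rfl fun j _ => ?_
        simp
        rfl
      rw [hP1]
      simp [hv]
    rw [e] at this
    simpa using this

theorem pow {a : E → ℝ} (ha : BddDerivOn s n C a) (j : ℕ) :
    BddDerivOn s n ((2 ^ n * C) ^ j) (fun x => a x ^ j) := by
  induction j with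
  | zero => simpa using const (1 : ℝ) (C := 1) (by simp)
  | succ j ih =>
    simp only [pow_succ]
    exact (ih.mul ha).mono_const (le_of_eq (by ring))

theorem sum {ι : Type*} (t : Finset ι) {c : ι → ℝ} {f : ι → E → F}
    (hf : ∀ i ∈ t, BddDerivOn s n (c i) (f i)) :
    BddDerivOn s n (∑ i ∈ t, c i) (fun x => ∑ i ∈ t, f i x) := by
  classical
  induction t using Finset.induction_on with
  | empty => simpa using const (0 : F) (C := 0) (by simp)
  | insert i t hi ih =>
    simp only [Finset.sum_insert hi]
    exact (hf i (Finset.mem_insert_self _ _)).add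
      (ih fun j hj => hf j (Finset.mem_insert_of_mem hj))

end BddDerivOn

end BoundedDerivatives

/-! ### Polynomial reproduction by Lagrange interpolation on a simplex -/

section Interpolation

open Set Finset

set_option maxSynthPendingDepth 3

/-- The generalized binomial coefficient as a product. -/
theorem Ring.choose_eq_prod (X : ℝ) (n : ℕ) :
    ∏ m ∈ Finset.range n, (X - (m : ℝ)) / ((m : ℝ) + 1) = Ring.choose X n := by
  rw [Ring.choose_eq_smul, Finset.prod_div_distrib, smul_eq_mul, div_eq_inv_mul]
  congr 1
  · rw [← Finset.prod_range_add_one_eq_factorial]; push_cast; rfl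
  · rw [← descPochhammer_eval_eq_prod_range, ← descPochhammer_map (Int.castRingHom ℝ),
      Polynomial.eval_map, Polynomial.eval₂_eq_sum, Polynomial.smeval_eq_sum]
    simp [Polynomial.sum, Polynomial.smul_pow]

theorem PowerSeries.coeff_prod_univ {ι : Type*} [Fintype ι] [DecidableEq ι]
    (f : ι → PowerSeries ℝ) (k : ℕ) :
    PowerSeries.coeff k (∏ v, f v) =
      ∑ α ∈ Finset.piAntidiag Finset.univ k, ∏ v, PowerSeries.coeff (α v) (f v) := by
  rw [PowerSeries.coeff_prod]
  refine Finset.sum_nbij' (fun l => ⇑l) (fun α => Finsupp.equivFunOnFinite.symm α) ?_ ?_ ?_ ?_ ?_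
  · intro l hl
    simpa using hl
  · intro α hα
    simpa using hα
  · intro l _
    simp
  · intro α _
    simp
  · intro l _
    rfl

/-- A Chu-Vandermonde identity in several variables. -/
theorem Ring.sum_choose_mul_choose {ι : Type*} [Fintype ι] [DecidableEq ι] (X : ι → ℝ) (k : ℕ)
    (hX : ∑ v, X v = k) (β : ι → ℕ) (hβ : ∑ v, β v ≤ k) :
    ∑ α ∈ Finset.piAntidiag Finset.univ k,
      (∏ v, Ring.choose (X v) (α v)) * ∏ v, Ring.choose (α v : ℝ) (β v) =
      ∏ v, Ring.choose (X v) (β v) := by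
  -- Generating functions: since `C(X,n) C(n,β) = C(X,β) C(X-β,n-β)`, the `n`-th coefficient of `f
  -- v` is the factor belonging to `v` on the left-hand side. The sum is then the `k`-th coefficient
  -- of the product of the `f v`.
  let f : ι → PowerSeries ℝ := fun v => PowerSeries.C (Ring.choose (X v) (β v)) *
    (PowerSeries.X ^ β v * PowerSeries.binomialSeries ℝ (X v - β v))
  have hf : ∀ v n, PowerSeries.coeff n (f v) = Ring.choose (X v) n * Ring.choose (n : ℝ) (β v) := by
    intro v n
    simp only [f, PowerSeries.coeff_C_mul, PowerSeries.coeff_X_pow_mul', Ring.choose_natCast]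
    split_ifs with h
    · have := Ring.choose_smul_choose (X v) h
      rw [nsmul_eq_mul] at this
      simp [← this, mul_comm]
    · rw [Nat.choose_eq_zero_of_lt (by omega)]; simp
  have hadd : ∀ s : Finset ι, ∏ v ∈ s, PowerSeries.binomialSeries ℝ (X v - β v) =
      PowerSeries.binomialSeries ℝ (∑ v ∈ s, (X v - β v)) := by
    intro s
    induction s using Finset.induction_on with
    | empty => simp
    | insert a s ha ih => rw [Finset.prod_insert ha, Finset.sum_insert ha, ih,
        PowerSeries.binomialSeries_add]
  have h1 := PowerSeries.coeff_prod_univ f k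
  simp only [hf, Finset.prod_mul_distrib] at h1
  rw [← h1]
  simp only [f, Finset.prod_mul_distrib]
  -- The binomial series multiply to the one with exponent `k - ∑ β`, a natural number, and its
  -- coefficient of exactly that order is `1`.
  rw [hadd, Finset.prod_pow_eq_pow_sum, ← map_prod, PowerSeries.coeff_C_mul,
    PowerSeries.coeff_X_pow_mul', if_pos hβ, PowerSeries.binomialSeries_coeff,
    Finset.sum_sub_distrib, hX, ← Nat.cast_sum, ← Nat.cast_sub hβ, Ring.choose_natCast]
  simp

namespace Cell

variable {d : ℕ} {F : Type*} [AddCommGroup F] [Module ℝ F] (T : Cell d) (k : ℕ)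

/-- The shape functions as functions of the barycentric coordinates. -/
noncomputable def refShape {d : ℕ} (k : ℕ) (α : Fin (d + 1) → ℕ) (ξ : Fin (d + 1) → ℝ) : ℝ :=
  ∏ v, ∏ m ∈ Finset.range (α v), ((k : ℝ) * ξ v - (m : ℝ)) / ((m : ℝ) + 1)

theorem shape_eq_refShape (α : Fin (d + 1) → ℕ) (x : Pt d) :
    T.shape k α x = refShape k α (fun v => T.coord v x) := rfl

/-- In this form the value of the function with index `β` at the lattice point `α` is a product of
the binomial coefficients `C(α v, β v)`, which makes interpolation accessible to the Chu-Vandermonde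
identity. -/
theorem refShape_eq_prod_choose (α : Fin (d + 1) → ℕ) (ξ : Fin (d + 1) → ℝ) :
    refShape k α ξ = ∏ v, Ring.choose ((k : ℝ) * ξ v) (α v) := by
  simp only [refShape, Ring.choose_eq_prod]

theorem sum_univ_of_mem {α : Fin (d + 1) → ℕ} (hα : α ∈ Finset.piAntidiag Finset.univ k) :
    ∑ v, α v = k := (Finset.mem_piAntidiag.1 hα).1

variable {k} in
theorem sum_weights_node (hk : 1 ≤ k) {α : Fin (d + 1) → ℕ}
    (hα : α ∈ Finset.piAntidiag Finset.univ k) : ∑ v, (α v : ℝ) / (k : ℝ) = 1 := by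
  rw [← Finset.sum_div, ← Nat.cast_sum, sum_univ_of_mem k hα, div_self]
  exact_mod_cast (by omega : k ≠ 0)

theorem coord_sum_smul {c : Fin (d + 1) → ℝ} (hc : ∑ v, c v = 1) (w : Fin (d + 1)) :
    T.coord w (∑ v, c v • T v) = c w := by
  rw [← Finset.univ.affineCombination_eq_linear_combination _ _ hc,
    T.coord_apply_combination_of_mem (Finset.mem_univ w) hc]

variable {k} in
theorem coord_node (hk : 1 ≤ k) {α : Fin (d + 1) → ℕ}
    (hα : α ∈ Finset.piAntidiag Finset.univ k) (w : Fin (d + 1)) :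
    T.coord w (T.node k α) = (α w : ℝ) / k := T.coord_sum_smul (sum_weights_node hk hα) w

theorem sum_coord_smul (x : Pt d) : ∑ v, T.coord v x • T v = x :=
  T.linear_combination_coord_eq_self x

theorem sum_coord (x : Pt d) : ∑ v, T.coord v x = 1 := T.sum_coord_apply_eq_one x

theorem interp_sub (f g : Pt d → F) (x : Pt d) :
    T.interp k (fun y => f y - g y) x = T.interp k f x - T.interp k g x := by
  simp [interp, smul_sub]

theorem interp_add (f g : Pt d → F) (x : Pt d) :
    T.interp k (fun y => f y + g y) x = T.interp k f x + T.interp k g x := by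
  simp [interp, smul_add, Finset.sum_add_distrib]

theorem interp_smul (a : ℝ) (f : Pt d → F) (x : Pt d) :
    T.interp k (fun y => a • f y) x = a • T.interp k f x := by
  simp [interp, Finset.smul_sum, smul_comm a]

theorem interp_sum {ι : Type*} (s : Finset ι) (f : ι → Pt d → F) (x : Pt d) :
    T.interp k (fun y => ∑ i ∈ s, f i y) x = ∑ i ∈ s, T.interp k (f i) x := by
  simp only [interp, Finset.smul_sum]
  exact Finset.sum_comm

variable {k} in
/-- Products of generalized binomial coefficients are reproduced by interpolation. -/
theorem interp_prod_choose (hk : 1 ≤ k) {β : Fin (d + 1) → ℕ} (hβ : ∑ v, β v ≤ k) (x : Pt d) :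
    T.interp k (fun y => refShape k β (fun v => T.coord v y)) x =
      refShape k β (fun v => T.coord v x) := by
  simp only [interp, shape_eq_refShape, refShape_eq_prod_choose]
  rw [← Ring.sum_choose_mul_choose (fun v => (k : ℝ) * T.coord v x) k
    (by rw [← Finset.mul_sum, T.sum_coord, mul_one]) β hβ]
  refine Finset.sum_congr rfl fun α hα => ?_
  rw [smul_eq_mul]
  congr 2
  funext v
  rw [T.coord_node hk hα, mul_div_cancel₀]
  exact_mod_cast (by omega : k ≠ 0)

variable {k} in
-- Multiplication by a coordinate stays within the span and raises the degree by one, because `X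
-- C(X,n) = (n+1) C(X,n+1) + n C(X,n)` with `X = k ξ`. Thus reproduction of the binomial products
-- implies reproduction of all polynomials of degree at most `k`.
theorem prod_coord_mem_span (hk : 1 ≤ k) {j : ℕ} (r : Fin j → Fin (d + 1)) :
    (fun x => ∏ i, T.coord (r i) x) ∈ Submodule.span ℝ
      {f | ∃ β : Fin (d + 1) → ℕ, ∑ v, β v ≤ j ∧
        f = fun x : Pt d => refShape k β (fun v => T.coord v x)} := by
  induction j with
  | zero =>
    refine Submodule.subset_span ⟨0, by simp, ?_⟩
    funext x
    simp [refShape]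
  | succ j ih =>
    have h1 := ih (fun i => r i.castSucc)
    have hk0 : (k : ℝ) ≠ 0 := by exact_mod_cast (by omega : k ≠ 0)
    set w := r (Fin.last j) with hw
    let L : (Pt d → ℝ) →ₗ[ℝ] (Pt d → ℝ) := LinearMap.mulRight ℝ (fun x => T.coord w x)
    have h2 : (fun x => ∏ i, T.coord (r i) x) = L (fun x => ∏ i : Fin j, T.coord (r i.castSucc) x) := by
      funext x
      simp [L, Fin.prod_univ_castSucc, hw]
    rw [h2]
    refine Submodule.span_induction (p := fun f _ => L f ∈ _) ?_ (by simp) ?_ ?_ h1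
    · rintro _ ⟨β, hβ, rfl⟩
      have h3 : L (fun x : Pt d => refShape k β (fun v => T.coord v x)) =
          ((k : ℝ)⁻¹ * ((β w : ℝ) + 1)) • (fun x : Pt d =>
            refShape k (Function.update β w (β w + 1)) (fun v => T.coord v x)) +
          ((k : ℝ)⁻¹ * (β w : ℝ)) • (fun x : Pt d => refShape k β (fun v => T.coord v x)) := by
        funext x
        simp only [L, LinearMap.mulRight_apply, Pi.mul_apply, Pi.add_apply, Pi.smul_apply, refShape,
          smul_eq_mul]
        rw [← Finset.mul_prod_erase _ _ (Finset.mem_univ w), ← Finset.mul_prod_erase _ _ (Finset.mem_univ w)]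
        have h4 : ∏ v ∈ Finset.univ.erase w, ∏ m ∈ Finset.range (Function.update β w (β w + 1) v),
            ((k : ℝ) * T.coord v x - (m : ℝ)) / ((m : ℝ) + 1) =
            ∏ v ∈ Finset.univ.erase w, ∏ m ∈ Finset.range (β v),
            ((k : ℝ) * T.coord v x - (m : ℝ)) / ((m : ℝ) + 1) :=
          Finset.prod_congr rfl fun v hv => by
            rw [Function.update_of_ne (Finset.ne_of_mem_erase hv)]
        rw [h4, Function.update_self, Finset.prod_range_succ]
        have : (β w : ℝ) + 1 ≠ 0 := by positivity
        field_simp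
        ring
      rw [h3]
      refine Submodule.add_mem _ (Submodule.smul_mem _ _ (Submodule.subset_span ⟨_, ?_, rfl⟩))
        (Submodule.smul_mem _ _ (Submodule.subset_span ⟨_, hβ.trans (Nat.le_succ j), rfl⟩))
      rw [Finset.sum_update_of_mem (Finset.mem_univ w), ← Finset.erase_eq]
      have := Finset.add_sum_erase Finset.univ β (Finset.mem_univ w)
      omega
    · intro f g _ _ hf hg
      rw [map_add]
      exact Submodule.add_mem _ hf hg
    · intro a f _ hf
      rw [map_smul]
      exact Submodule.smul_mem _ _ hf

variable {k} in
theorem interp_prod_coord (hk : 1 ≤ k) {j : ℕ} (hj : j ≤ k) (r : Fin j → Fin (d + 1)) (x : Pt d) :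
    T.interp k (fun y => ∏ i, T.coord (r i) y) x = ∏ i, T.coord (r i) x := by
  refine Submodule.span_induction (p := fun f _ => T.interp k f x = f x) ?_ ?_ ?_ ?_
    (T.prod_coord_mem_span hk r)
  · rintro _ ⟨β, hβ, rfl⟩
    exact T.interp_prod_choose hk (hβ.trans hj) x
  · simp [interp]
  · intro f g _ _ hf hg
    rw [Pi.add_apply, ← hf, ← hg]
    exact T.interp_add k f g x
  · intro a f _ hf
    rw [Pi.smul_apply, ← hf]
    exact T.interp_smul k a f x

theorem interp_smul_const (f : Pt d → ℝ) (c : F) (x : Pt d) :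
    T.interp k (fun y => f y • c) x = T.interp k f x • c := by
  simp [interp, Finset.sum_smul, smul_smul]

variable {k} in
/-- Interpolation reproduces homogeneous polynomials about any point. -/
theorem interp_multilinear {G : Type*} [NormedAddCommGroup G] [NormedSpace ℝ G] (hk : 1 ≤ k)
    {j : ℕ} (hj : j ≤ k) (M : ContinuousMultilinearMap ℝ (fun _ : Fin j => Pt d) G) (z x : Pt d) :
    T.interp k (fun y => M (fun _ => y - z)) x = M (fun _ => x - z) := by
  -- Since the barycentric coordinates add up to `1`, `y - z` is the combination of the vectors `T v
  -- - z` with the coordinates of `y` as coefficients. Multilinearity leaves products of `j`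
  -- coordinates.
  have h1 : ∀ y : Pt d, M (fun _ => y - z) =
      ∑ r : Fin j → Fin (d + 1), (∏ i, T.coord (r i) y) • M (fun i => T (r i) - z) := by
    intro y
    have h2 : y - z = ∑ v, T.coord v y • (T v - z) := by
      simp only [smul_sub, Finset.sum_sub_distrib, T.sum_coord_smul, ← Finset.sum_smul,
        T.sum_coord, one_smul]
    rw [h2, M.map_sum]
    exact Finset.sum_congr rfl fun r _ => M.map_smul_univ _ _
  simp only [h1, interp_sum, interp_smul_const, T.interp_prod_coord hk hj]

variable {k} in
theorem interp_const (hk : 1 ≤ k) (c : F) (x : Pt d) : T.interp k (fun _ => c) x = c := by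
  have := T.interp_prod_coord hk (Nat.zero_le k) Fin.elim0 x
  simp only [Finset.univ_eq_empty, Finset.prod_empty] at this
  have h2 := T.interp_smul_const k (fun _ => (1 : ℝ)) c x
  rw [this] at h2
  simpa using h2

end Cell

end Interpolation

/-! ### Shape regular simplices and conforming meshes -/

section Simplices

open Set Finset Filter Topology

set_option maxSynthPendingDepth 3

namespace Cell

variable {d : ℕ} (T : Cell d) {k : ℕ}

/-- The gradient of a barycentric coordinate. -/
noncomputable def coordL (v : Fin (d + 1)) : Pt d →L[ℝ] ℝ :=
  LinearMap.toContinuousLinearMap (T.coord v).linear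

theorem coord_sub_coord (v : Fin (d + 1)) (x y : Pt d) :
    T.coord v x - T.coord v y = T.coordL v (x - y) := by
  have := (T.coord v).linearMap_vsub x y
  simpa [coordL] using this.symm

theorem hasFDerivAt_coord (v : Fin (d + 1)) (x : Pt d) :
    HasFDerivAt (T.coord v) (T.coordL v) x := by
  have h : (T.coord v : Pt d → ℝ) = fun y => T.coordL v y + (T.coord v x - T.coordL v x) := by
    funext y
    have := T.coord_sub_coord v y x
    rw [map_sub] at this
    linarith
  rw [h]
  exact (T.coordL v).hasFDerivAt.add_const _

theorem mem_body {x : Pt d} : x ∈ T.body ↔ ∀ v, 0 ≤ T.coord v x := by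
  rw [body, T.convexHull_eq_nonneg_coord]; rfl

theorem mem_interior_body {x : Pt d} : x ∈ interior T.body ↔ ∀ v, 0 < T.coord v x := by
  rw [body, T.interior_convexHull]; rfl

theorem convex_body : Convex ℝ T.body := convex_convexHull ℝ _

theorem isCompact_body : IsCompact T.body := (Set.finite_range T).isCompact_convexHull ℝ

theorem isClosed_body : IsClosed T.body := T.isCompact_body.isClosed

theorem vertex_mem_body (v : Fin (d + 1)) : T v ∈ T.body := subset_convexHull ℝ _ ⟨v, rfl⟩

theorem centroid_mem_interior : Finset.univ.centroid ℝ T ∈ interior T.body :=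
  T.centroid_mem_interior_convexHull

theorem closure_interior_body : closure (interior T.body) = T.body := by
  rw [T.convex_body.closure_interior_eq_closure_of_nonempty_interior ⟨_, T.centroid_mem_interior⟩,
    T.isClosed_body.closure_eq]

theorem sum_smul_mem_body {c : Fin (d + 1) → ℝ} (h0 : ∀ v, 0 ≤ c v) (h1 : ∑ v, c v = 1) :
    ∑ v, c v • T v ∈ T.body := by
  rw [mem_body]
  intro v
  rw [T.coord_sum_smul h1]
  exact h0 v

theorem node_mem_body (hk : 1 ≤ k) {α : Fin (d + 1) → ℕ}
    (hα : α ∈ Finset.piAntidiag Finset.univ k) : T.node k α ∈ T.body :=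
  T.sum_smul_mem_body (fun _ => by positivity) (sum_weights_node hk hα)

theorem mem_face {σ : Finset (Fin (d + 1))} {x : Pt d} :
    x ∈ T.face σ ↔ (∀ v, 0 ≤ T.coord v x) ∧ ∀ v, v ∉ σ → T.coord v x = 0 := by
  constructor
  · intro hx
    have hb : x ∈ T.body := convexHull_mono (Set.image_subset_range _ _) hx
    refine ⟨T.mem_body.1 hb, fun v hv => ?_⟩
    have hc : Convex ℝ {y : Pt d | T.coord v y = 0} := by
      intro y hy z hz a b _ _ hab
      have h1 : T.coord v (a • y + b • z) = a • T.coord v y + b • T.coord v z :=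
        Convex.combo_affine_apply hab
      simp only [Set.mem_ofPred_eq] at hy hz ⊢
      rw [h1, hy, hz]; simp
    refine convexHull_min ?_ hc hx
    rintro _ ⟨w, hw, rfl⟩
    exact T.coord_apply_ne fun h => hv (h ▸ hw)
  · rintro ⟨h0, h1⟩
    have hs : ∑ v ∈ σ, T.coord v x = 1 := by
      rw [← T.sum_coord x]
      exact Finset.sum_subset (Finset.subset_univ _) fun v _ hv => h1 v hv
    have hx : ∑ v ∈ σ, T.coord v x • T v = x := by
      conv_rhs => rw [← T.sum_coord_smul x]
      exact Finset.sum_subset (Finset.subset_univ _) fun v _ hv => by rw [h1 v hv, zero_smul]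
    rw [← hx]
    exact (convex_convexHull ℝ _).sum_mem (fun v _ => h0 v) hs
      fun v hv => subset_convexHull ℝ _ ⟨v, hv, rfl⟩

theorem face_subset_body (σ : Finset (Fin (d + 1))) : T.face σ ⊆ T.body :=
  convexHull_mono (Set.image_subset_range _ _)

theorem exists_eq_single {α : Fin (d + 1) → ℕ} (hα : α ∈ Finset.piAntidiag Finset.univ 1) :
    ∃ v, α = Pi.single v 1 := by
  have hs := sum_univ_of_mem 1 hα
  obtain ⟨v, hv⟩ : ∃ v, α v ≠ 0 := by
    by_contra! h
    simp [h] at hs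
  refine ⟨v, ?_⟩
  have h1 := Finset.add_sum_erase Finset.univ α (Finset.mem_univ v)
  have h2 : ∑ w ∈ Finset.univ.erase v, α w = 0 := by omega
  funext w
  by_cases hw : w = v
  · subst hw; simp; omega
  · rw [Pi.single_eq_of_ne hw]
    exact Finset.sum_eq_zero_iff.1 h2 w (Finset.mem_erase.2 ⟨hw, Finset.mem_univ _⟩)

theorem interp_one {F : Type*} [AddCommGroup F] [Module ℝ F] (f : Pt d → F) (x : Pt d) :
    T.interp 1 f x = ∑ v, T.coord v x • f (T v) := by
  have h1 : T.interp 1 f x = T.interp 1 (fun y => ∑ v, T.coord v y • f (T v)) x := by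
    refine Finset.sum_congr rfl fun α hα => ?_
    congr 1
    obtain ⟨w, rfl⟩ := exists_eq_single hα
    have h2 : T.node 1 (Pi.single w 1) = T w := by
      simp [node, Pi.single_apply]
    have h3 : ∀ v, T.coord v (T w) = if v = w then 1 else 0 := fun v => T.coord_apply v w
    simp [h2, h3]
  rw [h1, T.interp_sum]
  refine Finset.sum_congr rfl fun v _ => ?_
  rw [T.interp_smul_const]
  have := T.interp_prod_coord le_rfl le_rfl (fun _ : Fin 1 => v) x
  simp only [Finset.univ_unique, Finset.prod_singleton] at this
  rw [this]

/-- `T` has diameter at most `h`, and its barycentric coordinates have slope at most `κ / h`. -/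
structure Regular (h κ : ℝ) : Prop where
  pos : 0 < h
  diam : ∀ y ∈ T.body, ∀ z ∈ T.body, ‖y - z‖ ≤ h
  slope : ∀ v, ‖T.coordL v‖ ≤ κ / h

/-- A barycentric coordinate takes values in `[0, 1]` on the inscribed ball, so it changes by at
most `1` over a step of length `ρ / 2`; half of the radius is used because the ball is open. -/
theorem norm_coordL_le_of_ball {ρ : ℝ} (hρ : 0 < ρ) {c : Pt d} (hc : Metric.ball c ρ ⊆ T.body)
    (v : Fin (d + 1)) : ‖T.coordL v‖ ≤ 2 / ρ := by
  refine ContinuousLinearMap.opNorm_le_bound _ (by positivity) fun x => ?_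
  rcases eq_or_ne x 0 with rfl | hx
  · simp
  have hx' : 0 < ‖x‖ := norm_pos_iff.2 hx
  have h01 : ∀ y ∈ T.body, T.coord v y ∈ Icc (0 : ℝ) 1 := fun y hy => by
    refine ⟨T.mem_body.1 hy v, ?_⟩
    rw [← T.sum_coord y]
    exact Finset.single_le_sum (fun w _ => T.mem_body.1 hy w) (Finset.mem_univ v)
  have h1 := h01 c (hc (Metric.mem_ball_self hρ))
  have h2 := h01 (c + (ρ / 2 / ‖x‖) • x) (hc (by
    rw [mem_ball_iff_norm, add_sub_cancel_left, norm_smul, Real.norm_of_nonneg (by positivity),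
      div_mul_cancel₀ _ hx'.ne']
    linarith))
  have h3 := T.coord_sub_coord v (c + (ρ / 2 / ‖x‖) • x) c
  rw [add_sub_cancel_left, map_smul, smul_eq_mul] at h3
  have h4 : |ρ / 2 / ‖x‖ * T.coordL v x| ≤ 1 := by
    rw [← h3, abs_le]; constructor <;> linarith [h1.1, h1.2, h2.1, h2.2]
  rw [abs_mul, abs_of_pos (by positivity : 0 < ρ / 2 / ‖x‖)] at h4
  rw [Real.norm_eq_abs]
  have h5 : |T.coordL v x| = (ρ / 2 / ‖x‖ * |T.coordL v x|) * (2 / ρ * ‖x‖) := by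
    field_simp
  rw [h5]
  exact mul_le_of_le_one_left (by positivity) h4

/-- The closed neighbourhood of width `h` of a simplex. -/
def nbhd (h : ℝ) : Set (Pt d) := {x | ∃ y ∈ T.body, ‖x - y‖ ≤ h}

variable {T} {h κ : ℝ}

theorem body_subset_nbhd (hh : 0 ≤ h) : T.body ⊆ T.nbhd h := fun x hx => ⟨x, hx, by simpa⟩

theorem coord_le_one {x : Pt d} (hx : x ∈ T.body) (v : Fin (d + 1)) : T.coord v x ≤ 1 := by
  rw [← T.sum_coord x]
  exact Finset.single_le_sum (fun w _ => T.mem_body.1 hx w) (Finset.mem_univ v)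

namespace Regular

theorem kappa_nonneg (hT : T.Regular h κ) : 0 ≤ κ := by
  have h1 := (norm_nonneg _).trans (hT.slope 0)
  have h2 := hT.pos
  by_contra! h3
  exact absurd h1 (not_le.2 (div_neg_of_neg_of_pos h3 h2))

theorem abs_coord_le (hT : T.Regular h κ) {x : Pt d} (hx : x ∈ T.nbhd h) (v : Fin (d + 1)) :
    |T.coord v x| ≤ 1 + κ := by
  obtain ⟨y, hy, hxy⟩ := hx
  have h1 := T.coord_sub_coord v x y
  have h2 : |T.coordL v (x - y)| ≤ κ := by
    rw [← Real.norm_eq_abs]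
    calc _ ≤ ‖T.coordL v‖ * ‖x - y‖ := (T.coordL v).le_opNorm _
      _ ≤ κ / h * h := by
        have := hT.pos
        have := hT.kappa_nonneg
        gcongr
        exact hT.slope v
      _ = κ := div_mul_cancel₀ _ hT.pos.ne'
  have h3 := T.mem_body.1 hy v
  have h4 := coord_le_one hy v
  rw [← h1] at h2
  rw [abs_le] at h2 ⊢
  constructor <;> linarith [h2.1, h2.2]

end Regular

theorem differentiable_refShape (k : ℕ) (α : Fin (d + 1) → ℕ) : ContDiff ℝ 1 (refShape k α) := by
  unfold refShape
  fun_prop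

/-- Uniformity over all simplices comes from compactness: the shape functions are fixed polynomials
in the barycentric coordinates, and these stay in a fixed cube. -/
theorem exists_refShape_bound (d k : ℕ) (R : ℝ) : ∃ C : ℝ, 1 ≤ C ∧
    ∀ α ∈ Finset.piAntidiag (Finset.univ : Finset (Fin (d + 1))) k, ∀ ξ : Fin (d + 1) → ℝ,
      (∀ v, |ξ v| ≤ R) → |refShape k α ξ| ≤ C ∧ ‖fderiv ℝ (refShape k α) ξ‖ ≤ C := by
  have h1 : ∀ α : Fin (d + 1) → ℕ, ∃ c : ℝ, 0 ≤ c ∧ ∀ ξ : Fin (d + 1) → ℝ, (∀ v, |ξ v| ≤ R) →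
      |refShape k α ξ| ≤ c ∧ ‖fderiv ℝ (refShape k α) ξ‖ ≤ c := by
    intro α
    have hc := isCompact_closedBall (0 : Fin (d + 1) → ℝ) |R|
    obtain ⟨c₁, hc₁⟩ := hc.exists_bound_of_continuousOn
      (differentiable_refShape k α).continuous.continuousOn
    obtain ⟨c₂, hc₂⟩ := hc.exists_bound_of_continuousOn
      ((differentiable_refShape k α).continuous_fderiv (by simp)).continuousOn
    refine ⟨max (max c₁ c₂) 0, le_max_right _ _, fun ξ hξ => ?_⟩
    have hm : ξ ∈ Metric.closedBall (0 : Fin (d + 1) → ℝ) |R| := by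
      rw [mem_closedBall_zero_iff, pi_norm_le_iff_of_nonneg (abs_nonneg _)]
      exact fun v => (hξ v).trans (le_abs_self R)
    exact ⟨(hc₁ ξ hm).trans ((le_max_left _ _).trans (le_max_left _ _)),
      (hc₂ ξ hm).trans ((le_max_right _ _).trans (le_max_left _ _))⟩
  choose c hc0 hc using h1
  refine ⟨1 + ∑ α ∈ Finset.piAntidiag (Finset.univ : Finset (Fin (d + 1))) k, c α,
    le_add_of_nonneg_right (Finset.sum_nonneg fun α _ => hc0 α), fun α hα ξ hξ => ?_⟩
  have h2 := Finset.single_le_sum (f := c) (fun α _ => hc0 α) hα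
  exact ⟨(hc α ξ hξ).1.trans (by linarith), (hc α ξ hξ).2.trans (by linarith)⟩

variable (T) in
theorem hasFDerivAt_shape (k : ℕ) (α : Fin (d + 1) → ℕ) (x : Pt d) : HasFDerivAt (T.shape k α)
    ((fderiv ℝ (refShape k α) (fun v => T.coord v x)).comp (ContinuousLinearMap.pi T.coordL)) x := by
  have h1 : HasFDerivAt (fun y => fun v => T.coord v y) (ContinuousLinearMap.pi T.coordL) x :=
    hasFDerivAt_pi.2 fun v => T.hasFDerivAt_coord v x
  exact (((differentiable_refShape k α).differentiable (by simp)) _).hasFDerivAt.comp x h1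

/-- The estimate covers a neighbourhood of width `h`, because the polynomial extension from `T` will
be evaluated at displaced points outside of `T`. There the coordinates are bounded by `1 + κ`. -/
theorem Regular.exists_shape_bound (d k : ℕ) (κ : ℝ) : ∃ C : ℝ, 1 ≤ C ∧
    ∀ (T : Cell d) (h : ℝ), T.Regular h κ → ∀ x ∈ T.nbhd h,
      ∀ α ∈ Finset.piAntidiag (Finset.univ : Finset (Fin (d + 1))) k,
        |T.shape k α x| ≤ C ∧ ‖fderiv ℝ (T.shape k α) x‖ ≤ C / h := by
  obtain ⟨C, hC1, hC⟩ := exists_refShape_bound d k (1 + κ)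
  refine ⟨C * (1 + |κ|), by nlinarith [abs_nonneg κ], fun T h hT x hx α hα => ?_⟩
  obtain ⟨h1, h2⟩ := hC α hα (fun v => T.coord v x) fun v => hT.abs_coord_le hx v
  have hκ := hT.kappa_nonneg
  have hh := hT.pos
  rw [abs_of_nonneg hκ]
  refine ⟨h1.trans (by nlinarith), ?_⟩
  rw [(T.hasFDerivAt_shape k α x).fderiv]
  have h3 : ‖ContinuousLinearMap.pi T.coordL‖ ≤ κ / h := by
    refine ContinuousLinearMap.opNorm_le_bound _ (by positivity) fun y => ?_
    rw [pi_norm_le_iff_of_nonneg (by positivity)]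
    intro v
    exact (T.coordL v).le_of_opNorm_le (hT.slope v) y
  calc _ ≤ ‖fderiv ℝ (refShape k α) (fun v => T.coord v x)‖ * ‖ContinuousLinearMap.pi T.coordL‖ :=
        ContinuousLinearMap.opNorm_comp_le _ _
    _ ≤ C * (κ / h) := by gcongr
    _ ≤ C * (1 + κ) / h := by
        rw [mul_div_assoc]
        gcongr
        linarith

section Estimates

variable {F : Type} [NormedAddCommGroup F] [NormedSpace ℝ F]

variable (T) in
theorem hasFDerivAt_interp (k : ℕ) (f : Pt d → F) (x : Pt d) : HasFDerivAt (T.interp k f)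
    (∑ α ∈ Finset.piAntidiag Finset.univ k,
      (fderiv ℝ (T.shape k α) x).smulRight (f (T.node k α))) x := by
  have h0 : T.interp k f = fun x => ∑ α ∈ Finset.piAntidiag Finset.univ k,
    T.shape k α x • f (T.node k α) := rfl
  rw [h0]
  refine HasFDerivAt.fun_sum fun α _ => ?_
  exact (T.hasFDerivAt_shape k α x).differentiableAt.hasFDerivAt.smul_const _

variable (T) in
theorem differentiableAt_interp (k : ℕ) (f : Pt d → F) (x : Pt d) :
    DifferentiableAt ℝ (T.interp k f) x := (T.hasFDerivAt_interp k f x).differentiableAt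

theorem Regular.exists_interp_bound (d k : ℕ) (κ : ℝ) : ∃ C : ℝ, 1 ≤ C ∧
    ∀ (F : Type) [NormedAddCommGroup F] [NormedSpace ℝ F] (T : Cell d) (h : ℝ), T.Regular h κ →
      ∀ (f : Pt d → F) (ε : ℝ), (∀ α ∈ Finset.piAntidiag (Finset.univ : Finset (Fin (d + 1))) k,
        ‖f (T.node k α)‖ ≤ ε) → ∀ x ∈ T.nbhd h,
          ‖T.interp k f x‖ ≤ C * ε ∧ ‖fderiv ℝ (T.interp k f) x‖ ≤ C * ε / h := by
  obtain ⟨C, hC1, hC⟩ := Regular.exists_shape_bound d k κ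
  set N : ℝ := ((Finset.piAntidiag (Finset.univ : Finset (Fin (d + 1))) k).card : ℝ) with hN
  have hN0 : 0 ≤ N := Nat.cast_nonneg _
  refine ⟨1 + N * C, by nlinarith, fun F _ _ T h hT f ε hf x hx => ?_⟩
  have hh := hT.pos
  have hε : 0 ≤ ε := by
    have h1 : (Pi.single 0 k : Fin (d + 1) → ℕ) ∈
        Finset.piAntidiag (Finset.univ : Finset (Fin (d + 1))) k := by simp
    exact (norm_nonneg _).trans (hf _ h1)
  constructor
  · calc ‖T.interp k f x‖ ≤ ∑ α ∈ Finset.piAntidiag Finset.univ k, ‖T.shape k α x • f (T.node k α)‖ :=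
          norm_sum_le _ _
      _ ≤ ∑ α ∈ Finset.piAntidiag (Finset.univ : Finset (Fin (d + 1))) k, C * ε := by
          refine Finset.sum_le_sum fun α hα => ?_
          rw [norm_smul]
          exact mul_le_mul (hC T h hT x hx α hα).1 (hf α hα) (norm_nonneg _) (by linarith)
      _ ≤ _ := by
          rw [Finset.sum_const, nsmul_eq_mul, ← hN]
          nlinarith
  · rw [(T.hasFDerivAt_interp k f x).fderiv]
    calc _ ≤ ∑ α ∈ Finset.piAntidiag Finset.univ k,
            ‖(fderiv ℝ (T.shape k α) x).smulRight (f (T.node k α))‖ := norm_sum_le _ _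
      _ ≤ ∑ α ∈ Finset.piAntidiag (Finset.univ : Finset (Fin (d + 1))) k, C / h * ε := by
          refine Finset.sum_le_sum fun α hα => ?_
          rw [ContinuousLinearMap.norm_smulRight_apply]
          exact mul_le_mul (hC T h hT x hx α hα).2 (hf α hα) (norm_nonneg _) (by positivity)
      _ ≤ _ := by
          rw [Finset.sum_const, nsmul_eq_mul, ← hN, mul_div_assoc, div_mul_eq_mul_div, mul_div_assoc]
          have : 0 ≤ ε / h := by positivity
          nlinarith

variable (T) in
theorem fderiv_interp_sub (f g : Pt d → F) (x : Pt d) :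
    fderiv ℝ (T.interp k (fun y => f y - g y)) x =
      fderiv ℝ (T.interp k f) x - fderiv ℝ (T.interp k g) x := by
  have h1 : T.interp k (fun y => f y - g y) = T.interp k f - T.interp k g := by
    funext y; exact T.interp_sub k f g y
  rw [h1]
  exact fderiv_sub (T.differentiableAt_interp k f x) (T.differentiableAt_interp k g x)

/-- The slope of an interpolant is controlled by the differences of the nodal values. -/
theorem Regular.exists_interp_slope_bound (d : ℕ) {k : ℕ} (hk : 1 ≤ k) (κ : ℝ) : ∃ C : ℝ, 1 ≤ C ∧
    ∀ (F : Type) [NormedAddCommGroup F] [NormedSpace ℝ F] (T : Cell d) (h : ℝ), T.Regular h κ →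
      ∀ (f : Pt d → F) (ε : ℝ), (∀ α ∈ Finset.piAntidiag (Finset.univ : Finset (Fin (d + 1))) k,
        ∀ β ∈ Finset.piAntidiag (Finset.univ : Finset (Fin (d + 1))) k,
          ‖f (T.node k α) - f (T.node k β)‖ ≤ ε) → ∀ x ∈ T.nbhd h,
          ‖fderiv ℝ (T.interp k f) x‖ ≤ C * ε / h := by
  obtain ⟨C, hC1, hC⟩ := Regular.exists_interp_bound d k κ
  refine ⟨C, hC1, fun F _ _ T h hT f ε hf x hx => ?_⟩
  have h1 : (Pi.single 0 k : Fin (d + 1) → ℕ) ∈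
      Finset.piAntidiag (Finset.univ : Finset (Fin (d + 1))) k := by simp
  -- Constants are reproduced and have slope zero, so one nodal value may be subtracted before the
  -- stability estimate is applied.
  set c := f (T.node k (Pi.single 0 k)) with hc
  have h2 := (hC F T h hT (fun y => f y - c) ε (fun α hα => hf α hα _ h1) x hx).2
  rw [T.fderiv_interp_sub f (fun _ => c)] at h2
  have h3 : T.interp k (fun _ => c) = fun _ => c := by
    funext y; exact T.interp_const hk c y
  rw [h3, fderiv_const_apply, sub_zero] at h2
  exact h2

/-- The interpolation error for functions with bounded derivatives. -/
theorem Regular.exists_interp_error (d : ℕ) {k : ℕ} (hk : 1 ≤ k) (κ : ℝ) : ∃ C : ℝ, 1 ≤ C ∧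
    ∀ (F : Type) [NormedAddCommGroup F] [NormedSpace ℝ F] (T : Cell d) (h : ℝ), T.Regular h κ →
      ∀ (s : Set (Pt d)) (f : Pt d → F) (M : ℝ), Convex ℝ s → T.body ⊆ s →
        BddDerivOn s (k + 1) M f → ∀ x ∈ T.nbhd h, s ∈ 𝓝 x →
          ‖f x - T.interp k f x‖ ≤ C * M * h ^ (k + 1) ∧
          ∀ f' : Pt d →L[ℝ] F, HasFDerivAt f f' x →
            ‖f' - fderiv ℝ (T.interp k f) x‖ ≤ C * M * h ^ k := by
  obtain ⟨C, hC1, hC⟩ := Regular.exists_interp_bound d k κ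
  have h2k : (1 : ℝ) ≤ 2 ^ (k + 1) := one_le_pow₀ (by norm_num)
  refine ⟨C * 2 ^ (k + 1), by nlinarith, fun F _ _ T h hT s f M hs hTs hf x hx hsx => ?_⟩
  have hh := hT.pos
  have hxs := mem_of_mem_nhds hsx
  have hM0 : 0 ≤ M := (norm_nonneg _).trans (hf.bound hxs)
  -- The Taylor polynomial is centred at the point `x` of evaluation. It is reproduced by the
  -- interpolation and agrees with `f` at `x`, so the error at `x` is, up to sign, the interpolant
  -- of the remainder.
  obtain ⟨P, -, hP⟩ := hf.exists_taylor hs hxs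
  set p : Pt d → F := fun y => ∑ j ∈ Finset.range (k + 1), P j (fun _ => y - x) with hp
  have hip : T.interp k p = p := by
    funext y
    simp only [hp]
    rw [T.interp_sum]
    refine Finset.sum_congr rfl fun j hj => ?_
    exact T.interp_multilinear hk (by have := Finset.mem_range.1 hj; omega) (P j) x y
  have hpx : p x = f x := by
    have : ‖f x - p x‖ ≤ M * ‖x - x‖ ^ (k + 1) := hP x hxs
    rw [sub_self, norm_zero, zero_pow (by omega), mul_zero] at this
    exact (sub_eq_zero.1 (norm_le_zero_iff.1 this)).symm
  have hnode : ∀ α ∈ Finset.piAntidiag (Finset.univ : Finset (Fin (d + 1))) k,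
      ‖f (T.node k α) - p (T.node k α)‖ ≤ M * (2 * h) ^ (k + 1) := by
    intro α hα
    have hb := T.node_mem_body hk hα
    refine (hP _ (hTs hb)).trans ?_
    have : ‖T.node k α - x‖ ≤ 2 * h := by
      obtain ⟨y, hy, hxy⟩ := hx
      have h1 := hT.diam _ hb y hy
      calc ‖T.node k α - x‖ = ‖(T.node k α - y) - (x - y)‖ := by congr 1; abel
        _ ≤ ‖T.node k α - y‖ + ‖x - y‖ := norm_sub_le _ _
        _ ≤ 2 * h := by linarith
    gcongr
  obtain ⟨e1, e2⟩ := hC F T h hT (fun y => f y - p y) _ hnode x hx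
  constructor
  · rw [T.interp_sub, hip, hpx] at e1
    rw [norm_sub_rev]
    refine e1.trans (le_of_eq ?_)
    rw [mul_pow]; ring
  · intro f' hf'
    rw [T.fderiv_interp_sub f p, hip] at e2
    -- The remainder is of order `k + 1 ≥ 2` at `x`, hence its derivative there vanishes and any
    -- derivative of `f` at `x` is one of `p`.
    have h0 : HasFDerivAt (fun y => f y - p y) (0 : Pt d →L[ℝ] F) x := by
      refine Asymptotics.IsBigO.hasFDerivAt (n := k + 1) ?_ (by omega)
      refine Asymptotics.IsBigO.of_bound M ?_
      filter_upwards [hsx] with y hy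
      rw [Real.norm_of_nonneg (by positivity)]
      exact hP y hy
    have h1 : HasFDerivAt p f' x := by
      have := hf'.sub h0
      rw [sub_zero] at this
      refine this.congr_of_eventuallyEq (Eventually.of_forall fun y => ?_)
      simp
    rw [h1.fderiv] at e2
    rw [norm_sub_rev]
    refine e2.trans (le_of_eq ?_)
    rw [mul_pow]
    field_simp
    ring

end Estimates

end Cell

namespace Mesh

variable {d : ℕ} (M : Mesh d)

theorem isClosed_elem (T : Fin M.card) : IsClosed (M.elem T) := (M.cell T).isClosed_body

theorem mem_domain {x : Pt d} : x ∈ M.domain ↔ ∃ T, x ∈ M.elem T := by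
  simp [domain, region]

theorem elem_subset_domain (T : Fin M.card) : M.elem T ⊆ M.domain :=
  fun _ hx => M.mem_domain.2 ⟨T, hx⟩

theorem isClosed_domain : IsClosed M.domain := by
  have : M.domain = ⋃ T, M.elem T := by simp [domain, region]
  rw [this]
  exact isClosed_iUnion_of_finite fun T => M.isClosed_elem T

/-- The numbers of the vertices of `T` that are vertices of `T'`. -/
noncomputable def common (T T' : Fin M.card) : Finset (Fin (d + 1)) :=
  {v | M.cell T v ∈ Set.range (M.cell T')}

theorem mem_common {T T' : Fin M.card} {v : Fin (d + 1)} :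
    v ∈ M.common T T' ↔ M.cell T v ∈ Set.range (M.cell T') := by
  classical
  simp [common]

theorem inter_eq_face (T T' : Fin M.card) :
    M.elem T ∩ M.elem T' = (M.cell T).face (M.common T T') := by
  rw [elem, elem, M.conforming, Cell.face]
  congr 1
  ext y
  constructor
  · rintro ⟨⟨v, rfl⟩, hy⟩
    exact ⟨v, M.mem_common.2 hy, rfl⟩
  · rintro ⟨v, hv, rfl⟩
    exact ⟨⟨v, rfl⟩, M.mem_common.1 hv⟩

/-- In the interior no coordinate vanishes, so the common face is the whole of `T` and every vertex
of `T` is one of `T'`. Both have `d + 1` vertices, and vertex sets determine elements. -/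
theorem eq_of_mem_interior {T T' : Fin M.card} {x : Pt d} (hx : x ∈ interior (M.elem T))
    (hx' : x ∈ M.elem T') : T = T' := by
  have h1 : x ∈ (M.cell T).face (M.common T T') := by
    rw [← M.inter_eq_face]; exact ⟨interior_subset hx, hx'⟩
  have h2 := ((M.cell T).mem_face.1 h1).2
  have h3 := (M.cell T).mem_interior_body.1 hx
  have h4 : Set.range (M.cell T) ⊆ Set.range (M.cell T') := by
    rintro _ ⟨v, rfl⟩
    by_contra hv
    exact (h3 v).ne' (h2 v fun h => hv (M.mem_common.1 h))
  apply M.vertices_injective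
  refine Set.eq_of_subset_of_ncard_le h4 ?_ (Set.finite_range _)
  change (Set.range (M.cell T')).ncard ≤ (Set.range (M.cell T)).ncard
  rw [← Set.image_univ, ← Set.image_univ, Set.ncard_image_of_injective _ (M.cell T).ind.injective,
    Set.ncard_image_of_injective _ (M.cell T').ind.injective]

/-- Interpolants of the same function on two elements agree on the common face. -/
theorem interp_eq_of_mem {F : Type*} [AddCommGroup F] [Module ℝ F] {T T' : Fin M.card} (k : ℕ)
    (f : Pt d → F) {x : Pt d} (hx : x ∈ M.elem T) (hx' : x ∈ M.elem T') :
    (M.cell T).interp k f x = (M.cell T').interp k f x := by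
  set A := M.cell T with hA
  set B := M.cell T' with hB
  set σ := M.common T T' with hσ
  have h1 : x ∈ A.face σ := by rw [hA, hσ, ← M.inter_eq_face]; exact ⟨hx, hx'⟩
  have h0 := (A.mem_face.1 h1).2
  have hc : ∀ v ∈ σ, ∃ w, B w = A v := fun v hv => M.mem_common.1 hv
  choose! e he using hc
  -- The identification of the common vertices is extended to a renumbering of all vertices. The
  -- choice of the extension is irrelevant, since the remaining coordinates vanish at `x`.
  obtain ⟨g, hg⟩ := Finset.exists_equiv_extend_of_card_eq (α := Fin (d + 1)) (β := Fin (d + 1))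
    (t := Finset.univ) (by simp) (s := σ) (f := e) (Finset.subset_univ _) (by
      intro v hv w hw hvw
      apply A.ind.injective
      rw [← he v hv, ← he w hw, hvw])
  let π : Fin (d + 1) ≃ Fin (d + 1) := g.trans ⟨fun x => x.1, fun x => ⟨x, Finset.mem_univ x⟩,
    fun _ => rfl, fun _ => rfl⟩
  have hπ : ∀ v ∈ σ, B (π v) = A v := fun v hv => by
    have : π v = e v := hg v hv
    rw [this, he v hv]
  have hcoord : ∀ v, B.coord (π v) x = A.coord v x := by
    intro v
    have hx1 : x = ∑ w, A.coord (π.symm w) x • B w := by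
      rw [← Equiv.sum_comp π]
      conv_lhs => rw [← A.sum_coord_smul x]
      refine Finset.sum_congr rfl fun w _ => ?_
      rw [Equiv.symm_apply_apply]
      by_cases hw : w ∈ σ
      · rw [hπ w hw]
      · rw [h0 w hw, zero_smul, zero_smul]
    have hs : ∑ w, A.coord (π.symm w) x = 1 := by
      rw [Equiv.sum_comp π.symm (fun w => A.coord w x)]
      exact A.sum_coord x
    conv_lhs => rw [hx1]
    rw [B.coord_sum_smul hs, Equiv.symm_apply_apply]
  refine Finset.sum_nbij' (fun α => α ∘ π.symm) (fun α => α ∘ π) ?_ ?_ ?_ ?_ ?_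
  · intro α hα
    simp only [Finset.mem_piAntidiag, Finset.mem_univ, implies_true, and_true] at hα ⊢
    rw [← hα]
    exact Equiv.sum_comp π.symm α
  · intro α hα
    simp only [Finset.mem_piAntidiag, Finset.mem_univ, implies_true, and_true] at hα ⊢
    rw [← hα]
    exact Equiv.sum_comp π α
  · intro α _
    funext v; simp
  · intro α _
    funext v; simp
  · intro α _
    have hsh : A.shape k α x = B.shape k (α ∘ π.symm) x := by
      unfold Cell.shape
      rw [← Equiv.prod_comp π (fun v => ∏ m ∈ Finset.range ((α ∘ π.symm) v),
        ((k : ℝ) * B.coord v x - (m : ℝ)) / ((m : ℝ) + 1))]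
      simp [hcoord]
    rw [← hsh]
    by_cases hα : ∀ v, v ∉ σ → α v = 0
    · congr 2
      unfold Cell.node
      rw [← Equiv.sum_comp π (fun v => (((α ∘ π.symm) v : ℕ) / (k : ℝ)) • B v)]
      refine Finset.sum_congr rfl fun v _ => ?_
      simp only [Function.comp, Equiv.symm_apply_apply]
      by_cases hv : v ∈ σ
      · rw [hπ v hv]
      · rw [hα v hv]; simp
    · push Not at hα
      obtain ⟨v, hv, hαv⟩ := hα
      -- A node off the common face has some `α v > 0` with `v ∉ σ`, and the factor with `m = 0` in
      -- its shape function is a multiple of the coordinate of `v`, which vanishes at `x`.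
      have hz : A.shape k α x = 0 := by
        unfold Cell.shape
        refine Finset.prod_eq_zero (Finset.mem_univ v) ?_
        refine Finset.prod_eq_zero (Finset.mem_range.2 (Nat.pos_of_ne_zero hαv)) ?_
        rw [h0 v hv]; simp
      rw [hz, zero_smul, zero_smul]

theorem linInterp_eq (T : Fin M.card) (u : Pt d → ℝ) {x : Pt d} (hx : x ∈ M.elem T) :
    M.linInterp u x = (M.cell T).interp 1 u x := by
  have h : ∃ T, x ∈ M.elem T := ⟨T, hx⟩
  rw [linInterp, dif_pos h]
  exact M.interp_eq_of_mem 1 u h.choose_spec hx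

theorem oswald_eq {k : ℕ} {A : Set (Fin M.card)} {T : Fin M.card} (hT : T ∈ A)
    (w : Fin M.card → Pt d → Pt d) {x : Pt d} (hx : x ∈ M.elem T) :
    M.oswald k A w x = (M.cell T).interp k (M.nodeAverage k A w) x := by
  have h : ∃ T, T ∈ A ∧ x ∈ M.elem T := ⟨T, hT, hx⟩
  rw [oswald, dif_pos h]
  exact M.interp_eq_of_mem k _ h.choose_spec.2 hx

/-- The barycentre of the face lies in some active element. The intersection of this element with
`T` is a face of `T`, and a face containing a relative interior point of another one contains all of
it. -/
theorem exists_elem_of_face_subset {A : Set (Fin M.card)} {T : Fin M.card}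
    {ρ : Finset (Fin (d + 1))} (hρ : ρ.Nonempty) (hA : (M.cell T).face ρ ⊆ M.region A) :
    ∃ T' ∈ A, (M.cell T).face ρ ⊆ M.elem T' := by
  have hc : (ρ.card : ℝ) ≠ 0 := by exact_mod_cast hρ.card_pos.ne'
  let c : Fin (d + 1) → ℝ := fun v => if v ∈ ρ then (ρ.card : ℝ)⁻¹ else 0
  have hs : ∑ v, c v = 1 := by
    simp [c, hc]
  have hx : ∑ v, c v • (M.cell T) v ∈ (M.cell T).face ρ := by
    rw [Cell.mem_face]
    simp only [(M.cell T).coord_sum_smul hs]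
    constructor
    · intro v; simp only [c]; split_ifs <;> positivity
    · intro v hv; simp [c, hv]
  obtain ⟨T', hT', hx'⟩ : ∃ T' ∈ A, ∑ v, c v • (M.cell T) v ∈ M.elem T' := by
    simpa [region] using hA hx
  refine ⟨T', hT', ?_⟩
  have h1 : ∑ v, c v • (M.cell T) v ∈ (M.cell T).face (M.common T T') := by
    rw [← M.inter_eq_face]
    exact ⟨(M.cell T).face_subset_body _ hx, hx'⟩
  have h2 : ρ ⊆ M.common T T' := by
    intro v hv
    by_contra hv'
    have := ((M.cell T).mem_face.1 h1).2 v hv'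
    rw [(M.cell T).coord_sum_smul hs] at this
    simp [c, hv, hρ.ne_empty] at this
  refine Set.Subset.trans ?_ (Set.inter_subset_right (s := M.elem T))
  rw [M.inter_eq_face]
  exact convexHull_mono (Set.image_mono (by exact_mod_cast h2))

end Mesh

end Simplices

/-! ### Interpolation in time -/

section TimeInterpolation

open Set Finset Filter Topology

set_option maxSynthPendingDepth 3

namespace Slab

variable {d : ℕ} (S : Slab d) {qt : ℕ} {τ : Fin (qt + 1) → ℝ}

theorem timeNode_mem (hdt : 0 < S.dt) (hτ : ∀ i, τ i ∈ Set.Ioc (0 : ℝ) 1) (i : Fin (qt + 1)) :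
    S.timeNode τ i ∈ S.I := by
  have h1 := (hτ i).1
  have h2 := (hτ i).2
  have h3 : S.dt * τ i ≤ S.dt * 1 := by gcongr
  have h4 : 0 < S.dt * τ i := by positivity
  simp only [timeNode, I, Set.mem_Ioc]
  constructor
  · linarith
  · unfold dt at *; linarith

theorem timeNode_injective (hdt : 0 < S.dt) (hτ : Function.Injective τ) :
    Function.Injective (S.timeNode τ) := by
  intro i j hij
  simp only [timeNode] at hij
  exact hτ (mul_left_cancel₀ hdt.ne' (add_left_cancel hij))

theorem convex_I : Convex ℝ S.I := convex_Ioc _ _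

theorem uniqueDiffOn_I : UniqueDiffOn ℝ S.I := uniqueDiffOn_Ioc _ _

theorem abs_sub_le_dt {s t : ℝ} (hs : s ∈ S.I) (ht : t ∈ S.I) : |s - t| ≤ S.dt := by
  simp only [I, Set.mem_Ioc] at hs ht
  rw [abs_le]; unfold dt; constructor <;> linarith [hs.1, hs.2, ht.1, ht.2]

theorem timeBasis_eq (hdt : 0 < S.dt) (i : Fin (qt + 1)) (t : ℝ) :
    S.timeBasis τ i t = (Lagrange.basis Finset.univ τ i).eval ((t - S.t₀) / S.dt) := by
  simp only [timeBasis, Lagrange.basis, Polynomial.eval_prod, Lagrange.basisDivisor,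
    Polynomial.eval_mul, Polynomial.eval_C, Polynomial.eval_sub, Polynomial.eval_X, timeNode]
  refine Finset.prod_congr rfl fun j _ => ?_
  have h1 : S.t₀ + S.dt * τ i - (S.t₀ + S.dt * τ j) = S.dt * (τ i - τ j) := by ring
  rw [h1, mul_inv]
  field_simp
  ring

theorem differentiable_timeBasis (i : Fin (qt + 1)) : Differentiable ℝ (S.timeBasis τ i) :=
  Polynomial.differentiable _

/-- In the variable `(t - t₀) / Δt` the basis is a fixed family of polynomials on the compact
interval `[0, 1]`; each time derivative costs a factor `Δt⁻¹`. -/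
theorem exists_timeBasis_bound (τ : Fin (qt + 1) → ℝ) : ∃ C : ℝ, 1 ≤ C ∧
    ∀ (d : ℕ) (S : Slab d), 0 < S.dt → ∀ t ∈ S.I, ∀ i,
      |S.timeBasis τ i t| ≤ C ∧ |deriv (S.timeBasis τ i) t| ≤ C / S.dt := by
  have h1 : ∀ i, ∃ c : ℝ, 0 ≤ c ∧ ∀ s ∈ Set.Icc (0 : ℝ) 1,
      |(Lagrange.basis Finset.univ τ i).eval s| ≤ c ∧
      |(Lagrange.basis Finset.univ τ i).derivative.eval s| ≤ c := by
    intro i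
    obtain ⟨c₁, hc₁⟩ := (isCompact_Icc (a := (0 : ℝ)) (b := 1)).exists_bound_of_continuousOn
      (Lagrange.basis Finset.univ τ i).continuous.continuousOn
    obtain ⟨c₂, hc₂⟩ := (isCompact_Icc (a := (0 : ℝ)) (b := 1)).exists_bound_of_continuousOn
      (Lagrange.basis Finset.univ τ i).derivative.continuous.continuousOn
    exact ⟨max (max c₁ c₂) 0, le_max_right _ _, fun s hs =>
      ⟨(hc₁ s hs).trans ((le_max_left _ _).trans (le_max_left _ _)),
      (hc₂ s hs).trans ((le_max_right _ _).trans (le_max_left _ _))⟩⟩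
  choose c hc0 hc using h1
  refine ⟨1 + ∑ i, c i, le_add_of_nonneg_right (Finset.sum_nonneg fun i _ => hc0 i),
    fun d S hdt t ht i => ?_⟩
  have h2 := Finset.single_le_sum (f := c) (fun i _ => hc0 i) (Finset.mem_univ i)
  have hs : (t - S.t₀) / S.dt ∈ Set.Icc (0 : ℝ) 1 := by
    simp only [I, Set.mem_Ioc] at ht
    constructor
    · exact div_nonneg (by linarith [ht.1]) hdt.le
    · rw [div_le_one hdt]; unfold dt; linarith [ht.2]
  have hf : S.timeBasis τ i = fun t => (Lagrange.basis Finset.univ τ i).eval ((t - S.t₀) / S.dt) :=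
    funext fun t => S.timeBasis_eq hdt i t
  refine ⟨?_, ?_⟩
  · rw [hf]
    exact (hc i _ hs).1.trans (by linarith)
  · have h3 : HasDerivAt (S.timeBasis τ i)
        ((Lagrange.basis Finset.univ τ i).derivative.eval ((t - S.t₀) / S.dt) * (1 / S.dt)) t := by
      rw [hf]
      exact ((Lagrange.basis Finset.univ τ i).hasDerivAt _).comp t
        (((hasDerivAt_id t).sub_const S.t₀).div_const S.dt)
    rw [h3.deriv, abs_mul, abs_of_pos (by positivity : 0 < 1 / S.dt), mul_one_div]
    gcongr
    exact (hc i _ hs).2.trans (by linarith)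

variable {F : Type} [NormedAddCommGroup F] [NormedSpace ℝ F]

theorem sum_timeBasis_pow (hdt : 0 < S.dt) (hτ : Function.Injective τ) {j : ℕ} (hj : j ≤ qt)
    (z t : ℝ) : ∑ i, S.timeBasis τ i t * (S.timeNode τ i - z) ^ j = (t - z) ^ j := by
  have hdeg : ((Polynomial.X - Polynomial.C z) ^ j).degree <
      ((Finset.univ : Finset (Fin (qt + 1))).card : WithBot ℕ) := by
    rw [Polynomial.degree_pow, Polynomial.degree_X_sub_C]
    simp only [Finset.card_univ, Fintype.card_fin, nsmul_eq_mul, mul_one]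
    exact_mod_cast Nat.lt_succ_of_le hj
  have h := Lagrange.eq_interpolate (S.timeNode_injective hdt hτ).injOn hdeg
  have h2 := congrArg (Polynomial.eval t) h
  simp only [Lagrange.interpolate_apply, Polynomial.eval_finsetSum, Polynomial.eval_mul,
    Polynomial.eval_C, Polynomial.eval_pow, Polynomial.eval_sub, Polynomial.eval_X] at h2
  rw [h2]
  exact Finset.sum_congr rfl fun i _ => mul_comm _ _

theorem sum_timeBasis_polynomial (hdt : 0 < S.dt) (hτ : Function.Injective τ)
    (M : ∀ j : ℕ, ContinuousMultilinearMap ℝ (fun _ : Fin j => ℝ) F) {n : ℕ} (hn : n ≤ qt + 1)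
    (z t : ℝ) : ∑ i, S.timeBasis τ i t • ∑ j ∈ Finset.range n, M j (fun _ => S.timeNode τ i - z) =
      ∑ j ∈ Finset.range n, M j (fun _ => t - z) := by
  have h1 : ∀ (j : ℕ) (s : ℝ), M j (fun _ => s) = s ^ j • M j (fun _ => 1) := by
    intro j s
    have := (M j).map_smul_univ (fun _ => s) (fun _ => (1 : ℝ))
    simpa using this
  simp only [Finset.smul_sum]
  rw [Finset.sum_comm]
  refine Finset.sum_congr rfl fun j hj => ?_
  have := S.sum_timeBasis_pow hdt hτ (j := j) (by have := Finset.mem_range.1 hj; omega) z t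
  rw [h1 j (t - z), ← this, Finset.sum_smul]
  exact Finset.sum_congr rfl fun i _ => by rw [h1 j, smul_smul]

/-- The error of interpolation in time, as a functional. -/
noncomputable def timeError (τ : Fin (qt + 1) → ℝ) (t : ℝ) (f : ℝ → F) : F :=
  f t - ∑ i, S.timeBasis τ i t • f (S.timeNode τ i)

theorem timeError_add (t : ℝ) (f g : ℝ → F) :
    S.timeError τ t (fun s => f s + g s) = S.timeError τ t f + S.timeError τ t g := by
  simp only [timeError, smul_add, Finset.sum_add_distrib]
  abel

theorem timeError_sub (t : ℝ) (f g : ℝ → F) :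
    S.timeError τ t (fun s => f s - g s) = S.timeError τ t f - S.timeError τ t g := by
  simp only [timeError, smul_sub, Finset.sum_sub_distrib]
  abel

theorem timeError_polynomial (hdt : 0 < S.dt) (hτ : Function.Injective τ)
    (M : ∀ j : ℕ, ContinuousMultilinearMap ℝ (fun _ : Fin j => ℝ) F) {n : ℕ} (hn : n ≤ qt + 1)
    (z t : ℝ) : S.timeError τ t (fun s => ∑ j ∈ Finset.range n, M j (fun _ => s - z)) = 0 := by
  rw [timeError, S.sum_timeBasis_polynomial hdt hτ M hn, sub_self]

theorem exists_timeError_le (τ : Fin (qt + 1) → ℝ) (hτI : ∀ i, τ i ∈ Set.Ioc (0 : ℝ) 1) :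
    ∃ C : ℝ, 1 ≤ C ∧ ∀ (d : ℕ) (S : Slab d), 0 < S.dt →
      ∀ (F : Type) [NormedAddCommGroup F] [NormedSpace ℝ F] (f : ℝ → F) (ε : ℝ),
        (∀ t ∈ S.I, ‖f t‖ ≤ ε) → ∀ t ∈ S.I, ‖S.timeError τ t f‖ ≤ C * ε := by
  obtain ⟨C, hC1, hC⟩ := exists_timeBasis_bound τ
  refine ⟨1 + (qt + 1) * C, by nlinarith [(Nat.cast_nonneg qt : (0 : ℝ) ≤ qt)],
    fun d S hdt F _ _ f ε hf t ht => ?_⟩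
  calc ‖S.timeError τ t f‖ ≤ ‖f t‖ + ‖∑ i, S.timeBasis τ i t • f (S.timeNode τ i)‖ := norm_sub_le _ _
    _ ≤ ε + ∑ _i : Fin (qt + 1), C * ε := by
        refine add_le_add (hf t ht) ((norm_sum_le _ _).trans (Finset.sum_le_sum fun i _ => ?_))
        rw [norm_smul]
        exact mul_le_mul (hC d S hdt t ht i).1 (hf _ (S.timeNode_mem hdt hτI i)) (norm_nonneg _)
          (by linarith)
    _ = _ := by
        rw [Finset.sum_const, Finset.card_univ, Fintype.card_fin, nsmul_eq_mul]
        push_cast; ring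

/-- The error of interpolation in time for functions with bounded derivatives. -/
theorem exists_timeInterp_error (τ : Fin (qt + 1) → ℝ) (hτ : Function.Injective τ)
    (hτI : ∀ i, τ i ∈ Set.Ioc (0 : ℝ) 1) (hqt : 1 ≤ qt) :
    ∃ C : ℝ, 1 ≤ C ∧ ∀ (d : ℕ) (S : Slab d), 0 < S.dt →
      ∀ (F : Type) [NormedAddCommGroup F] [NormedSpace ℝ F] (f : ℝ → F) (M : ℝ),
        BddDerivOn S.I (qt + 1) M f → ∀ t ∈ S.I,
          ‖S.timeError τ t f‖ ≤ C * M * S.dt ^ (qt + 1) ∧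
          ∀ f' : F, HasDerivWithinAt f f' S.I t →
            ‖f' - ∑ i, deriv (S.timeBasis τ i) t • f (S.timeNode τ i)‖ ≤ C * M * S.dt ^ qt := by
  obtain ⟨C₁, hC₁1, hC₁⟩ := exists_timeBasis_bound τ
  obtain ⟨C₂, hC₂1, hC₂⟩ := exists_timeError_le τ hτI
  refine ⟨C₂ + (qt + 1) * C₁, by nlinarith [(Nat.cast_nonneg qt : (0 : ℝ) ≤ qt)],
    fun d S hdt F _ _ f M hf t ht => ?_⟩
  have hM0 : 0 ≤ M := (norm_nonneg _).trans (hf.bound ht)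
  obtain ⟨P, -, hP⟩ := hf.exists_taylor S.convex_I ht
  set p : ℝ → F := fun s => ∑ j ∈ Finset.range (qt + 1), P j (fun _ => s - t) with hp
  have hfp : ∀ s ∈ S.I, ‖f s - p s‖ ≤ M * S.dt ^ (qt + 1) := by
    intro s hs
    refine (hP s hs).trans ?_
    have : ‖s - t‖ ≤ S.dt := S.abs_sub_le_dt hs ht
    gcongr
  have hq : (0 : ℝ) ≤ qt := Nat.cast_nonneg qt
  constructor
  · have h1 := S.timeError_sub (τ := τ) t f p
    rw [S.timeError_polynomial hdt hτ P le_rfl, sub_zero] at h1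
    rw [← h1]
    refine (hC₂ d S hdt F _ _ hfp t ht).trans ?_
    rw [← mul_assoc]
    gcongr
    nlinarith
  · intro f' hf'
    have h0 : HasDerivWithinAt (fun y => f y - p y) 0 S.I t := by
      have : HasFDerivWithinAt (fun y => f y - p y) (0 : ℝ →L[ℝ] F) S.I t := by
        refine Asymptotics.IsBigO.hasFDerivWithinAt (n := qt + 1) ?_ ht (by omega)
        refine Asymptotics.IsBigO.of_bound M ?_
        filter_upwards [self_mem_nhdsWithin] with y hy
        rw [Real.norm_of_nonneg (by positivity)]
        exact hP y hy
      simpa using this.hasDerivWithinAt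
    have h1 : HasDerivWithinAt p f' S.I t := by
      have := hf'.sub h0
      rw [sub_zero] at this
      refine this.congr (fun y _ => ?_) ?_ <;> simp
    -- The Taylor polynomial equals its own interpolant, so its derivative at `t` is the same
    -- combination of its nodal values that is applied to `f`. Only nodal values of the remainder
    -- are left.
    have h2 : HasDerivAt p (∑ i, deriv (S.timeBasis τ i) t • p (S.timeNode τ i)) t := by
      have h3 : p = fun s => ∑ i, S.timeBasis τ i s • p (S.timeNode τ i) := by
        funext s
        exact (S.sum_timeBasis_polynomial hdt hτ P le_rfl t s).symm
      conv => arg 1; rw [h3]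
      exact HasDerivAt.fun_sum fun i _ =>
        ((S.differentiable_timeBasis i) t).hasDerivAt.smul_const _
    have h4 := (S.uniqueDiffOn_I t ht).eq_deriv _ h1 h2.hasDerivWithinAt
    rw [h4, ← Finset.sum_sub_distrib]
    calc _ ≤ ∑ i, ‖deriv (S.timeBasis τ i) t • p (S.timeNode τ i) -
            deriv (S.timeBasis τ i) t • f (S.timeNode τ i)‖ := norm_sum_le _ _
      _ ≤ ∑ _i : Fin (qt + 1), C₁ / S.dt * (M * S.dt ^ (qt + 1)) := by
          refine Finset.sum_le_sum fun i _ => ?_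
          rw [← smul_sub, norm_smul, norm_sub_rev]
          exact mul_le_mul (hC₁ d S hdt t ht i).2 (hfp _ (S.timeNode_mem hdt hτI i))
            (norm_nonneg _) (by positivity)
      _ = (qt + 1) * C₁ * M * S.dt ^ qt := by
          rw [Finset.sum_const, Finset.card_univ, Fintype.card_fin, nsmul_eq_mul]
          push_cast
          field_simp
          ring
      _ ≤ _ := by
          gcongr
          linarith

/-- The interpolation error of a product, one factor of which is small and smooth while the other
one is less regular. -/
theorem exists_timeError_smul_le (τ : Fin (qt + 1) → ℝ) (hτ : Function.Injective τ)
    (hτI : ∀ i, τ i ∈ Set.Ioc (0 : ℝ) 1) (hqt : 1 ≤ qt) (n : ℕ) :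
    ∃ C : ℝ, 1 ≤ C ∧ ∀ (d : ℕ) (S : Slab d), 0 < S.dt → S.dt ≤ 1 →
      ∀ (F : Type) [NormedAddCommGroup F] [NormedSpace ℝ F] (a : ℝ → ℝ) (u : ℝ → F) (M N δ : ℝ),
        BddDerivOn S.I (qt + 1) M a → (∀ t ∈ S.I, |a t| ≤ δ) → BddDerivOn S.I (n + 1) N u →
        ∀ t ∈ S.I, ‖S.timeError τ t (fun s => a s • u s)‖ ≤
          C * (M * N * S.dt ^ (qt + 1) + δ * N * S.dt ^ (n + 1)) := by
  obtain ⟨C₁, hC₁1, hC₁⟩ := exists_timeInterp_error τ hτ hτI hqt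
  obtain ⟨C₂, hC₂1, hC₂⟩ := exists_timeError_le τ hτI
  set A : ℝ := ∑ j ∈ Finset.range (n + 1), 2 ^ (qt + 1) * (2 ^ (qt + 1) * 1) ^ j with hA
  have hA0 : 0 ≤ A := Finset.sum_nonneg fun j _ => by positivity
  refine ⟨C₁ * (2 ^ (qt + 1) * A) + C₂, le_add_of_nonneg_of_le (by positivity) hC₂1,
    fun d S hdt hdt1 F _ _ a u M N δ ha hδ hu t ht => ?_⟩
  have hM0 : 0 ≤ M := (norm_nonneg _).trans (ha.bound ht)
  have hN0 : 0 ≤ N := (norm_nonneg _).trans (hu.bound ht)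
  have hδ0 : 0 ≤ δ := (abs_nonneg _).trans (hδ t ht)
  -- Only the less regular factor is expanded. The product `a p` has `qt + 1` bounded derivatives
  -- and is interpolated with full order. For `a (u - p)`, which is small pointwise, stability of
  -- the interpolation suffices.
  obtain ⟨P, hPn, hP⟩ := hu.exists_taylor S.convex_I ht
  set p : ℝ → F := fun s => ∑ j ∈ Finset.range (n + 1), P j (fun _ => s - t) with hp
  have hlin : BddDerivOn S.I (qt + 1) 1 (fun s => s - t) := by
    refine ⟨fun s hs => (S.abs_sub_le_dt hs ht).trans hdt1, fun _ => ContinuousLinearMap.id ℝ ℝ,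
      fun s _ => (hasFDerivWithinAt_id s S.I).sub_const t,
      BddDerivOn.const _ ContinuousLinearMap.norm_id_le⟩
  have hpb : BddDerivOn S.I (qt + 1) (A * N) p := by
    rw [hA, Finset.sum_mul]
    refine BddDerivOn.sum _ fun j _ => ?_
    have h1 : ∀ s : ℝ, P j (fun _ => s - t) = (s - t) ^ j • P j (fun _ => 1) := by
      intro s
      have := (P j).map_smul_univ (fun _ => s - t) (fun _ => (1 : ℝ))
      simpa using this
    simp only [h1]
    have h2 : ‖P j (fun _ => 1)‖ ≤ N := by
      refine ((P j).le_opNorm _).trans ?_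
      simpa using hPn j
    exact ((hlin.pow j).smul (BddDerivOn.const _ h2)).mono_const (le_of_eq (by ring))
  have e1 := (hC₁ d S hdt F _ _ (ha.smul hpb) t ht).1
  have e2 := hC₂ d S hdt F (fun s => a s • (u s - p s)) (δ * (N * S.dt ^ (n + 1))) (fun s hs => by
    rw [norm_smul]
    refine mul_le_mul (hδ s hs) ((hP s hs).trans ?_) (norm_nonneg _) hδ0
    have : ‖s - t‖ ≤ S.dt := S.abs_sub_le_dt hs ht
    gcongr) t ht
  have h3 : (fun s => a s • u s) = fun s => a s • p s + a s • (u s - p s) := by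
    funext s; rw [← smul_add, add_sub_cancel]
  rw [h3, S.timeError_add]
  refine (norm_add_le_of_le e1 e2).trans ?_
  have h4 : C₁ * (2 ^ (qt + 1) * (M * (A * N))) * S.dt ^ (qt + 1) =
      C₁ * (2 ^ (qt + 1) * A) * (M * N * S.dt ^ (qt + 1)) := by ring
  rw [h4]
  have h5 : 0 ≤ M * N * S.dt ^ (qt + 1) := by positivity
  have h6 : 0 ≤ δ * N * S.dt ^ (n + 1) := by positivity
  have h7 : 0 ≤ C₁ * (2 ^ (qt + 1) * A) := by positivity
  nlinarith [mul_nonneg h7 h6, mul_nonneg (by linarith : (0:ℝ) ≤ C₂) h5]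

end Slab

end TimeInterpolation

/-! ### An implicit function theorem with bounds -/

section ImplicitFunction

open Set Filter Topology

set_option maxSynthPendingDepth 3

/-- The implicit function theorem with bounds for the derivatives, for a function that is
increasing in the last variable with a slope bounded below. -/
theorem BddDerivOn.implicit {E : Type} [NormedAddCommGroup E] [NormedSpace ℝ E] {m : ℕ}
    {C a κ : ℝ} (ha : a ≤ C) (hκ : 0 < κ) {S : Set E} {F : E × ℝ → ℝ}
    (hF : BddDerivOn (S ×ˢ Ioo (-a) a) (m + 1) C F)
    (hslope : ∀ e ∈ S, ∀ α ∈ Ioo (-a) a, ∀ c, HasDerivAt (fun β => F (e, β)) c α → κ ≤ c)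
    {D : E → ℝ} (hD : ∀ e ∈ S, D e ∈ Ioo (-a) a ∧ F (e, D e) = 0) :
    BddDerivOn S (m + 1) (odeConst (max C (2 ^ m * (invConst κ (1 * C) m * (1 * C)))) (m + 1)) D := by
  obtain ⟨-, F', hF', hF'b⟩ := hF
  set Q := S ×ˢ Ioo (-a) a with hQ
  have hα : ∀ e ∈ S, ∀ α ∈ Ioo (-a) a, HasDerivAt (fun β => F (e, β)) (F' (e, α) (0, 1)) α := by
    intro e he α hα
    have h1 : HasDerivWithinAt (fun β : ℝ => ((e, β) : E × ℝ)) (0, 1) (Ioo (-a) a) α :=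
      (hasDerivWithinAt_const α _ e).prodMk (hasDerivWithinAt_id α _)
    have h2 := (hF' (e, α) ⟨he, hα⟩).comp_hasDerivWithinAt α h1 (fun β hβ => ⟨he, hβ⟩)
    exact h2.hasDerivAt (Ioo_mem_nhds hα.1 hα.2)
  have hlow : ∀ q ∈ Q, κ ≤ F' q (0, 1) := fun q hq => hslope q.1 hq.1 q.2 hq.2 _ (hα q.1 hq.1 q.2 hq.2)
  -- Expansion in the last variable replaces the inverse function theorem. It yields the Lipschitz
  -- continuity of `D` also when `S` is not open, which is needed for half-open time intervals.
  have hmono : ∀ e ∈ S, ∀ α ∈ Ioo (-a) a, ∀ β ∈ Ioo (-a) a,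
      κ * |α - β| ≤ |F (e, α) - F (e, β)| := by
    intro e he
    have key : ∀ α ∈ Ioo (-a) a, ∀ β ∈ Ioo (-a) a, α ≤ β → κ * (β - α) ≤ F (e, β) - F (e, α) := by
      refine (convex_Ioo (-a) a).mul_sub_le_image_sub_of_le_deriv
        (f := fun β => F (e, β)) ?_ ?_ ?_
      · exact fun α h => (hα e he α h).continuousAt.continuousWithinAt
      · rw [interior_Ioo]
        exact fun α h => (hα e he α h).differentiableAt.differentiableWithinAt
      · rw [interior_Ioo]
        intro α h
        rw [(hα e he α h).deriv]
        exact hlow (e, α) ⟨he, h⟩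
    intro α h1 β h2
    rcases le_total α β with h | h
    · have := key α h1 β h2 h
      rw [abs_sub_comm α, abs_sub_comm (F _), abs_of_nonneg (by linarith : 0 ≤ β - α)]
      exact this.trans (le_abs_self _)
    · have := key β h2 α h1 h
      rw [abs_of_nonneg (by linarith : 0 ≤ α - β)]
      exact this.trans (le_abs_self _)
  have hmemQ : ∀ e ∈ S, (e, D e) ∈ Q := fun e he => ⟨he, (hD e he).1⟩
  -- Implicit differentiation, `D' = -(∂F/∂α)⁻¹ ∂F/∂e` at `(e, D e)`, is a differential equation for
  -- `D` with a smooth right-hand side, so that all bounds follow by bootstrapping.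
  let X : E × ℝ → (E →L[ℝ] ℝ) := fun q =>
    -((F' q (0, 1))⁻¹ • (F' q).comp (ContinuousLinearMap.inl ℝ E ℝ))
  have hX : BddDerivOn Q m (2 ^ m * (invConst κ (1 * C) m * (1 * C))) X := by
    have h1 : BddDerivOn Q m (1 * C) (fun q => F' q (0, 1)) := by
      refine hF'b.clm_comp (ContinuousLinearMap.apply ℝ ℝ ((0, 1) : E × ℝ)) ?_
      refine ContinuousLinearMap.opNorm_le_bound _ zero_le_one fun L => ?_
      rw [one_mul, ContinuousLinearMap.apply_apply]
      refine (L.le_opNorm _).trans (mul_le_of_le_one_right (norm_nonneg _) ?_)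
      simp [Prod.norm_def]
    have h2 : BddDerivOn Q m (1 * C) (fun q => (F' q).comp (ContinuousLinearMap.inl ℝ E ℝ)) := by
      refine hF'b.clm_comp ((ContinuousLinearMap.compL ℝ E (E × ℝ) ℝ).flip
        (ContinuousLinearMap.inl ℝ E ℝ)) ?_
      refine ContinuousLinearMap.opNorm_le_bound _ zero_le_one fun L => ?_
      rw [one_mul]
      refine (ContinuousLinearMap.opNorm_comp_le _ _).trans
        (mul_le_of_le_one_right (norm_nonneg _) (ContinuousLinearMap.norm_inl_le_one ℝ E ℝ))
    exact ((h1.inv hκ hlow).smul h2).neg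
  refine BddDerivOn.of_hasFDerivWithinAt (hX.mono_const (le_max_right _ _)) hmemQ ?_ ?_
  · intro e he
    rw [Real.norm_eq_abs]
    exact (abs_le.2 ⟨(hD e he).1.1.le, (hD e he).1.2.le⟩).trans (ha.trans (le_max_left _ _))
  · intro e he
    have hq := hmemQ e he
    have hc := (hlow _ hq)
    set c := F' (e, D e) (0, 1) with hcdef
    have hc0 : 0 < c := hκ.trans_le hc
    have hfd := hF' _ hq
    -- `D` is Lipschitz at `e`
    have hLip : (fun e' => D e' - D e) =O[𝓝[S] e] fun e' => e' - e := by
      have h1 : HasFDerivWithinAt (fun e' => F (e', D e)) ((F' (e, D e)).comp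
          (ContinuousLinearMap.inl ℝ E ℝ)) S e := by
        have h2 : HasFDerivWithinAt (fun e' : E => (e', D e)) (ContinuousLinearMap.inl ℝ E ℝ) S e :=
          (hasFDerivAt_prodMk_left e (D e)).hasFDerivWithinAt
        exact hfd.comp e h2 fun e' he' => Set.mk_mem_prod he' (hD e he).1
      refine Asymptotics.IsBigO.trans ?_ h1.isBigO_sub
      refine Asymptotics.IsBigO.of_bound κ⁻¹ ?_
      filter_upwards [self_mem_nhdsWithin] with e' he'
      have h3 := hmono e' he' (D e') (hD e' he').1 (D e) (hD e he).1
      rw [(hD e' he').2, zero_sub, abs_neg] at h3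
      rw [(hD e he).2, sub_zero, Real.norm_eq_abs, Real.norm_eq_abs, inv_mul_eq_div, le_div_iff₀ hκ,
        mul_comm]
      exact h3
    have htend : Tendsto (fun e' => (e', D e')) (𝓝[S] e) (𝓝[Q] (e, D e)) := by
      refine tendsto_nhdsWithin_of_tendsto_nhds_of_eventually_within _ ?_ ?_
      · refine Tendsto.prodMk_nhds (tendsto_nhdsWithin_of_tendsto_nhds tendsto_id) ?_
        have h4 : Tendsto (fun e' => D e' - D e) (𝓝[S] e) (𝓝 0) := by
          refine hLip.trans_tendsto ?_
          have : Tendsto (fun e' : E => e' - e) (𝓝 e) (𝓝 (e - e)) :=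
            (continuous_id.sub continuous_const).tendsto e
          rw [sub_self] at this
          exact this.mono_left nhdsWithin_le_nhds
        simpa using h4.add_const (D e)
      · filter_upwards [self_mem_nhdsWithin] with e' he' using hmemQ e' he'
    -- As `D` is Lipschitz at `e`, the remainder of the linearization of `F` at `(e, D e)` is `o(e'
    -- - e)` along the graph. `F` vanishes on the graph, so the linearization can be solved for `D
    -- e' - D e`.
    have h5 := (hasFDerivWithinAt_iff_isLittleO.1 hfd).comp_tendsto htend
    have h6 : (fun e' => ((e', D e') : E × ℝ) - (e, D e)) =O[𝓝[S] e] fun e' => e' - e := by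
      have : (fun e' => ((e', D e') : E × ℝ) - (e, D e)) = fun e' => (e' - e, D e' - D e) := by
        funext e'; rfl
      rw [this]
      exact (Asymptotics.isBigO_refl _ _).prod_left hLip
    have h7 := h5.trans_isBigO h6
    rw [hasFDerivWithinAt_iff_isLittleO]
    refine (Asymptotics.IsLittleO.congr' (h7.const_mul_left (-c⁻¹)) ?_ EventuallyEq.rfl)
    filter_upwards [self_mem_nhdsWithin] with e' he'
    simp only [Function.comp]
    rw [(hD e he).2, (hD e' he').2]
    have h8 : ((e', D e') : E × ℝ) - (e, D e) = ContinuousLinearMap.inl ℝ E ℝ (e' - e) +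
        (D e' - D e) • ((0, 1) : E × ℝ) := by
      simp
    rw [h8, map_add, map_smul]
    simp only [X, neg_apply, smul_apply, ContinuousLinearMap.comp_apply, smul_eq_mul, ← hcdef]
    field_simp
    ring

end ImplicitFunction

/-! ### Displacements along the gradient of a level set function -/

section LevelSets

open Set Filter Topology

set_option maxSynthPendingDepth 3

/-- A smooth family of level set functions on a ball, with bounded derivatives and with a lower
bound for the slope. -/
structure LevelSetOn {d : ℕ} (φ : Pt d → ℝ → ℝ) (x₀ : Pt d) (ρ : ℝ) (I : Set ℝ) (m : ℕ) (K : ℝ) :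
    Prop where
  one_le : 1 ≤ K
  pos : 0 < ρ
  convex : Convex ℝ I
  smooth : BddDerivOn (Metric.ball x₀ ρ ×ˢ I) (m + 2) K (Function.uncurry φ)
  lower : ∀ x ∈ Metric.ball x₀ ρ, ∀ t ∈ I, K⁻¹ ≤ ‖gradient (fun y => φ y t) x‖

namespace LevelSetOn

variable {d : ℕ} {φ : Pt d → ℝ → ℝ} {x₀ : Pt d} {ρ : ℝ} {I : Set ℝ} {m : ℕ} {K : ℝ}

/-- The spatial derivative. -/
noncomputable def dx (φ : Pt d → ℝ → ℝ) (p : Pt d × ℝ) : Pt d →L[ℝ] ℝ :=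
  fderiv ℝ (fun y => φ y p.2) p.1

/-- The spatial gradient. -/
noncomputable def grad (φ : Pt d → ℝ → ℝ) (p : Pt d × ℝ) : Pt d :=
  gradient (fun y => φ y p.2) p.1

theorem grad_eq (φ : Pt d → ℝ → ℝ) (p : Pt d × ℝ) :
    grad φ p = (InnerProductSpace.toDual ℝ (Pt d)).symm (dx φ p) := rfl

theorem dx_apply_grad (φ : Pt d → ℝ → ℝ) (p : Pt d × ℝ) : dx φ p (grad φ p) = ‖grad φ p‖ ^ 2 := by
  have h := InnerProductSpace.toDual_symm_apply (𝕜 := ℝ) (x := grad φ p) (y := dx φ p)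
  rw [← grad_eq, real_inner_self_eq_norm_sq] at h
  exact h.symm

/-- The cylinder over a half-open time interval is not open, but at a fixed time the spatial section
is, so that spatial derivatives are genuine two-sided ones. -/
theorem hasFDerivAt_slice {F : Type} [NormedAddCommGroup F] [NormedSpace ℝ F]
    {Φ : Pt d × ℝ → F} {Φ' : Pt d × ℝ →L[ℝ] F} {U : Set (Pt d)} (hU : IsOpen U) {x : Pt d} {t : ℝ}
    (hx : x ∈ U) (ht : t ∈ I) (h : HasFDerivWithinAt Φ Φ' (U ×ˢ I) (x, t)) :
    HasFDerivAt (fun y => Φ (y, t)) (Φ'.comp (ContinuousLinearMap.inl ℝ (Pt d) ℝ)) x := by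
  have h1 : HasFDerivWithinAt (fun y : Pt d => (y, t)) (ContinuousLinearMap.inl ℝ (Pt d) ℝ) U x :=
    (hasFDerivAt_prodMk_left x t).hasFDerivWithinAt
  exact (h.comp x h1 fun y hy => Set.mk_mem_prod hy ht).hasFDerivAt (hU.mem_nhds hx)

theorem norm_comp_inl_flip_le (F : Type) [NormedAddCommGroup F] [NormedSpace ℝ F] :
    ‖(ContinuousLinearMap.compL ℝ (Pt d) (Pt d × ℝ) F).flip (ContinuousLinearMap.inl ℝ (Pt d) ℝ)‖ ≤ 1 := by
  refine ContinuousLinearMap.opNorm_le_bound _ zero_le_one fun L => ?_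
  rw [one_mul]
  exact (ContinuousLinearMap.opNorm_comp_le _ _).trans
    (mul_le_of_le_one_right (norm_nonneg _) (ContinuousLinearMap.norm_inl_le_one ℝ (Pt d) ℝ))

section

variable (h : LevelSetOn φ x₀ ρ I m K)
include h

theorem hasFDerivAt {x : Pt d} (hx : x ∈ Metric.ball x₀ ρ) {t : ℝ} (ht : t ∈ I) :
    HasFDerivAt (fun y => φ y t) (dx φ (x, t)) x := by
  obtain ⟨-, Φ', h1, -⟩ := h.smooth
  have := hasFDerivAt_slice Metric.isOpen_ball hx ht (h1 (x, t) ⟨hx, ht⟩)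
  exact this.differentiableAt.hasFDerivAt

theorem bdd_dx : BddDerivOn (Metric.ball x₀ ρ ×ˢ I) (m + 1) K (dx φ) := by
  obtain ⟨-, Φ', h1, h2⟩ := h.smooth
  have h3 := h2.clm_comp _ (norm_comp_inl_flip_le ℝ (d := d))
  rw [one_mul] at h3
  refine h3.congr fun p hp => ?_
  exact (hasFDerivAt_slice Metric.isOpen_ball hp.1 hp.2 (h1 p hp)).fderiv

theorem bdd_grad : BddDerivOn (Metric.ball x₀ ρ ×ˢ I) (m + 1) K (grad φ) := by
  have := h.bdd_dx.clm_comp (InnerProductSpace.toDual ℝ (Pt d)).symm.toContinuousLinearEquiv.toContinuousLinearMap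
    (A := 1) (ContinuousLinearMap.opNorm_le_bound _ zero_le_one fun L => by simp)
  rw [one_mul] at this
  exact this

theorem norm_grad_le {x : Pt d} (hx : x ∈ Metric.ball x₀ ρ) {t : ℝ} (ht : t ∈ I) :
    ‖grad φ (x, t)‖ ≤ K := h.bdd_grad.bound ⟨hx, ht⟩

theorem convex_cylinder : Convex ℝ (Metric.ball x₀ ρ ×ˢ I) := (convex_ball _ _).prod h.convex

theorem lipschitz {F : Type} [NormedAddCommGroup F] [NormedSpace ℝ F] {f : Pt d × ℝ → F} {C : ℝ}
    {n : ℕ} (hf : BddDerivOn (Metric.ball x₀ ρ ×ˢ I) (n + 1) C f) {x y : Pt d}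
    (hx : x ∈ Metric.ball x₀ ρ) (hy : y ∈ Metric.ball x₀ ρ) {t : ℝ} (ht : t ∈ I) :
    ‖f (y, t) - f (x, t)‖ ≤ C * ‖y - x‖ := by
  obtain ⟨-, f', h1, h2⟩ := hf
  have := h.convex_cylinder.norm_image_sub_le_of_norm_hasFDerivWithin_le h1
    (fun p hp => h2.bound hp) (x := (x, t)) (y := (y, t)) ⟨hx, ht⟩ ⟨hy, ht⟩
  simpa [Prod.norm_def] using this

theorem displaced_mem {a : ℝ} (ha : a * K ≤ ρ / 2) {x : Pt d} (hx : x ∈ Metric.ball x₀ (ρ / 2))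
    {t : ℝ} (ht : t ∈ I) {α : ℝ} (hα : α ∈ Ioo (-a) a) :
    x + α • grad φ (x, t) ∈ Metric.ball x₀ ρ := by
  have hρ := h.pos
  have h1 : ‖grad φ (x, t)‖ ≤ K := h.norm_grad_le (Metric.ball_subset_ball (by linarith) hx) ht
  have h2 : |α| ≤ a := abs_le.2 ⟨hα.1.le, hα.2.le⟩
  rw [mem_ball_iff_norm] at hx ⊢
  calc ‖x + α • grad φ (x, t) - x₀‖ = ‖(x - x₀) + α • grad φ (x, t)‖ := by congr 1; abel
    _ ≤ ‖x - x₀‖ + ‖α • grad φ (x, t)‖ := norm_add_le _ _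
    _ ≤ ‖x - x₀‖ + a * K := by
        rw [norm_smul, Real.norm_eq_abs]
        have := (abs_nonneg α).trans h2
        gcongr
    _ < ρ := by linarith

theorem hasDerivAt_displaced {a : ℝ} (ha : a * K ≤ ρ / 2) {x : Pt d}
    (hx : x ∈ Metric.ball x₀ (ρ / 2)) {t : ℝ} (ht : t ∈ I) {α : ℝ} (hα : α ∈ Ioo (-a) a) :
    HasDerivAt (fun β => φ (x + β • grad φ (x, t)) t)
      (dx φ (x + α • grad φ (x, t), t) (grad φ (x, t))) α := by
  have h1 := h.hasFDerivAt (h.displaced_mem ha hx ht hα) ht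
  have h2 : HasDerivAt (fun β : ℝ => x + β • grad φ (x, t)) (grad φ (x, t)) α := by
    simpa using ((hasDerivAt_id α).smul_const (grad φ (x, t))).const_add x
  exact h1.comp_hasDerivAt α h2

/-- At `α = 0` the slope is `|∇φ|^2 ≥ K⁻²`. A displacement by `α ∇φ` changes the derivative of `φ`
by at most `K |α| |∇φ|`, and `a K ≤ 1/2` limits the loss to one half. -/
theorem slope_lower {a : ℝ} (ha : a * K ≤ ρ / 2) (ha' : a * K ≤ 1 / 2) {x : Pt d}
    (hx : x ∈ Metric.ball x₀ (ρ / 2)) {t : ℝ} (ht : t ∈ I) {α : ℝ} (hα : α ∈ Ioo (-a) a) :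
    (2 * K ^ 2)⁻¹ ≤ dx φ (x + α • grad φ (x, t), t) (grad φ (x, t)) := by
  have hK : 0 < K := by linarith [h.one_le]
  have hρ := h.pos
  have hx' : x ∈ Metric.ball x₀ ρ := Metric.ball_subset_ball (by linarith) hx
  set g := grad φ (x, t) with hg
  have h1 : ‖dx φ (x + α • g, t) - dx φ (x, t)‖ ≤ K * ‖(x + α • g) - x‖ :=
    h.lipschitz h.bdd_dx hx' (h.displaced_mem ha hx ht hα) ht
  rw [add_sub_cancel_left, norm_smul, Real.norm_eq_abs] at h1
  have h2 : |α| ≤ a := abs_le.2 ⟨hα.1.le, hα.2.le⟩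
  have h3 : |(dx φ (x + α • g, t) - dx φ (x, t)) g| ≤ 1 / 2 * ‖g‖ ^ 2 := by
    rw [← Real.norm_eq_abs]
    calc _ ≤ ‖dx φ (x + α • g, t) - dx φ (x, t)‖ * ‖g‖ := ContinuousLinearMap.le_opNorm _ _
      _ ≤ (K * (|α| * ‖g‖)) * ‖g‖ := by gcongr
      _ ≤ (K * (a * ‖g‖)) * ‖g‖ := by gcongr
      _ = (a * K) * ‖g‖ ^ 2 := by ring
      _ ≤ _ := by gcongr
  rw [sub_apply, dx_apply_grad, ← hg] at h3
  have h4 : K⁻¹ ≤ ‖g‖ := h.lower x hx' t ht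
  have h5 : (K⁻¹) ^ 2 ≤ ‖g‖ ^ 2 := by gcongr
  have h6 : (2 * K ^ 2)⁻¹ = 1 / 2 * (K⁻¹) ^ 2 := by field_simp
  rw [h6]
  have := (abs_le.1 h3).1
  linarith

/-- A lower bound for the increments of the level set function along the search direction. -/
theorem slope_mul_le {a : ℝ} (ha : a * K ≤ ρ / 2) (ha' : a * K ≤ 1 / 2) {x : Pt d}
    (hx : x ∈ Metric.ball x₀ (ρ / 2)) {t : ℝ} (ht : t ∈ I) {α β : ℝ} (hα : α ∈ Ioo (-a) a)
    (hβ : β ∈ Ioo (-a) a) (hαβ : α ≤ β) : (2 * K ^ 2)⁻¹ * (β - α) ≤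
      φ (x + β • grad φ (x, t)) t - φ (x + α • grad φ (x, t)) t := by
  refine (convex_Ioo (-a) a).mul_sub_le_image_sub_of_le_deriv
    (f := fun β => φ (x + β • grad φ (x, t)) t) ?_ ?_ ?_ α hα β hβ hαβ
  · exact fun γ hγ => (h.hasDerivAt_displaced ha hx ht hγ).continuousAt.continuousWithinAt
  · rw [interior_Ioo]
    exact fun γ hγ => (h.hasDerivAt_displaced ha hx ht hγ).differentiableAt.differentiableWithinAt
  · rw [interior_Ioo]
    intro γ hγ
    rw [(h.hasDerivAt_displaced ha hx ht hγ).deriv]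
    exact h.slope_lower ha ha' hx ht hγ

theorem slope_mul_abs_le {a : ℝ} (ha : a * K ≤ ρ / 2) (ha' : a * K ≤ 1 / 2) {x : Pt d}
    (hx : x ∈ Metric.ball x₀ (ρ / 2)) {t : ℝ} (ht : t ∈ I) {α β : ℝ} (hα : α ∈ Ioo (-a) a)
    (hβ : β ∈ Ioo (-a) a) : (2 * K ^ 2)⁻¹ * |β - α| ≤
      |φ (x + β • grad φ (x, t)) t - φ (x + α • grad φ (x, t)) t| := by
  rcases le_total α β with h1 | h1
  · rw [abs_of_nonneg (by linarith : 0 ≤ β - α)]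
    exact (h.slope_mul_le ha ha' hx ht hα hβ h1).trans (le_abs_self _)
  · rw [abs_sub_comm β, abs_sub_comm (φ _ t), abs_of_nonneg (by linarith : 0 ≤ α - β)]
    exact (h.slope_mul_le ha ha' hx ht hβ hα h1).trans (le_abs_self _)

/-- Solvability of the level set equation along the search direction. -/
theorem exists_displacement {a : ℝ} (ha0 : 0 < a) (ha : a * K ≤ ρ / 2) (ha' : a * K ≤ 1 / 2)
    {x : Pt d} (hx : x ∈ Metric.ball x₀ (ρ / 2)) {t : ℝ} (ht : t ∈ I) {σ : ℝ}
    (hσ : |σ| < a / 2 * (2 * K ^ 2)⁻¹) : ∃ α ∈ Ioo (-a) a,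
      φ (x + α • grad φ (x, t)) t = φ x t + σ := by
  have hK : 0 < K := by linarith [h.one_le]
  have hsub : Icc (-(a / 2)) (a / 2) ⊆ Ioo (-a) a := fun β hβ => ⟨by linarith [hβ.1], by linarith [hβ.2]⟩
  have hcont : ContinuousOn (fun β => φ (x + β • grad φ (x, t)) t) (Icc (-(a / 2)) (a / 2)) :=
    fun γ hγ => (h.hasDerivAt_displaced ha hx ht (hsub hγ)).continuousAt.continuousWithinAt
  have h0 : (0 : ℝ) ∈ Ioo (-a) a := ⟨by linarith, ha0⟩
  have h1 := h.slope_mul_le ha ha' hx ht h0 (hsub ⟨by linarith, le_rfl⟩) (by linarith : 0 ≤ a / 2)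
  have h2 := h.slope_mul_le ha ha' hx ht (hsub ⟨le_rfl, by linarith⟩) h0 (by linarith : -(a / 2) ≤ 0)
  rw [zero_smul, add_zero] at h1 h2
  rw [abs_lt] at hσ
  obtain ⟨α, hα, he⟩ := intermediate_value_Icc (by linarith : -(a / 2) ≤ a / 2) hcont
    (show φ x t + σ ∈ Icc _ _ from ⟨by linarith, by linarith⟩)
  exact ⟨α, hsub hα, he⟩

end

/-- The displacement along the search direction which changes the value of the level set function by
a given amount, as a function of space, time, and that amount. -/
theorem exists_displacement_function (d m : ℕ) {K ρ : ℝ} (hK : 1 ≤ K) (hρ : 0 < ρ) :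
    ∃ a c C : ℝ, 0 < a ∧ a * K ≤ ρ / 2 ∧ a * K ≤ 1 / 2 ∧ 0 < c ∧ 1 ≤ C ∧
      ∀ (φ : Pt d → ℝ → ℝ) (x₀ : Pt d) (I : Set ℝ), LevelSetOn φ x₀ ρ I m K →
        ∃ D : (Pt d × ℝ) × ℝ → ℝ,
          BddDerivOn ((Metric.ball x₀ (ρ / 2) ×ˢ I) ×ˢ Ioo (-c) c) (m + 1) C D ∧
          ∀ x ∈ Metric.ball x₀ (ρ / 2), ∀ t ∈ I, ∀ σ ∈ Ioo (-c) c,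
            D ((x, t), σ) ∈ Ioo (-a) a ∧ |D ((x, t), σ)| ≤ C * |σ| ∧
            φ (x + D ((x, t), σ) • grad φ (x, t)) t = φ x t + σ ∧
            ∀ β ∈ Ioo (-a) a, φ (x + β • grad φ (x, t)) t = φ x t + σ → β = D ((x, t), σ) := by
  have hK0 : 0 < K := by linarith
  -- The largest `a` for which the displaced points stay in the ball of radius `ρ` and at least half
  -- of the slope is kept.
  set a : ℝ := min (ρ / 2) (1 / 2) / K with ha_def
  have ha0 : 0 < a := by positivity
  have haK : a * K = min (ρ / 2) (1 / 2) := div_mul_cancel₀ _ hK0.ne'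
  have ha1 : a * K ≤ ρ / 2 := haK.trans_le (min_le_left _ _)
  have ha2 : a * K ≤ 1 / 2 := haK.trans_le (min_le_right _ _)
  have ha3 : a ≤ 1 := by nlinarith
  -- The change of value that is guaranteed at the displacements `± a / 2`; any smaller change is
  -- attained in between.
  set c : ℝ := a / 2 * (2 * K ^ 2)⁻¹ with hc_def
  have hc0 : 0 < c := by positivity
  have hc1 : c ≤ 1 := by
    have : (2 * K ^ 2)⁻¹ ≤ 1 := inv_le_one_of_one_le₀ (by nlinarith)
    nlinarith
  set G : ℝ := BddDerivOn.compConst (m + 1) K 1 with hG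
  set CF : ℝ := max (BddDerivOn.compConst (m + 1) K (1 + 1 * (2 ^ (m + 1) * (1 * G))) + G + 1) 1
    with hCF
  set κ : ℝ := (2 * K ^ 2)⁻¹ with hκ
  have hκ0 : 0 < κ := by positivity
  set CD : ℝ := BddDerivOn.odeConst (max CF (2 ^ m * (BddDerivOn.invConst κ (1 * CF) m * (1 * CF))))
    (m + 1) with hCD
  refine ⟨a, c, max CD (2 * K ^ 2), ha0, ha1, ha2, hc0, ?_, fun φ x₀ I h => ?_⟩
  · exact le_max_of_le_right (by nlinarith)
  have hex : ∀ e : (Pt d × ℝ) × ℝ, ∃ α, e ∈ (Metric.ball x₀ (ρ / 2) ×ˢ I) ×ˢ Ioo (-c) c →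
      α ∈ Ioo (-a) a ∧ φ (e.1.1 + α • grad φ e.1) e.1.2 = φ e.1.1 e.1.2 + e.2 := by
    intro e
    by_cases he : e ∈ (Metric.ball x₀ (ρ / 2) ×ˢ I) ×ˢ Ioo (-c) c
    · obtain ⟨α, hα, hα'⟩ := h.exists_displacement ha0 ha1 ha2 he.1.1 he.1.2 (σ := e.2)
        (abs_lt.2 he.2)
      exact ⟨α, fun _ => ⟨hα, hα'⟩⟩
    · exact ⟨0, fun h' => absurd h' he⟩
  choose D hD using hex
  refine ⟨D, ?_, fun x hx t ht σ hσ => ?_⟩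
  · have hsub : Metric.ball x₀ (ρ / 2) ⊆ Metric.ball x₀ ρ := Metric.ball_subset_ball (by linarith)
    set S := (Metric.ball x₀ (ρ / 2) ×ˢ I) ×ˢ Ioo (-c) c with hS
    let p₁ : ((Pt d × ℝ) × ℝ) × ℝ →L[ℝ] Pt d × ℝ :=
      (ContinuousLinearMap.fst ℝ (Pt d × ℝ) ℝ).comp (ContinuousLinearMap.fst ℝ ((Pt d × ℝ) × ℝ) ℝ)
    have hp₁ : ‖p₁‖ ≤ 1 := (ContinuousLinearMap.opNorm_comp_le _ _).trans
      (mul_le_one₀ (ContinuousLinearMap.norm_fst_le _ _ _) (norm_nonneg _)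
        (ContinuousLinearMap.norm_fst_le _ _ _))
    let p₂ : ((Pt d × ℝ) × ℝ) × ℝ →L[ℝ] ℝ :=
      (ContinuousLinearMap.snd ℝ (Pt d × ℝ) ℝ).comp (ContinuousLinearMap.fst ℝ ((Pt d × ℝ) × ℝ) ℝ)
    have hp₂ : ‖p₂‖ ≤ 1 := (ContinuousLinearMap.opNorm_comp_le _ _).trans
      (mul_le_one₀ (ContinuousLinearMap.norm_snd_le _ _ _) (norm_nonneg _)
        (ContinuousLinearMap.norm_fst_le _ _ _))
    have e1 : BddDerivOn (S ×ˢ Ioo (-a) a) (m + 1) G (fun q => grad φ (p₁ q)) :=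
      h.bdd_grad.comp_derivBddOn (DerivBddOn.clm p₁ hp₁) fun q hq => ⟨hsub hq.1.1.1, hq.1.1.2⟩
    have e2 : BddDerivOn (S ×ˢ Ioo (-a) a) (m + 1) 1 (fun q => ContinuousLinearMap.snd ℝ
        ((Pt d × ℝ) × ℝ) ℝ q) := BddDerivOn.clm _ (ContinuousLinearMap.norm_snd_le _ _ _)
          fun q hq => (abs_le.2 ⟨hq.2.1.le, hq.2.2.le⟩).trans ha3
    have e3 : BddDerivOn (S ×ˢ Ioo (-a) a) (m + 1) 1 (fun q => p₂ q) := BddDerivOn.clm _ hp₂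
      fun q hq => (abs_le.2 ⟨hq.1.2.1.le, hq.1.2.2.le⟩).trans hc1
    have e4 : DerivBddOn (S ×ˢ Ioo (-a) a) (m + 1) (1 + 1 * (2 ^ (m + 1) * (1 * G)))
        (fun q => p₁ q + ContinuousLinearMap.inl ℝ (Pt d) ℝ (q.2 • grad φ (p₁ q))) :=
      (DerivBddOn.clm p₁ hp₁).add
        ((e2.smul e1).clm_comp _ (ContinuousLinearMap.norm_inl_le_one ℝ (Pt d) ℝ)).derivBddOn
    have e5 := h.smooth.of_succ.comp_derivBddOn e4 fun q hq => by
      refine ⟨?_, ?_⟩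
      · exact h.displaced_mem ha1 hq.1.1.1 hq.1.1.2 hq.2
      · simpa [p₁] using hq.1.1.2
    have e6 : BddDerivOn (S ×ˢ Ioo (-a) a) (m + 1) G (fun q => Function.uncurry φ (p₁ q)) :=
      h.smooth.of_succ.comp_derivBddOn (DerivBddOn.clm p₁ hp₁)
        fun q hq => ⟨hsub hq.1.1.1, hq.1.1.2⟩
    -- The equation is `φ(x + α ∇φ(x,t), t) - φ(x,t) - σ = 0`. The gradient inside costs one order,
    -- so `m + 2` derivatives of `φ` leave `m + 1` for the displacement.
    have hF := ((e5.sub e6).sub e3).mono_const (le_max_left _ 1)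
    refine (BddDerivOn.implicit (D := D) (ha3.trans (le_max_right _ 1)) hκ0 hF ?_ ?_).mono_const (le_max_left _ _)
    · intro e he α hα b hb
      have h1 := h.hasDerivAt_displaced ha1 he.1.1 he.1.2 hα
      have h2 := (h1.sub_const (φ e.1.1 e.1.2)).sub_const e.2
      have h3 : (fun β => Function.uncurry φ (p₁ (e, β) + ContinuousLinearMap.inl ℝ (Pt d) ℝ
          (β • grad φ (p₁ (e, β)))) - Function.uncurry φ (p₁ (e, β)) - p₂ (e, β)) =
          fun β => φ (e.1.1 + β • grad φ (e.1.1, e.1.2)) e.1.2 - φ e.1.1 e.1.2 - e.2 := by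
        funext β
        simp [p₁, p₂, Function.uncurry]
      have h4 := hb.unique (h3 ▸ h2)
      rw [h4]
      exact h.slope_lower ha1 ha2 he.1.1 he.1.2 hα
    · intro e he
      refine ⟨(hD e he).1, ?_⟩
      have := (hD e he).2
      simp [p₁, p₂, Function.uncurry, this]
  · have he : ((x, t), σ) ∈ (Metric.ball x₀ (ρ / 2) ×ˢ I) ×ˢ Ioo (-c) c := ⟨⟨hx, ht⟩, hσ⟩
    obtain ⟨h1, h2⟩ := hD _ he
    simp only at h1 h2
    refine ⟨h1, ?_, h2, fun β hβ hβ' => ?_⟩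
    · have h3 := h.slope_mul_abs_le ha1 ha2 hx ht (α := 0) ⟨by linarith, ha0⟩ h1
      rw [zero_smul, add_zero, h2, sub_zero, add_sub_cancel_left, ← hκ] at h3
      have h4 : |D ((x, t), σ)| ≤ 2 * K ^ 2 * |σ| := by
        have : |D ((x, t), σ)| = 2 * K ^ 2 * (κ * |D ((x, t), σ)|) := by
          rw [hκ]; field_simp
        rw [this]
        gcongr
      exact h4.trans (mul_le_mul_of_nonneg_right (le_max_right _ _) (abs_nonneg _))
    · have h3 := h.slope_mul_abs_le ha1 ha2 hx ht h1 hβ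
      rw [h2, hβ', sub_self, abs_zero] at h3
      have h4 : |β - D ((x, t), σ)| ≤ 0 := by
        by_contra! h5
        have := mul_pos hκ0 h5
        linarith
      exact sub_eq_zero.1 (abs_nonpos_iff.1 h4)

end LevelSetOn

end LevelSets

/-! ### The discrete level set function on an element -/

section Discrete

open Set Filter Topology

set_option maxSynthPendingDepth 3

namespace Cell

variable {d : ℕ} (T : Cell d) {k : ℕ}

/-- Interpolation reproduces polynomials. -/
theorem interp_mvPolynomial (hk : 1 ≤ k) {p : MvPolynomial (Fin d) ℝ} (hp : p.totalDegree ≤ k)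
    (x : Pt d) : T.interp k (fun y => MvPolynomial.eval (fun i => y i) p) x =
      MvPolynomial.eval (fun i => x i) p := by
  have h1 : ∀ y : Pt d, MvPolynomial.eval (fun i => y i) p =
      ∑ m ∈ p.support, p.coeff m • ∏ i, y i ^ m i := fun y => by
    rw [MvPolynomial.eval_eq']; rfl
  simp only [h1, interp_sum, interp_smul]
  refine Finset.sum_congr rfl fun m hm => ?_
  congr 1
  have hdeg : m.degree ≤ k := (MvPolynomial.le_totalDegree hm).trans hp
  obtain ⟨l, hl⟩ := Quot.exists_rep (Finsupp.toMultiset m)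
  have hlen : l.length ≤ k := by
    have h2 : (Finsupp.toMultiset m).card = l.length := by rw [← hl]; rfl
    rw [← h2, Finsupp.card_toMultiset]
    exact hdeg
  have h3 : ∀ y : Pt d, ∏ i, y i ^ m i = ∏ j : Fin l.length, y (l.get j) := by
    intro y
    have h4 : ((Finsupp.toMultiset m).map fun i => y i).prod = ∏ i, y i ^ m i := by
      rw [Finsupp.toMultiset_map, Finsupp.prod_toMultiset, Finsupp.prod_mapDomain_index (by simp)
        (by intros; rw [pow_add])]
      exact Finsupp.prod_fintype _ _ (by simp)
    rw [← h4, ← hl]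
    change ((l.map fun i => y i)).prod = _
    rw [← List.prod_ofFn]
    congr 1
    apply List.ext_get <;> simp
  simp only [h3]
  -- A monomial, written as a list of coordinates, is the diagonal of a product of coordinate
  -- functionals.
  let M : ContinuousMultilinearMap ℝ (fun _ : Fin l.length => Pt d) ℝ :=
    (ContinuousMultilinearMap.mkPiAlgebra ℝ (Fin l.length) ℝ).compContinuousLinearMap
      fun j => EuclideanSpace.proj (l.get j)
  have h5 := T.interp_multilinear hk hlen M 0 x
  simpa [M] using h5

end Cell

namespace Slab

variable {d : ℕ} {S : Slab d} {qs qt : ℕ} {K δΩ δU r : ℝ} {ℓ : ℕ}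

theorem dt_pos (hG : S.GeometryAssumption ℓ K δΩ δU) : 0 < S.dt := sub_pos.2 hG.time

theorem diam_le (T : Fin S.mesh.card) : Metric.diam (S.mesh.elem T) ≤ S.h :=
  le_ciSup (f := fun T => Metric.diam (S.mesh.elem T)) (Set.finite_range _).bddAbove T

theorem norm_sub_le_h {T : Fin S.mesh.card} {x y : Pt d} (hx : x ∈ S.mesh.elem T)
    (hy : y ∈ S.mesh.elem T) : ‖x - y‖ ≤ S.h := by
  rw [← dist_eq_norm]
  exact (Metric.dist_le_diam_of_mem (S.mesh.cell T).isCompact_body.isBounded hx hy).trans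
    (diam_le T)

theorem h_pos (hd : 1 ≤ d) (T : Fin S.mesh.card) : 0 < S.h := by
  have h1 : (S.mesh.cell T) ⟨0, by omega⟩ ≠ (S.mesh.cell T) ⟨1, by omega⟩ := fun h => by
    have := (S.mesh.cell T).ind.injective h
    simp at this
  exact (norm_pos_iff.2 (sub_ne_zero.2 h1)).trans_le (norm_sub_le_h (T := T)
    ((S.mesh.cell T).vertex_mem_body _) ((S.mesh.cell T).vertex_mem_body _))

theorem regular (hd : 1 ≤ d) (hK : 0 < K) (hG : S.GeometryAssumption ℓ K δΩ δU)
    (T : Fin S.mesh.card) : (S.mesh.cell T).Regular S.h (2 * K) := by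
  have hh := h_pos hd T
  refine ⟨hh, fun y hy z hz => norm_sub_le_h (T := T) hy hz, fun v => ?_⟩
  obtain ⟨c, hc⟩ := hG.quasiUniform T
  refine ((S.mesh.cell T).norm_coordL_le_of_ball (div_pos hh hK) hc v).trans (le_of_eq ?_)
  change 2 / (S.h / K) = _
  field_simp

theorem elem_subset_ball {T : Fin S.mesh.card} {x : Pt d} (hx : x ∈ S.mesh.elem T) {ρ : ℝ}
    (hρ : S.h < ρ) : S.mesh.elem T ⊆ Metric.ball x ρ := fun _ hy =>
  mem_ball_iff_norm.2 ((norm_sub_le_h hy hx).trans_lt hρ)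

/-- At a fixed time in the slab the tensor product form makes `φh` a polynomial of degree at most
`qs` on `T`, and interpolation reproduces it. -/
theorem φhExt_eq (hqs : 1 ≤ qs) (hD : S.DiscreteAssumption qs qt K δU r) {t : ℝ} (ht : t ∈ S.I)
    {T : Fin S.mesh.card} {x : Pt d} (hx : x ∈ S.mesh.elem T) : S.φhExt qs T t x = S.φh x t := by
  obtain ⟨c, hc, hφ⟩ := hD.tensor
  choose p hp hpe using fun i => (hc i).2 T
  have h1 : ∀ y ∈ S.mesh.elem T, S.φh y t =
      ∑ i : Fin (qt + 1), t ^ (i : ℕ) • MvPolynomial.eval (fun j => y j) (p i) := fun y hy => by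
    rw [hφ y (S.mesh.elem_subset_domain T hy) t ht]
    exact Finset.sum_congr rfl fun i _ => by rw [hpe i y hy, smul_eq_mul, mul_comm]
  have h2 : S.φhExt qs T t x = (S.mesh.cell T).interp qs (fun y =>
      ∑ i : Fin (qt + 1), t ^ (i : ℕ) • MvPolynomial.eval (fun j => y j) (p i)) x := by
    refine Finset.sum_congr rfl fun α hα => ?_
    simp only
    rw [h1 _ ((S.mesh.cell T).node_mem_body hqs hα)]
  rw [h2, h1 x hx, Cell.interp_sum]
  refine Finset.sum_congr rfl fun i _ => ?_
  rw [Cell.interp_smul, Cell.interp_mvPolynomial _ hqs (hp i)]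

theorem differentiableAt_φhExt (T : Fin S.mesh.card) (t : ℝ) (x : Pt d) :
    DifferentiableAt ℝ (S.φhExt qs T t) x := (S.mesh.cell T).differentiableAt_interp qs _ x

theorem continuousOn_φ (hG : S.GeometryAssumption ℓ K δΩ δU) {t : ℝ} (ht : t ∈ S.I) :
    ContinuousOn (fun y => S.φ y t) S.mesh.domain := by
  have h1 : ContinuousOn (fun y : Pt d => (y, t)) S.mesh.domain := by fun_prop
  exact hG.continuous.comp h1 fun y hy => Set.mk_mem_prod hy ht

theorem continuousOn_φh (hqs : 1 ≤ qs) (hD : S.DiscreteAssumption qs qt K δU r) {t : ℝ}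
    (ht : t ∈ S.I) (T : Fin S.mesh.card) : ContinuousOn (fun y => S.φh y t) (S.mesh.elem T) := by
  have h1 : Continuous (S.φhExt qs T t) :=
    continuous_iff_continuousAt.2 fun x => (differentiableAt_φhExt T t x).continuousAt
  exact h1.continuousOn.congr fun x hx => (φhExt_eq hqs hD ht hx).symm

theorem mem_closure_interior {T : Fin S.mesh.card} {x : Pt d} (hx : x ∈ S.mesh.elem T) :
    x ∈ closure (interior (S.mesh.elem T)) := by
  rw [Mesh.elem, Cell.closure_interior_body]; exact hx

/-- The error of the discrete level set function on the closed elements. -/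
theorem abs_φ_sub_φh_le (hqs : 1 ≤ qs) (hG : S.GeometryAssumption ℓ K δΩ δU)
    (hD : S.DiscreteAssumption qs qt K δU r) {T : Fin S.mesh.card} (hT : T ∈ S.meshU δU) {t : ℝ}
    (ht : t ∈ S.I) {x : Pt d} (hx : x ∈ S.mesh.elem T) :
    |S.φ x t - S.φh x t| ≤ K * (S.h ^ (qs + 1) + S.dt ^ (qt + 1)) := by
  have hsub : interior (S.mesh.elem T) ⊆ S.mesh.elem T := interior_subset
  -- The accuracy is assumed in the interior only, while Lagrange nodes also lie on the boundary;
  -- continuity closes the gap.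
  refine ContinuousWithinAt.closure_le (mem_closure_interior hx) (f := fun x => |S.φ x t - S.φh x t|)
    (g := fun _ => K * (S.h ^ (qs + 1) + S.dt ^ (qt + 1))) ?_ continuousWithinAt_const ?_
  · have h1 := ((continuousOn_φ hG ht).mono (S.mesh.elem_subset_domain T)).sub
      (continuousOn_φh hqs hD ht T)
    exact (h1 x hx).abs.mono hsub
  · intro y hy
    have := hD.accurate 0 0 (Or.inl ⟨Nat.zero_le _, Nat.zero_le _⟩) T hT y hy t ht
    simpa using this

/-- The Lipschitz constant of the error of the discrete level set function. -/
theorem abs_φ_sub_φh_sub_le (hqs : 1 ≤ qs) (hG : S.GeometryAssumption ℓ K δΩ δU)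
    (hD : S.DiscreteAssumption qs qt K δU r) {T : Fin S.mesh.card} (hT : T ∈ S.meshU δU) {t : ℝ}
    (ht : t ∈ S.I) (hdiff : ∀ y ∈ S.mesh.elem T, DifferentiableAt ℝ (fun y => S.φ y t) y)
    {x : Pt d} (hx : x ∈ S.mesh.elem T) {z : Pt d} (hz : z ∈ S.mesh.elem T) :
    |(S.φ x t - S.φh x t) - (S.φ z t - S.φh z t)| ≤
      K * (S.h ^ qs + S.dt ^ (qt + 1)) * ‖x - z‖ := by
  have hsub : interior (S.mesh.elem T) ⊆ S.mesh.elem T := interior_subset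
  set ψ : Pt d → ℝ := fun x => S.φ x t - S.φh x t with hψ
  have hcont : ContinuousOn ψ (S.mesh.elem T) :=
    ((continuousOn_φ hG ht).mono (S.mesh.elem_subset_domain T)).sub (continuousOn_φh hqs hD ht T)
  -- The mean value inequality on the convex interior, from the gradient error; the two points are
  -- then moved to the boundary one after the other.
  have hint : ∀ y ∈ interior (S.mesh.elem T), ∀ w ∈ interior (S.mesh.elem T),
      |ψ y - ψ w| ≤ K * (S.h ^ qs + S.dt ^ (qt + 1)) * ‖y - w‖ := by
    intro y hy w hw
    rw [← Real.norm_eq_abs]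
    refine Convex.norm_image_sub_le_of_norm_fderiv_le (𝕜 := ℝ) (f := ψ)
      (s := interior (S.mesh.elem T)) ?_ ?_ (S.mesh.cell T).convex_body.interior hw hy
    · intro v hv
      have h1 : ψ =ᶠ[𝓝 v] fun x => S.φ x t - S.φhExt qs T t x := by
        filter_upwards [isOpen_interior.mem_nhds hv] with u hu
        rw [φhExt_eq hqs hD ht (hsub hu)]
      exact ((hdiff v (hsub hv)).sub (differentiableAt_φhExt T t v)).congr_of_eventuallyEq h1
    · intro v hv
      have := hD.accurate 1 0 (Or.inl ⟨by omega, Nat.zero_le _⟩) T hT v hv t ht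
      rw [← norm_iteratedFDeriv_fderiv, norm_iteratedFDeriv_zero] at this
      simpa using this
  have hint2 : ∀ y ∈ interior (S.mesh.elem T),
      |ψ y - ψ z| ≤ K * (S.h ^ qs + S.dt ^ (qt + 1)) * ‖y - z‖ := by
    intro y hy
    refine ContinuousWithinAt.closure_le (mem_closure_interior hz) (f := fun z => |ψ y - ψ z|)
      (g := fun z => K * (S.h ^ qs + S.dt ^ (qt + 1)) * ‖y - z‖) ?_ ?_ (hint y hy)
    · exact (continuousWithinAt_const.sub ((hcont z hz).mono hsub)).abs
    · fun_prop
  refine ContinuousWithinAt.closure_le (mem_closure_interior hx) (f := fun x => |ψ x - ψ z|)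
      (g := fun x => K * (S.h ^ qs + S.dt ^ (qt + 1)) * ‖x - z‖) ?_ ?_ hint2
  · exact (((hcont x hx).mono hsub).sub continuousWithinAt_const).abs
  · fun_prop

end Slab

end Discrete

/-! ### Both sides of the interface at a fixed time -/

section Geometry

open Set Filter Topology

set_option maxSynthPendingDepth 3

namespace Slab

variable {d : ℕ} {S : Slab d} {qs qt : ℕ} {K δΩ δU r : ℝ} {ℓ : ℕ}

theorem _root_.IsPreconnected.exists_mem_frontier {X : Type*} [TopologicalSpace X] {C s : Set X}
    (hC : IsPreconnected C) (h1 : (C ∩ s).Nonempty) (h2 : (C ∩ sᶜ).Nonempty) :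
    ∃ w ∈ C, w ∈ frontier s := by
  by_contra! h
  have hc : ∀ w ∈ C, w ∈ interior s ∨ w ∈ interior sᶜ := fun w hw => by
    by_contra! h'
    refine h w hw ⟨?_, h'.1⟩
    have h3 := h'.2
    rw [interior_compl] at h3
    exact not_not.1 h3
  obtain ⟨x, hx, hxs⟩ := h1
  obtain ⟨y, hy, hys⟩ := h2
  obtain ⟨z, -, hz1, hz2⟩ := hC _ _ isOpen_interior isOpen_interior hc
    ⟨x, hx, (hc x hx).resolve_right fun h => interior_subset h hxs⟩
    ⟨y, hy, (hc y hy).resolve_left fun h => hys (interior_subset h)⟩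
  exact interior_subset hz2 (interior_subset hz1)

theorem Ω_subset (t : ℝ) : S.Ω t ⊆ S.mesh.domain := fun _ h => h.1

theorem frontier_Ω_subset (t : ℝ) : frontier (S.Ω t) ⊆ S.mesh.domain :=
  frontier_subset_closure.trans (closure_minimal (Ω_subset t) S.mesh.isClosed_domain)

/-- A ball about an interface point that left the interior of the domain would, being connected,
meet the boundary of the domain, at a distance below `δΩ`. -/
theorem ball_subset_interior (hδΩ : 0 < δΩ) (hG : S.GeometryAssumption ℓ K δΩ δU) {t : ℝ}
    (ht : t ∈ S.I) {y : Pt d} (hy : y ∈ frontier (S.Ω t)) :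
    Metric.ball y δΩ ⊆ interior S.mesh.domain := by
  have hsep : ∀ z ∈ Metric.ball y δΩ, z ∉ frontier S.mesh.domain := fun z hz hz' => by
    have h1 := hG.separated t ht z hz' y hy
    exact absurd (Metric.mem_ball.1 hz) (not_lt.2 h1.le)
  have hy0 : y ∈ interior S.mesh.domain := by
    have h1 := hsep y (Metric.mem_ball_self hδΩ)
    rw [S.mesh.isClosed_domain.frontier_eq] at h1
    by_contra h2
    exact h1 ⟨frontier_Ω_subset t hy, h2⟩
  intro z hz
  by_contra hz'
  obtain ⟨w, hw1, hw2⟩ := IsPreconnected.exists_mem_frontier (convex_ball y δΩ).isPreconnected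
    (s := interior S.mesh.domain) ⟨y, Metric.mem_ball_self hδΩ, hy0⟩ ⟨z, hz, hz'⟩
  exact hsep w hw1 (frontier_interior_subset hw2)

theorem φ_eq_zero (hδΩ : 0 < δΩ) (hG : S.GeometryAssumption ℓ K δΩ δU) {t : ℝ} (ht : t ∈ S.I)
    {y : Pt d} (hy : y ∈ frontier (S.Ω t)) : S.φ y t = 0 := by
  have hint : y ∈ interior S.mesh.domain :=
    ball_subset_interior hδΩ hG ht hy (Metric.mem_ball_self hδΩ)
  have hnh : S.mesh.domain ∈ 𝓝 y := mem_interior_iff_mem_nhds.1 hint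
  have hc : ContinuousAt (fun y => S.φ y t) y := (continuousOn_φ hG ht).continuousAt hnh
  rcases lt_trichotomy (S.φ y t) 0 with h | h | h
  · exfalso
    apply hy.2
    rw [mem_interior_iff_mem_nhds]
    filter_upwards [hnh, hc.eventually (gt_mem_nhds h)] with z h1 h2 using ⟨h1, h2⟩
  · exact h
  · exfalso
    have h1 := mem_closure_iff_nhds.1 hy.1 _ (hc.eventually (lt_mem_nhds h))
    obtain ⟨z, hz, hz'⟩ := h1
    exact absurd hz'.2 (not_lt.2 (le_of_lt hz))

theorem exists_frontier_mem_ball {t : ℝ} {y z₁ z₂ : Pt d} {κ : ℝ}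
    (hball : Metric.ball y κ ⊆ S.mesh.domain) (h1 : z₁ ∈ Metric.ball y κ)
    (h2 : z₂ ∈ Metric.ball y κ) (hz₁ : S.φ z₁ t < 0) (hz₂ : 0 < S.φ z₂ t) :
    ∃ y' ∈ frontier (S.Ω t), y' ∈ Metric.ball y κ := by
  obtain ⟨w, hw1, hw2⟩ := IsPreconnected.exists_mem_frontier (convex_ball y κ).isPreconnected
    (s := S.Ω t) ⟨z₁, h1, hball h1, hz₁⟩ ⟨z₂, h2, fun h => absurd h.2 (not_lt.2 hz₂.le)⟩
  exact ⟨w, hw2, hw1⟩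

/-- Derivatives within the neighbourhood `Ust` have to be transferred to cylinders, where unique
differentiability is clear. A cylinder that lies in `Ust` is relatively open in it, and iterated
derivatives within a set do not change under intersection with an open set. -/
theorem bddDerivOn_of_subset {n : ℕ} (hn : n ≤ ℓ) (hG : S.GeometryAssumption ℓ K δΩ δU)
    {B : Set (Pt d)} {J : Set ℝ} (hB : IsOpen B) (hJ : IsOpen J)
    (hsub : B ×ˢ (S.I ∩ J) ⊆ S.Ust δU) :
    BddDerivOn (B ×ˢ (S.I ∩ J)) n K (Function.uncurry S.φ) := by
  have heq : B ×ˢ (S.I ∩ J) = S.Ust δU ∩ B ×ˢ J := by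
    ext p
    constructor
    · intro hp
      exact ⟨hsub hp, hp.1, hp.2.2⟩
    · intro hp
      exact ⟨hp.2.1, hp.1.1, hp.2.2⟩
  refine BddDerivOn.of_contDiffOn ?_ (hG.smooth.mono hsub) hn fun k hk p hp => ?_
  · exact hB.uniqueDiffOn.prod (S.uniqueDiffOn_I.inter hJ)
  · rw [heq, iteratedFDerivWithin_inter_open (hB.prod hJ) ⟨hp.1, hp.2.2⟩]
    exact hG.bounded k (hk.trans hn) p (hsub hp)

/-- Close to a boundary point there are points on both sides at which the level set function is not
small. -/
theorem exists_sides (hK : 0 < K) (hδΩ : 0 < δΩ) (hδU : 0 < δU) (hG : S.GeometryAssumption ℓ K δΩ δU)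
    {t : ℝ} (ht : t ∈ S.I) {y : Pt d} (hy : y ∈ frontier (S.Ω t)) :
    1 ≤ K ∧ ∀ κ, 0 < κ → κ ≤ min δΩ δU → ∃ z₁ ∈ Metric.ball y κ, ∃ z₂ ∈ Metric.ball y κ,
      S.φ z₁ t ≤ -(K⁻¹ * min K⁻¹ (κ / (2 * K))) ∧ K⁻¹ * min K⁻¹ (κ / (2 * K)) ≤ S.φ z₂ t := by
  have hball := ball_subset_interior hδΩ hG ht hy
  have hU : ∀ z ∈ Metric.ball y (min δΩ δU), z ∈ S.U δU t := fun z hz =>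
    ⟨hball (Metric.ball_subset_ball (min_le_left _ _) hz), y, hy,
      (Metric.mem_ball.1 hz).trans_le (min_le_right _ _)⟩
  have hm : 0 < min δΩ δU := lt_min hδΩ hδU
  have hyU : y ∈ S.U δU t := hU y (Metric.mem_ball_self hm)
  set g := gradient (fun y => S.φ y t) y with hg
  have hglow : K⁻¹ ≤ ‖g‖ := hG.gradient_lower (y, t) ⟨ht, hyU⟩
  have h0 := φ_eq_zero hδΩ hG ht hy
  have hKinv : 0 < K⁻¹ := inv_pos.2 hK
  have hgpos : 0 < ‖g‖ := hKinv.trans_le hglow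
  -- The gradient of a function that is not differentiable is zero by convention, which the lower
  -- bound excludes.
  have hdiff : DifferentiableAt ℝ (fun y => S.φ y t) y := by
    by_contra h
    have : g = 0 := gradient_eq_zero_of_not_differentiableAt h
    rw [this, norm_zero] at hgpos
    exact lt_irrefl _ hgpos
  have hline : HasDerivAt (fun ε : ℝ => S.φ (y + ε • g) t) (‖g‖ ^ 2) 0 := by
    have h1 : HasFDerivAt (fun y => S.φ y t) (fderiv ℝ (fun y => S.φ y t) y) (y + (0 : ℝ) • g) := by
      simpa using hdiff.hasFDerivAt
    have h2 : HasDerivAt (fun β : ℝ => y + β • g) g 0 := by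
      simpa using ((hasDerivAt_id (0 : ℝ)).smul_const g).const_add y
    have h3 := h1.comp_hasDerivAt (0 : ℝ) h2
    have h4 : fderiv ℝ (fun y => S.φ y t) y g = ‖g‖ ^ 2 := LevelSetOn.dx_apply_grad S.φ (y, t)
    rw [h4] at h3
    exact h3
  have hmemU : ∀ ε : ℝ, |ε| * ‖g‖ < min δΩ δU → y + ε • g ∈ S.U δU t := fun ε hε => by
    apply hU
    rw [mem_ball_iff_norm, add_sub_cancel_left, norm_smul, Real.norm_eq_abs]
    exact hε
  have hsd : ∀ ε : ℝ, |ε| ≤ K⁻¹ → |ε| * ‖g‖ < min δΩ δU → ∀ ε' : ℝ, |ε'| ≤ K⁻¹ →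
      |ε'| * ‖g‖ < min δΩ δU → K⁻¹ * |ε - ε'| ≤ |S.φ (y + ε • g) t - S.φ (y + ε' • g) t| ∧
        |S.φ (y + ε • g) t - S.φ (y + ε' • g) t| ≤ K * |ε - ε'| := fun ε h1 h2 ε' h3 h4 =>
    hG.signedDistance t ht y hyU ε ε' h1 h3 (hmemU ε h2) (hmemU ε' h4)
  -- The derivative of `φ` along the search line at `y` is `|∇φ|^2`, and the signed distance
  -- property bounds it by `K`. Together with `|∇φ| ≥ K⁻¹` this forces `K ≥ 1`, and then `|∇φ| ≤ K`.
  have hg2 : ‖g‖ ^ 2 ≤ K := by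
    have h1 := hline.hasFDerivAt.le_of_lip' hK.le (by
      have h2 : ∀ᶠ ε : ℝ in 𝓝 0, |ε| < min K⁻¹ (min δΩ δU / ‖g‖) := by
        have : Metric.ball (0 : ℝ) (min K⁻¹ (min δΩ δU / ‖g‖)) ∈ 𝓝 (0 : ℝ) :=
          Metric.ball_mem_nhds _ (lt_min hKinv (by positivity))
        filter_upwards [this] with ε hε
        simpa using hε
      filter_upwards [h2] with ε hε
      have h3 := hsd ε (hε.le.trans (min_le_left _ _))
        ((lt_div_iff₀ hgpos).1 (hε.trans_le (min_le_right _ _))) 0 (by simpa using hKinv.le)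
        (by simpa using hm)
      simpa using h3.2)
    simpa [abs_of_nonneg (sq_nonneg ‖g‖)] using h1
  have hK1 : 1 ≤ K := by
    by_contra! h
    have h1 : 1 < K⁻¹ := (one_lt_inv₀ hK).2 h
    nlinarith
  have hgK : ‖g‖ ≤ K := by nlinarith
  refine ⟨hK1, fun κ hκ hκm => ?_⟩
  -- The first bound keeps the displacement in the range of the signed distance property; the second
  -- one keeps the displaced points within `κ / 2` of `y`.
  set ε := min K⁻¹ (κ / (2 * K)) with hε
  have hε0 : 0 < ε := lt_min hKinv (by positivity)
  have hεg : ε * ‖g‖ < κ := by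
    calc ε * ‖g‖ ≤ κ / (2 * K) * K := by
          gcongr
          exact min_le_right _ _
      _ = κ / 2 := by field_simp
      _ < κ := by linarith
  have hin : ∀ β ∈ Icc (-ε) ε, |β| ≤ K⁻¹ ∧ |β| * ‖g‖ < κ := fun β hβ => by
    have h1 : |β| ≤ ε := abs_le.2 hβ
    exact ⟨h1.trans (min_le_left _ _), (mul_le_mul_of_nonneg_right h1 hgpos.le).trans_lt hεg⟩
  have hcont : ContinuousOn (fun β : ℝ => S.φ (y + β • g) t) (Icc (-ε) ε) := by
    refine (continuousOn_φ hG ht).comp (by fun_prop) fun β hβ => ?_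
    exact interior_subset (hmemU β ((hin β hβ).2.trans_le hκm)).1
  -- The lower signed distance bound makes `φ` injective along the line, so it is strictly monotone
  -- with value zero at `y`. Either orientation yields points on both sides.
  have hinj : InjOn (fun β : ℝ => S.φ (y + β • g) t) (Icc (-ε) ε) := by
    intro β hβ γ hγ hbg
    have h1 := (hsd β (hin β hβ).1 ((hin β hβ).2.trans_le hκm) γ (hin γ hγ).1
      ((hin γ hγ).2.trans_le hκm)).1
    simp only at hbg
    rw [hbg, sub_self, abs_zero] at h1
    have h2 : |β - γ| ≤ 0 := by
      by_contra! h3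
      have := mul_pos hKinv h3
      linarith
    exact sub_eq_zero.1 (abs_nonpos_iff.1 h2)
  have hmemε : ε ∈ Icc (-ε) ε := ⟨by linarith, le_rfl⟩
  have hmemε' : -ε ∈ Icc (-ε) ε := ⟨le_rfl, by linarith⟩
  have hmem0 : (0 : ℝ) ∈ Icc (-ε) ε := ⟨by linarith, hε0.le⟩
  have hb : ∀ β ∈ Icc (-ε) ε, y + β • g ∈ Metric.ball y κ := fun β hβ => by
    rw [mem_ball_iff_norm, add_sub_cancel_left, norm_smul, Real.norm_eq_abs]
    exact (hin β hβ).2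
  have habs : ∀ β ∈ Icc (-ε) ε, K⁻¹ * |β| ≤ |S.φ (y + β • g) t| := fun β hβ => by
    have h1 := (hsd β (hin β hβ).1 ((hin β hβ).2.trans_le hκm) 0 (hin 0 hmem0).1
      ((hin 0 hmem0).2.trans_le hκm)).1
    simpa [h0] using h1
  have ha1 := habs ε hmemε
  have ha2 := habs (-ε) hmemε'
  rw [abs_neg, abs_of_pos hε0] at ha2
  rw [abs_of_pos hε0] at ha1
  rcases hcont.strictMonoOn_of_injOn_Icc' (by linarith) hinj with hmono | hanti
  · have h1 := hmono hmem0 hmemε hε0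
    have h2 := hmono hmemε' hmem0 (by linarith)
    simp only [zero_smul, add_zero, h0] at h1 h2
    rw [abs_of_pos h1] at ha1
    rw [abs_of_neg h2] at ha2
    exact ⟨_, hb _ hmemε', _, hb _ hmemε, by linarith, by linarith⟩
  · have h1 := hanti hmem0 hmemε hε0
    have h2 := hanti hmemε' hmem0 (by linarith)
    simp only [zero_smul, add_zero, h0] at h1 h2
    rw [abs_of_neg h1] at ha1
    rw [abs_of_pos h2] at ha2
    exact ⟨_, hb _ hmemε, _, hb _ hmemε', by linarith, by linarith⟩

end Slab

end Geometry

/-! ### Stability of the interface neighbourhood during a slab -/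

section Geometry

open Set Filter Topology

set_option maxSynthPendingDepth 3

theorem BddDerivOn.norm_sub_le {E F : Type} [NormedAddCommGroup E] [NormedSpace ℝ E]
    [NormedAddCommGroup F] [NormedSpace ℝ F] {s : Set E} {f : E → F} {C : ℝ} {n : ℕ}
    (hs : Convex ℝ s) (hf : BddDerivOn s (n + 1) C f) {x y : E} (hx : x ∈ s) (hy : y ∈ s) :
    ‖f y - f x‖ ≤ C * ‖y - x‖ := by
  obtain ⟨-, f', h1, h2⟩ := hf
  exact hs.norm_image_sub_le_of_norm_hasFDerivWithin_le h1 (fun p hp => h2.bound hp) hx hy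

namespace Slab

variable {d : ℕ} {S : Slab d} {qs qt : ℕ} {K δΩ δU r : ℝ} {ℓ : ℕ}

theorem ball_subset_U (hδΩ : 0 < δΩ) (hG : S.GeometryAssumption ℓ K δΩ δU) {t : ℝ}
    (ht : t ∈ S.I) {y : Pt d} (hy : y ∈ frontier (S.Ω t)) :
    Metric.ball y (min δΩ δU) ⊆ S.U δU t := fun _ hz =>
  ⟨ball_subset_interior hδΩ hG ht hy (Metric.ball_subset_ball (min_le_left _ _) hz), y, hy,
    (Metric.mem_ball.1 hz).trans_le (min_le_right _ _)⟩

/-- The signs of the level set function at two points close to its zero set do not change during a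
short time slab. -/
theorem signs_persist (hℓ : 1 ≤ ℓ) (hδΩ : 0 < δΩ)
    (hG : S.GeometryAssumption ℓ K δΩ δU) {t : ℝ} (ht : t ∈ S.I) {y : Pt d}
    (hy : y ∈ frontier (S.Ω t)) {κ : ℝ} (hκm : 2 * κ ≤ min δΩ δU)
    {z₁ z₂ : Pt d} (hz₁ : z₁ ∈ Metric.ball y κ) (hz₂ : z₂ ∈ Metric.ball y κ) {a : ℝ}
    (ha₁ : S.φ z₁ t ≤ -a) (ha₂ : a ≤ S.φ z₂ t) (ha : K * S.dt < a) {t' : ℝ} (ht' : t' ∈ S.I)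
    (hK : 0 < K) :
    S.φ z₁ t' < 0 ∧ 0 < S.φ z₂ t' := by
  have hκ : 0 < κ := (dist_nonneg.trans_lt (Metric.mem_ball.1 hz₁))
  have hball : Metric.ball y κ ⊆ S.mesh.domain := fun z hz => interior_subset
    (ball_subset_U hδΩ hG ht hy (Metric.ball_subset_ball (by linarith) hz)).1
  have hcz : ∀ z ∈ Metric.ball y κ, ContinuousOn (fun τ => S.φ z τ) S.I := fun z hz => by
    have h1 : ContinuousOn (fun τ : ℝ => (z, τ)) S.I := by fun_prop
    exact hG.continuous.comp h1 fun τ hτ => Set.mk_mem_prod (hball hz) hτ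
  set s : ℝ → ℝ := fun θ => t + θ * (t' - t) with hs
  have hsI : ∀ θ ∈ Icc (0 : ℝ) 1, s θ ∈ S.I := fun θ hθ => by
    have h1 := S.convex_I.lineMap_mem ht ht' hθ
    rw [AffineMap.lineMap_apply] at h1
    simpa [hs, add_comm] using h1
  have hdt : |t' - t| ≤ S.dt := S.abs_sub_le_dt ht' ht
  set f : ℝ → ℝ := fun θ => max |S.φ z₁ (s θ) - S.φ z₁ t| |S.φ z₂ (s θ) - S.φ z₂ t| with hf
  have hcs : ContinuousOn s (Icc 0 1) := by fun_prop
  have hfc : ContinuousOn f (Icc 0 1) := by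
    have h1 := ((hcz z₁ hz₁).comp hcs hsI).sub (continuousOn_const (c := S.φ z₁ t))
    have h2 := ((hcz z₂ hz₂).comp hcs hsI).sub (continuousOn_const (c := S.φ z₂ t))
    exact ContinuousOn.sup h1.abs h2.abs
  have hsign : ∀ θ ∈ Icc (0 : ℝ) 1, f θ ≤ K * |t' - t| * θ →
      S.φ z₁ (s θ) < 0 ∧ 0 < S.φ z₂ (s θ) := fun θ hθ hle => by
    have h1 : f θ < a := by
      calc f θ ≤ K * |t' - t| * θ := hle
        _ ≤ K * S.dt * 1 := by
            have := hθ.2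
            have := hθ.1
            have := (abs_nonneg _).trans hdt
            gcongr
        _ < a := by rwa [mul_one]
    have h2 := (le_max_left _ _).trans_lt h1
    have h3 := (le_max_right _ _).trans_lt h1
    rw [abs_lt] at h2 h3
    exact ⟨by linarith [h2.2], by linarith [h3.1]⟩
  -- Continuation along the segment of times. The time derivative of `φ` is controlled only near the
  -- interface of the same time, and it must be shown that `z₁`, `z₂` stay near it. As long as the
  -- change of `φ` is below `a` the signs differ, so an interface point lies within `κ` of `y`; then
  -- `φ` is `K`-Lipschitz in time there and the estimate extends a little further.
  have hall : Icc (0 : ℝ) 1 ⊆ {θ | f θ ≤ K * |t' - t| * θ} := by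
    refine IsClosed.Icc_subset_of_forall_exists_gt ?_ ?_ ?_
    · have h1 := isClosed_Icc.isClosed_le hfc
        (g := fun θ => K * |t' - t| * θ) (by fun_prop)
      convert h1 using 1
      ext θ
      exact and_comm
    · simp [hf, hs]
    · rintro x ⟨hx, hx0, hx1⟩ w hw
      have hxI : x ∈ Icc (0 : ℝ) 1 := ⟨hx0, hx1.le⟩
      obtain ⟨h1, h2⟩ := hsign x hxI hx
      -- By continuity in time alone the signs persist for nearby times, which puts a whole
      -- space-time cylinder into the neighbourhood where `φ` is smooth.
      have h3 : ∀ᶠ τ in 𝓝[S.I] (s x), S.φ z₁ τ < 0 ∧ 0 < S.φ z₂ τ :=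
        ((hcz z₁ hz₁ _ (hsI x hxI)).eventually (gt_mem_nhds h1)).and
          ((hcz z₂ hz₂ _ (hsI x hxI)).eventually (lt_mem_nhds h2))
      obtain ⟨ε, hε, hεs⟩ := Metric.mem_nhdsWithin_iff.1 h3
      have hU : Metric.ball y κ ×ˢ (S.I ∩ Metric.ball (s x) ε) ⊆ S.Ust δU := by
        rintro ⟨z, τ⟩ ⟨hz, hτ, hτ'⟩
        obtain ⟨h4, h5⟩ := hεs ⟨hτ', hτ⟩
        obtain ⟨y', hy', hyb⟩ := exists_frontier_mem_ball hball hz₁ hz₂ h4 h5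
        refine ⟨hτ, ball_subset_U hδΩ hG hτ hy' ?_⟩
        rw [Metric.mem_ball] at hz hyb ⊢
        have := dist_triangle_right z y' y
        linarith
      have hB := bddDerivOn_of_subset (n := 1) hℓ hG Metric.isOpen_ball Metric.isOpen_ball hU
      have hconv : Convex ℝ (Metric.ball y κ ×ˢ (S.I ∩ Metric.ball (s x) ε)) :=
        (convex_ball _ _).prod (S.convex_I.inter (convex_ball _ _))
      -- A step short enough to remain in that cylinder; the `+ 1` avoids a division by zero if `t'
      -- = t`.
      set x' := min (min w 1) (x + ε / (2 * (|t' - t| + 1))) with hx'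
      have hpos : 0 < |t' - t| + 1 := by positivity
      have hxx' : x < x' := lt_min (lt_min hw hx1) (by
        have : 0 < ε / (2 * (|t' - t| + 1)) := by positivity
        linarith)
      have hx'w : x' ≤ w := (min_le_left _ _).trans (min_le_left _ _)
      have hx'1 : x' ≤ 1 := (min_le_left _ _).trans (min_le_right _ _)
      have hx'I : x' ∈ Icc (0 : ℝ) 1 := ⟨hx0.trans hxx'.le, hx'1⟩
      have hss : |s x' - s x| = |t' - t| * (x' - x) := by
        have : s x' - s x = (x' - x) * (t' - t) := by simp only [hs]; ring
        rw [this, abs_mul, abs_of_pos (by linarith : 0 < x' - x), mul_comm]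
      have hclose : |s x' - s x| < ε := by
        have h6 : x' - x ≤ ε / (2 * (|t' - t| + 1)) := by
          linarith [min_le_right (min w 1) (x + ε / (2 * (|t' - t| + 1)))]
        calc |s x' - s x| = |t' - t| * (x' - x) := hss
          _ ≤ (|t' - t| + 1) * (ε / (2 * (|t' - t| + 1))) := by
              have : 0 ≤ x' - x := by linarith
              gcongr
              linarith
          _ = ε / 2 := by field_simp
          _ < ε := by linarith
      have hlip : ∀ z ∈ Metric.ball y κ, |S.φ z (s x') - S.φ z (s x)| ≤ K * |t' - t| * (x' - x) := by
        intro z hz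
        have h7 := BddDerivOn.norm_sub_le hconv hB (x := (z, s x)) (y := (z, s x'))
          ⟨hz, hsI x hxI, Metric.mem_ball_self hε⟩
          ⟨hz, hsI x' hx'I, by rw [Metric.mem_ball, Real.dist_eq]; exact hclose⟩
        have h8 : ‖((z, s x') : Pt d × ℝ) - (z, s x)‖ = |s x' - s x| := by
          simp [Prod.norm_def]
        rw [h8, hss] at h7
        simpa [Function.uncurry, mul_assoc] using h7
      refine ⟨x', ?_, hxx', hx'w⟩
      have hx : max |S.φ z₁ (s x) - S.φ z₁ t| |S.φ z₂ (s x) - S.φ z₂ t| ≤ K * |t' - t| * x := hx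
      have e1 := (le_max_left _ _).trans hx
      have e2 := (le_max_right _ _).trans hx
      change max |S.φ z₁ (s x') - S.φ z₁ t| |S.φ z₂ (s x') - S.φ z₂ t| ≤ K * |t' - t| * x'
      refine max_le ?_ ?_
      · have := abs_sub_le (S.φ z₁ (s x')) (S.φ z₁ (s x)) (S.φ z₁ t)
        linarith [hlip z₁ hz₁]
      · have := abs_sub_le (S.φ z₂ (s x')) (S.φ z₂ (s x)) (S.φ z₂ t)
        linarith [hlip z₂ hz₂]
  have h1 : (1 : ℝ) ∈ Icc (0 : ℝ) 1 := by simp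
  have h2 := hsign 1 h1 (hall h1)
  simpa [hs] using h2

/-- In a short time slab, the neighbourhoods of the interface for the different times are
comparable. -/
theorem one_le_and_ball_subset_U (hℓ : 1 ≤ ℓ) (hK : 0 < K) (hδΩ : 0 < δΩ) (hδU : 0 < δU)
    (hG : S.GeometryAssumption ℓ K δΩ δU) {δ κ : ℝ} (hδ : 0 ≤ δ) (hκ : 0 < κ)
    (hδκ : δ + 2 * κ ≤ min δΩ δU) (hdt : K * S.dt < K⁻¹ * min K⁻¹ (κ / (2 * K)))
    {t : ℝ} (ht : t ∈ S.I) {y : Pt d} (hy : y ∈ frontier (S.Ω t)) {x : Pt d} (hx : dist x y ≤ δ) :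
    1 ≤ K ∧ ∀ t' ∈ S.I, Metric.ball x κ ⊆ S.U δU t' := by
  obtain ⟨h1, h2⟩ := exists_sides hK hδΩ hδU hG ht hy
  refine ⟨h1, fun t' ht' z hz => ?_⟩
  obtain ⟨z₁, hz₁, z₂, hz₂, ha₁, ha₂⟩ := h2 κ hκ (by linarith)
  obtain ⟨h3, h4⟩ := signs_persist hℓ hδΩ hG ht hy (by linarith) hz₁ hz₂ ha₁ ha₂ hdt ht' hK
  have hball : Metric.ball y κ ⊆ S.mesh.domain := fun z hz => interior_subset
    (ball_subset_U hδΩ hG ht hy (Metric.ball_subset_ball (by linarith) hz)).1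
  obtain ⟨y', hy', hyb⟩ := exists_frontier_mem_ball hball hz₁ hz₂ h3 h4
  refine ball_subset_U hδΩ hG ht' hy' ?_
  rw [Metric.mem_ball] at hz hyb ⊢
  have e1 := dist_triangle z x y'
  have e2 := dist_triangle_right x y' y
  linarith

theorem levelSetOn {m : ℕ} (hG : S.GeometryAssumption (m + 2) K δΩ δU) (hK : 1 ≤ K) {x : Pt d}
    {κ : ℝ} (hκ : 0 < κ) (hx : ∀ t ∈ S.I, Metric.ball x κ ⊆ S.U δU t) :
    LevelSetOn S.φ x κ S.I m K where
  one_le := hK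
  pos := hκ
  convex := S.convex_I
  smooth := by
    have h1 := bddDerivOn_of_subset (n := m + 2) (B := Metric.ball x κ) (J := univ) le_rfl hG
      Metric.isOpen_ball isOpen_univ
      (by rintro ⟨z, τ⟩ ⟨hz, hτ, -⟩; exact ⟨hτ, hx τ hτ hz⟩)
    rwa [inter_univ] at h1
  lower z hz t ht := hG.gradient_lower (z, t) ⟨ht, hx t ht hz⟩

end Slab

end Geometry

/-! ### Data on an active element and the errors of its level set functions -/

section ActiveElements

open Set Filter Topology

set_option maxSynthPendingDepth 3

namespace BddDerivOn

variable {E F G : Type} [NormedAddCommGroup E] [NormedSpace ℝ E] [NormedAddCommGroup F]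
  [NormedSpace ℝ F] [NormedAddCommGroup G] [NormedSpace ℝ G] {n : ℕ} {C : ℝ}

/-- Composition with an affine map whose linear part is a contraction. -/
theorem comp_affine {s : Set F} {f : F → G} (hf : BddDerivOn s n C f) {u : Set E} {g : E → F}
    (L : E →L[ℝ] F) (hL : ‖L‖ ≤ 1) (hg : ∀ x ∈ u, HasFDerivWithinAt g L u x) (hgu : MapsTo g u s) :
    BddDerivOn u n C fun x => f (g x) := by
  induction n generalizing G with
  | zero => exact fun x hx => hf _ (hgu hx)
  | succ n ih =>
    obtain ⟨h0, f', h1, h2⟩ := hf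
    refine ⟨fun x hx => h0 _ (hgu hx), fun x => (f' (g x)).comp L,
      fun x hx => (h1 _ (hgu hx)).comp x (hg x hx) hgu, ?_⟩
    have h3 : ‖(ContinuousLinearMap.compL ℝ E F G).flip L‖ ≤ 1 := by
      refine ContinuousLinearMap.opNorm_le_bound _ zero_le_one fun M => ?_
      rw [one_mul]
      exact (ContinuousLinearMap.opNorm_comp_le _ _).trans
        (mul_le_of_le_one_right (norm_nonneg _) hL)
    have h4 := (ih h2).clm_comp _ h3
    rwa [one_mul] at h4

theorem slice_left {s : Set E} {u : Set F} {f : E × F → G} (hf : BddDerivOn (s ×ˢ u) n C f) {t : F}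
    (ht : t ∈ u) : BddDerivOn s n C fun x => f (x, t) :=
  hf.comp_affine (ContinuousLinearMap.inl ℝ E F) (ContinuousLinearMap.norm_inl_le_one ℝ E F)
    (fun x _ => (hasFDerivAt_prodMk_left x t).hasFDerivWithinAt) fun _ hx => mk_mem_prod hx ht

theorem slice_right {s : Set E} {u : Set F} {f : E × F → G} (hf : BddDerivOn (s ×ˢ u) n C f)
    {x : E} (hx : x ∈ s) : BddDerivOn u n C fun t => f (x, t) :=
  hf.comp_affine (ContinuousLinearMap.inr ℝ E F) (ContinuousLinearMap.norm_inr_le_one ℝ E F)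
    (fun t _ => (hasFDerivAt_prodMk_right x t).hasFDerivWithinAt) fun _ ht => mk_mem_prod hx ht

/-- Differences in the first variable, as functions of the second one. -/
theorem slice_sub {s : Set E} {u : Set F} {f : E × F → G} (hs : Convex ℝ s) (hu : Convex ℝ u)
    (hf : BddDerivOn (s ×ˢ u) (n + 1) C f) {x y : E} (hx : x ∈ s) (hy : y ∈ s) :
    BddDerivOn u n (C * ‖x - y‖) fun t => f (x, t) - f (y, t) := by
  induction n generalizing G with
  | zero =>
    intro t ht
    have h1 := norm_sub_le (hs.prod hu) hf (x := (y, t)) (y := (x, t)) ⟨hy, ht⟩ ⟨hx, ht⟩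
    simpa [Prod.norm_def] using h1
  | succ n ih =>
    refine ⟨fun t ht => ?_, ?_⟩
    · have h1 := norm_sub_le (hs.prod hu) hf (x := (y, t)) (y := (x, t)) ⟨hy, ht⟩ ⟨hx, ht⟩
      simpa [Prod.norm_def] using h1
    · obtain ⟨-, f', h1, h2⟩ := hf
      refine ⟨fun t => (f' (x, t) - f' (y, t)).comp (ContinuousLinearMap.inr ℝ E F),
        fun t ht => ?_, ?_⟩
      · have h3 : ∀ z ∈ s, HasFDerivWithinAt (fun t => f (z, t))
            ((f' (z, t)).comp (ContinuousLinearMap.inr ℝ E F)) u t := fun z hz =>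
          (h1 (z, t) ⟨hz, ht⟩).comp t (hasFDerivAt_prodMk_right z t).hasFDerivWithinAt
            fun _ ht => mk_mem_prod hz ht
        exact (h3 x hx).sub (h3 y hy)
      · have h3 : ‖(ContinuousLinearMap.compL ℝ F (E × F) G).flip
            (ContinuousLinearMap.inr ℝ E F)‖ ≤ 1 := by
          refine ContinuousLinearMap.opNorm_le_bound _ zero_le_one fun M => ?_
          rw [one_mul]
          exact (ContinuousLinearMap.opNorm_comp_le _ _).trans
            (mul_le_of_le_one_right (norm_nonneg _) (ContinuousLinearMap.norm_inr_le_one ℝ E F))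
        have h4 := (ih h2).clm_comp _ h3
        rwa [one_mul] at h4

end BddDerivOn

namespace Slab

variable {d : ℕ}

/-- The order of the errors of function values. -/
noncomputable def err₀ (S : Slab d) (qs qt : ℕ) : ℝ := S.h ^ (qs + 1) + S.dt ^ (qt + 1)

/-- The order of the errors of spatial derivatives. -/
noncomputable def err₁ (S : Slab d) (qs qt : ℕ) : ℝ := S.h ^ qs + S.dt ^ (qt + 1)

/-- The properties of the data on an element in the interior of the neighbourhood of the interface
which are used for the error estimate. -/
structure ActiveElem (S : Slab d) (qs qt m : ℕ) (K ρ : ℝ) (b : Pt d → ℝ → ℝ)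
    (T : Fin S.mesh.card) : Prop where
  qs_le : qs ≤ m
  qt_le : qt ≤ m
  qs_pos : 1 ≤ qs
  qt_pos : 1 ≤ qt
  dt_pos : 0 < S.dt
  dt_le : S.dt ≤ 1
  h_le : S.h ≤ 1
  h_le_rho : 4 * S.h < ρ
  dt_pow_le : S.dt ^ (qt + 1) ≤ S.h
  regular : (S.mesh.cell T).Regular S.h (2 * K)
  level : LevelSetOn S.φ (S.mesh.cell T 0) ρ S.I m K
  ball_subset : Metric.ball (S.mesh.cell T 0) ρ ⊆ S.mesh.domain
  b_smooth : BddDerivOn (Metric.ball (S.mesh.cell T 0) ρ ×ˢ S.I) (m + 2) K (Function.uncurry b)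
  b_range : ∀ x ∈ Metric.ball (S.mesh.cell T 0) ρ, ∀ t ∈ S.I, b x t ∈ Icc (0 : ℝ) 1
  φh_ext : ∀ t ∈ S.I, ∀ x ∈ S.mesh.elem T, S.φhExt qs T t x = S.φh x t
  error : ∀ t ∈ S.I, ∀ x ∈ S.mesh.elem T, |S.φ x t - S.φh x t| ≤ K * S.err₀ qs qt
  error_sub : ∀ t ∈ S.I, ∀ x ∈ S.mesh.elem T, ∀ y ∈ S.mesh.elem T,
    |(S.φ x t - S.φh x t) - (S.φ y t - S.φh y t)| ≤ K * S.err₁ qs qt * ‖x - y‖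
  polynomial : ∀ x ∈ S.mesh.elem T, ∃ c : Fin (qt + 1) → ℝ, ∀ t ∈ S.I,
    S.φh x t = ∑ i, c i * t ^ (i : ℕ)

namespace ActiveElem

variable {S : Slab d} {qs qt m : ℕ} {K ρ : ℝ} {b : Pt d → ℝ → ℝ} {T : Fin S.mesh.card}
theorem vertex_mem (_A : S.ActiveElem qs qt m K ρ b T) :
    S.mesh.cell T 0 ∈ S.mesh.elem T := (S.mesh.cell T).vertex_mem_body 0

theorem node_mem (_A : S.ActiveElem qs qt m K ρ b T) {k : ℕ} (hk : 1 ≤ k) {α : Fin (d + 1) → ℕ}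
    (hα : α ∈ Finset.univ.piAntidiag k) : (S.mesh.cell T).node k α ∈ S.mesh.elem T :=
  (S.mesh.cell T).node_mem_body hk hα

variable (A : S.ActiveElem qs qt m K ρ b T)
include A

theorem h_pos : 0 < S.h := A.regular.pos

theorem K_pos : 0 < K := by linarith [A.level.one_le]

theorem err₀_nonneg : 0 ≤ S.err₀ qs qt := by
  have := A.h_pos; have := A.dt_pos; unfold err₀; positivity

theorem err₁_nonneg : 0 ≤ S.err₁ qs qt := by
  have := A.h_pos; have := A.dt_pos; unfold err₁; positivity

theorem pow_le_err₀ : S.h ^ (qs + 1) ≤ S.err₀ qs qt := by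
  have := A.dt_pos; unfold err₀; linarith [pow_pos this (qt + 1)]

theorem dt_pow_le_err₀ : S.dt ^ (qt + 1) ≤ S.err₀ qs qt := by
  have := A.h_pos; unfold err₀; linarith [pow_pos this (qs + 1)]

theorem pow_le_err₁ : S.h ^ qs ≤ S.err₁ qs qt := by
  have := A.dt_pos; unfold err₁; linarith [pow_pos this (qt + 1)]

theorem dt_pow_le_err₁ : S.dt ^ (qt + 1) ≤ S.err₁ qs qt := by
  have := A.h_pos; unfold err₁; linarith [pow_pos this qs]

theorem err₀_le_err₁ : S.err₀ qs qt ≤ S.err₁ qs qt := by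
  have h1 : S.h ^ (qs + 1) ≤ S.h ^ qs :=
    pow_le_pow_of_le_one A.h_pos.le A.h_le (Nat.le_succ _)
  unfold err₀ err₁
  linarith

theorem mul_err₁_le_err₀ : S.h * S.err₁ qs qt ≤ S.err₀ qs qt := by
  have h1 : S.h * S.dt ^ (qt + 1) ≤ 1 * S.dt ^ (qt + 1) := by
    have := A.dt_pos
    have := A.h_le
    gcongr
  unfold err₀ err₁
  rw [pow_succ' S.h, mul_add]
  linarith

theorem err₁_le_two_mul : S.err₁ qs qt ≤ 2 * S.h := by
  have h1 : S.h ^ qs ≤ S.h ^ 1 := pow_le_pow_of_le_one A.h_pos.le A.h_le A.qs_pos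
  have h2 := A.dt_pow_le
  unfold err₁
  rw [pow_one] at h1
  linarith

theorem nbhd_subset_half : (S.mesh.cell T).nbhd S.h ⊆ Metric.ball (S.mesh.cell T 0) (ρ / 2) := by
  rintro x ⟨y, hy, hxy⟩
  have h1 := norm_sub_le_h (T := T) hy A.vertex_mem
  rw [mem_ball_iff_norm]
  have h2 := norm_sub_le_norm_sub_add_norm_sub x y (S.mesh.cell T 0)
  linarith [A.h_le_rho]

theorem half_subset :
    Metric.ball (S.mesh.cell T 0) (ρ / 2) ⊆ Metric.ball (S.mesh.cell T 0) ρ :=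
  Metric.ball_subset_ball (by linarith [A.level.pos])

theorem nbhd_subset : (S.mesh.cell T).nbhd S.h ⊆ Metric.ball (S.mesh.cell T 0) ρ :=
  A.nbhd_subset_half.trans A.half_subset

theorem elem_subset_nbhd : S.mesh.elem T ⊆ (S.mesh.cell T).nbhd S.h :=
  Cell.body_subset_nbhd A.h_pos.le

theorem elem_subset : S.mesh.elem T ⊆ Metric.ball (S.mesh.cell T 0) ρ :=
  A.elem_subset_nbhd.trans A.nbhd_subset

theorem φ_smooth {t : ℝ} (ht : t ∈ S.I) :
    BddDerivOn (Metric.ball (S.mesh.cell T 0) ρ) (m + 2) K (fun y => S.φ y t) :=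
  A.level.smooth.slice_left ht

end ActiveElem

/-- The error of the polynomial extension of the discrete level set function. -/
theorem exists_ext_error (d qs : ℕ) (K : ℝ) : ∃ C : ℝ, 1 ≤ C ∧
    ∀ (S : Slab d) (qt m : ℕ) (ρ : ℝ) (b : Pt d → ℝ → ℝ) (T : Fin S.mesh.card),
      S.ActiveElem qs qt m K ρ b T → ∀ t ∈ S.I, ∀ x ∈ (S.mesh.cell T).nbhd S.h,
        |S.φ x t - S.φhExt qs T t x| ≤ C * S.err₀ qs qt ∧
        ‖LevelSetOn.dx S.φ (x, t) - fderiv ℝ (S.φhExt qs T t) x‖ ≤ C * S.err₁ qs qt := by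
  rcases Nat.eq_zero_or_pos qs with h0 | hqs
  · exact ⟨1, le_rfl, fun S qt m ρ b T A => absurd A.qs_pos (by omega)⟩
  obtain ⟨C₁, hC₁, H₁⟩ := Cell.Regular.exists_interp_error d (k := qs) hqs (2 * K)
  obtain ⟨C₂, hC₂, H₂⟩ := Cell.Regular.exists_interp_bound d qs (2 * K)
  obtain ⟨C₃, hC₃, H₃⟩ := Cell.Regular.exists_interp_slope_bound d (k := qs) hqs (2 * K)
  refine ⟨1 + |K| * (C₁ + C₂ + C₃), by
    have := abs_nonneg K
    nlinarith, fun S qt m ρ b T A t ht x hx => ?_⟩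
  have hK := A.K_pos
  have hh := A.h_pos
  have hT := A.regular
  have e0 := A.err₀_nonneg
  have e1 := A.err₁_nonneg
  rw [abs_of_pos hK]
  have hxb := A.nbhd_subset hx
  obtain ⟨a1, a2⟩ := H₁ ℝ _ _ hT _ _ K (convex_ball _ _) A.elem_subset
    ((A.φ_smooth ht).mono_order (show qs + 1 ≤ m + 2 by linarith [A.qs_le])) x hx
    (Metric.isOpen_ball.mem_nhds hxb)
  have a2 := a2 _ (A.level.hasFDerivAt hxb ht)
  obtain ⟨b1, -⟩ := H₂ ℝ _ _ hT (fun y => S.φ y t - S.φh y t) (K * S.err₀ qs qt)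
    (fun α hα => by
      rw [Real.norm_eq_abs]
      exact A.error t ht _ (A.node_mem hqs hα)) x hx
  -- Differences of nodal errors are used for the gradient: the Lipschitz bound of `φ - φh` makes
  -- them `O(h err₁)`. The nodal errors themselves would produce a term `Δt^(qt+1) / h`.
  have b2 := H₃ ℝ _ _ hT (fun y => S.φ y t - S.φh y t) (K * S.err₁ qs qt * S.h)
    (fun α hα β hβ => by
      rw [Real.norm_eq_abs]
      refine (A.error_sub t ht _ (A.node_mem hqs hα) _ (A.node_mem hqs hβ)).trans ?_
      have := norm_sub_le_h (T := T) (A.node_mem hqs hα) (A.node_mem hqs hβ)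
      gcongr) x hx
  rw [Cell.interp_sub] at b1
  rw [Cell.fderiv_interp_sub] at b2
  have b2' : C₃ * (K * S.err₁ qs qt * S.h) / S.h = K * C₃ * S.err₁ qs qt := by
    field_simp
  rw [b2'] at b2
  have p0 := A.pow_le_err₀
  have p1 := A.pow_le_err₁
  constructor
  · rw [← Real.norm_eq_abs]
    refine (norm_sub_le_norm_sub_add_norm_sub _
      ((S.mesh.cell T).interp qs (fun y => S.φ y t) x) _).trans ?_
    have h1 : C₁ * K * S.h ^ (qs + 1) ≤ C₁ * K * S.err₀ qs qt := by gcongr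
    have h2 : 0 ≤ K * C₃ * S.err₀ qs qt := by positivity
    change _ + ‖_ - (S.mesh.cell T).interp qs (fun y => S.φh y t) x‖ ≤ _
    nlinarith
  · refine (norm_sub_le_norm_sub_add_norm_sub _
      (fderiv ℝ ((S.mesh.cell T).interp qs (fun y => S.φ y t)) x) _).trans ?_
    have h1 : C₁ * K * S.h ^ qs ≤ C₁ * K * S.err₁ qs qt := by gcongr
    have h2 : 0 ≤ K * C₂ * S.err₁ qs qt := by positivity
    change _ + ‖_ - fderiv ℝ ((S.mesh.cell T).interp qs (fun y => S.φh y t)) x‖ ≤ _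
    nlinarith

/-- The errors of piecewise linear interpolation. -/
theorem exists_lin_error (d : ℕ) (K : ℝ) : ∃ C : ℝ, 1 ≤ C ∧
    ∀ (S : Slab d) (qs qt m : ℕ) (ρ : ℝ) (b : Pt d → ℝ → ℝ) (T : Fin S.mesh.card),
      S.ActiveElem qs qt m K ρ b T → ∀ t ∈ S.I, ∀ x ∈ (S.mesh.cell T).nbhd S.h,
        |(S.mesh.cell T).interp 1 (fun y => S.φ y t) x - S.φ x t| ≤ C * S.h ^ 2 ∧
        ‖fderiv ℝ ((S.mesh.cell T).interp 1 (fun y => S.φ y t)) x - LevelSetOn.dx S.φ (x, t)‖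
          ≤ C * S.h ∧
        |(S.mesh.cell T).interp 1 (fun y => S.φ y t - S.φh y t) x| ≤ C * S.err₀ qs qt ∧
        ‖fderiv ℝ ((S.mesh.cell T).interp 1 (fun y => S.φ y t - S.φh y t)) x‖
          ≤ C * S.err₁ qs qt := by
  obtain ⟨C₁, hC₁, H₁⟩ := Cell.Regular.exists_interp_error d (k := 1) le_rfl (2 * K)
  obtain ⟨C₂, hC₂, H₂⟩ := Cell.Regular.exists_interp_bound d 1 (2 * K)
  obtain ⟨C₃, hC₃, H₃⟩ := Cell.Regular.exists_interp_slope_bound d (k := 1) le_rfl (2 * K)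
  refine ⟨1 + |K| * (C₁ + C₂ + C₃), by
    have := abs_nonneg K
    nlinarith, fun S qs qt m ρ b T A t ht x hx => ?_⟩
  have hK := A.K_pos
  have hh := A.h_pos
  have hT := A.regular
  have e0 := A.err₀_nonneg
  have e1 := A.err₁_nonneg
  rw [abs_of_pos hK]
  have hxb := A.nbhd_subset hx
  obtain ⟨a1, a2⟩ := H₁ ℝ _ _ hT _ _ K (convex_ball _ _) A.elem_subset
    ((A.φ_smooth ht).mono_order (show 1 + 1 ≤ m + 2 by omega)) x hx
    (Metric.isOpen_ball.mem_nhds hxb)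
  have a2 := a2 _ (A.level.hasFDerivAt hxb ht)
  obtain ⟨b1, -⟩ := H₂ ℝ _ _ hT (fun y => S.φ y t - S.φh y t) (K * S.err₀ qs qt)
    (fun α hα => by
      rw [Real.norm_eq_abs]
      exact A.error t ht _ (A.node_mem le_rfl hα)) x hx
  have b2 := H₃ ℝ _ _ hT (fun y => S.φ y t - S.φh y t) (K * S.err₁ qs qt * S.h)
    (fun α hα β hβ => by
      rw [Real.norm_eq_abs]
      refine (A.error_sub t ht _ (A.node_mem le_rfl hα) _ (A.node_mem le_rfl hβ)).trans ?_
      have := norm_sub_le_h (T := T) (A.node_mem le_rfl hα) (A.node_mem le_rfl hβ)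
      gcongr) x hx
  have b2' : C₃ * (K * S.err₁ qs qt * S.h) / S.h = K * C₃ * S.err₁ qs qt := by
    field_simp
  rw [b2'] at b2
  rw [pow_one] at a2
  have key : ∀ c e : ℝ, 0 ≤ e → c ≤ C₁ + C₂ + C₃ →
      K * c * e ≤ (1 + K * (C₁ + C₂ + C₃)) * e := fun c e he hc => by
    have : K * c ≤ K * (C₁ + C₂ + C₃) := by gcongr
    have : K * c ≤ 1 + K * (C₁ + C₂ + C₃) := by linarith
    gcongr
  refine ⟨?_, ?_, ?_, ?_⟩
  · rw [abs_sub_comm, ← Real.norm_eq_abs]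
    refine a1.trans (le_trans (le_of_eq ?_) (key C₁ (S.h ^ 2) (by positivity) (by linarith)))
    ring
  · rw [norm_sub_rev]
    refine a2.trans (le_trans (le_of_eq ?_) (key C₁ S.h hh.le (by linarith)))
    ring
  · rw [← Real.norm_eq_abs]
    refine b1.trans (le_trans (le_of_eq ?_) (key C₂ _ e0 (by linarith)))
    ring
  · exact b2.trans (key C₃ _ e1 (by linarith))

end Slab

end ActiveElements

/-! ### Comparison of the exact and the discrete search -/

section DiscreteMapping

open Set Filter Topology

set_option maxSynthPendingDepth 3

/-- A solution of smallest absolute value is in particular no larger than `α`, so uniqueness among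
such competitors is enough. Solutions far away, which may well exist, play no role. -/
theorem smallest_eq {P : ℝ → Prop} {α : ℝ} (h : P α) (hu : ∀ β, P β → |β| ≤ |α| → β = α) :
    smallest P = α := by
  have hex : ∃ α, P α ∧ ∀ β, P β → |α| ≤ |β| := by
    refine ⟨α, h, fun β hβ => ?_⟩
    by_contra! hlt
    rw [hu β hβ hlt.le] at hlt
    exact lt_irrefl _ hlt
  rw [smallest, dif_pos hex]
  exact hu _ hex.choose_spec.1 (hex.choose_spec.2 α h)

/-- A function on an interval with almost constant slope takes every value close to the one at the
centre exactly once. -/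
theorem exists_of_almost_linear {F : ℝ → ℝ} {r s e : ℝ} (hr : 0 ≤ r) (he : e ≤ s / 2) (hs : 0 < s)
    (hF : ContinuousOn F (Icc (-r) r))
    (hl : ∀ α ∈ Icc (-r) r, ∀ β ∈ Icc (-r) r, |F α - F β - s * (α - β)| ≤ e * |α - β|) {σ : ℝ}
    (hσ : |σ| ≤ s / 2 * r) : ∃ α ∈ Icc (-r) r, F α = F 0 + σ ∧ s / 2 * |α| ≤ |σ| ∧
      ∀ β ∈ Icc (-r) r, F β = F 0 + σ → β = α := by
  have hl' : ∀ α ∈ Icc (-r) r, ∀ β ∈ Icc (-r) r, s / 2 * |α - β| ≤ |F α - F β| := by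
    intro α hα β hβ
    have h1 := hl α hα β hβ
    have h2 : |s * (α - β)| ≤ |F α - F β| + |F α - F β - s * (α - β)| := by
      have := abs_sub_abs_le_abs_sub (s * (α - β)) (F α - F β)
      rw [abs_sub_comm (s * (α - β))] at this
      linarith
    rw [abs_mul, abs_of_pos hs] at h2
    have h3 : e * |α - β| ≤ s / 2 * |α - β| := mul_le_mul_of_nonneg_right he (abs_nonneg _)
    linarith
  have h0 : (0 : ℝ) ∈ Icc (-r) r := ⟨by linarith, hr⟩
  have hr1 : r ∈ Icc (-r) r := ⟨by linarith, le_rfl⟩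
  have hr2 : -r ∈ Icc (-r) r := ⟨le_rfl, by linarith⟩
  have h1 := (abs_le.1 (hl r hr1 0 h0)).1
  have h2 := (abs_le.1 (hl (-r) hr2 0 h0)).2
  simp only [sub_zero, abs_neg, abs_of_nonneg hr] at h1 h2
  have h3 : e * r ≤ s / 2 * r := mul_le_mul_of_nonneg_right he hr
  obtain ⟨hσ1, hσ2⟩ := abs_le.1 hσ
  obtain ⟨α, hα, hFα⟩ := intermediate_value_Icc (by linarith : -r ≤ r) hF
    (show F 0 + σ ∈ Icc _ _ from ⟨by linarith, by linarith⟩)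
  refine ⟨α, hα, hFα, ?_, fun β hβ hFβ => ?_⟩
  · have := hl' α hα 0 h0
    rw [hFα] at this
    simpa using this
  · have h4 := hl' β hβ α hα
    rw [hFα, hFβ, sub_self, abs_zero] at h4
    have h5 : |β - α| ≤ 0 := by
      by_contra! h6
      have := mul_pos (half_pos hs) h6
      linarith
    exact sub_eq_zero.1 (abs_nonpos_iff.1 h5)

theorem almost_linear_of_hasDerivAt {F F' : ℝ → ℝ} {r s e : ℝ}
    (hF : ∀ α ∈ Icc (-r) r, HasDerivAt F (F' α) α) (hF' : ∀ α ∈ Icc (-r) r, |F' α - s| ≤ e)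
    {α β : ℝ} (hα : α ∈ Icc (-r) r) (hβ : β ∈ Icc (-r) r) :
    |F α - F β - s * (α - β)| ≤ e * |α - β| := by
  have h1 := (convex_Icc (-r) r).norm_image_sub_le_of_norm_hasDerivWithin_le
    (f := fun α => F α - s * α) (f' := fun α => F' α - s) (C := e)
    (fun γ hγ => by
      have := (hF γ hγ).sub ((hasDerivAt_id γ).const_mul s)
      simp only [mul_one] at this
      exact this.hasDerivWithinAt) hF' hβ hα
  rw [Real.norm_eq_abs, Real.norm_eq_abs] at h1
  refine le_trans (le_of_eq ?_) h1
  congr 1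
  ring

section Comparison

variable {E : Type} [NormedAddCommGroup E] [InnerProductSpace ℝ E]

/-- A level set function `φ` and a perturbation `f` of it close to the point `z`, together with their
search directions `g` and `G`. -/
structure SearchPair (φ f : E → ℝ) (z g G : E) (K h ε : ℝ) where
  one_le : 1 ≤ K
  h_pos : 0 < h
  dφ : E → (E →L[ℝ] ℝ)
  df : E → (E →L[ℝ] ℝ)
  hasFDerivAt : ∀ y, ‖y - z‖ ≤ h → HasFDerivAt φ (dφ y) y
  hasFDerivAt' : ∀ y, ‖y - z‖ ≤ h → HasFDerivAt f (df y) y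
  lipschitz : ∀ y, ‖y - z‖ ≤ h → ‖dφ y - dφ z‖ ≤ K * ‖y - z‖
  bound : ∀ y, ‖y - z‖ ≤ h → ‖dφ y‖ ≤ K
  close : ∀ y, ‖y - z‖ ≤ h → ‖dφ y - df y‖ ≤ ε
  dφ_g : dφ z g = ‖g‖ ^ 2
  lower : K⁻¹ ≤ ‖g‖
  upper : ‖g‖ ≤ K
  direction : ‖G - g‖ ≤ ε
  small : 3 * K * ε + 2 * K ^ 2 * h ≤ (2 * K ^ 2)⁻¹

namespace SearchPair

variable {φ f : E → ℝ} {z g G : E} {K h ε : ℝ} (P : SearchPair φ f z g G K h ε)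
include P

theorem sq_lower : 2 * (2 * K ^ 2)⁻¹ ≤ ‖g‖ ^ 2 := by
  have hK : 0 < K := by linarith [P.one_le]
  have h1 : (K⁻¹) ^ 2 ≤ ‖g‖ ^ 2 := pow_le_pow_left₀ (by positivity) P.lower 2
  refine le_trans (le_of_eq ?_) h1
  field_simp

theorem ε_nonneg : 0 ≤ ε := (norm_nonneg _).trans P.direction

theorem ε_le : ε ≤ K := by
  have hK := P.one_le
  have h1 := P.small
  have h2 : (2 * K ^ 2)⁻¹ ≤ 1 := inv_le_one_of_one_le₀ (by nlinarith)
  have := P.ε_nonneg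
  have := P.h_pos
  have : 0 ≤ 2 * K ^ 2 * h := by positivity
  nlinarith

theorem norm_G_le : ‖G‖ ≤ 2 * K := by
  have h1 := norm_add_le (G - g) g
  rw [sub_add_cancel] at h1
  linarith [P.direction, P.upper, P.ε_le]

theorem mem_of_le {α r : ℝ} (hr : 2 * K * r ≤ h) (hα : α ∈ Icc (-r) r) :
    ‖(z + α • G) - z‖ ≤ h ∧ ‖(z + α • g) - z‖ ≤ h := by
  have hK := P.one_le
  have h1 : |α| ≤ r := abs_le.2 hα
  have h2 := (abs_nonneg α).trans h1
  rw [add_sub_cancel_left, add_sub_cancel_left, norm_smul, norm_smul, Real.norm_eq_abs]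
  constructor
  · calc |α| * ‖G‖ ≤ r * (2 * K) := by
          have := P.norm_G_le
          gcongr
      _ ≤ h := by linarith
  · calc |α| * ‖g‖ ≤ r * K := by
          have := P.upper
          gcongr
      _ ≤ h := by nlinarith

theorem hasDerivAt_discrete {α r : ℝ} (hr : 2 * K * r ≤ h) (hα : α ∈ Icc (-r) r) :
    HasDerivAt (fun β => f (z + β • G)) (P.df (z + α • G) G) α := by
  have h2 : HasDerivAt (fun β : ℝ => z + β • G) G α := by
    simpa using ((hasDerivAt_id α).smul_const G).const_add z
  exact (P.hasFDerivAt' _ (P.mem_of_le hr hα).1).comp_hasDerivAt α h2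

theorem hasDerivAt_exact {α r : ℝ} (hr : 2 * K * r ≤ h) (hα : α ∈ Icc (-r) r) :
    HasDerivAt (fun β => φ (z + β • g)) (P.dφ (z + α • g) g) α := by
  have h2 : HasDerivAt (fun β : ℝ => z + β • g) g α := by
    simpa using ((hasDerivAt_id α).smul_const g).const_add z
  exact (P.hasFDerivAt _ (P.mem_of_le hr hα).2).comp_hasDerivAt α h2

/-- Three perturbations of `dφ z g = |g|^2` are added up: `f` for `φ`, the displaced point for `z`,
and `G` for `g`. -/
theorem discrete_slope {α r : ℝ} (hr : 2 * K * r ≤ h) (hα : α ∈ Icc (-r) r) :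
    |P.df (z + α • G) G - ‖g‖ ^ 2| ≤ 3 * K * ε + 2 * K ^ 2 * h := by
  have hK := P.one_le
  have hε := P.ε_nonneg
  have hm := (P.mem_of_le hr hα).1
  have e1 : P.df (z + α • G) G - ‖g‖ ^ 2 =
      (P.df (z + α • G) - P.dφ (z + α • G)) G + (P.dφ (z + α • G) - P.dφ z) G +
        P.dφ z (G - g) := by
    rw [← P.dφ_g]
    simp only [sub_apply, map_sub]
    ring
  have b1 : ‖(P.df (z + α • G) - P.dφ (z + α • G)) G‖ ≤ ε * (2 * K) := by
    refine (ContinuousLinearMap.le_opNorm _ _).trans ?_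
    rw [norm_sub_rev]
    have := P.close _ hm
    have := P.norm_G_le
    gcongr
  have b2 : ‖(P.dφ (z + α • G) - P.dφ z) G‖ ≤ (K * h) * (2 * K) := by
    refine (ContinuousLinearMap.le_opNorm _ _).trans ?_
    have h1 := P.lipschitz _ hm
    have h2 : K * ‖z + α • G - z‖ ≤ K * h := by gcongr
    have := P.norm_G_le
    have := P.h_pos
    gcongr
    exact h1.trans h2
  have b3 : ‖P.dφ z (G - g)‖ ≤ K * ε := by
    refine (ContinuousLinearMap.le_opNorm _ _).trans ?_
    have := P.bound z (by simpa using P.h_pos.le)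
    have := P.direction
    gcongr
  rw [e1, ← Real.norm_eq_abs]
  refine (norm_add₃_le).trans ?_
  nlinarith

/-- The discrete displacement exists, and is small and locally unique. -/
theorem exists_discrete {r : ℝ} (hr0 : 0 ≤ r) (hr : 2 * K * r ≤ h) {σ : ℝ}
    (hσ : |σ| ≤ (2 * K ^ 2)⁻¹ * r) :
    ∃ α ∈ Icc (-r) r, f (z + α • G) = f z + σ ∧ smallest (fun α => f (z + α • G) = f z + σ) = α := by
  have hK : 0 < K := by linarith [P.one_le]
  have hs := P.sq_lower
  have hs0 : 0 < (2 * K ^ 2)⁻¹ := by positivity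
  obtain ⟨α, hα, h1, -, h3⟩ := exists_of_almost_linear (F := fun α => f (z + α • G)) (s := ‖g‖ ^ 2)
    (e := 3 * K * ε + 2 * K ^ 2 * h) hr0 (by linarith [P.small]) (by linarith)
    (fun α hα => (P.hasDerivAt_discrete hr hα).continuousAt.continuousWithinAt)
    (fun α hα β hβ => almost_linear_of_hasDerivAt (fun α hα => P.hasDerivAt_discrete hr hα)
      (fun α hα => P.discrete_slope hr hα) hα hβ) (σ := σ)
    (hσ.trans (by gcongr; linarith))
  simp only [zero_smul, add_zero] at h1 h3
  exact ⟨α, hα, h1, smallest_eq h1 fun β hβ hβα =>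
    h3 β (abs_le.1 (hβα.trans (abs_le.2 hα))) hβ⟩

/-- Comparison of the exact and the discrete displacements. -/
theorem norm_displacement_sub_le {r : ℝ} (hr : 2 * K * r ≤ h) (hr' : K ^ 3 * r ≤ (2 * K ^ 2)⁻¹)
    {α β σ σ' : ℝ} (hα : α ∈ Icc (-r) r) (hβ : β ∈ Icc (-r) r) (hαe : f (z + α • G) = f z + σ')
    (hβe : φ (z + β • g) = φ z + σ) :
    ‖α • G - β • g - ((σ' - σ) / ‖g‖ ^ 2) • g‖ ≤ 15 * K ^ 7 * r * (ε + |σ' - σ|) := by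
  have hK := P.one_le
  have hK0 : 0 < K := by linarith
  have hε := P.ε_nonneg
  have hα' : |α| ≤ r := abs_le.2 hα
  have hr0 : 0 ≤ r := (abs_nonneg _).trans hα'
  have hs := P.sq_lower
  have hg0 : 0 < ‖g‖ := (inv_pos.2 hK0).trans_le P.lower
  have hball : Convex ℝ {y : E | ‖y - z‖ ≤ h} := by
    have : {y : E | ‖y - z‖ ≤ h} = Metric.closedBall z h := by
      ext y; simp [dist_eq_norm]
    rw [this]
    exact convex_closedBall _ _
  have hz : z ∈ {y : E | ‖y - z‖ ≤ h} := by simpa using P.h_pos.le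
  obtain ⟨hm1, hm2⟩ := P.mem_of_le hr hα
  -- the perturbation along the discrete direction
  have d1 : |(φ (z + α • G) - f (z + α • G)) - (φ z - f z)| ≤ ε * (r * (2 * K)) := by
    have h1 := hball.norm_image_sub_le_of_norm_hasFDerivWithin_le (f := fun y => φ y - f y)
      (fun y hy => ((P.hasFDerivAt y hy).sub (P.hasFDerivAt' y hy)).hasFDerivWithinAt)
      (fun y hy => P.close y hy) hz hm1
    refine h1.trans ?_
    rw [add_sub_cancel_left, norm_smul, Real.norm_eq_abs]
    have := P.norm_G_le
    gcongr
  -- the change of direction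
  have d2 : |φ (z + α • G) - φ (z + α • g)| ≤ K * (r * ε) := by
    have h1 := hball.norm_image_sub_le_of_norm_hasFDerivWithin_le
      (fun y hy => (P.hasFDerivAt y hy).hasFDerivWithinAt)
      (fun y hy => P.bound y hy) hm2 hm1
    refine h1.trans ?_
    have : z + α • G - (z + α • g) = α • (G - g) := by rw [smul_sub]; abel
    rw [this, norm_smul, Real.norm_eq_abs]
    have := P.direction
    gcongr
  have d3 : |φ (z + α • g) - φ (z + β • g) - ‖g‖ ^ 2 * (α - β)| ≤ K ^ 3 * r * |α - β| := by
    refine almost_linear_of_hasDerivAt (F := fun α => φ (z + α • g))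
      (fun γ hγ => P.hasDerivAt_exact hr hγ) (fun γ hγ => ?_) hα hβ
    have hmγ := (P.mem_of_le hr hγ).2
    rw [← P.dφ_g, ← sub_apply, ← Real.norm_eq_abs]
    refine (ContinuousLinearMap.le_opNorm _ _).trans ?_
    have h1 := P.lipschitz _ hmγ
    rw [add_sub_cancel_left, norm_smul, Real.norm_eq_abs] at h1
    have h2 : |γ| ≤ r := abs_le.2 hγ
    have h3 := P.upper
    calc _ ≤ (K * (|γ| * ‖g‖)) * ‖g‖ := by gcongr
      _ ≤ (K * (r * K)) * K := by gcongr
      _ = _ := by ring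
  -- The deviation of `α - β` from its first order prediction. All three contributions to it carry
  -- the factor `r`, which is the gain over a plain Lipschitz estimate.
  set e := ‖g‖ ^ 2 * (α - β) - (σ' - σ) with he
  have he1 : |e| ≤ 3 * K * r * ε + K ^ 3 * r * |α - β| := by
    have e1 : e = -((φ (z + α • g) - φ (z + β • g) - ‖g‖ ^ 2 * (α - β))) -
        (φ (z + α • G) - φ (z + α • g)) + ((φ (z + α • G) - f (z + α • G)) - (φ z - f z)) := by
      rw [he, hαe, hβe]
      ring
    rw [e1]
    refine (abs_add_le _ _).trans ?_
    have h1 := abs_sub (-((φ (z + α • g) - φ (z + β • g) - ‖g‖ ^ 2 * (α - β))))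
      (φ (z + α • G) - φ (z + α • g))
    rw [abs_neg] at h1
    linarith
  have hab : |α - β| ≤ 2 * K ^ 2 * (|σ' - σ| + 3 * K * r * ε) := by
    have h1 : ‖g‖ ^ 2 * |α - β| ≤ |σ' - σ| + |e| := by
      have : ‖g‖ ^ 2 * (α - β) = (σ' - σ) + e := by rw [he]; ring
      rw [← abs_of_nonneg (sq_nonneg ‖g‖), ← abs_mul, this]
      exact abs_add_le _ _
    -- By the smallness of `r` the quadratic term uses up at most half of the slope and is absorbed
    -- on the left.
    have h2 : K ^ 3 * r * |α - β| ≤ (2 * K ^ 2)⁻¹ * |α - β| := by gcongr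
    have h3 : 2 * (2 * K ^ 2)⁻¹ * |α - β| ≤ ‖g‖ ^ 2 * |α - β| := by gcongr
    have h4 : (2 * K ^ 2)⁻¹ * |α - β| ≤ |σ' - σ| + 3 * K * r * ε := by linarith
    calc |α - β| = 2 * K ^ 2 * ((2 * K ^ 2)⁻¹ * |α - β|) := by field_simp
      _ ≤ _ := by gcongr
  have hKr : K * r ≤ 1 := by
    have h1 : K ^ 3 * r ≤ 1 := hr'.trans (inv_le_one_of_one_le₀ (by nlinarith))
    have h2 : K * r ≤ K ^ 3 * r := by
      have : K ≤ K ^ 3 := le_self_pow₀ hK (by norm_num)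
      gcongr
    linarith
  have he2 : |e| ≤ r * (9 * K ^ 5 * ε + 2 * K ^ 5 * |σ' - σ|) := by
    have h1 : 3 * K * r * ε ≤ 3 * ε := by nlinarith
    have h2 : |α - β| ≤ 2 * K ^ 2 * (|σ' - σ| + 3 * ε) := hab.trans (by gcongr)
    have h3 : K ^ 3 * r * |α - β| ≤ K ^ 3 * r * (2 * K ^ 2 * (|σ' - σ| + 3 * ε)) := by gcongr
    have h4 : K ≤ K ^ 5 := le_self_pow₀ hK (by norm_num)
    have h5 : 3 * K * r * ε ≤ 3 * K ^ 5 * r * ε := by gcongr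
    calc |e| ≤ 3 * K ^ 5 * r * ε + K ^ 3 * r * (2 * K ^ 2 * (|σ' - σ| + 3 * ε)) := by linarith
      _ = _ := by ring
  have hfin : α • G - β • g - ((σ' - σ) / ‖g‖ ^ 2) • g =
      (e / ‖g‖ ^ 2) • g + α • (G - g) := by
    have : e / ‖g‖ ^ 2 = (α - β) - (σ' - σ) / ‖g‖ ^ 2 := by
      rw [he]; field_simp
    rw [this, sub_smul, sub_smul, smul_sub]
    abel
  rw [hfin]
  refine (norm_add_le _ _).trans ?_
  rw [norm_smul, norm_smul, Real.norm_eq_abs, Real.norm_eq_abs, abs_div, abs_of_nonneg (sq_nonneg ‖g‖)]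
  have f1 : |e| / ‖g‖ ^ 2 * ‖g‖ ≤ |e| * K := by
    have : |e| / ‖g‖ ^ 2 * ‖g‖ = |e| * ‖g‖⁻¹ := by field_simp
    rw [this]
    gcongr
    exact inv_le_of_inv_le₀ hK0 P.lower
  have f2 : |α| * ‖G - g‖ ≤ r * ε := by
    have := P.direction
    gcongr
  have f3 : |e| * K ≤ r * (9 * K ^ 5 * ε + 2 * K ^ 5 * |σ' - σ|) * K := by gcongr
  have f4 : K ^ 6 ≤ K ^ 7 := pow_le_pow_right₀ hK (by norm_num)
  have f5 : (1 : ℝ) ≤ K ^ 7 := one_le_pow₀ hK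
  have g1 : r * ε ≤ K ^ 7 * (r * ε) := by nlinarith [mul_nonneg hr0 hε]
  have g2 : K ^ 6 * (r * ε) ≤ K ^ 7 * (r * ε) := by
    have := mul_nonneg hr0 hε
    gcongr
  have g3 : K ^ 6 * (r * |σ' - σ|) ≤ K ^ 7 * (r * |σ' - σ|) := by gcongr
  have g4 : 0 ≤ K ^ 7 * (r * |σ' - σ|) := by positivity
  have g5 : 0 ≤ K ^ 7 * (r * ε) := by positivity
  nlinarith

end SearchPair

end Comparison

end DiscreteMapping

/-! ### The error of the discrete mapping at a point -/

section LocalError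

open Set Filter Topology

set_option maxSynthPendingDepth 3

/-- `D` is the displacement along the gradient of `φ` which changes the value of `φ` by a given
amount. -/
structure DisplacementOn {d : ℕ} (φ : Pt d → ℝ → ℝ) (x₀ : Pt d) (ρ : ℝ) (I : Set ℝ) (m : ℕ)
    (a c C : ℝ) (D : (Pt d × ℝ) × ℝ → ℝ) : Prop where
  smooth : BddDerivOn ((Metric.ball x₀ (ρ / 2) ×ˢ I) ×ˢ Ioo (-c) c) (m + 1) C D
  mem : ∀ x ∈ Metric.ball x₀ (ρ / 2), ∀ t ∈ I, ∀ σ ∈ Ioo (-c) c, D ((x, t), σ) ∈ Ioo (-a) a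
  abs_le : ∀ x ∈ Metric.ball x₀ (ρ / 2), ∀ t ∈ I, ∀ σ ∈ Ioo (-c) c, |D ((x, t), σ)| ≤ C * |σ|
  eq : ∀ x ∈ Metric.ball x₀ (ρ / 2), ∀ t ∈ I, ∀ σ ∈ Ioo (-c) c,
    φ (x + D ((x, t), σ) • LevelSetOn.grad φ (x, t)) t = φ x t + σ
  unique : ∀ x ∈ Metric.ball x₀ (ρ / 2), ∀ t ∈ I, ∀ σ ∈ Ioo (-c) c, ∀ β ∈ Ioo (-a) a,
    φ (x + β • LevelSetOn.grad φ (x, t)) t = φ x t + σ → β = D ((x, t), σ)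

theorem LevelSetOn.exists_displacementOn (d m : ℕ) {K ρ : ℝ} (hK : 1 ≤ K) (hρ : 0 < ρ) :
    ∃ a c C : ℝ, 0 < a ∧ a * K ≤ ρ / 2 ∧ a * K ≤ 1 / 2 ∧ 0 < c ∧ 1 ≤ C ∧
      ∀ (φ : Pt d → ℝ → ℝ) (x₀ : Pt d) (I : Set ℝ), LevelSetOn φ x₀ ρ I m K →
        ∃ D, DisplacementOn φ x₀ ρ I m a c C D := by
  obtain ⟨a, c, C, h1, h2, h3, h4, h5, H⟩ := LevelSetOn.exists_displacement_function d m hK hρ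
  refine ⟨a, c, C, h1, h2, h3, h4, h5, fun φ x₀ I h => ?_⟩
  obtain ⟨D, hD, hD'⟩ := H φ x₀ I h
  exact ⟨D, hD, fun x hx t ht σ hσ => (hD' x hx t ht σ hσ).1,
    fun x hx t ht σ hσ => (hD' x hx t ht σ hσ).2.1,
    fun x hx t ht σ hσ => (hD' x hx t ht σ hσ).2.2.1,
    fun x hx t ht σ hσ => (hD' x hx t ht σ hσ).2.2.2⟩

namespace Slab

variable {d : ℕ}

/-- The amount by which the ideal mapping changes the value of the level set function. -/
noncomputable def shift (S : Slab d) (b : Pt d → ℝ → ℝ) (x : Pt d) (t : ℝ) : ℝ :=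
  (1 - b x t) * (S.φlin x t - S.φ x t)

/-- The leading part of the error of the discrete mapping. -/
noncomputable def leadingError (S : Slab d) (b : Pt d → ℝ → ℝ) (x : Pt d) (t : ℝ) : Pt d :=
  ((1 - b x t) * (S.φ x t - S.φh x t) / ‖LevelSetOn.grad S.φ (x, t)‖ ^ 2) •
    LevelSetOn.grad S.φ (x, t)

theorem φlin_sub_eq {S : Slab d} {T : Fin S.mesh.card} {t : ℝ} {x : Pt d} (hx : x ∈ S.mesh.elem T) : S.φlin x t - S.φ x t =
    ((S.mesh.cell T).interp 1 (fun y => S.φ y t) x - S.φ x t) -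
      (S.mesh.cell T).interp 1 (fun y => S.φ y t - S.φh y t) x := by
  rw [φlin, S.mesh.linInterp_eq T _ hx, Cell.interp_sub]
  ring

theorem ActiveElem.abs_one_sub_b_le {S : Slab d} {qs qt m : ℕ} {K ρ : ℝ} {b : Pt d → ℝ → ℝ}
    {T : Fin S.mesh.card} (A : S.ActiveElem qs qt m K ρ b T) {x : Pt d} (hx : x ∈ Metric.ball (S.mesh.cell T 0) ρ) {t : ℝ}
    (ht : t ∈ S.I) : |1 - b x t| ≤ 1 := by
  have := A.b_range x hx t ht
  rw [abs_le]
  constructor <;> linarith [this.1, this.2]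

/-- Linear interpolation of `φ` contributes `h^2`, the interpolated discretization error contributes
`err₀`, and the factor `1 - b` lies in `[0, 1]`. -/
theorem exists_shift_le (d : ℕ) (K : ℝ) : ∃ C : ℝ, 1 ≤ C ∧
    ∀ (S : Slab d) (qs qt m : ℕ) (ρ : ℝ) (b : Pt d → ℝ → ℝ) (T : Fin S.mesh.card),
      S.ActiveElem qs qt m K ρ b T → ∀ t ∈ S.I, ∀ x ∈ S.mesh.elem T,
        |S.φlin x t - S.φ x t| ≤ C * (S.h ^ 2 + S.err₀ qs qt) ∧
        |S.φlin x t - S.φh x t| ≤ C * (S.h ^ 2 + S.err₀ qs qt) ∧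
        |S.shift b x t| ≤ C * (S.h ^ 2 + S.err₀ qs qt) := by
  obtain ⟨C, hC, H⟩ := exists_lin_error d K
  refine ⟨C + |K|, by linarith [abs_nonneg K], fun S qs qt m ρ b T A t ht x hx => ?_⟩
  have hK := A.K_pos
  have hh := A.h_pos
  rw [abs_of_pos hK]
  have e0 := A.err₀_nonneg
  obtain ⟨h1, -, h2, -⟩ := H S qs qt m ρ b T A t ht x (A.elem_subset_nbhd hx)
  have h3 := A.error t ht x hx
  have h4 : |S.φlin x t - S.φ x t| ≤ C * (S.h ^ 2 + S.err₀ qs qt) := by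
    rw [φlin_sub_eq hx]
    refine (abs_sub _ _).trans ?_
    linarith
  have h5 : 0 ≤ K * (S.h ^ 2 + S.err₀ qs qt) := by positivity
  have h6 : K * S.err₀ qs qt ≤ K * (S.h ^ 2 + S.err₀ qs qt) := by
    gcongr
    linarith [sq_nonneg S.h]
  refine ⟨by linarith, ?_, ?_⟩
  · have : S.φlin x t - S.φh x t = (S.φlin x t - S.φ x t) + (S.φ x t - S.φh x t) := by ring
    rw [this]
    refine (abs_add_le _ _).trans ?_
    linarith
  · rw [shift, abs_mul]
    have h7 := A.abs_one_sub_b_le (A.elem_subset hx) ht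
    calc _ ≤ 1 * |S.φlin x t - S.φ x t| := by gcongr
      _ ≤ _ := by linarith

/-- This is where `Δt^(qt+1) ≤ η h` enters: the displacements become small compared with `h`, so the
displaced points stay where the polynomial extension from the element is accurate. -/
theorem ActiveElem.sq_add_err₀_le {S : Slab d} {qs qt m : ℕ} {K ρ : ℝ} {b : Pt d → ℝ → ℝ}
    {T : Fin S.mesh.card} (A : S.ActiveElem qs qt m K ρ b T) {η : ℝ} (h1 : S.h ≤ η)
    (h2 : S.dt ^ (qt + 1) ≤ η * S.h) : S.h ^ 2 + S.err₀ qs qt ≤ 3 * η * S.h := by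
  have hh := A.h_pos
  have h3 : S.h ^ (qs + 1) ≤ S.h ^ 2 :=
    pow_le_pow_of_le_one hh.le A.h_le (by linarith [A.qs_pos])
  have h4 : S.h ^ 2 ≤ η * S.h := by rw [sq]; gcongr
  unfold err₀
  linarith

/-- The ideal mapping on an active element in terms of the displacement function. -/
theorem exists_distΓ_eq (d : ℕ) {K ρ a c C : ℝ} (hc : 0 < c)
    (haK : a * K ≤ ρ / 2) : ∃ η : ℝ, 0 < η ∧
    ∀ (S : Slab d) (qs qt m : ℕ) (b : Pt d → ℝ → ℝ) (T : Fin S.mesh.card),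
      S.ActiveElem qs qt m K ρ b T → S.h ≤ η → S.dt ^ (qt + 1) ≤ η * S.h →
      ∀ D, DisplacementOn S.φ (S.mesh.cell T 0) ρ S.I m a c C D →
      ∀ t ∈ S.I, ∀ x ∈ S.mesh.elem T, S.shift b x t ∈ Ioo (-c) c ∧
        S.distΓ b x t = D ((x, t), S.shift b x t) := by
  obtain ⟨C₁, hC₁, H⟩ := exists_shift_le d K
  refine ⟨c / (6 * C₁), by positivity, fun S qs qt m b T A h1 h2 D hD t ht x hx => ?_⟩
  have hh := A.h_pos
  have h3 := (H S qs qt m ρ b T A t ht x hx).2.2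
  have h4 := A.sq_add_err₀_le h1 h2
  have h5 : |S.shift b x t| < c := by
    calc |S.shift b x t| ≤ C₁ * (S.h ^ 2 + S.err₀ qs qt) := h3
      _ ≤ C₁ * (3 * (c / (6 * C₁)) * S.h) := by gcongr
      _ = c / 2 * S.h := by field_simp; norm_num
      _ ≤ c / 2 * 1 := by
          have := A.h_le
          gcongr
      _ < c := by linarith
  have hσ : S.shift b x t ∈ Ioo (-c) c := abs_lt.1 h5
  have hx2 := A.nbhd_subset_half (A.elem_subset_nbhd hx)
  have hmem := hD.mem x hx2 t ht _ hσ
  refine ⟨hσ, ?_⟩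
  have hval : ∀ α : ℝ, S.φ (x + α • LevelSetOn.grad S.φ (x, t)) t =
      (1 - b x t) * S.φlin x t + b x t * S.φ x t ↔
      S.φ (x + α • LevelSetOn.grad S.φ (x, t)) t = S.φ x t + S.shift b x t := fun α => by
    rw [shift]
    constructor <;> intro h <;> linarith
  unfold distΓ
  apply smallest_eq (α := D ((x, t), S.shift b x t))
  rotate_left
  -- A competitor is no larger than the displacement, hence also below `a`, where the level set
  -- equation has only one solution.
  · intro β hβ hβα
    refine hD.unique x hx2 t ht _ hσ β ?_ ((hval β).1 hβ.2)
    exact abs_lt.1 (hβα.trans_lt (abs_lt.2 hmem))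
  refine ⟨?_, ?_⟩
  · exact A.ball_subset (A.level.displaced_mem haK hx2 ht hmem)
  · exact (hval _).2 (hD.eq x hx2 t ht _ hσ)

/-- The gradient error of the polynomial extension and the error of the search direction are both of
order `err₁`, so a single `ε = C err₁` covers them. Since `err₁ ≤ 2 h`, the required smallness holds
for small `h`. -/
theorem exists_searchPair (d qs : ℕ) {K : ℝ} (hK : 1 ≤ K) (C₀ : ℝ) : ∃ C η : ℝ, 1 ≤ C ∧ 0 < η ∧
    ∀ (S : Slab d) (qt m : ℕ) (ρ : ℝ) (b : Pt d → ℝ → ℝ) (T : Fin S.mesh.card),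
      S.ActiveElem qs qt m K ρ b T → S.h ≤ η → ∀ t ∈ S.I, ∀ z ∈ S.mesh.elem T, ∀ G : Pt d,
        ‖G - LevelSetOn.grad S.φ (z, t)‖ ≤ C₀ * S.err₁ qs qt →
        Nonempty (SearchPair (fun y => S.φ y t) (S.φhExt qs T t) z (LevelSetOn.grad S.φ (z, t)) G K
          S.h (C * S.err₁ qs qt)) := by
  obtain ⟨C₁, hC₁, H⟩ := exists_ext_error d qs K
  have hK0 : 0 < K := by linarith
  set C := max C₀ C₁ with hC
  have hC1 : 1 ≤ C := hC₁.trans (le_max_right _ _)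
  refine ⟨C, (2 * K ^ 2)⁻¹ / (6 * K * C + 2 * K ^ 2), hC1, by positivity,
    fun S qt m ρ b T A hη t ht z hz G hG => ⟨?_⟩⟩
  have hh := A.h_pos
  have e1 := A.err₁_nonneg
  have hin : ∀ y, ‖y - z‖ ≤ S.h → y ∈ (S.mesh.cell T).nbhd S.h := fun y hy => ⟨z, hz, hy⟩
  have hin' : ∀ y, ‖y - z‖ ≤ S.h → y ∈ Metric.ball (S.mesh.cell T 0) ρ := fun y hy =>
    A.nbhd_subset (hin y hy)
  exact {
    one_le := hK
    h_pos := hh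
    dφ := fun y => LevelSetOn.dx S.φ (y, t)
    df := fun y => fderiv ℝ (S.φhExt qs T t) y
    hasFDerivAt := fun y hy => A.level.hasFDerivAt (hin' y hy) ht
    hasFDerivAt' := fun y _ => (differentiableAt_φhExt T t y).hasFDerivAt
    lipschitz := fun y hy => A.level.lipschitz A.level.bdd_dx (A.elem_subset hz) (hin' y hy) ht
    bound := fun y hy => A.level.bdd_dx.bound (mk_mem_prod (hin' y hy) ht)
    close := fun y hy => (H S qt m ρ b T A t ht y (hin y hy)).2.trans (by
      gcongr
      exact le_max_right _ _)
    dφ_g := LevelSetOn.dx_apply_grad _ _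
    lower := A.level.lower z (A.elem_subset hz) t ht
    upper := A.level.norm_grad_le (A.elem_subset hz) ht
    direction := hG.trans (by
      gcongr
      exact le_max_left _ _)
    small := by
      have h1 := A.err₁_le_two_mul
      rw [le_div_iff₀ (by positivity)] at hη
      have h2 : 3 * K * (C * S.err₁ qs qt) ≤ 3 * K * (C * (2 * S.h)) := by gcongr
      linarith }

/-- The error of the discrete mapping at a point. -/
theorem exists_discrete_error (d qs m : ℕ) {K ρ : ℝ} (hK : 1 ≤ K) (hρ : 0 < ρ) (C₀ : ℝ) :
    ∃ C η : ℝ, 1 ≤ C ∧ 0 < η ∧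
    ∀ (S : Slab d) (qt : ℕ) (b : Pt d → ℝ → ℝ) (T : Fin S.mesh.card),
      S.ActiveElem qs qt m K ρ b T → S.h ≤ η → S.dt ^ (qt + 1) ≤ η * S.h →
      ∀ t ∈ S.I, ∀ z ∈ S.mesh.elem T, ∀ G : Pt d,
        ‖G - LevelSetOn.grad S.φ (z, t)‖ ≤ C₀ * S.err₁ qs qt →
        ‖(z + smallest (fun α => S.φhExt qs T t (z + α • G) =
            (1 - b z t) * S.φlin z t + b z t * S.φh z t) • G) - S.ΨΓ b z t - S.leadingError b z t‖
          ≤ C * (S.h * S.err₁ qs qt) := by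
  obtain ⟨a, c, C₁, ha, haK, haK', hc, hC₁, HD⟩ := LevelSetOn.exists_displacementOn d m hK hρ
  obtain ⟨η₁, hη₁, H₁⟩ := exists_distΓ_eq d (C := C₁) hc haK
  obtain ⟨C₂, hC₂, H₂⟩ := exists_shift_le d K
  obtain ⟨C₃, η₃, hC₃, hη₃, H₃⟩ := exists_searchPair d qs hK C₀
  have hK0 : 0 < K := by linarith
  -- With `q = h^2 + err₀`, the radius `r = B q` accommodates both displacements: solving the
  -- discrete equation needs `r ≥ 2 K^2 C₂ q`, and the exact displacement is at most `C₁ C₂ q`.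
  set B : ℝ := (2 * K ^ 2 + C₁) * C₂ with hB
  have hB0 : 0 < B := by positivity
  set η₄ : ℝ := (2 * K ^ 2)⁻¹ / (6 * K ^ 3 * B) with hη₄
  have hη₄0 : 0 < η₄ := by positivity
  refine ⟨15 * K ^ 7 * (3 * B) * (C₃ + K), min (min η₁ η₃) (min 1 η₄), ?_, by positivity,
    fun S qt b T A hh1 hdt t ht z hz G hG => ?_⟩
  · have h1 : (1 : ℝ) ≤ K ^ 7 := one_le_pow₀ hK
    have h2 : 1 ≤ B := by nlinarith
    have h3 : 1 ≤ C₃ + K := by linarith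
    calc (1 : ℝ) ≤ 15 * 1 * (3 * 1) * 1 := by norm_num
      _ ≤ _ := by gcongr
  have hh := A.h_pos
  have e0 := A.err₀_nonneg
  have e1 := A.err₁_nonneg
  set η := min (min η₁ η₃) (min 1 η₄) with hη
  have m1 : η ≤ η₁ := (min_le_left _ _).trans (min_le_left _ _)
  have m3 : η ≤ η₃ := (min_le_left _ _).trans (min_le_right _ _)
  have m2 : η ≤ 1 := (min_le_right _ _).trans (min_le_left _ _)
  have m4 : η ≤ η₄ := (min_le_right _ _).trans (min_le_right _ _)
  obtain ⟨D, hD⟩ := HD _ _ _ A.level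
  obtain ⟨hσ, hdist⟩ := H₁ S qs qt m b T A (hh1.trans m1) (hdt.trans (by gcongr)) D hD t ht z hz
  obtain ⟨P⟩ := H₃ S qt m ρ b T A (hh1.trans m3) t ht z hz G hG
  obtain ⟨-, s1, s2⟩ := H₂ S qs qt m ρ b T A t ht z hz
  have hz2 := A.nbhd_subset_half (A.elem_subset_nbhd hz)
  set σ := S.shift b z t with hσdef
  -- The discrete counterpart of the shift, by which `φh` has to change. It differs from `σ` by `(1
  -- - b)(φ - φh)`, so the first order prediction for the difference of the displacements is exactly
  -- `leadingError`.
  set σ' := (1 - b z t) * (S.φlin z t - S.φh z t) with hσ'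
  have hb1 := A.abs_one_sub_b_le (A.elem_subset hz) ht
  have hsq := A.sq_add_err₀_le (η := η) hh1 hdt
  set q := S.h ^ 2 + S.err₀ qs qt with hq
  have hq0 : 0 ≤ q := by positivity
  have hσ'b : |σ'| ≤ C₂ * q := by
    rw [hσ', abs_mul]
    calc _ ≤ 1 * |S.φlin z t - S.φh z t| := by gcongr
      _ ≤ _ := by linarith
  set r := B * q with hr
  have hr0 : 0 ≤ r := by positivity
  have hrb : r ≤ B * (3 * η₄ * S.h) := by
    have : 3 * η * S.h ≤ 3 * η₄ * S.h := by gcongr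
    have := hsq.trans this
    rw [hr]
    gcongr
  have hrb' : B * (3 * η₄ * S.h) = (2 * K ^ 2)⁻¹ / (2 * K ^ 3) * S.h := by
    rw [hη₄]; field_simp; norm_num
  rw [hrb'] at hrb
  have hK3 : (1 : ℝ) ≤ K ^ 3 := one_le_pow₀ hK
  have hK2 : (1 : ℝ) ≤ K ^ 2 := one_le_pow₀ hK
  have hi0 : 0 < (2 * K ^ 2)⁻¹ := by positivity
  have hi1 : (2 * K ^ 2)⁻¹ ≤ 1 := inv_le_one_of_one_le₀ (by linarith)
  have hr1 : K ^ 3 * r ≤ (2 * K ^ 2)⁻¹ / 2 * S.h := by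
    calc K ^ 3 * r ≤ K ^ 3 * ((2 * K ^ 2)⁻¹ / (2 * K ^ 3) * S.h) := by gcongr
      _ = _ := by field_simp
  have hr2 : 2 * K * r ≤ S.h := by
    have h1 : K * r ≤ K ^ 3 * r := by
      have : K ≤ K ^ 3 := le_self_pow₀ hK (by norm_num)
      gcongr
    have h2 : (2 * K ^ 2)⁻¹ / 2 * S.h ≤ 1 / 2 * S.h := by gcongr
    linarith
  have hr3 : K ^ 3 * r ≤ (2 * K ^ 2)⁻¹ := by
    have h2 : (2 * K ^ 2)⁻¹ / 2 * S.h ≤ (2 * K ^ 2)⁻¹ / 2 * 1 := by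
      have := A.h_le
      gcongr
    linarith
  have hσ'r : |σ'| ≤ (2 * K ^ 2)⁻¹ * r := by
    calc |σ'| ≤ C₂ * q := hσ'b
      _ = (2 * K ^ 2)⁻¹ * ((2 * K ^ 2 + 0) * C₂ * q) := by field_simp; ring
      _ ≤ (2 * K ^ 2)⁻¹ * ((2 * K ^ 2 + C₁) * C₂ * q) := by gcongr; linarith
  obtain ⟨α, hα, hαe, hαs⟩ := P.exists_discrete hr0 hr2 hσ'r
  set β := D ((z, t), σ) with hβ
  have hβr : β ∈ Icc (-r) r := by
    refine abs_le.1 ?_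
    calc |β| ≤ C₁ * |σ| := hD.abs_le z hz2 t ht σ hσ
      _ ≤ C₁ * (C₂ * q) := by gcongr
      _ = (0 + C₁) * C₂ * q := by ring
      _ ≤ (2 * K ^ 2 + C₁) * C₂ * q := by gcongr; positivity
  have hmain := P.norm_displacement_sub_le hr2 hr3 hα hβr hαe (hD.eq z hz2 t ht σ hσ)
  have hfz : S.φhExt qs T t z = S.φh z t := A.φh_ext t ht z hz
  have hsm : smallest (fun α => S.φhExt qs T t (z + α • G) =
      (1 - b z t) * S.φlin z t + b z t * S.φh z t) = α := by
    rw [← hαs]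
    congr 1
    funext α
    rw [hfz, hσ']
    have : (1 - b z t) * S.φlin z t + b z t * S.φh z t =
      S.φh z t + (1 - b z t) * (S.φlin z t - S.φh z t) := by ring
    rw [this]
  have hσσ : σ' - σ = (1 - b z t) * (S.φ z t - S.φh z t) := by
    rw [hσ', hσdef, shift]; ring
  have heq : (z + α • G) - S.ΨΓ b z t - S.leadingError b z t =
      α • G - β • LevelSetOn.grad S.φ (z, t) -
        ((σ' - σ) / ‖LevelSetOn.grad S.φ (z, t)‖ ^ 2) • LevelSetOn.grad S.φ (z, t) := by
    rw [hσσ, leadingError, ΨΓ, hdist]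
    change z + α • G - (z + β • LevelSetOn.grad S.φ (z, t)) - _ = _
    abel
  rw [hsm, heq]
  refine hmain.trans ?_
  have f1 : |σ' - σ| ≤ K * S.err₁ qs qt := by
    rw [hσσ, abs_mul]
    have h1 := A.error t ht z hz
    have h2 := A.err₀_le_err₁
    calc _ ≤ 1 * (K * S.err₀ qs qt) := by gcongr
      _ ≤ K * S.err₁ qs qt := by rw [one_mul]; gcongr
  have f2 : r ≤ 3 * B * S.h := by
    have : 3 * η * S.h ≤ 3 * 1 * S.h := by gcongr
    have : B * q ≤ B * (3 * 1 * S.h) := by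
      have := hsq.trans this
      gcongr
    linarith
  calc 15 * K ^ 7 * r * (C₃ * S.err₁ qs qt + |σ' - σ|)
      ≤ 15 * K ^ 7 * (3 * B * S.h) * (C₃ * S.err₁ qs qt + K * S.err₁ qs qt) := by gcongr
    _ = _ := by ring

theorem LevelSetOn_grad_sq {φ : Pt d → ℝ → ℝ} {x₀ : Pt d} {ρ : ℝ} {I : Set ℝ} {m : ℕ} {K : ℝ}
    (h : LevelSetOn φ x₀ ρ I m K) : BddDerivOn (Metric.ball x₀ ρ ×ˢ I) (m + 1)
      (2 ^ (m + 1) * (1 * K * K)) (fun p => ‖LevelSetOn.grad φ p‖ ^ 2) := by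
  have h1 := h.bdd_dx.bilin (ContinuousLinearMap.id ℝ (Pt d →L[ℝ] ℝ))
    ContinuousLinearMap.norm_id_le h.bdd_grad
  exact h1.congr fun p _ => (LevelSetOn.dx_apply_grad φ p).symm

/-- The leading error is `φ - φh` times a smooth field. It inherits the size `err₀` and the slope
`err₁`, so its values at two points of one element differ by only `O(h err₁)`, as needed for the
gradient. -/
theorem exists_leadingError_bound (d m : ℕ) {K : ℝ} (hK : 1 ≤ K) : ∃ C : ℝ, 1 ≤ C ∧
    ∀ (S : Slab d) (qs qt : ℕ) (ρ : ℝ) (b : Pt d → ℝ → ℝ) (T : Fin S.mesh.card),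
      S.ActiveElem qs qt m K ρ b T → ∀ t ∈ S.I, ∀ x ∈ S.mesh.elem T,
        ‖S.leadingError b x t‖ ≤ C * S.err₀ qs qt ∧ ∀ y ∈ S.mesh.elem T,
          ‖S.leadingError b x t - S.leadingError b y t‖ ≤ C * (S.h * S.err₁ qs qt) := by
  have hK0 : 0 < K := by linarith
  set c₀ : ℝ := (K⁻¹) ^ 2 with hc₀
  have hc₀0 : 0 < c₀ := by positivity
  set C₁ := 2 ^ (m + 1) * (((1 + K) * BddDerivOn.invConst c₀ (2 ^ (m + 1) * (1 * K * K)) (m + 1))) with hC₁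
  set C₂ := 2 ^ (m + 1) * (C₁ * K) with hC₂
  refine ⟨1 + 2 * |C₂| * K, by
    have := abs_nonneg C₂
    nlinarith [mul_nonneg this hK0.le], fun S qs qt ρ b T A t ht x hx => ?_⟩
  have hh := A.h_pos
  have e0 := A.err₀_nonneg
  have e1 := A.err₁_nonneg
  have hinv := (LevelSetOn_grad_sq A.level).inv hc₀0 fun p hp => by
    have := A.level.lower p.1 hp.1 p.2 hp.2
    exact pow_le_pow_left₀ (by positivity) this 2
  have hb := (BddDerivOn.const (s := Metric.ball (S.mesh.cell T 0) ρ ×ˢ S.I) (n := m + 1)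
    (C := 1) (1 : ℝ) (by simp)).sub A.b_smooth.of_succ
  have h1 := hb.mul hinv
  have h2 := h1.smul A.level.bdd_grad
  obtain ⟨w, hw⟩ : ∃ w : Pt d × ℝ → Pt d, w = fun p => ((1 - Function.uncurry b p) *
    (‖LevelSetOn.grad S.φ p‖ ^ 2)⁻¹) • LevelSetOn.grad S.φ p := ⟨_, rfl⟩
  rw [← hw] at h2
  have h3 : BddDerivOn (Metric.ball (S.mesh.cell T 0) ρ ×ˢ S.I) (m + 1) |C₂| w :=
    h2.mono_const (le_trans (le_of_eq (by rw [hC₂, hC₁])) (le_abs_self _))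
  have hle : ∀ y, S.leadingError b y t = (S.φ y t - S.φh y t) • w (y, t) := fun y => by
    simp only [leadingError, hw, smul_smul, Function.uncurry]
    congr 1
    ring
  have hbd : ∀ y ∈ S.mesh.elem T, ‖w (y, t)‖ ≤ |C₂| := fun y hy =>
    h3.bound (mk_mem_prod (A.elem_subset hy) ht)
  have herr := A.error t ht
  constructor
  · rw [hle, norm_smul, Real.norm_eq_abs]
    calc _ ≤ (K * S.err₀ qs qt) * |C₂| := by
          gcongr
          · exact herr x hx
          · exact hbd x hx
      _ ≤ _ := by nlinarith [abs_nonneg C₂, mul_nonneg (mul_nonneg (abs_nonneg C₂) hK0.le) e0]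
  · intro y hy
    have hxy := norm_sub_le_h (T := T) hx hy
    have heq : S.leadingError b x t - S.leadingError b y t =
        ((S.φ x t - S.φh x t) - (S.φ y t - S.φh y t)) • w (x, t) +
          (S.φ y t - S.φh y t) • (w (x, t) - w (y, t)) := by
      rw [hle, hle, sub_smul, smul_sub, sub_smul _ _ (w (x, t)), sub_smul _ _ (w (x, t))]
      abel
    rw [heq]
    refine (norm_add_le _ _).trans ?_
    rw [norm_smul, norm_smul, Real.norm_eq_abs, Real.norm_eq_abs]
    have g1 := A.level.lipschitz h3 (A.elem_subset hy) (A.elem_subset hx) ht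
    have g2 : |(S.φ x t - S.φh x t) - (S.φ y t - S.φh y t)| ≤ K * S.err₁ qs qt * S.h :=
      (A.error_sub t ht x hx y hy).trans (by gcongr)
    have g3 : |S.φ y t - S.φh y t| ≤ K * S.err₁ qs qt :=
      (herr y hy).trans (by
        have := A.err₀_le_err₁
        gcongr)
    calc _ ≤ (K * S.err₁ qs qt * S.h) * |C₂| + (K * S.err₁ qs qt) * (|C₂| * S.h) := by
          refine add_le_add (mul_le_mul g2 (hbd x hx) (norm_nonneg _) (by positivity))
            (mul_le_mul g3 (g1.trans (by gcongr)) (norm_nonneg _) (by positivity))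
      _ ≤ _ := by nlinarith [mul_nonneg hh.le e1]

end Slab

end LocalError

/-! ### Averaged nodal values -/

section NodalError

open Set Filter Topology

set_option maxSynthPendingDepth 3

/-- An average inherits a common bound. The reference value `v` must not depend on the element; the
exact gradient and the ideal mapping plus its leading error are of this kind. -/
theorem Mesh.norm_nodeAverage_sub_le {d : ℕ} (M : Mesh d) {k : ℕ} {A : Set (Fin M.card)}
    {w : Fin M.card → Pt d → Pt d} {z v : Pt d} {ε : ℝ} (hne : (M.nodeStar k A z).Nonempty)
    (h : ∀ T ∈ M.nodeStar k A z, ‖w T z - v‖ ≤ ε) : ‖M.nodeAverage k A w z - v‖ ≤ ε := by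
  have hc : (0 : ℝ) < (M.nodeStar k A z).card := by exact_mod_cast hne.card_pos
  have h1 : M.nodeAverage k A w z - v =
      ((M.nodeStar k A z).card : ℝ)⁻¹ • ∑ T ∈ M.nodeStar k A z, (w T z - v) := by
    rw [Finset.sum_sub_distrib, Finset.sum_const, smul_sub, ← Nat.cast_smul_eq_nsmul ℝ, smul_smul,
      inv_mul_cancel₀ hc.ne', one_smul]
    rfl
  rw [h1, norm_smul, norm_inv, Real.norm_eq_abs, abs_of_pos hc]
  have h2 := norm_sum_le_of_le _ h
  rw [Finset.sum_const, nsmul_eq_mul] at h2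
  calc _ ≤ ((M.nodeStar k A z).card : ℝ)⁻¹ * ((M.nodeStar k A z).card * ε) := by gcongr
    _ = ε := by field_simp

open scoped Classical in
theorem Mesh.mem_nodeStar_self {d : ℕ} (M : Mesh d) {k : ℕ} {A : Set (Fin M.card)} {T : Fin M.card}
    (hT : T ∈ A) {α : Fin (d + 1) → ℕ} (hα : α ∈ Finset.univ.piAntidiag k) :
    T ∈ M.nodeStar k A ((M.cell T).node k α) :=
  Finset.mem_filter.2 ⟨Finset.mem_univ _, hT, α, hα, rfl⟩

open scoped Classical in
theorem Mesh.mem_of_mem_nodeStar {d : ℕ} (M : Mesh d) {k : ℕ} (hk : 1 ≤ k) {A : Set (Fin M.card)}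
    {T : Fin M.card} {z : Pt d} (hT : T ∈ M.nodeStar k A z) : T ∈ A ∧ z ∈ M.elem T := by
  obtain ⟨-, h1, α, hα, rfl⟩ := Finset.mem_filter.1 hT
  exact ⟨h1, (M.cell T).node_mem_body hk hα⟩

namespace Slab

variable {d : ℕ}

theorem exists_gradient_error (d qs : ℕ) (K : ℝ) : ∃ C : ℝ, 1 ≤ C ∧
    ∀ (S : Slab d) (qt m : ℕ) (ρ : ℝ) (b : Pt d → ℝ → ℝ) (T : Fin S.mesh.card),
      S.ActiveElem qs qt m K ρ b T → ∀ t ∈ S.I, ∀ x ∈ S.mesh.elem T,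
        ‖gradient (S.φhExt qs T t) x - LevelSetOn.grad S.φ (x, t)‖ ≤ C * S.err₁ qs qt := by
  obtain ⟨C, hC, H⟩ := exists_ext_error d qs K
  refine ⟨C, hC, fun S qt m ρ b T A t ht x hx => ?_⟩
  have h1 := (H S qt m ρ b T A t ht x (A.elem_subset_nbhd hx)).2
  have h2 : gradient (S.φhExt qs T t) x - LevelSetOn.grad S.φ (x, t) =
      (InnerProductSpace.toDual ℝ (Pt d)).symm
        (fderiv ℝ (S.φhExt qs T t) x - LevelSetOn.dx S.φ (x, t)) := by
    rw [map_sub]; rfl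
  rw [h2, LinearIsometryEquiv.norm_map, norm_sub_rev]
  exact h1

/-- The error of the discrete search directions. -/
theorem exists_direction_error (d qs : ℕ) (hqs : 1 ≤ qs) {K : ℝ} (hK : 1 ≤ K) : ∃ C : ℝ, 1 ≤ C ∧
    ∀ (S : Slab d) (qt m : ℕ) (ρ : ℝ) (b : Pt d → ℝ → ℝ) (A : Set (Fin S.mesh.card))
      (g : SearchDirection), (∀ T ∈ A, S.ActiveElem qs qt m K ρ b T) → ∀ T ∈ A, ∀ t ∈ S.I,
        ∀ x ∈ S.mesh.elem T,
          ‖S.Gh qs g A t T x - LevelSetOn.grad S.φ (x, t)‖ ≤ C * S.err₁ qs qt := by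
  obtain ⟨C, hC, H⟩ := exists_gradient_error d qs K
  obtain ⟨C₁, hC₁, H₁⟩ := Cell.Regular.exists_interp_error d (k := qs) hqs (2 * K)
  obtain ⟨C₂, hC₂, H₂⟩ := Cell.Regular.exists_interp_bound d qs (2 * K)
  refine ⟨C₁ * K + C₂ * C, by nlinarith, fun S qt m ρ b A g hA T hT t ht x hx => ?_⟩
  have AT := hA T hT
  have hh := AT.h_pos
  have e1 := AT.err₁_nonneg
  have hx' := AT.elem_subset_nbhd hx
  cases g with
  | gradient =>
    refine (H S qt m ρ b T AT t ht x hx).trans ?_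
    gcongr
    nlinarith
  | averaged =>
    set w : Fin S.mesh.card → Pt d → Pt d := fun T' => gradient (S.φhExt qs T' t) with hw
    have h1 : S.Gh qs .averaged A t T x =
        (S.mesh.cell T).interp qs (S.mesh.nodeAverage qs A w) x := S.mesh.oswald_eq hT w hx
    -- At a node the gradients from all active neighbours are compared with the same `∇φ`. Stability
    -- of the interpolation carries the nodal error `err₁` to all of `T`, and interpolating `∇φ`
    -- itself costs another `h^(qs+1)`.
    have h2 := (H₂ (Pt d) _ _ AT.regular (fun y => S.mesh.nodeAverage qs A w y -
      LevelSetOn.grad S.φ (y, t)) (C * S.err₁ qs qt) (fun α hα => by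
        refine S.mesh.norm_nodeAverage_sub_le ⟨T, S.mesh.mem_nodeStar_self hT hα⟩ fun T' hT' => ?_
        obtain ⟨h3, h4⟩ := S.mesh.mem_of_mem_nodeStar hqs hT'
        exact H S qt m ρ b T' (hA T' h3) t ht _ h4) x hx').1
    have h3 := (H₁ (Pt d) _ _ AT.regular _ (fun y => LevelSetOn.grad S.φ (y, t)) K
      (convex_ball _ _) AT.elem_subset ((AT.level.bdd_grad.slice_left ht).mono_order
        (show qs + 1 ≤ m + 1 by linarith [AT.qs_le])) x hx'
      (Metric.isOpen_ball.mem_nhds (AT.elem_subset hx))).1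
    rw [Cell.interp_sub] at h2
    rw [h1]
    refine (norm_sub_le_norm_sub_add_norm_sub _ ((S.mesh.cell T).interp qs
      (fun y => LevelSetOn.grad S.φ (y, t)) x) _).trans ?_
    rw [norm_sub_rev _ (LevelSetOn.grad S.φ (x, t))]
    have h4 : C₁ * K * S.h ^ (qs + 1) ≤ C₁ * K * S.err₁ qs qt := by
      have := AT.pow_le_err₀.trans AT.err₀_le_err₁
      gcongr
    linarith

/-- The error of the nodal values of the discrete mapping. -/
theorem exists_nodal_error (d qs m : ℕ) (hqs : 1 ≤ qs) {K ρ : ℝ} (hK : 1 ≤ K) (hρ : 0 < ρ) :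
    ∃ C η : ℝ, 1 ≤ C ∧ 0 < η ∧
    ∀ (S : Slab d) (qt : ℕ) (b : Pt d → ℝ → ℝ) (A : Set (Fin S.mesh.card)) (g : SearchDirection),
      (∀ T ∈ A, S.ActiveElem qs qt m K ρ b T) → S.h ≤ η → S.dt ^ (qt + 1) ≤ η * S.h →
      ∀ T ∈ A, ∀ t ∈ S.I, ∀ α ∈ Finset.univ.piAntidiag qs,
        ‖S.mesh.nodeAverage qs A (S.ΨhΓ qs g A b t) ((S.mesh.cell T).node qs α) -
          S.ΨΓ b ((S.mesh.cell T).node qs α) t - S.leadingError b ((S.mesh.cell T).node qs α) t‖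
          ≤ C * (S.h * S.err₁ qs qt) := by
  obtain ⟨C₀, hC₀, H₀⟩ := exists_direction_error d qs hqs hK
  obtain ⟨C, η, hC, hη, H⟩ := exists_discrete_error d qs m hK hρ C₀
  refine ⟨C, η, hC, hη, fun S qt b A g hA h1 h2 T hT t ht α hα => ?_⟩
  rw [sub_sub]
  refine S.mesh.norm_nodeAverage_sub_le ⟨T, S.mesh.mem_nodeStar_self hT hα⟩ fun T' hT' => ?_
  obtain ⟨h3, h4⟩ := S.mesh.mem_of_mem_nodeStar hqs hT'
  rw [← sub_sub]
  exact H S qt b T' (hA T' h3) h1 h2 t ht _ h4 _ (H₀ S qt m ρ b A g hA T' h3 t ht _ h4)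

end Slab

end NodalError

/-! ### The smooth part of the shift -/

section SmoothMapping

open Set Filter Topology

set_option maxSynthPendingDepth 3

namespace BddDerivOn

variable {E F : Type} [NormedAddCommGroup E] [NormedSpace ℝ E] [NormedAddCommGroup F]
  [NormedSpace ℝ F] {n : ℕ} {C : ℝ}

/-- The partial derivative in space. -/
theorem exists_spatial_deriv {d : ℕ} {U : Set (Pt d)} {I : Set ℝ} {Φ : Pt d × ℝ → F} (hU : IsOpen U)
    (h : BddDerivOn (U ×ˢ I) (n + 1) C Φ) : ∃ Φx : Pt d × ℝ → (Pt d →L[ℝ] F),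
      BddDerivOn (U ×ˢ I) n C Φx ∧
      ∀ x ∈ U, ∀ t ∈ I, HasFDerivAt (fun y => Φ (y, t)) (Φx (x, t)) x := by
  obtain ⟨-, Φ', h1, h2⟩ := h
  refine ⟨fun p => (Φ' p).comp (ContinuousLinearMap.inl ℝ (Pt d) ℝ), ?_, fun x hx t ht =>
    LevelSetOn.hasFDerivAt_slice hU hx ht (h1 (x, t) ⟨hx, ht⟩)⟩
  have h3 := h2.clm_comp _ (LevelSetOn.norm_comp_inl_flip_le F (d := d))
  rwa [one_mul] at h3

/-- The difference of the derivatives of two compositions. -/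
theorem exists_hasFDerivWithinAt_comp_sub_le {U : Set E} (hU : Convex ℝ U) {H : E → F}
    (hH : BddDerivOn U (n + 2) C H) {X : Type} [NormedAddCommGroup X] [NormedSpace ℝ X] {s : Set X}
    {x : X} (hx : x ∈ s) {f₁ f₂ : X → E} {f₁' f₂' : X →L[ℝ] E} (h₁ : HasFDerivWithinAt f₁ f₁' s x)
    (h₂ : HasFDerivWithinAt f₂ f₂' s x) (hm₁ : MapsTo f₁ s U) (hm₂ : MapsTo f₂ s U) :
    ∃ L₁ L₂ : X →L[ℝ] F, HasFDerivWithinAt (fun y => H (f₁ y)) L₁ s x ∧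
      HasFDerivWithinAt (fun y => H (f₂ y)) L₂ s x ∧
      ‖L₁ - L₂‖ ≤ C * (‖f₁ x - f₂ x‖ * ‖f₂'‖ + ‖f₁' - f₂'‖) := by
  obtain ⟨-, H', h1, h2⟩ := hH
  refine ⟨(H' (f₁ x)).comp f₁', (H' (f₂ x)).comp f₂', (h1 _ (hm₁ hx)).comp x h₁ hm₁,
    (h1 _ (hm₂ hx)).comp x h₂ hm₂, ?_⟩
  have h3 : (H' (f₁ x)).comp f₁' - (H' (f₂ x)).comp f₂' =
      (H' (f₁ x)).comp (f₁' - f₂') + (H' (f₁ x) - H' (f₂ x)).comp f₂' := by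
    ext z
    simp
  rw [h3]
  have h4 := h2.norm_sub_le hU (hm₂ hx) (hm₁ hx)
  have h5 := h2.bound (hm₁ hx)
  calc _ ≤ ‖H' (f₁ x)‖ * ‖f₁' - f₂'‖ + ‖H' (f₁ x) - H' (f₂ x)‖ * ‖f₂'‖ :=
        (norm_add_le _ _).trans (add_le_add (ContinuousLinearMap.opNorm_comp_le _ _)
          (ContinuousLinearMap.opNorm_comp_le _ _))
    _ ≤ C * ‖f₁' - f₂'‖ + (C * ‖f₁ x - f₂ x‖) * ‖f₂'‖ := by gcongr
    _ = _ := by ring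

end BddDerivOn

namespace Cell

variable {d : ℕ} (T : Cell d)

/-- The derivative of the linear interpolant. -/
noncomputable def linDeriv (u : Pt d → ℝ) : Pt d →L[ℝ] ℝ := ∑ v, u (T v) • T.coordL v

theorem hasFDerivAt_interp_one (u : Pt d → ℝ) (x : Pt d) :
    HasFDerivAt (T.interp 1 u) (T.linDeriv u) x := by
  have h1 : T.interp 1 u = fun y => ∑ v, u (T v) * T.coord v y := by
    funext y
    rw [interp_one]
    exact Finset.sum_congr rfl fun v _ => by rw [smul_eq_mul, mul_comm]
  rw [h1]
  exact HasFDerivAt.fun_sum fun v _ => (T.hasFDerivAt_coord v x).const_mul _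

theorem sum_coordL : ∑ v, T.coordL v = 0 := by
  have h1 : HasFDerivAt (fun y => ∑ v, T.coord v y) (∑ v, T.coordL v) 0 :=
    HasFDerivAt.fun_sum fun v _ => T.hasFDerivAt_coord v 0
  have h2 : (fun y => ∑ v, T.coord v y) = fun _ => (1 : ℝ) := funext fun y => T.sum_coord y
  rw [h2] at h1
  exact h1.unique (hasFDerivAt_const _ _)

/-- The gradients of the coordinates sum to zero, so only differences of vertex values enter. Being
of order `h`, these compensate the slopes of order `1 / h`. -/
theorem linDeriv_eq (u : Pt d → ℝ) : T.linDeriv u = ∑ v, (u (T v) - u (T 0)) • T.coordL v := by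
  simp only [sub_smul, Finset.sum_sub_distrib, ← Finset.smul_sum, sum_coordL, smul_zero, sub_zero]
  rfl

end Cell

namespace Slab

variable {d : ℕ}

/-- The part of the shift which is smooth in time. -/
noncomputable def smoothShift (S : Slab d) (b : Pt d → ℝ → ℝ) (T : Fin S.mesh.card) (x : Pt d)
    (t : ℝ) : ℝ := (1 - b x t) * ((S.mesh.cell T).interp 1 (fun y => S.φ y t) x - S.φ x t)

/-- The open neighbourhood of width `h` of an element. -/
def thick (S : Slab d) (T : Fin S.mesh.card) : Set (Pt d) := Metric.thickening S.h (S.mesh.elem T)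

namespace ActiveElem

variable {S : Slab d} {qs qt m : ℕ} {K ρ : ℝ} {b : Pt d → ℝ → ℝ} {T : Fin S.mesh.card}

theorem convex_thick : Convex ℝ (S.thick T) := (S.mesh.cell T).convex_body.thickening _

theorem isOpen_thick : IsOpen (S.thick T) := Metric.isOpen_thickening

theorem thick_subset_nbhd : S.thick T ⊆ (S.mesh.cell T).nbhd S.h := fun x hx => by
  obtain ⟨y, hy, hxy⟩ := Metric.mem_thickening_iff.1 hx
  exact ⟨y, hy, by rw [← dist_eq_norm]; exact hxy.le⟩

variable (A : S.ActiveElem qs qt m K ρ b T)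
include A

theorem elem_subset_thick : S.mesh.elem T ⊆ S.thick T := Metric.self_subset_thickening A.h_pos _

theorem thick_subset : S.thick T ⊆ Metric.ball (S.mesh.cell T 0) ρ :=
  thick_subset_nbhd.trans A.nbhd_subset

/-- Time derivatives of differences of vertex values are `O(h)` by one further spatial derivative;
this is why the order is `m + 1` and not `m + 2`. -/
theorem bddDerivOn_linDeriv : BddDerivOn S.I (m + 1) ((d + 1) * (2 * K ^ 2))
    (fun t => (S.mesh.cell T).linDeriv fun y => S.φ y t) := by
  have hh := A.h_pos
  have hK := A.K_pos
  simp only [Cell.linDeriv_eq]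
  have h1 : ∀ v ∈ (Finset.univ : Finset (Fin (d + 1))), BddDerivOn S.I (m + 1) (2 * K ^ 2)
      (fun t => (S.φ (S.mesh.cell T v) t - S.φ (S.mesh.cell T 0) t) •
        (S.mesh.cell T).coordL v) := by
    intro v _
    have h2 := BddDerivOn.slice_sub (convex_ball _ _) S.convex_I A.level.smooth
      (A.elem_subset ((S.mesh.cell T).vertex_mem_body v)) (A.elem_subset A.vertex_mem)
    have h3 := h2.clm_comp (ContinuousLinearMap.toSpanSingleton ℝ ((S.mesh.cell T).coordL v))
      (A := 2 * K / S.h) (by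
        rw [ContinuousLinearMap.norm_toSpanSingleton]
        exact A.regular.slope v)
    have h4 := norm_sub_le_h (T := T) ((S.mesh.cell T).vertex_mem_body v) A.vertex_mem
    refine (h3.mono_const ?_).congr fun t _ => rfl
    calc 2 * K / S.h * (K * ‖S.mesh.cell T v - S.mesh.cell T 0‖) ≤ 2 * K / S.h * (K * S.h) := by
          gcongr
      _ = _ := by field_simp
  have h5 := BddDerivOn.sum _ h1
  simpa using h5

theorem bddDerivOn_interp_time {x : Pt d} (hx : x ∈ (S.mesh.cell T).nbhd S.h) :
    BddDerivOn S.I (m + 2) ((d + 1) * ((1 + 2 * K) * K))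
      (fun t => (S.mesh.cell T).interp 1 (fun y => S.φ y t) x) := by
  have hK := A.K_pos
  simp only [Cell.interp_one]
  have h1 : ∀ v ∈ (Finset.univ : Finset (Fin (d + 1))), BddDerivOn S.I (m + 2) ((1 + 2 * K) * K)
      (fun t => (S.mesh.cell T).coord v x • S.φ (S.mesh.cell T v) t) := by
    intro v _
    have h2 := A.level.smooth.slice_right (A.elem_subset ((S.mesh.cell T).vertex_mem_body v))
    have h3 := h2.clm_comp ((S.mesh.cell T).coord v x • ContinuousLinearMap.id ℝ ℝ)
      (A := 1 + 2 * K) (by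
        rw [norm_smul, Real.norm_eq_abs]
        have := A.regular.abs_coord_le hx v
        calc _ ≤ (1 + 2 * K) * 1 := by
              gcongr
              exact ContinuousLinearMap.norm_id_le
          _ = _ := mul_one _)
    exact h3.congr fun t _ => rfl
  have h5 := BddDerivOn.sum _ h1
  simpa using h5

theorem bddDerivOn_interp_space {t : ℝ} (ht : t ∈ S.I) :
    BddDerivOn ((S.mesh.cell T).nbhd S.h) (m + 2)
      ((d + 1) * ((1 + 2 * K) * K) + (d + 1) * (2 * K ^ 2))
      (fun x => (S.mesh.cell T).interp 1 (fun y => S.φ y t) x) := by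
  have hK := A.K_pos
  refine ⟨fun x hx => ((A.bddDerivOn_interp_time hx).bound ht).trans ?_,
    fun _ => (S.mesh.cell T).linDeriv fun y => S.φ y t,
    fun x _ => ((S.mesh.cell T).hasFDerivAt_interp_one _ x).hasFDerivWithinAt,
    BddDerivOn.const _ ((A.bddDerivOn_linDeriv.bound ht).trans ?_)⟩
  · have : 0 ≤ (d + 1) * (2 * K ^ 2) := by positivity
    linarith
  · have : 0 ≤ (d + 1) * ((1 + 2 * K) * K) := by positivity
    linarith

end ActiveElem

/-- The regularity of the smooth part of the shift. -/
theorem exists_smoothShift_bound (d m : ℕ) {K : ℝ} (hK : 1 ≤ K) : ∃ C : ℝ, 1 ≤ C ∧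
    ∀ (S : Slab d) (qs qt : ℕ) (ρ : ℝ) (b : Pt d → ℝ → ℝ) (T : Fin S.mesh.card),
      S.ActiveElem qs qt m K ρ b T →
      (∀ t ∈ S.I, BddDerivOn (S.thick T) (m + 1) C fun x => S.smoothShift b T x t) ∧
      (∀ x ∈ S.thick T, BddDerivOn S.I (m + 1) C (S.smoothShift b T x)) ∧
      (∀ x ∈ S.thick T, ∀ t ∈ S.I, |S.smoothShift b T x t| ≤ C * S.h ^ 2) ∧
      ∀ x ∈ S.thick T, ∃ σ' : ℝ → (Pt d →L[ℝ] ℝ), BddDerivOn S.I (m + 1) C σ' ∧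
        ∀ t ∈ S.I, HasFDerivAt (fun y => S.smoothShift b T y t) (σ' t) x := by
  obtain ⟨C₁, hC₁, H⟩ := exists_lin_error d K
  have hK0 : 0 < K := by linarith
  set B : ℝ := (d + 1) * ((1 + 2 * K) * K) + (d + 1) * (2 * K ^ 2) with hB
  have hB0 : 0 ≤ (d + 1 : ℝ) * (2 * K ^ 2) := by positivity
  have hB1 : 0 ≤ (d + 1 : ℝ) * ((1 + 2 * K) * K) := by positivity
  set P : ℝ := 2 ^ (m + 1) * ((1 + K) * (B + K)) with hP
  set Q : ℝ := 2 ^ (m + 1) * ((B + K) * K) with hQ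
  have hP0 : 0 ≤ P := by positivity
  have hQ0 : 0 ≤ Q := by positivity
  refine ⟨C₁ + P + Q, by linarith, fun S qs qt ρ b T A => ?_⟩
  have hh := A.h_pos
  refine ⟨fun t ht => ?_, fun x hx => ?_, fun x hx t ht => ?_, fun x hx => ?_⟩
  · have h1 := (BddDerivOn.const (s := S.thick T) (n := m + 1) (C := 1) (1 : ℝ) (by simp)).sub
      ((A.b_smooth.of_succ.slice_left ht).mono_set A.thick_subset)
    have h2 := ((A.bddDerivOn_interp_space ht).of_succ.mono_set
      ActiveElem.thick_subset_nbhd).sub ((A.level.smooth.of_succ.slice_left ht).mono_set A.thick_subset)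
    exact (h1.mul h2).mono_const (by linarith)
  · have h1 := (BddDerivOn.const (s := S.I) (n := m + 1) (C := 1) (1 : ℝ) (by simp)).sub
      (A.b_smooth.of_succ.slice_right (A.thick_subset hx))
    have h2 := ((A.bddDerivOn_interp_time (ActiveElem.thick_subset_nbhd hx)).of_succ.mono_const
      (show _ ≤ B by linarith)).sub (A.level.smooth.of_succ.slice_right (A.thick_subset hx))
    exact (h1.mul h2).mono_const (by linarith)
  · rw [smoothShift, abs_mul]
    have h1 := (H S qs qt m ρ b T A t ht x (ActiveElem.thick_subset_nbhd hx)).1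
    have h2 := A.abs_one_sub_b_le (A.thick_subset hx) ht
    calc _ ≤ 1 * (C₁ * S.h ^ 2) := by gcongr
      _ ≤ _ := by
        rw [one_mul]
        gcongr
        linarith
  · obtain ⟨bx, hbx, hbx'⟩ := A.b_smooth.exists_spatial_deriv Metric.isOpen_ball
    have h1 := (BddDerivOn.const (s := S.I) (n := m + 1) (C := 1) (1 : ℝ) (by simp)).sub
      (A.b_smooth.of_succ.slice_right (A.thick_subset hx))
    have h2 := ((A.bddDerivOn_interp_time (ActiveElem.thick_subset_nbhd hx)).of_succ.mono_const
      (show _ ≤ B by linarith)).sub (A.level.smooth.of_succ.slice_right (A.thick_subset hx))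
    have h3 := (A.bddDerivOn_linDeriv.mono_const (show _ ≤ B by linarith)).sub
      (A.level.bdd_dx.slice_right (A.thick_subset hx))
    have h4 := (h1.smul h3).add (h2.smul (hbx.slice_right (A.thick_subset hx)).neg)
    refine ⟨_, h4.mono_const (by linarith), fun t ht => ?_⟩
    have h5 := (hbx' x (A.thick_subset hx) t ht).const_sub 1
    have h6 := ((S.mesh.cell T).hasFDerivAt_interp_one (fun y => S.φ y t) x).sub
      (A.level.hasFDerivAt (A.thick_subset hx) ht)
    exact h5.mul h6

end Slab

end SmoothMapping

/-! ### Regularity of the smooth part of the ideal mapping -/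

section SmoothMapping

open Set Filter Topology

set_option maxSynthPendingDepth 3

theorem norm_smulRightL_le_one (E F : Type) [NormedAddCommGroup E] [NormedSpace ℝ E]
    [NormedAddCommGroup F] [NormedSpace ℝ F] : ‖ContinuousLinearMap.smulRightL ℝ E F‖ ≤ 1 := by
  refine ContinuousLinearMap.opNorm_le_bound _ zero_le_one fun c => ?_
  rw [one_mul]
  refine ContinuousLinearMap.opNorm_le_bound _ (norm_nonneg _) fun f => ?_
  rw [ContinuousLinearMap.smulRightL_apply_apply, ContinuousLinearMap.norm_smulRight_apply]

namespace Slab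

variable {d : ℕ}

/-- The displacement vector as a function of space, time and shift. -/
noncomputable def offset (S : Slab d) (D : (Pt d × ℝ) × ℝ → ℝ) (p : (Pt d × ℝ) × ℝ) : Pt d :=
  D p • LevelSetOn.grad S.φ p.1

/-- The regularity of the smooth part of the ideal mapping. -/
theorem exists_smooth_regular (d m : ℕ) {K ρ a c C₁ : ℝ} (hK : 1 ≤ K) (hc : 0 < c) (hC₁ : 1 ≤ C₁)
    (haK : a * K ≤ ρ / 2) (haK' : a * K ≤ 1 / 2) : ∃ C η : ℝ, 1 ≤ C ∧ 0 < η ∧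
    ∀ (S : Slab d) (qs qt : ℕ) (b : Pt d → ℝ → ℝ) (T : Fin S.mesh.card),
      S.ActiveElem qs qt m K ρ b T → S.h ≤ η →
      ∀ D, DisplacementOn S.φ (S.mesh.cell T 0) ρ S.I m a c C₁ D →
      (∀ x ∈ S.thick T, ∀ t ∈ S.I, S.smoothShift b T x t ∈ Ioo (-c) c) ∧
      (∀ t ∈ S.I, BddDerivOn (S.thick T) (m + 1) C
        fun x => S.offset D ((x, t), S.smoothShift b T x t)) ∧
      (∀ x ∈ S.thick T, BddDerivOn S.I (m + 1) C
        fun t => S.offset D ((x, t), S.smoothShift b T x t)) ∧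
      ∀ x ∈ S.thick T, ∃ (α : ℝ → ℝ) (u v : ℝ → (Pt d →L[ℝ] Pt d)),
        BddDerivOn S.I (m + 1) C α ∧ (∀ t ∈ S.I, |α t| ≤ C * S.h ^ 2) ∧ BddDerivOn S.I m C u ∧
        BddDerivOn S.I (m + 1) C v ∧ ∀ t ∈ S.I,
          HasFDerivAt (fun y => S.offset D ((y, t), S.smoothShift b T y t)) (v t + α t • u t) x := by
  obtain ⟨C₂, hC₂, H⟩ := exists_smoothShift_bound d m hK
  have hK0 : 0 < K := by linarith
  -- the constants of the functions which occur
  obtain ⟨V, hV⟩ : ∃ V, V = 2 ^ (m + 1) * (C₁ * K) := ⟨_, rfl⟩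
  obtain ⟨Cx, hCx⟩ : ∃ Cx, Cx = BddDerivOn.compConst (m + 1) V (1 + 0 + C₂) := ⟨_, rfl⟩
  obtain ⟨Ct, hCt⟩ : ∃ Ct, Ct = BddDerivOn.compConst (m + 1) V (0 + 1 + C₂) := ⟨_, rfl⟩
  obtain ⟨Ca, hCa⟩ : ∃ Ca, Ca = BddDerivOn.compConst (m + 1) C₁ (0 + 1 + C₂) := ⟨_, rfl⟩
  obtain ⟨Cy, hCy⟩ : ∃ Cy, Cy = BddDerivOn.compConst (m + 1) K
    (0 + 2 ^ (m + 1) * (Ca * K) + 1) := ⟨_, rfl⟩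
  obtain ⟨Cs, hCs⟩ : ∃ Cs, Cs = BddDerivOn.invConst (2 * K ^ 2)⁻¹
    (2 ^ (m + 1) * (1 * Cy * K)) (m + 1) := ⟨_, rfl⟩
  obtain ⟨Cv, hCv⟩ : ∃ Cv, Cv = 2 ^ (m + 1) * (Cs * (2 ^ (m + 1) * (1 * (K + C₂ + Cy) * K))) :=
    ⟨_, rfl⟩
  obtain ⟨Cu, hCu⟩ : ∃ Cu, Cu = K + 2 ^ m * (Cs * (2 ^ m * (1 * (2 ^ m * (1 * Cy * K)) * K))) :=
    ⟨_, rfl⟩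
  refine ⟨1 + |Cx| + |Ct| + |Ca| + |Cv| + |Cu| + C₁ * C₂, c / (2 * C₂), ?_, by positivity,
    fun S qs qt b T A hη D hD => ?_⟩
  · have : 0 ≤ C₁ * C₂ := by positivity
    linarith [abs_nonneg Cx, abs_nonneg Ct, abs_nonneg Ca, abs_nonneg Cv, abs_nonneg Cu]
  have hsum : ∀ e : ℝ, e ≤ |Cx| ∨ e ≤ |Ct| ∨ e ≤ |Ca| ∨ e ≤ |Cv| ∨ e ≤ |Cu| →
      e ≤ 1 + |Cx| + |Ct| + |Ca| + |Cv| + |Cu| + C₁ * C₂ := fun e he => by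
    have : 0 ≤ C₁ * C₂ := by positivity
    rcases he with he | he | he | he | he <;>
    linarith [abs_nonneg Cx, abs_nonneg Ct, abs_nonneg Ca, abs_nonneg Cv, abs_nonneg Cu]
  obtain ⟨hσx, hσt, hσb, hσd⟩ := H S qs qt ρ b T A
  have hh := A.h_pos
  have hσmem : ∀ x ∈ S.thick T, ∀ t ∈ S.I, S.smoothShift b T x t ∈ Ioo (-c) c := fun x hx t ht => by
    refine abs_lt.1 ?_
    calc |S.smoothShift b T x t| ≤ C₂ * S.h ^ 2 := hσb x hx t ht
      _ ≤ C₂ * (c / (2 * C₂) * 1) := by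
          rw [sq]
          have := A.h_le
          gcongr
      _ = c / 2 := by field_simp
      _ < c := by linarith
  have hhalf : ∀ x ∈ S.thick T, x ∈ Metric.ball (S.mesh.cell T 0) (ρ / 2) := fun x hx =>
    A.nbhd_subset_half (ActiveElem.thick_subset_nbhd hx)
  have hmem : ∀ x ∈ S.thick T, ∀ t ∈ S.I, ((x, t), S.smoothShift b T x t) ∈
      (Metric.ball (S.mesh.cell T 0) (ρ / 2) ×ˢ S.I) ×ˢ Ioo (-c) c := fun x hx t ht =>
    mk_mem_prod (mk_mem_prod (hhalf x hx) ht) (hσmem x hx t ht)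
  have hVs : BddDerivOn ((Metric.ball (S.mesh.cell T 0) (ρ / 2) ×ˢ S.I) ×ˢ Ioo (-c) c) (m + 1) V
      (S.offset D) := by
    have h1 := (A.level.bdd_grad.mono_set (prod_mono_left A.half_subset)).comp_affine
      (u := (Metric.ball (S.mesh.cell T 0) (ρ / 2) ×ˢ S.I) ×ˢ Ioo (-c) c) (g := Prod.fst)
      (ContinuousLinearMap.fst ℝ (Pt d × ℝ) ℝ) (ContinuousLinearMap.norm_fst_le ..)
      (fun _ _ => hasFDerivWithinAt_fst) fun _ hp => hp.1
    rw [hV]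
    exact hD.smooth.smul h1
  refine ⟨hσmem, fun t ht => ?_, fun x hx => ?_, fun x hx => ?_⟩
  · have h1 := ((DerivBddOn.id (s := S.thick T) (n := m + 1)).prodMk
      (DerivBddOn.const t)).prodMk (hσx t ht).derivBddOn
    have h2 := hVs.comp_derivBddOn h1 fun x hx => hmem x hx t ht
    rw [← hCx] at h2
    exact h2.mono_const (hsum _ (Or.inl (le_abs_self _)))
  · have h1 := ((DerivBddOn.const (s := S.I) (n := m + 1) x).prodMk
      DerivBddOn.id).prodMk (hσt x hx).derivBddOn
    have h2 := hVs.comp_derivBddOn h1 fun t ht => hmem x hx t ht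
    rw [← hCt] at h2
    exact h2.mono_const (hsum _ (Or.inr (Or.inl (le_abs_self _))))
  · obtain ⟨σ', hσ', hσ'd⟩ := hσd x hx
    obtain ⟨gx, hgx, hgxd⟩ := A.level.bdd_grad.exists_spatial_deriv Metric.isOpen_ball
    have hxb := A.thick_subset hx
    obtain ⟨α, hα⟩ : ∃ α : ℝ → ℝ, α = fun t => D ((x, t), S.smoothShift b T x t) := ⟨_, rfl⟩
    obtain ⟨g, hg⟩ : ∃ g : ℝ → Pt d, g = fun t => LevelSetOn.grad S.φ (x, t) := ⟨_, rfl⟩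
    obtain ⟨P, hP⟩ : ∃ P : ℝ → (Pt d →L[ℝ] ℝ),
      P = fun t => LevelSetOn.dx S.φ (x + α t • g t, t) := ⟨_, rfl⟩
    have hαb : BddDerivOn S.I (m + 1) Ca α := by
      have h1 := ((DerivBddOn.const (s := S.I) (n := m + 1) x).prodMk
        DerivBddOn.id).prodMk (hσt x hx).derivBddOn
      rw [hCa, hα]
      exact hD.smooth.comp_derivBddOn h1 fun t ht => hmem x hx t ht
    have hgb : BddDerivOn S.I (m + 1) K g := by
      rw [hg]
      exact A.level.bdd_grad.slice_right hxb
    have hαmem : ∀ t ∈ S.I, α t ∈ Ioo (-a) a := fun t ht => by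
      rw [hα]
      exact hD.mem x (hhalf x hx) t ht _ (hσmem x hx t ht)
    have hymem : ∀ t ∈ S.I, x + α t • g t ∈ Metric.ball (S.mesh.cell T 0) ρ := fun t ht => by
      rw [hg]
      exact A.level.displaced_mem haK (hhalf x hx) ht (hαmem t ht)
    have hPb : BddDerivOn S.I (m + 1) Cy P := by
      have h1 := (((DerivBddOn.const (s := S.I) (n := m + 1) x).add
        (hαb.smul hgb).derivBddOn).prodMk DerivBddOn.id)
      rw [hCy, hP]
      exact A.level.bdd_dx.comp_derivBddOn h1 fun t ht => mk_mem_prod (hymem t ht) ht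
    have hsb : BddDerivOn S.I (m + 1) Cs fun t => (P t (g t))⁻¹ := by
      have h1 := hPb.bilin (ContinuousLinearMap.id ℝ (Pt d →L[ℝ] ℝ))
        ContinuousLinearMap.norm_id_le hgb
      rw [hCs]
      refine h1.inv (by positivity) fun t ht => ?_
      rw [hP, hg]
      exact A.level.slope_lower haK haK' (hhalf x hx) ht (hαmem t ht)
    have hspos : ∀ t ∈ S.I, P t (g t) ≠ 0 := fun t ht => by
      have h1 := A.level.slope_lower haK haK' (hhalf x hx) ht (hαmem t ht)
      rw [hP, hg]
      exact ((by positivity : (0 : ℝ) < (2 * K ^ 2)⁻¹).trans_le h1).ne'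
    -- The level set equation is differentiated implicitly with `P = dφ` at the displaced point. The
    -- part of the gradient without second derivatives of `φ` is `P(g)⁻¹ (dφ + σ' - P) ⊗ g`; it
    -- becomes `v`.
    have hwb := ((A.level.bdd_dx.slice_right hxb).add hσ').sub hPb
    have hvb := hsb.smul (hwb.bilin (ContinuousLinearMap.smulRightL ℝ (Pt d) (Pt d))
      (norm_smulRightL_le_one _ _) hgb)
    rw [← hCv] at hvb
    have hgxb := hgx.slice_right hxb
    -- The terms with the spatial derivative of `∇φ`, which has only `m` bounded derivatives. They
    -- all come with the factor `α`, the displacement, of size `h^2`.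
    have hub := hgxb.sub (hsb.of_succ.smul ((hPb.of_succ.bilin
      (ContinuousLinearMap.compL ℝ (Pt d) (Pt d) ℝ) (ContinuousLinearMap.norm_compL_le ..)
      hgxb).bilin (ContinuousLinearMap.smulRightL ℝ (Pt d) (Pt d))
      (norm_smulRightL_le_one _ _) hgb.of_succ))
    rw [← hCu] at hub
    refine ⟨α, _, _, hαb.mono_const (hsum _ (Or.inr (Or.inr (Or.inl (le_abs_self _))))),
      fun t ht => ?_,
      hub.mono_const (hsum _ (Or.inr (Or.inr (Or.inr (Or.inr (le_abs_self _)))))),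
      hvb.mono_const (hsum _ (Or.inr (Or.inr (Or.inr (Or.inl (le_abs_self _)))))), fun t ht => ?_⟩
    · rw [hα]
      calc |D ((x, t), S.smoothShift b T x t)| ≤ C₁ * |S.smoothShift b T x t| :=
            hD.abs_le x (hhalf x hx) t ht _ (hσmem x hx t ht)
        _ ≤ C₁ * (C₂ * S.h ^ 2) := by
            gcongr
            exact hσb x hx t ht
        _ = C₁ * C₂ * S.h ^ 2 := by ring
        _ ≤ _ := by
            gcongr
            linarith [abs_nonneg Cx, abs_nonneg Ct, abs_nonneg Ca, abs_nonneg Cv, abs_nonneg Cu]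
    · -- the derivative of the displacement, from the implicit equation
      have hopen : S.thick T ∈ 𝓝 x := ActiveElem.isOpen_thick.mem_nhds hx
      obtain ⟨α', hα'⟩ : ∃ α' : Pt d →L[ℝ] ℝ,
          HasFDerivAt (fun y => D ((y, t), S.smoothShift b T y t)) α' x := by
        obtain ⟨-, D', hD', -⟩ := hD.smooth
        have h1 := (hD' _ (hmem x hx t ht)).comp x (t := (Metric.ball (S.mesh.cell T 0) (ρ / 2) ×ˢ S.I) ×ˢ Ioo (-c) c)
          (((hasFDerivAt_prodMk_left x t).prodMk (hσ'd t ht)).hasFDerivWithinAt (s := S.thick T))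
          fun y hy => hmem y hy t ht
        exact ⟨_, h1.hasFDerivAt hopen⟩
      have hgd := hgxd x hxb t ht
      have hqd := hα'.smul hgd
      have hyd := (hasFDerivAt_id x).add hqd
      have hφy : HasFDerivAt (fun y => S.φ y t) (P t) (x + α t • g t) := by
        rw [hP]
        exact A.level.hasFDerivAt (hymem t ht) ht
      have hαt : D ((x, t), S.smoothShift b T x t) = α t := by rw [hα]
      have hgt : LevelSetOn.grad S.φ (x, t) = g t := by rw [hg]
      rw [hαt, hgt] at hqd hyd
      have hL : HasFDerivAt (fun y => S.φ (y + D ((y, t), S.smoothShift b T y t) •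
          LevelSetOn.grad S.φ (y, t)) t) ((P t).comp (ContinuousLinearMap.id ℝ (Pt d) +
            (α t • gx (x, t) + α'.smulRight (g t)))) x := by
        refine HasFDerivAt.comp x (g := fun y => S.φ y t) ?_ hyd
        change HasFDerivAt _ _ (x + D ((x, t), S.smoothShift b T x t) • LevelSetOn.grad S.φ (x, t))
        rw [hαt, hgt]
        exact hφy
      have hR := (A.level.hasFDerivAt hxb ht).add (hσ'd t ht)
      have hE := hL.unique (hR.congr_of_eventuallyEq (by
        filter_upwards [hopen] with y hy
        exact hD.eq y (hhalf y hy) t ht _ (hσmem y hy t ht)))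
      have hα'z : ∀ z, α' z = (P t (g t))⁻¹ * (LevelSetOn.dx S.φ (x, t) z + σ' t z - P t z -
          α t * P t (gx (x, t) z)) := fun z => by
        have h1 := congrArg (fun L => L z) hE
        simp only [ContinuousLinearMap.comp_apply, add_apply, ContinuousLinearMap.id_apply,
          smul_apply, ContinuousLinearMap.smulRight_apply, map_add, map_smul, smul_eq_mul] at h1
        have h2 := hspos t ht
        field_simp
        linarith
      refine hqd.congr_fderiv ?_
      ext1 z
      simp only [add_apply, sub_apply, smul_apply, ContinuousLinearMap.smulRight_apply,
        ContinuousLinearMap.smulRightL_apply_apply, ContinuousLinearMap.compL_apply,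
        ContinuousLinearMap.comp_apply, hα'z]
      module

end Slab

end SmoothMapping

/-! ### The remainder of the shift -/

section ShiftError

open Set Filter Topology

set_option maxSynthPendingDepth 3

/-- The outer derivative is Lipschitz, so a perturbation `e` of the last argument changes the
derivative of the composition by no more than the sizes of `e` and `e'` allow. It serves for space
and for time, with `j` the corresponding inclusion. -/
theorem BddDerivOn.exists_shift_sub_le {E F X : Type} [NormedAddCommGroup E] [NormedSpace ℝ E]
    [NormedAddCommGroup F] [NormedSpace ℝ F] [NormedAddCommGroup X] [NormedSpace ℝ X] {n : ℕ}
    {C : ℝ} {U : Set (E × ℝ)} (hU : Convex ℝ U) {H : E × ℝ → F} (hH : BddDerivOn U (n + 2) C H)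
    {s : Set X} {x : X} (hx : x ∈ s) {j : X → E} {j' : X →L[ℝ] E} (hj : HasFDerivWithinAt j j' s x)
    (hj' : ‖j'‖ ≤ 1) {σ e : X → ℝ} {σ' e' : X →L[ℝ] ℝ} (hσ : HasFDerivWithinAt σ σ' s x)
    (he : HasFDerivWithinAt e e' s x) (hm₁ : MapsTo (fun y => (j y, σ y + e y)) s U)
    (hm₂ : MapsTo (fun y => (j y, σ y)) s U) :
    ∃ L₁ L₂ : X →L[ℝ] F, HasFDerivWithinAt (fun y => H (j y, σ y + e y)) L₁ s x ∧
      HasFDerivWithinAt (fun y => H (j y, σ y)) L₂ s x ∧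
      ‖L₁ - L₂‖ ≤ C * (|e x| * (1 + ‖σ'‖) + ‖e'‖) := by
  obtain ⟨L₁, L₂, h1, h2, h3⟩ := BddDerivOn.exists_hasFDerivWithinAt_comp_sub_le hU hH hx
    (hj.prodMk (hσ.fun_add he)) (hj.prodMk hσ) hm₁ hm₂
  refine ⟨L₁, L₂, h1, h2, h3.trans ?_⟩
  have hC : 0 ≤ C := (norm_nonneg _).trans (hH.bound (hm₂ hx))
  have e1 : ‖((j x, σ x + e x) : E × ℝ) - (j x, σ x)‖ = |e x| := by
    simp [Prod.norm_def]
  have e2 : ‖j'.prod σ'‖ ≤ 1 + ‖σ'‖ := by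
    refine ContinuousLinearMap.opNorm_le_bound _ (by positivity) fun z => ?_
    rw [ContinuousLinearMap.prod_apply, Prod.norm_def]
    have h4 := j'.le_of_opNorm_le hj' z
    have h5 := σ'.le_opNorm z
    have h6 : 0 ≤ ‖σ'‖ * ‖z‖ := by positivity
    have h7 := norm_nonneg z
    exact max_le (by linarith) (by linarith)
  have e3 : ‖j'.prod (σ' + e') - j'.prod σ'‖ ≤ ‖e'‖ := by
    refine ContinuousLinearMap.opNorm_le_bound _ (by positivity) fun z => ?_
    have : (j'.prod (σ' + e') - j'.prod σ') z = (0, e' z) := by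
      simp
    rw [this, Prod.norm_def]
    simpa using e'.le_opNorm z
  rw [e1]
  gcongr

namespace Slab

variable {d : ℕ}

theorem eq_sum_timeBasis (S : Slab d) {qt : ℕ} {τ : Fin (qt + 1) → ℝ} (hdt : 0 < S.dt)
    (hτ : Function.Injective τ) (c : Fin (qt + 1) → ℝ) (t : ℝ) :
    ∑ i, c i * t ^ (i : ℕ) =
      ∑ j, S.timeBasis τ j t * ∑ i, c i * S.timeNode τ j ^ (i : ℕ) := by
  classical
  set p : Polynomial ℝ := ∑ i : Fin (qt + 1), Polynomial.C (c i) * Polynomial.X ^ (i : ℕ) with hp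
  have heval : ∀ s, p.eval s = ∑ i, c i * s ^ (i : ℕ) := fun s => by
    simp [hp, Polynomial.eval_finsetSum]
  have hdeg : p.degree < (Finset.univ : Finset (Fin (qt + 1))).card := by
    rw [Finset.card_univ, Fintype.card_fin]
    refine (Polynomial.degree_sum_le _ _).trans_lt ?_
    rw [Finset.sup_lt_iff (WithBot.bot_lt_coe _)]
    intro i _
    refine (Polynomial.degree_C_mul_X_pow_le _ _).trans_lt ?_
    exact_mod_cast i.2
  have h1 := Lagrange.eq_interpolate (s := Finset.univ) (v := S.timeNode τ)
    (S.timeNode_injective hdt hτ).injOn hdeg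
  rw [← heval t, h1, Lagrange.interpolate_apply, Polynomial.eval_finsetSum]
  refine Finset.sum_congr rfl fun j _ => ?_
  rw [Polynomial.eval_mul, Polynomial.eval_C, heval, mul_comm]
  rfl

/-- The time derivative of the error of the discrete level set function. -/
theorem exists_time_derivative_error {qt : ℕ} (τ : Fin (qt + 1) → ℝ) (hτ : Function.Injective τ)
    (hτI : ∀ i, τ i ∈ Ioc (0 : ℝ) 1) (hqt : 1 ≤ qt) {K : ℝ} (hK : 1 ≤ K) : ∃ C : ℝ, 1 ≤ C ∧
    ∀ (d : ℕ) (S : Slab d) (qs m : ℕ) (ρ : ℝ) (b : Pt d → ℝ → ℝ) (T : Fin S.mesh.card),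
      S.ActiveElem qs qt m K ρ b T → ∀ z ∈ S.mesh.elem T, ∀ t ∈ S.I,
        ∃ ψ', HasDerivWithinAt (fun s => S.φ z s - S.φh z s) ψ' S.I t ∧
          S.dt * |ψ'| ≤ C * S.err₀ qs qt := by
  obtain ⟨C₁, hC₁, H₁⟩ := exists_timeInterp_error τ hτ hτI hqt
  obtain ⟨C₂, hC₂, H₂⟩ := exists_timeBasis_bound τ
  have hK0 : 0 < K := by linarith
  refine ⟨C₁ * K + (qt + 1) * C₂ * K, ?_, fun d S qs m ρ b T A z hz t ht => ?_⟩
  · have : 0 ≤ (qt + 1) * C₂ * K := by positivity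
    nlinarith
  have hdt := A.dt_pos
  have e0 := A.err₀_nonneg
  have hφb : BddDerivOn S.I (qt + 1) K (S.φ z) :=
    (A.level.smooth.slice_right (A.elem_subset hz)).mono_order (by linarith [A.qt_le])
  obtain ⟨φ', hφ'⟩ : ∃ φ', HasDerivWithinAt (S.φ z) φ' S.I t := by
    obtain ⟨-, f', hf', -⟩ := hφb
    exact ⟨_, (hf' t ht).hasDerivWithinAt⟩
  have h1 := (H₁ d S hdt ℝ (S.φ z) K hφb t ht).2 φ' hφ'
  obtain ⟨c, hc⟩ := A.polynomial z hz
  have hφh : ∀ s ∈ S.I, S.φh z s = ∑ j, S.timeBasis τ j s * S.φh z (S.timeNode τ j) := by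
    intro s hs
    rw [hc s hs, S.eq_sum_timeBasis hdt hτ c s]
    refine Finset.sum_congr rfl fun j _ => ?_
    rw [hc _ (S.timeNode_mem hdt hτI j)]
  have hφh' : HasDerivWithinAt (S.φh z)
      (∑ j, deriv (S.timeBasis τ j) t * S.φh z (S.timeNode τ j)) S.I t := by
    have h2 : HasDerivWithinAt (fun s => ∑ j, S.timeBasis τ j s * S.φh z (S.timeNode τ j))
        (∑ j, deriv (S.timeBasis τ j) t * S.φh z (S.timeNode τ j)) S.I t := by
      refine HasDerivWithinAt.fun_sum fun j _ => ?_
      have := (S.differentiable_timeBasis (τ := τ) j t).hasDerivAt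
      exact (this.mul_const _).hasDerivWithinAt
    exact h2.congr hφh (hφh t ht)
  refine ⟨_, hφ'.sub hφh', ?_⟩
  -- In time `φh` is a polynomial of degree at most `qt` and equals its interpolant. So the error
  -- splits into the interpolation error of `φ` and the nodal errors, which are multiplied by
  -- derivatives of the basis of size `1 / Δt`.
  have h3 : φ' - ∑ j, deriv (S.timeBasis τ j) t * S.φh z (S.timeNode τ j) =
      (φ' - ∑ j, deriv (S.timeBasis τ j) t • S.φ z (S.timeNode τ j)) +
        ∑ j, deriv (S.timeBasis τ j) t * (S.φ z (S.timeNode τ j) - S.φh z (S.timeNode τ j)) := by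
    simp only [mul_sub, Finset.sum_sub_distrib, smul_eq_mul]
    ring
  have h4 : |∑ j, deriv (S.timeBasis τ j) t * (S.φ z (S.timeNode τ j) - S.φh z (S.timeNode τ j))| ≤
      (qt + 1) * (C₂ / S.dt * (K * S.err₀ qs qt)) := by
    refine (Finset.abs_sum_le_sum_abs _ _).trans ?_
    have : ∀ j ∈ (Finset.univ : Finset (Fin (qt + 1))),
        |deriv (S.timeBasis τ j) t * (S.φ z (S.timeNode τ j) - S.φh z (S.timeNode τ j))| ≤
          C₂ / S.dt * (K * S.err₀ qs qt) := fun j _ => by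
      rw [abs_mul]
      have h5 := (H₂ d S hdt t ht j).2
      have h6 := A.error _ (S.timeNode_mem hdt hτI j) z hz
      gcongr
    refine (Finset.sum_le_sum this).trans (le_of_eq ?_)
    simp
  rw [Real.norm_eq_abs] at h1
  rw [h3]
  have h7 := A.dt_pow_le_err₀
  calc _ ≤ S.dt * (C₁ * K * S.dt ^ qt + (qt + 1) * (C₂ / S.dt * (K * S.err₀ qs qt))) := by
        gcongr
        exact (abs_add_le _ _).trans (add_le_add h1 h4)
    _ = C₁ * K * S.dt ^ (qt + 1) + (qt + 1) * C₂ * K * S.err₀ qs qt := by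
        field_simp
        ring
    _ ≤ C₁ * K * S.err₀ qs qt + (qt + 1) * C₂ * K * S.err₀ qs qt := by gcongr
    _ = _ := by ring

/-- The difference between the shift of the ideal mapping and its smooth part. -/
noncomputable def shiftError (S : Slab d) (b : Pt d → ℝ → ℝ) (T : Fin S.mesh.card) (x : Pt d)
    (t : ℝ) : ℝ :=
  -((1 - b x t) * (S.mesh.cell T).interp 1 (fun y => S.φ y t - S.φh y t) x)

theorem shift_eq {S : Slab d} {b : Pt d → ℝ → ℝ} {T : Fin S.mesh.card} {x : Pt d} {t : ℝ}
    (hx : x ∈ S.mesh.elem T) : S.shift b x t = S.smoothShift b T x t + S.shiftError b T x t := by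
  rw [shift, φlin_sub_eq hx, smoothShift, shiftError]
  ring

/-- The remainder is `1 - b` times the linear interpolant of `φ - φh`. Spatial slopes come from
differences of vertex values, and time derivatives from those at the vertices. -/
theorem exists_shiftError_bound {qt : ℕ} (τ : Fin (qt + 1) → ℝ) (hτ : Function.Injective τ)
    (hτI : ∀ i, τ i ∈ Ioc (0 : ℝ) 1) (hqt : 1 ≤ qt) (d : ℕ) {K : ℝ} (hK : 1 ≤ K) : ∃ C : ℝ, 1 ≤ C ∧
    ∀ (S : Slab d) (qs m : ℕ) (ρ : ℝ) (b : Pt d → ℝ → ℝ) (T : Fin S.mesh.card),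
      S.ActiveElem qs qt m K ρ b T → ∀ x ∈ S.thick T, ∀ t ∈ S.I,
        |S.shiftError b T x t| ≤ C * S.err₀ qs qt ∧
        (∃ e' : Pt d →L[ℝ] ℝ, HasFDerivAt (fun y => S.shiftError b T y t) e' x ∧
          ‖e'‖ ≤ C * S.err₁ qs qt) ∧
        ∃ e' : ℝ →L[ℝ] ℝ, HasFDerivWithinAt (fun s => S.shiftError b T x s) e' S.I t ∧
          S.dt * ‖e'‖ ≤ C * S.err₀ qs qt := by
  obtain ⟨C₁, hC₁, H₁⟩ := exists_lin_error d K
  obtain ⟨C₂, hC₂, H₂⟩ := exists_time_derivative_error τ hτ hτI hqt hK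
  have hK0 : 0 < K := by linarith
  refine ⟨K * C₁ + C₁ + (d + 1) * ((1 + 2 * K) * C₂), ?_,
    fun S qs m ρ b T A x hx t ht => ?_⟩
  · have : 0 ≤ K * C₁ + (d + 1) * ((1 + 2 * K) * C₂) := by positivity
    linarith
  have hdt := A.dt_pos
  have e0 := A.err₀_nonneg
  have e1 := A.err₁_nonneg
  have hxn := ActiveElem.thick_subset_nbhd hx
  have hxb := A.thick_subset hx
  obtain ⟨-, -, h1, h2⟩ := H₁ S qs qt m ρ b T A t ht x hxn
  have hb := A.abs_one_sub_b_le hxb ht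
  set J := (S.mesh.cell T).interp 1 (fun y => S.φ y t - S.φh y t) x with hJ
  have hCle : ∀ e : ℝ, 0 ≤ e → ∀ c, c ≤ K * C₁ + C₁ + (d + 1) * ((1 + 2 * K) * C₂) →
    c * e ≤ (K * C₁ + C₁ + (d + 1) * ((1 + 2 * K) * C₂)) * e := fun e he c hc => by gcongr
  have p1 : 0 ≤ K * C₁ := by positivity
  have p2 : 0 ≤ (d + 1) * ((1 + 2 * K) * C₂) := by positivity
  refine ⟨?_, ?_, ?_⟩
  · rw [shiftError, abs_neg, abs_mul]
    calc _ ≤ 1 * (C₁ * S.err₀ qs qt) := by gcongr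
      _ ≤ _ := by
        rw [one_mul]
        exact hCle _ e0 _ (by linarith)
  · obtain ⟨bx, hbx, hbx'⟩ := A.b_smooth.exists_spatial_deriv Metric.isOpen_ball
    have h3 := ((S.mesh.cell T).differentiableAt_interp 1 (fun y => S.φ y t - S.φh y t) x).hasFDerivAt
    have h4 := (((hbx' x hxb t ht).const_sub 1).mul h3).neg
    refine ⟨_, h4, ?_⟩
    rw [norm_neg]
    refine (norm_add_le _ _).trans ?_
    rw [norm_smul, norm_smul, norm_neg, Real.norm_eq_abs, Real.norm_eq_abs]
    have h5 := hbx.bound (mk_mem_prod hxb ht)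
    calc _ ≤ 1 * (C₁ * S.err₁ qs qt) + (C₁ * S.err₀ qs qt) * K := by gcongr; exact hb
      _ ≤ 1 * (C₁ * S.err₁ qs qt) + (C₁ * S.err₁ qs qt) * K := by
          have := A.err₀_le_err₁
          gcongr
      _ = (K * C₁ + C₁) * S.err₁ qs qt := by ring
      _ ≤ _ := hCle _ e1 _ (by linarith)
  · obtain ⟨bt, hbt, hbt'⟩ : ∃ bt, HasDerivWithinAt (b x) bt S.I t ∧ |bt| ≤ K := by
      obtain ⟨-, f', hf', hf''⟩ := A.b_smooth.slice_right hxb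
      refine ⟨_, (hf' t ht).hasDerivWithinAt, ?_⟩
      have := (f' t).le_of_opNorm_le (hf''.bound ht) 1
      simpa using this
    choose ψ' hψ' hψ'b using fun v => H₂ d S qs m ρ b T A (S.mesh.cell T v)
      ((S.mesh.cell T).vertex_mem_body v) t ht
    have h3 : HasDerivWithinAt (fun s => (S.mesh.cell T).interp 1 (fun y => S.φ y s - S.φh y s) x)
        (∑ v, (S.mesh.cell T).coord v x * ψ' v) S.I t := by
      simp only [Cell.interp_one, smul_eq_mul]
      exact HasDerivWithinAt.fun_sum fun v _ => (hψ' v).const_mul _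
    have h4 : S.dt * |∑ v, (S.mesh.cell T).coord v x * ψ' v| ≤
        (d + 1) * ((1 + 2 * K) * C₂) * S.err₀ qs qt := by
      calc _ ≤ S.dt * ∑ v, (1 + 2 * K) * |ψ' v| := by
            gcongr
            refine (Finset.abs_sum_le_sum_abs _ _).trans (Finset.sum_le_sum fun v _ => ?_)
            rw [abs_mul]
            have := A.regular.abs_coord_le hxn v
            gcongr
        _ = ∑ v, (1 + 2 * K) * (S.dt * |ψ' v|) := by
            rw [Finset.mul_sum]
            exact Finset.sum_congr rfl fun v _ => by ring
        _ ≤ ∑ _v : Fin (d + 1), (1 + 2 * K) * (C₂ * S.err₀ qs qt) := by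
            refine Finset.sum_le_sum fun v _ => ?_
            have := hψ'b v
            gcongr
        _ = _ := by
            simp
            ring
    have h5 := ((hbt.const_sub 1).mul h3).neg
    refine ⟨_, h5.hasFDerivWithinAt, ?_⟩
    rw [ContinuousLinearMap.norm_toSpanSingleton, norm_neg]
    calc _ ≤ S.dt * (K * (C₁ * S.err₀ qs qt) + 1 * |∑ v, (S.mesh.cell T).coord v x * ψ' v|) := by
          gcongr
          refine (norm_add_le _ _).trans ?_
          rw [norm_mul, norm_mul, norm_neg, Real.norm_eq_abs, Real.norm_eq_abs, Real.norm_eq_abs,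
            Real.norm_eq_abs]
          gcongr
      _ = S.dt * (K * (C₁ * S.err₀ qs qt)) + S.dt * |∑ v, (S.mesh.cell T).coord v x * ψ' v| := by
          ring
      _ ≤ 1 * (K * (C₁ * S.err₀ qs qt)) + (d + 1) * ((1 + 2 * K) * C₂) * S.err₀ qs qt := by
          have := A.dt_le
          gcongr
      _ = (K * C₁ + (d + 1) * ((1 + 2 * K) * C₂)) * S.err₀ qs qt := by ring
      _ ≤ _ := hCle _ e0 _ (by linarith)

end Slab

end ShiftError

/-! ### Interpolation of the smooth part, and distance of the ideal mapping to it -/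

section ElementError

open Set Filter Topology

set_option maxSynthPendingDepth 3

namespace Slab

variable {d : ℕ}

/-- This pays for the time derivative that is missing if `qt = m`. If `Δt ≤ h` the left side is at
most `h^(m+2) ≤ h^qs`; otherwise one factor `h` is replaced by `Δt`, which gives `Δt^(qt+1)`. -/
theorem ActiveElem.sq_mul_dt_pow_le {S : Slab d} {qs qt m : ℕ} {K ρ : ℝ} {b : Pt d → ℝ → ℝ}
    {T : Fin S.mesh.card} (A : S.ActiveElem qs qt m K ρ b T) :
    S.h ^ 2 * S.dt ^ m ≤ S.err₁ qs qt := by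
  have hh := A.h_pos
  have hdt := A.dt_pos
  have h1 : S.h ^ 2 ≤ 1 := pow_le_one₀ hh.le A.h_le
  rcases A.qt_le.lt_or_eq with hlt | heq
  · calc S.h ^ 2 * S.dt ^ m ≤ 1 * S.dt ^ (qt + 1) :=
          mul_le_mul h1 (pow_le_pow_of_le_one hdt.le A.dt_le hlt) (by positivity) zero_le_one
      _ ≤ _ := by rw [one_mul]; exact A.dt_pow_le_err₁
  · rw [← heq]
    rcases le_total S.dt S.h with h2 | h2
    · calc S.h ^ 2 * S.dt ^ qt ≤ S.h ^ 2 * S.h ^ qt := by gcongr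
        _ = S.h ^ (qt + 2) := by ring
        _ ≤ S.h ^ qs := pow_le_pow_of_le_one hh.le A.h_le (by have := A.qs_le; omega)
        _ ≤ _ := A.pow_le_err₁
    · calc S.h ^ 2 * S.dt ^ qt ≤ S.h * S.dt ^ qt := by
            gcongr
            rw [sq]
            exact mul_le_of_le_one_left hh.le A.h_le
        _ ≤ S.dt * S.dt ^ qt := by gcongr
        _ = S.dt ^ (qt + 1) := by ring
        _ ≤ _ := A.dt_pow_le_err₁

/-- The errors of interpolation in time of the smooth part of the ideal mapping. -/
theorem exists_smooth_time_error {qt : ℕ} (τ : Fin (qt + 1) → ℝ) (hτ : Function.Injective τ)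
    (hτI : ∀ i, τ i ∈ Ioc (0 : ℝ) 1) (hqt : 1 ≤ qt) (d m : ℕ) (hm : 1 ≤ m) {K ρ a c C₁ : ℝ}
    (hK : 1 ≤ K) (hc : 0 < c) (hC₁ : 1 ≤ C₁) (haK : a * K ≤ ρ / 2) (haK' : a * K ≤ 1 / 2) :
    ∃ C η : ℝ, 1 ≤ C ∧ 0 < η ∧
    ∀ (S : Slab d) (qs : ℕ) (b : Pt d → ℝ → ℝ) (T : Fin S.mesh.card),
      S.ActiveElem qs qt m K ρ b T → S.h ≤ η →
      ∀ D, DisplacementOn S.φ (S.mesh.cell T 0) ρ S.I m a c C₁ D →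
      ∀ x ∈ S.thick T,
        (∀ t ∈ S.I, ‖S.timeError τ t fun s => S.offset D ((x, s), S.smoothShift b T x s)‖ ≤
          C * S.err₀ qs qt) ∧
        (∀ t ∈ S.I, ∀ f', HasDerivWithinAt
          (fun s => S.offset D ((x, s), S.smoothShift b T x s)) f' S.I t →
          S.dt * ‖f' - ∑ i, deriv (S.timeBasis τ i) t • S.offset D ((x, S.timeNode τ i),
            S.smoothShift b T x (S.timeNode τ i))‖ ≤ C * S.err₀ qs qt) ∧
        ∃ Q : ℝ → (Pt d →L[ℝ] Pt d),
          (∀ t ∈ S.I, HasFDerivAt (fun y => S.offset D ((y, t), S.smoothShift b T y t)) (Q t) x) ∧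
          ∀ t ∈ S.I, ‖S.timeError τ t Q‖ ≤ C * S.err₁ qs qt := by
  obtain ⟨C₂, η, hC₂, hη, H⟩ := exists_smooth_regular d m hK hc hC₁ haK haK'
  obtain ⟨C₃, hC₃, H₃⟩ := exists_timeInterp_error τ hτ hτI hqt
  obtain ⟨C₄, hC₄, H₄⟩ := exists_timeError_smul_le τ hτ hτI hqt (m - 1)
  refine ⟨C₃ * C₂ + C₄ * (C₂ * C₂ + C₂ * C₂), η, by
    have : 0 ≤ C₄ * (C₂ * C₂ + C₂ * C₂) := by positivity
    nlinarith, hη, fun S qs b T A hh1 D hD x hx => ?_⟩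
  obtain ⟨-, -, hqt', hQ⟩ := H S qs qt b T A hh1 D hD
  have hdt := A.dt_pos
  have hh := A.h_pos
  have e0 := A.err₀_nonneg
  have e1 := A.err₁_nonneg
  have p0 := A.dt_pow_le_err₀
  have p1 := A.dt_pow_le_err₁
  have hpos : 0 ≤ C₄ * (C₂ * C₂ + C₂ * C₂) := by positivity
  have hqle : qt + 1 ≤ m + 1 := by linarith [A.qt_le]
  have hfin : C₃ * C₂ * S.dt ^ (qt + 1) ≤ (C₃ * C₂ + C₄ * (C₂ * C₂ + C₂ * C₂)) * S.err₀ qs qt := by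
    have : C₃ * C₂ ≤ C₃ * C₂ + C₄ * (C₂ * C₂ + C₂ * C₂) := by linarith
    gcongr
  have h3 := H₃ d S hdt (Pt d) _ C₂ ((hqt' x hx).mono_order hqle)
  refine ⟨fun t ht => (h3 t ht).1.trans hfin, fun t ht f' hf' => ?_, ?_⟩
  · calc _ ≤ S.dt * (C₃ * C₂ * S.dt ^ qt) := by
          gcongr
          exact (h3 t ht).2 f' hf'
      _ = C₃ * C₂ * S.dt ^ (qt + 1) := by ring
      _ ≤ _ := hfin
  · obtain ⟨α, u, v, hα, hαb, hu, hv, hQd⟩ := hQ x hx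
    refine ⟨fun t => v t + α t • u t, hQd, fun t ht => ?_⟩
    rw [timeError_add]
    have h4 := (H₃ d S hdt _ v C₂ (hv.mono_order hqle) t ht).1
    -- The product estimate with `n = m - 1`: the factor `α` is small and regular enough, while `u`
    -- has only `m` derivatives. The extra term is `h^2 Δt^m`.
    have h5 := H₄ d S hdt A.dt_le _ α u C₂ C₂ (C₂ * S.h ^ 2) (hα.mono_order hqle) hαb
      (by rwa [Nat.sub_add_cancel hm]) t ht
    rw [Nat.sub_add_cancel hm] at h5
    have h6 := A.sq_mul_dt_pow_le
    calc _ ≤ C₃ * C₂ * S.dt ^ (qt + 1) + C₄ * (C₂ * C₂ * S.dt ^ (qt + 1) +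
          C₂ * S.h ^ 2 * C₂ * S.dt ^ m) := (norm_add_le _ _).trans (add_le_add h4 h5)
      _ = C₃ * C₂ * S.dt ^ (qt + 1) + C₄ * (C₂ * C₂ * S.dt ^ (qt + 1) +
          C₂ * C₂ * (S.h ^ 2 * S.dt ^ m)) := by ring
      _ ≤ C₃ * C₂ * S.err₁ qs qt + C₄ * (C₂ * C₂ * S.err₁ qs qt +
          C₂ * C₂ * S.err₁ qs qt) := by gcongr
      _ = _ := by ring

/-- The errors of interpolation in space of the smooth part of the ideal mapping. -/
theorem exists_smooth_space_error (d qs m : ℕ) (hqs : 1 ≤ qs) {K ρ a c C₁ : ℝ} (hK : 1 ≤ K)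
    (hc : 0 < c) (hC₁ : 1 ≤ C₁) (haK : a * K ≤ ρ / 2) (haK' : a * K ≤ 1 / 2) :
    ∃ C η : ℝ, 1 ≤ C ∧ 0 < η ∧
    ∀ (S : Slab d) (qt : ℕ) (b : Pt d → ℝ → ℝ) (T : Fin S.mesh.card),
      S.ActiveElem qs qt m K ρ b T → S.h ≤ η →
      ∀ D, DisplacementOn S.φ (S.mesh.cell T 0) ρ S.I m a c C₁ D →
      ∀ x ∈ S.mesh.elem T, ∀ t ∈ S.I,
        ‖(S.mesh.cell T).interp qs (fun y => S.offset D ((y, t), S.smoothShift b T y t)) x -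
          S.offset D ((x, t), S.smoothShift b T x t)‖ ≤ C * S.err₀ qs qt ∧
        ∀ Q, HasFDerivAt (fun y => S.offset D ((y, t), S.smoothShift b T y t)) Q x →
          ‖fderiv ℝ ((S.mesh.cell T).interp qs
            (fun y => S.offset D ((y, t), S.smoothShift b T y t))) x - Q‖ ≤ C * S.err₁ qs qt := by
  obtain ⟨C₂, η, hC₂, hη, H⟩ := exists_smooth_regular d m hK hc hC₁ haK haK'
  obtain ⟨C₃, hC₃, H₃⟩ := Cell.Regular.exists_interp_error d (k := qs) hqs (2 * K)
  refine ⟨C₃ * C₂, η, by nlinarith, hη, fun S qt b T A hh1 D hD x hx t ht => ?_⟩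
  obtain ⟨-, hqx, -, -⟩ := H S qs qt b T A hh1 D hD
  -- The smooth shift uses the linear interpolant of this one element as a polynomial beyond `T`.
  -- Hence the offset is smooth on a convex open neighbourhood, and derivatives at boundary points
  -- of `T` are covered.
  have h1 := H₃ (Pt d) _ _ A.regular (S.thick T) _ C₂ ActiveElem.convex_thick A.elem_subset_thick
    ((hqx t ht).mono_order (show qs + 1 ≤ m + 1 by linarith [A.qs_le])) x (A.elem_subset_nbhd hx)
    (ActiveElem.isOpen_thick.mem_nhds (A.elem_subset_thick hx))
  have p0 := A.pow_le_err₀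
  have p1 := A.pow_le_err₁
  refine ⟨?_, fun Q hQ => ?_⟩
  · rw [norm_sub_rev]
    exact h1.1.trans (by gcongr)
  · rw [norm_sub_rev]
    exact (h1.2 Q hQ).trans (by gcongr)

/-- The difference between the ideal mapping and its smooth part. -/
theorem exists_ideal_error {qt : ℕ} (τ : Fin (qt + 1) → ℝ) (hτ : Function.Injective τ)
    (hτI : ∀ i, τ i ∈ Ioc (0 : ℝ) 1) (hqt : 1 ≤ qt) (d m : ℕ) (hm : 1 ≤ m) {K ρ a c C₁ : ℝ}
    (hK : 1 ≤ K) (hc : 0 < c) (hC₁ : 1 ≤ C₁) (haK : a * K ≤ ρ / 2) (haK' : a * K ≤ 1 / 2) :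
    ∃ C η : ℝ, 1 ≤ C ∧ 0 < η ∧
    ∀ (S : Slab d) (qs : ℕ) (b : Pt d → ℝ → ℝ) (T : Fin S.mesh.card),
      S.ActiveElem qs qt m K ρ b T → S.h ≤ η → S.dt ^ (qt + 1) ≤ η * S.h →
      ∀ D, DisplacementOn S.φ (S.mesh.cell T 0) ρ S.I m a c C₁ D →
      ∀ x ∈ S.thick T, ∀ t ∈ S.I,
        ‖S.offset D ((x, t), S.smoothShift b T x t + S.shiftError b T x t) -
          S.offset D ((x, t), S.smoothShift b T x t)‖ ≤ C * S.err₀ qs qt ∧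
        (∃ L₁ L₂ : Pt d →L[ℝ] Pt d, HasFDerivAt
            (fun y => S.offset D ((y, t), S.smoothShift b T y t + S.shiftError b T y t)) L₁ x ∧
          HasFDerivAt (fun y => S.offset D ((y, t), S.smoothShift b T y t)) L₂ x ∧
          ‖L₁ - L₂‖ ≤ C * S.err₁ qs qt) ∧
        ∃ v₁ v₂ : Pt d, HasDerivWithinAt
            (fun s => S.offset D ((x, s), S.smoothShift b T x s + S.shiftError b T x s)) v₁ S.I t ∧
          HasDerivWithinAt (fun s => S.offset D ((x, s), S.smoothShift b T x s)) v₂ S.I t ∧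
          S.dt * ‖v₁ - v₂‖ ≤ C * S.err₀ qs qt := by
  obtain ⟨C₂, η₂, hC₂, hη₂, H₂⟩ := exists_smooth_regular d m hK hc hC₁ haK haK'
  obtain ⟨C₃, hC₃, H₃⟩ := exists_shiftError_bound τ hτ hτI hqt d hK
  obtain ⟨C₄, hC₄, H₄⟩ := exists_smoothShift_bound d m hK
  have hK0 : 0 < K := by linarith
  obtain ⟨V, hV⟩ : ∃ V, V = 2 ^ (m + 1) * (C₁ * K) := ⟨_, rfl⟩
  have hV1 : 1 ≤ V := by
    rw [hV]
    have h1 : (1 : ℝ) ≤ 2 ^ (m + 1) := one_le_pow₀ (by norm_num)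
    have h2 : 1 ≤ C₁ * K := by nlinarith
    nlinarith
  refine ⟨V * (C₃ * (1 + C₄) + C₃), min η₂ (c / (6 * (C₃ + C₄))), by
    have : 0 ≤ C₃ * (1 + C₄) := by positivity
    nlinarith, by positivity,
    fun S qs b T A hh1 hdt1 D hD x hx t ht => ?_⟩
  have hdt := A.dt_pos
  have hh := A.h_pos
  have e0 := A.err₀_nonneg
  have e1 := A.err₁_nonneg
  obtain ⟨hσmem, -, -, -⟩ := H₂ S qs qt b T A (hh1.trans (min_le_left _ _)) D hD
  obtain ⟨-, hσt, hσb, hσd⟩ := H₄ S qs qt ρ b T A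
  have hhalf : ∀ x ∈ S.thick T, x ∈ Metric.ball (S.mesh.cell T 0) (ρ / 2) := fun x hx =>
    A.nbhd_subset_half (ActiveElem.thick_subset_nbhd hx)
  have hsmall := A.sq_add_err₀_le (hh1.trans (min_le_right _ _))
    (hdt1.trans (by gcongr; exact min_le_right _ _))
  have hσmem' : ∀ x ∈ S.thick T, ∀ t ∈ S.I,
      S.smoothShift b T x t + S.shiftError b T x t ∈ Ioo (-c) c := fun x hx t ht => by
    refine abs_lt.1 ?_
    have h1 := hσb x hx t ht
    have h2 := (H₃ S qs m ρ b T A x hx t ht).1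
    calc _ ≤ C₄ * S.h ^ 2 + C₃ * S.err₀ qs qt := (abs_add_le _ _).trans (add_le_add h1 h2)
      _ ≤ (C₃ + C₄) * (S.h ^ 2 + S.err₀ qs qt) := by nlinarith [sq_nonneg S.h]
      _ ≤ (C₃ + C₄) * (3 * (c / (6 * (C₃ + C₄))) * S.h) := by gcongr
      _ = c / 2 * S.h := by field_simp; norm_num
      _ ≤ c / 2 * 1 := by
          have := A.h_le
          gcongr
      _ < c := by linarith
  obtain ⟨U, hU⟩ : ∃ U : Set ((Pt d × ℝ) × ℝ),
    U = (Metric.ball (S.mesh.cell T 0) (ρ / 2) ×ˢ S.I) ×ˢ Ioo (-c) c := ⟨_, rfl⟩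
  have hUc : Convex ℝ U := by
    rw [hU]
    exact ((convex_ball _ _).prod S.convex_I).prod (convex_Ioo _ _)
  have hmem : ∀ x ∈ S.thick T, ∀ t ∈ S.I, ((x, t), S.smoothShift b T x t) ∈ U :=
    fun x hx t ht => by
      rw [hU]
      exact mk_mem_prod (mk_mem_prod (hhalf x hx) ht) (hσmem x hx t ht)
  have hmem' : ∀ x ∈ S.thick T, ∀ t ∈ S.I,
      ((x, t), S.smoothShift b T x t + S.shiftError b T x t) ∈ U := fun x hx t ht => by
    rw [hU]
    exact mk_mem_prod (mk_mem_prod (hhalf x hx) ht) (hσmem' x hx t ht)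
  have hVs : BddDerivOn U (m + 1) V (S.offset D) := by
    have h1 := (A.level.bdd_grad.mono_set (prod_mono_left A.half_subset)).comp_affine
      (u := U) (g := Prod.fst)
      (ContinuousLinearMap.fst ℝ (Pt d × ℝ) ℝ) (ContinuousLinearMap.norm_fst_le ..)
      (fun _ _ => hasFDerivWithinAt_fst) fun _ hp => by
        rw [hU] at hp
        exact hp.1
    rw [hV]
    rw [hU] at h1 ⊢
    exact hD.smooth.smul h1
  obtain ⟨E1, ⟨ex, hex, hexb⟩, ⟨et, het, hetb⟩⟩ := H₃ S qs m ρ b T A x hx t ht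
  obtain ⟨σx, hσxb, hσx⟩ := hσd x hx
  -- Comparing derivatives needs two bounded derivatives of the offset, available because `m ≥ 1`.
  have hVm : BddDerivOn U ((m - 1) + 2) V (S.offset D) := hVs.mono_order (by omega)
  have hle : ∀ e : ℝ, 0 ≤ e → C₃ * e ≤ (C₃ * (1 + C₄) + C₃) * e := fun e he => by
    gcongr
    nlinarith
  refine ⟨?_, ?_, ?_⟩
  · have h1 := (hVm.mono_order (show 0 + 1 ≤ m - 1 + 2 by omega)).norm_sub_le hUc
      (hmem x hx t ht) (hmem' x hx t ht)
    have h2 : ‖(((x, t), S.smoothShift b T x t + S.shiftError b T x t) : (Pt d × ℝ) × ℝ) -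
        ((x, t), S.smoothShift b T x t)‖ = |S.shiftError b T x t| := by
      simp [Prod.norm_def]
    rw [h2] at h1
    calc _ ≤ V * |S.shiftError b T x t| := h1
      _ ≤ V * ((C₃ * (1 + C₄) + C₃) * S.err₀ qs qt) := by
          have := E1.trans (hle _ e0)
          gcongr
      _ = _ := by ring
  · have hopen : S.thick T ∈ 𝓝 x := ActiveElem.isOpen_thick.mem_nhds hx
    obtain ⟨L₁, L₂, h1, h2, h3⟩ := BddDerivOn.exists_shift_sub_le hUc hVm hx
      (hasFDerivAt_prodMk_left (𝕜 := ℝ) x t).hasFDerivWithinAt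
      (ContinuousLinearMap.norm_inl_le_one ℝ (Pt d) ℝ)
      (hσx t ht).hasFDerivWithinAt hex.hasFDerivWithinAt (fun y hy => hmem' y hy t ht)
      (fun y hy => hmem y hy t ht)
    refine ⟨L₁, L₂, h1.hasFDerivAt hopen, h2.hasFDerivAt hopen, h3.trans ?_⟩
    have h4 := hσxb.bound ht
    have h5 := A.err₀_le_err₁
    calc _ ≤ V * (C₃ * S.err₁ qs qt * (1 + C₄) + C₃ * S.err₁ qs qt) := by
          gcongr
          exact E1.trans (by gcongr)
      _ = _ := by ring
  · obtain ⟨σt, hσtd, hσtb⟩ : ∃ σt : ℝ →L[ℝ] ℝ,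
        HasFDerivWithinAt (S.smoothShift b T x) σt S.I t ∧ ‖σt‖ ≤ C₄ := by
      obtain ⟨-, f', hf', hf''⟩ := hσt x hx
      exact ⟨f' t, hf' t ht, hf''.bound ht⟩
    obtain ⟨L₁, L₂, h1, h2, h3⟩ := BddDerivOn.exists_shift_sub_le hUc hVm ht
      (hasFDerivAt_prodMk_right (𝕜 := ℝ) x t).hasFDerivWithinAt
      (ContinuousLinearMap.norm_inr_le_one ℝ (Pt d) ℝ)
      hσtd het (fun s hs => hmem' x hx s hs) (fun s hs => hmem x hx s hs)
    refine ⟨L₁ 1, L₂ 1, h1.hasDerivWithinAt, h2.hasDerivWithinAt, ?_⟩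
    have h4 : ‖L₁ 1 - L₂ 1‖ ≤ ‖L₁ - L₂‖ := by
      have := (L₁ - L₂).le_opNorm 1
      simpa using this
    calc _ ≤ S.dt * (V * (|S.shiftError b T x t| * (1 + ‖σt‖) + ‖et‖)) := by
          gcongr
          exact h4.trans h3
      _ = V * (S.dt * |S.shiftError b T x t| * (1 + ‖σt‖) + S.dt * ‖et‖) := by ring
      _ ≤ V * (1 * (C₃ * S.err₀ qs qt) * (1 + C₄) + C₃ * S.err₀ qs qt) := by
          have := A.dt_le
          gcongr
      _ = _ := by ring

end Slab

end ElementError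

/-! ### The error on an active element -/

section ActiveError

open Set Filter Topology

set_option maxSynthPendingDepth 3

theorem Cell.interp_id {d k : ℕ} (T : Cell d) (hk : 1 ≤ k) (x : Pt d) :
    T.interp k (fun y => y) x = x := by
  have := T.interp_multilinear hk hk
    ((continuousMultilinearCurryFin1 ℝ (Pt d) (Pt d)).symm (ContinuousLinearMap.id ℝ (Pt d))) 0 x
  simpa using this

namespace Slab

variable {d : ℕ}

theorem sum_timeBasis (S : Slab d) {qt : ℕ} {τ : Fin (qt + 1) → ℝ} (hdt : 0 < S.dt)
    (hτ : Function.Injective τ) (t : ℝ) : ∑ i, S.timeBasis τ i t = 1 := by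
  simpa using S.sum_timeBasis_pow hdt hτ (Nat.zero_le qt) 0 t

theorem sum_deriv_timeBasis (S : Slab d) {qt : ℕ} {τ : Fin (qt + 1) → ℝ} (hdt : 0 < S.dt)
    (hτ : Function.Injective τ) (t : ℝ) : ∑ i, deriv (S.timeBasis τ i) t = 0 := by
  have h1 : HasDerivAt (fun s => ∑ i, S.timeBasis τ i s) (∑ i, deriv (S.timeBasis τ i) t) t :=
    HasDerivAt.fun_sum fun i _ => (S.differentiable_timeBasis i t).hasDerivAt
  have h2 : (fun s => ∑ i, S.timeBasis τ i s) = fun _ => 1 :=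
    funext fun s => S.sum_timeBasis hdt hτ s
  rw [h2] at h1
  exact h1.unique (hasDerivAt_const t 1)

theorem norm_sum_smul_le {ι F : Type} [Fintype ι] [NormedAddCommGroup F] [NormedSpace ℝ F]
    {a : ι → ℝ} {v : ι → F} {A B : ℝ} (ha : ∀ i, |a i| ≤ A) (hv : ∀ i, ‖v i‖ ≤ B) :
    ‖∑ i, a i • v i‖ ≤ Fintype.card ι * (A * B) := by
  refine (norm_sum_le _ _).trans ?_
  have : ∀ i ∈ (Finset.univ : Finset ι), ‖a i • v i‖ ≤ A * B := fun i _ => by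
    rw [norm_smul, Real.norm_eq_abs]
    have h1 := (abs_nonneg _).trans (ha i)
    exact mul_le_mul (ha i) (hv i) (norm_nonneg _) h1
  refine (Finset.sum_le_sum this).trans (le_of_eq ?_)
  simp

/-- The nodal values of the discrete mapping compared with the smooth part of the ideal mapping. -/
theorem exists_smooth_nodal_error {qt : ℕ} (τ : Fin (qt + 1) → ℝ) (hτ : Function.Injective τ)
    (hτI : ∀ i, τ i ∈ Ioc (0 : ℝ) 1) (hqt : 1 ≤ qt) (d qs m : ℕ) (hqs : 1 ≤ qs) (hm : 1 ≤ m)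
    {K ρ a c C₁ : ℝ} (hK : 1 ≤ K) (hρ : 0 < ρ) (hc : 0 < c) (hC₁ : 1 ≤ C₁) (haK : a * K ≤ ρ / 2)
    (haK' : a * K ≤ 1 / 2) : ∃ C η : ℝ, 1 ≤ C ∧ 0 < η ∧
    ∀ (S : Slab d) (b : Pt d → ℝ → ℝ) (A : Set (Fin S.mesh.card)) (g : SearchDirection),
      (∀ T ∈ A, S.ActiveElem qs qt m K ρ b T) → S.h ≤ η → S.dt ^ (qt + 1) ≤ η * S.h →
      ∀ T ∈ A, ∀ D, DisplacementOn S.φ (S.mesh.cell T 0) ρ S.I m a c C₁ D →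
      ∀ t ∈ S.I, ∀ E : Pt d → Pt d, (E = fun z => S.mesh.nodeAverage qs A (S.ΨhΓ qs g A b t) z -
        (z + S.offset D ((z, t), S.smoothShift b T z t))) →
      ∀ α ∈ Finset.univ.piAntidiag qs, ‖E ((S.mesh.cell T).node qs α)‖ ≤ C * S.err₀ qs qt ∧
        ∀ β ∈ Finset.univ.piAntidiag qs,
          ‖E ((S.mesh.cell T).node qs α) - E ((S.mesh.cell T).node qs β)‖ ≤
            C * (S.h * S.err₁ qs qt) := by
  obtain ⟨C₂, η₂, hC₂, hη₂, H₂⟩ := exists_nodal_error d qs m hqs hK hρ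
  obtain ⟨C₃, hC₃, H₃⟩ := exists_leadingError_bound d m hK
  obtain ⟨C₄, η₄, hC₄, hη₄, H₄⟩ := exists_ideal_error τ hτ hτI hqt d m hm hK hc hC₁ haK haK'
  obtain ⟨η₅, hη₅, H₅⟩ := exists_distΓ_eq (C := C₁) d hc haK
  refine ⟨2 * C₂ + C₃ + C₄, min η₂ (min η₄ η₅), by linarith, by positivity,
    fun S b A g hA hh1 hdt1 T hT D hD t ht E hE => ?_⟩
  have AT := hA T hT
  have hh := AT.h_pos
  have e0 := AT.err₀_nonneg
  have e1 := AT.err₁_nonneg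
  have e2 : 0 ≤ S.h * S.err₁ qs qt := by positivity
  have hdt2 := hdt1.trans (show _ ≤ η₂ * S.h by gcongr; exact min_le_left _ _)
  have hdt4 := hdt1.trans (show _ ≤ η₄ * S.h by
    gcongr; exact (min_le_right _ _).trans (min_le_left _ _))
  have hdt5 := hdt1.trans (show _ ≤ η₅ * S.h by
    gcongr; exact (min_le_right _ _).trans (min_le_right _ _))
  have G₂ := H₂ S qt b A g hA (hh1.trans (min_le_left _ _)) hdt2 T hT t ht
  have G₄ := H₄ S qs b T AT (hh1.trans ((min_le_right _ _).trans (min_le_left _ _))) hdt4 D hD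
  have G₅ := H₅ S qs qt m b T AT (hh1.trans ((min_le_right _ _).trans (min_le_right _ _))) hdt5
    D hD t ht
  obtain ⟨w, hw⟩ : ∃ w : Pt d → Pt d, w = fun z =>
    S.offset D ((z, t), S.smoothShift b T z t + S.shiftError b T z t) -
      S.offset D ((z, t), S.smoothShift b T z t) := ⟨_, rfl⟩
  obtain ⟨u, hu⟩ : ∃ u : Pt d → Pt d, u = fun z => S.mesh.nodeAverage qs A (S.ΨhΓ qs g A b t) z -
    S.ΨΓ b z t - S.leadingError b z t := ⟨_, rfl⟩
  -- Three contributions. The nodal comparison error `u` is `O(h err₁)`, so nothing need be known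
  -- about its slope. The leading error and `w` have size `err₀`, but they are Lipschitz with
  -- constant of order `err₁`.
  have hdec : ∀ z ∈ S.mesh.elem T, E z = u z + S.leadingError b z t + w z := fun z hz => by
    have h1 : S.ΨΓ b z t = z + S.offset D ((z, t), S.smoothShift b T z t +
        S.shiftError b T z t) := by
      rw [ΨΓ, (G₅ z hz).2, shift_eq hz]
      rfl
    rw [hE, hu, hw]
    simp only [h1]
    abel
  have hwLip : ∀ x ∈ S.mesh.elem T, ∀ y ∈ S.mesh.elem T,
      ‖w x - w y‖ ≤ C₄ * (S.h * S.err₁ qs qt) := fun x hx y hy => by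
    have h1 : ∀ z ∈ S.mesh.elem T, ∃ L, HasFDerivWithinAt w L (S.mesh.elem T) z ∧
        ‖L‖ ≤ C₄ * S.err₁ qs qt := fun z hz => by
      obtain ⟨-, ⟨L₁, L₂, h1, h2, h3⟩, -⟩ := G₄ z (AT.elem_subset_thick hz) t ht
      refine ⟨L₁ - L₂, ?_, h3⟩
      rw [hw]
      exact (h1.sub h2).hasFDerivWithinAt
    choose! L hL hLb using h1
    have h2 := (S.mesh.cell T).convex_body.norm_image_sub_le_of_norm_hasFDerivWithin_le hL hLb hy hx
    have h3 := AT.regular.diam x hx y hy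
    calc _ ≤ C₄ * S.err₁ qs qt * ‖x - y‖ := h2
      _ ≤ C₄ * S.err₁ qs qt * S.h := by gcongr
      _ = _ := by ring
  intro α hα
  have hz := AT.node_mem AT.qs_pos hα
  have hue : ∀ β ∈ Finset.univ.piAntidiag qs, ‖u ((S.mesh.cell T).node qs β)‖ ≤
      C₂ * (S.h * S.err₁ qs qt) := fun β hβ => by
    rw [hu]
    exact G₂ β hβ
  refine ⟨?_, fun β hβ => ?_⟩
  · rw [hdec _ hz]
    have h1 := (H₃ S qs qt ρ b T AT t ht _ hz).1
    have h2 := (G₄ _ (AT.elem_subset_thick hz) t ht).1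
    have h3 : ‖w ((S.mesh.cell T).node qs α)‖ ≤ C₄ * S.err₀ qs qt := by
      rw [hw]
      exact h2
    have h4 : C₂ * (S.h * S.err₁ qs qt) ≤ C₂ * S.err₀ qs qt := by
      have := AT.mul_err₁_le_err₀
      gcongr
    have h5 : 0 ≤ C₂ * S.err₀ qs qt := by positivity
    refine (norm_add₃_le).trans ?_
    linarith [hue α hα]
  · have hz' := AT.node_mem AT.qs_pos hβ
    rw [hdec _ hz, hdec _ hz']
    have h1 := (H₃ S qs qt ρ b T AT t ht _ hz).2 _ hz'
    have h2 := hwLip _ hz _ hz'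
    have h3 := norm_sub_le (u ((S.mesh.cell T).node qs α)) (u ((S.mesh.cell T).node qs β))
    rw [show ∀ p q r p' q' r' : Pt d, p + q + r - (p' + q' + r') = (p - p') + (q - q') + (r - r')
      from fun p q r p' q' r' => by abel]
    refine (norm_add₃_le).trans ?_
    linarith [hue α hα, hue β hβ]

/-- The error estimates on an active element, for extensions of the mappings to smooth functions. -/
theorem exists_element_error {qt : ℕ} (τ : Fin (qt + 1) → ℝ) (hτ : Function.Injective τ)
    (hτI : ∀ i, τ i ∈ Ioc (0 : ℝ) 1) (hqt : 1 ≤ qt) (d qs m : ℕ) (hqs : 1 ≤ qs) (hm : 1 ≤ m)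
    {K ρ : ℝ} (hK : 1 ≤ K) (hρ : 0 < ρ) : ∃ C η : ℝ, 1 ≤ C ∧ 0 < η ∧
    ∀ (S : Slab d) (b : Pt d → ℝ → ℝ) (A : Set (Fin S.mesh.card)) (g : SearchDirection),
      (∀ T ∈ A, S.ActiveElem qs qt m K ρ b T) → S.h ≤ η → S.dt ^ (qt + 1) ≤ η * S.h →
      ∀ T ∈ A, ∃ Ψ Θ : Pt d → ℝ → Pt d, ∀ x ∈ S.mesh.elem T, ∀ t ∈ S.I,
        S.ΨΓ b x t = Ψ x t ∧ S.ΘΓ qs τ g A b x t = Θ x t ∧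
        ‖Θ x t - Ψ x t‖ ≤ C * S.err₀ qs qt ∧
        (∃ θ ψ : Pt d, HasDerivWithinAt (Θ x) θ S.I t ∧ HasDerivWithinAt (Ψ x) ψ S.I t ∧
          S.dt * ‖θ - ψ‖ ≤ C * S.err₀ qs qt) ∧
        ∃ L L' : Pt d →L[ℝ] Pt d, HasFDerivAt (fun y => Θ y t) L x ∧
          HasFDerivAt (fun y => Ψ y t) L' x ∧ ‖L - L'‖ ≤ C * S.err₁ qs qt := by
  obtain ⟨a, c, C₁, ha, haK, haK', hc, hC₁, HD⟩ := LevelSetOn.exists_displacementOn d m hK hρ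
  obtain ⟨C₂, η₂, hC₂, hη₂, H₂⟩ :=
    exists_smooth_nodal_error τ hτ hτI hqt d qs m hqs hm hK hρ hc hC₁ haK haK'
  obtain ⟨C₃, η₃, hC₃, hη₃, H₃⟩ := exists_smooth_time_error τ hτ hτI hqt d m hm hK hc hC₁ haK haK'
  obtain ⟨C₄, η₄, hC₄, hη₄, H₄⟩ := exists_ideal_error τ hτ hτI hqt d m hm hK hc hC₁ haK haK'
  obtain ⟨η₅, hη₅, H₅⟩ := exists_distΓ_eq (C := C₁) d hc haK
  obtain ⟨C₆, η₆, hC₆, hη₆, H₆⟩ := exists_smooth_space_error d qs m hqs hK hc hC₁ haK haK'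
  obtain ⟨C₇, hC₇, H₇⟩ := Cell.Regular.exists_interp_bound d qs (2 * K)
  obtain ⟨C₈, hC₈, H₈⟩ := Cell.Regular.exists_interp_slope_bound d hqs (2 * K)
  obtain ⟨C₉, hC₉, H₉⟩ := exists_timeBasis_bound τ
  obtain ⟨η, hη⟩ : ∃ η, η = min (min η₂ η₃) (min η₄ (min η₅ η₆)) := ⟨_, rfl⟩
  have l2 : η ≤ η₂ := hη ▸ (min_le_left _ _).trans (min_le_left _ _)
  have l3 : η ≤ η₃ := hη ▸ (min_le_left _ _).trans (min_le_right _ _)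
  have l4 : η ≤ η₄ := hη ▸ (min_le_right _ _).trans (min_le_left _ _)
  have l5 : η ≤ η₅ := hη ▸ (min_le_right _ _).trans ((min_le_right _ _).trans (min_le_left _ _))
  have l6 : η ≤ η₆ := hη ▸ (min_le_right _ _).trans ((min_le_right _ _).trans (min_le_right _ _))
  have hη0 : 0 < η := by rw [hη]; positivity
  obtain ⟨N, hN⟩ : ∃ N : ℝ, N = Fintype.card (Fin (qt + 1)) := ⟨_, rfl⟩
  have hN0 : 0 ≤ N := by rw [hN]; positivity
  refine ⟨N * (C₉ * ((C₇ + C₈) * C₂ + C₆)) + C₃ + C₄, η, ?_, hη0,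
    fun S b A g hA hh1 hdt1 T hT => ?_⟩
  · have : 0 ≤ N * (C₉ * ((C₇ + C₈) * C₂ + C₆)) := by positivity
    linarith
  have AT := hA T hT
  have hh := AT.h_pos
  have hdt := AT.dt_pos
  have e0 := AT.err₀_nonneg
  have e1 := AT.err₁_nonneg
  obtain ⟨D, hD⟩ := HD _ _ _ AT.level
  have G₂ := H₂ S b A g hA (hh1.trans l2) (hdt1.trans (by gcongr)) T hT D hD
  have G₃ := H₃ S qs b T AT (hh1.trans l3) D hD
  have G₄ := H₄ S qs b T AT (hh1.trans l4) (hdt1.trans (by gcongr)) D hD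
  have G₅ := H₅ S qs qt m b T AT (hh1.trans l5) (hdt1.trans (by gcongr)) D hD
  have G₆ := H₆ S qt b T AT (hh1.trans l6) D hD
  -- the smooth part, its perturbation, and the nodal values
  obtain ⟨f, hf⟩ : ∃ f : Pt d → ℝ → Pt d,
    f = fun z t => S.offset D ((z, t), S.smoothShift b T z t) := ⟨_, rfl⟩
  obtain ⟨F, hF⟩ : ∃ F : Pt d → ℝ → Pt d, F = fun z t =>
    S.offset D ((z, t), S.smoothShift b T z t + S.shiftError b T z t) := ⟨_, rfl⟩
  obtain ⟨ν, hν⟩ : ∃ ν : Fin (qt + 1) → Pt d → Pt d, ν = fun i =>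
    S.mesh.nodeAverage qs A (S.ΨhΓ qs g A b (S.timeNode τ i)) := ⟨_, rfl⟩
  obtain ⟨E, hE⟩ : ∃ E : Fin (qt + 1) → Pt d → Pt d, E = fun i z =>
    ν i z - (z + f z (S.timeNode τ i)) := ⟨_, rfl⟩
  obtain ⟨J, hJ⟩ : ∃ J : (Pt d → Pt d) → Pt d → Pt d, J = (S.mesh.cell T).interp qs := ⟨_, rfl⟩
  have hti := fun i => S.timeNode_mem hdt hτI i
  have hEe : ∀ i, E i = fun z => ν i z - (z + f z (S.timeNode τ i)) := fun i => by rw [hE]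
  have hEi : ∀ i, E i = fun z => S.mesh.nodeAverage qs A (S.ΨhΓ qs g A b (S.timeNode τ i)) z -
      (z + S.offset D ((z, S.timeNode τ i), S.smoothShift b T z (S.timeNode τ i))) := fun i => by
    rw [hE, hν, hf]
  -- The interpolation reproduces the identity, so each discrete mapping is the identity plus the
  -- interpolated smooth part plus the interpolated nodal errors.
  have hJν : ∀ i z, J (ν i) z = J (E i) z + (z + J (fun y => f y (S.timeNode τ i)) z) := by
    intro i z
    rw [hEe i, hJ, Cell.interp_sub, Cell.interp_add, Cell.interp_id _ hqs]
    abel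
  have hJd : ∀ u z, DifferentiableAt ℝ (J u) z := fun u z => by
    rw [hJ]
    exact (S.mesh.cell T).differentiableAt_interp qs u z
  -- Both formulas belong to the element `T` and remain smooth beyond it. Derivatives at boundary
  -- points are needed later, where the maps are composed with projections to faces.
  refine ⟨fun x t => x + F x t, fun x t => ∑ i, S.timeBasis τ i t • J (ν i) x,
    fun x hx t ht => ?_⟩
  have hxn := AT.elem_subset_nbhd hx
  have hxt := AT.elem_subset_thick hx
  have bE0 : ∀ i, ‖J (E i) x‖ ≤ C₇ * (C₂ * S.err₀ qs qt) := fun i => by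
    rw [hJ]
    exact (H₇ (Pt d) _ _ AT.regular (E i) _ (fun α hα => (G₂ _ (hti i) _ (hEi i) α hα).1) x hxn).1
  have bE1 : ∀ i, ‖fderiv ℝ (J (E i)) x‖ ≤ C₈ * (C₂ * S.err₁ qs qt) := fun i => by
    rw [hJ]
    refine (H₈ (Pt d) _ _ AT.regular (E i) _
      (fun α hα => (G₂ _ (hti i) _ (hEi i) α hα).2) x hxn).trans (le_of_eq ?_)
    field_simp
  have bR0 : ∀ i, ‖J (fun y => f y (S.timeNode τ i)) x - f x (S.timeNode τ i)‖ ≤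
      C₆ * S.err₀ qs qt := fun i => by
    rw [hJ, hf]
    exact (G₆ x hx _ (hti i)).1
  have bR1 : ∀ i, ∀ Q, HasFDerivAt (fun y => f y (S.timeNode τ i)) Q x →
      ‖fderiv ℝ (J fun y => f y (S.timeNode τ i)) x - Q‖ ≤ C₆ * S.err₁ qs qt := fun i Q hQ => by
    rw [hJ]
    rw [hf] at hQ ⊢
    exact (G₆ x hx _ (hti i)).2 Q hQ
  have bb := fun i => (H₉ d S hdt t ht i).1
  have bb' := fun i => (H₉ d S hdt t ht i).2
  have s1 := S.sum_timeBasis hdt hτ t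
  have s0 := S.sum_deriv_timeBasis hdt hτ t
  obtain ⟨k1, k2, Q, hQ, k3⟩ := G₃ x hxt
  obtain ⟨k4, ⟨L₁, L₂, hL₁, hL₂, k5⟩, v₁, v₂, hv₁, hv₂, k6⟩ := G₄ x hxt t ht
  have K1 : ‖S.timeError τ t (f x)‖ ≤ C₃ * S.err₀ qs qt := by
    rw [hf]
    exact k1 t ht
  have K2 : S.dt * ‖v₂ - ∑ i, deriv (S.timeBasis τ i) t • f x (S.timeNode τ i)‖ ≤
      C₃ * S.err₀ qs qt := by
    rw [hf]
    exact k2 t ht v₂ hv₂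
  have K4 : ‖F x t - f x t‖ ≤ C₄ * S.err₀ qs qt := by
    rw [hF, hf]
    exact k4
  have fin : ∀ e : ℝ, 0 ≤ e → ∀ c ≤ C₇ + C₈, N * (C₉ * (c * (C₂ * e) + C₆ * e)) +
      C₃ * e + C₄ * e ≤ (N * (C₉ * ((C₇ + C₈) * C₂ + C₆)) + C₃ + C₄) * e := fun e he c hc => by
    calc _ ≤ N * (C₉ * ((C₇ + C₈) * (C₂ * e) + C₆ * e)) + C₃ * e + C₄ * e := by gcongr
      _ = _ := by ring
  refine ⟨?_, ?_, ?_, ?_, ?_⟩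
  · rw [ΨΓ, (G₅ t ht x hx).2, shift_eq hx, hF]
    rfl
  · rw [ΘΓ]
    refine Finset.sum_congr rfl fun i _ => ?_
    rw [S.mesh.oswald_eq hT _ hx, hJ, hν]
  · have hid : ∑ i, S.timeBasis τ i t • J (ν i) x - (x + F x t) =
        ∑ i, S.timeBasis τ i t • (J (E i) x + (J (fun y => f y (S.timeNode τ i)) x -
          f x (S.timeNode τ i))) - S.timeError τ t (f x) - (F x t - f x t) := by
      have h1 : ∀ i, S.timeBasis τ i t • J (ν i) x = S.timeBasis τ i t • (J (E i) x +
          (J (fun y => f y (S.timeNode τ i)) x - f x (S.timeNode τ i))) +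
          (S.timeBasis τ i t • x + S.timeBasis τ i t • f x (S.timeNode τ i)) := fun i => by
        rw [hJν, ← smul_add, ← smul_add]
        congr 1
        abel
      simp only [h1, Finset.sum_add_distrib, ← Finset.sum_smul, s1, one_smul, timeError]
      abel
    rw [hid]
    have h1 := norm_sum_smul_le bb fun i => (norm_add_le _ _).trans (add_le_add (bE0 i) (bR0 i))
    rw [← hN] at h1
    refine ((norm_sub_le _ _).trans (add_le_add (norm_sub_le _ _) le_rfl)).trans ?_
    exact (add_le_add (add_le_add h1 K1) K4).trans (fin _ e0 _ (by linarith))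
  · refine ⟨∑ i, deriv (S.timeBasis τ i) t • J (ν i) x, v₁, ?_, ?_, ?_⟩
    · refine HasDerivWithinAt.fun_sum fun i _ => ?_
      exact ((S.differentiable_timeBasis i t).hasDerivAt.smul_const _).hasDerivWithinAt
    · have h1 := hv₁.const_add x
      rw [hF]
      exact h1
    · have hid : ∑ i, deriv (S.timeBasis τ i) t • J (ν i) x - v₁ =
          ∑ i, deriv (S.timeBasis τ i) t • (J (E i) x + (J (fun y => f y (S.timeNode τ i)) x -
            f x (S.timeNode τ i))) -
          (v₂ - ∑ i, deriv (S.timeBasis τ i) t • f x (S.timeNode τ i)) - (v₁ - v₂) := by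
        have h1 : ∀ i, deriv (S.timeBasis τ i) t • J (ν i) x = deriv (S.timeBasis τ i) t •
            (J (E i) x + (J (fun y => f y (S.timeNode τ i)) x - f x (S.timeNode τ i))) +
            (deriv (S.timeBasis τ i) t • x + deriv (S.timeBasis τ i) t • f x (S.timeNode τ i)) :=
          fun i => by
            rw [hJν, ← smul_add, ← smul_add]
            congr 1
            abel
        simp only [h1, Finset.sum_add_distrib, ← Finset.sum_smul, s0, zero_smul]
        abel
      rw [hid]
      have h1 := norm_sum_smul_le bb' fun i => (norm_add_le _ _).trans (add_le_add (bE0 i) (bR0 i))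
      rw [← hN] at h1
      calc _ ≤ S.dt * (N * (C₉ / S.dt * (C₇ * (C₂ * S.err₀ qs qt) + C₆ * S.err₀ qs qt)) +
            ‖v₂ - ∑ i, deriv (S.timeBasis τ i) t • f x (S.timeNode τ i)‖ + ‖v₁ - v₂‖) := by
            gcongr
            exact (norm_sub_le _ _).trans (add_le_add ((norm_sub_le _ _).trans
              (add_le_add h1 le_rfl)) le_rfl)
        _ = N * (C₉ * (C₇ * (C₂ * S.err₀ qs qt) + C₆ * S.err₀ qs qt)) +
            S.dt * ‖v₂ - ∑ i, deriv (S.timeBasis τ i) t • f x (S.timeNode τ i)‖ +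
            S.dt * ‖v₁ - v₂‖ := by
            field_simp
        _ ≤ N * (C₉ * (C₇ * (C₂ * S.err₀ qs qt) + C₆ * S.err₀ qs qt)) + C₃ * S.err₀ qs qt +
            C₄ * S.err₀ qs qt := by gcongr
        _ ≤ _ := fin _ e0 _ (by linarith)
  · refine ⟨∑ i, S.timeBasis τ i t • fderiv ℝ (J (ν i)) x,
      ContinuousLinearMap.id ℝ (Pt d) + L₁, ?_, ?_, ?_⟩
    · exact HasFDerivAt.fun_sum fun i _ => (hJd _ x).hasFDerivAt.fun_const_smul _
    · have h1 := (hasFDerivAt_id x).add hL₁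
      rw [hF]
      exact h1
    · have hQ' : Q t = L₂ := (hQ t ht).unique hL₂
      have hJν' : ∀ i, fderiv ℝ (J (ν i)) x = fderiv ℝ (J (E i)) x +
          (ContinuousLinearMap.id ℝ (Pt d) + fderiv ℝ (J fun y => f y (S.timeNode τ i)) x) := by
        intro i
        have h1 : J (ν i) = fun z => J (E i) z + (z + J (fun y => f y (S.timeNode τ i)) z) :=
          funext fun z => hJν i z
        rw [h1]
        exact ((hJd _ x).hasFDerivAt.add ((hasFDerivAt_id x).add (hJd _ x).hasFDerivAt)).fderiv
      -- The same decomposition for gradients; the interpolation error in time is now that of the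
      -- gradient `Q` of the smooth part.
      have hid : ∑ i, S.timeBasis τ i t • fderiv ℝ (J (ν i)) x -
          (ContinuousLinearMap.id ℝ (Pt d) + L₁) =
          ∑ i, S.timeBasis τ i t • (fderiv ℝ (J (E i)) x +
            (fderiv ℝ (J fun y => f y (S.timeNode τ i)) x - Q (S.timeNode τ i))) -
          S.timeError τ t Q - (L₁ - L₂) := by
        have h1 : ∀ i, S.timeBasis τ i t • fderiv ℝ (J (ν i)) x = S.timeBasis τ i t •
            (fderiv ℝ (J (E i)) x + (fderiv ℝ (J fun y => f y (S.timeNode τ i)) x -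
              Q (S.timeNode τ i))) + (S.timeBasis τ i t • ContinuousLinearMap.id ℝ (Pt d) +
              S.timeBasis τ i t • Q (S.timeNode τ i)) := fun i => by
          rw [hJν', ← smul_add, ← smul_add]
          congr 1
          abel
        simp only [h1, Finset.sum_add_distrib, ← Finset.sum_smul, s1, one_smul, timeError, hQ']
        abel
      rw [hid]
      have bR1' : ∀ i, ‖fderiv ℝ (J fun y => f y (S.timeNode τ i)) x - Q (S.timeNode τ i)‖ ≤
          C₆ * S.err₁ qs qt := fun i => bR1 i _ (by
        rw [hf]
        exact hQ _ (hti i))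
      have h1 := norm_sum_smul_le bb fun i => (norm_add_le _ _).trans (add_le_add (bE1 i) (bR1' i))
      rw [← hN] at h1
      refine ((norm_sub_le _ _).trans (add_le_add (norm_sub_le _ _) le_rfl)).trans ?_
      exact (add_le_add (add_le_add h1 (k3 t ht)) k5).trans (fin _ e1 _ (by linarith))

end Slab

end ActiveError

/-! ### Cut and blended elements lie in the smooth neighbourhood -/

section ActiveGeometry

open Set Filter Topology

set_option maxSynthPendingDepth 3

namespace Slab

variable {d : ℕ}

/-- Elements close to the exact interface, for short time steps and small mesh sizes. -/
theorem activeElem_of_dist_le {S : Slab d} {qs qt m : ℕ} (hd : 1 ≤ d) (hqs : 1 ≤ qs) (hqt : 1 ≤ qt)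
    (hqsm : qs ≤ m) (hqtm : qt ≤ m) {K δΩ δU r : ℝ} (hK : 0 < K) (hδΩ : 0 < δΩ) (hδU : 0 < δU)
    (hG : S.GeometryAssumption (m + 2) K δΩ δU) (hD : S.DiscreteAssumption qs qt K δU r) {δ κ : ℝ}
    (hδ : 0 ≤ δ) (hκ : 0 < κ) (hδκ : δ + 2 * κ ≤ min δΩ δU)
    (hdt : K * S.dt < K⁻¹ * min K⁻¹ (κ / (2 * K))) (hdt1 : S.dt ≤ 1) (hh : S.h ≤ 1)
    (hhκ : 8 * S.h < κ) (hdth : S.dt ^ (qt + 1) ≤ S.h) {b : Pt d → ℝ → ℝ}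
    (hb : ∀ B : Set (Pt d), IsOpen B → B ⊆ interior S.mesh.domain →
      BddDerivOn (B ×ˢ S.I) (m + 2) K (Function.uncurry b))
    (hb01 : ∀ x ∈ S.mesh.domain, ∀ t ∈ S.I, b x t ∈ Icc (0 : ℝ) 1)
    {t : ℝ} (ht : t ∈ S.I) {y : Pt d} (hy : y ∈ frontier (S.Ω t)) {T : Fin S.mesh.card} {x : Pt d}
    (hx : x ∈ S.mesh.elem T) (hxy : dist x y ≤ δ) :
    1 ≤ K ∧ S.ActiveElem qs qt m K (κ / 2) b T := by
  obtain ⟨hK1, hU⟩ :=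
    one_le_and_ball_subset_U (by omega) hK hδΩ hδU hG hδ hκ hδκ hdt ht hy hxy
  refine ⟨hK1, ?_⟩
  have hh0 := h_pos hd T
  have hv : S.mesh.cell T 0 ∈ S.mesh.elem T := (S.mesh.cell T).vertex_mem_body 0
  have hball : Metric.ball (S.mesh.cell T 0) (κ / 2) ⊆ Metric.ball x κ := by
    refine Metric.ball_subset_ball' ?_
    have := norm_sub_le_h hv hx
    rw [dist_eq_norm]
    linarith
  have hUv : ∀ t ∈ S.I, Metric.ball (S.mesh.cell T 0) (κ / 2) ⊆ S.U δU t :=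
    fun t ht => hball.trans (hU t ht)
  have hint : Metric.ball (S.mesh.cell T 0) (κ / 2) ⊆ interior S.mesh.domain :=
    fun z hz => (hUv t ht hz).1
  have hTb : S.mesh.elem T ⊆ Metric.ball (S.mesh.cell T 0) (κ / 2) :=
    elem_subset_ball hv (by linarith)
  have hTU : T ∈ S.meshU δU := fun t ht => hTb.trans (hUv t ht)
  have hL := levelSetOn hG hK1 (half_pos hκ) hUv
  refine ⟨hqsm, hqtm, hqs, hqt, dt_pos hG, hdt1, hh, by linarith, hdth, regular hd hK hG T, hL,
    hint.trans interior_subset, hb _ Metric.isOpen_ball hint,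
    fun x hx t ht => hb01 x (interior_subset (hint hx)) t ht,
    fun t ht x hx => φhExt_eq hqs hD ht hx, fun t ht x hx => abs_φ_sub_φh_le hqs hG hD hTU ht hx,
    fun t ht x hx y hy => ?_, fun x hx => ?_⟩
  · exact abs_φ_sub_φh_sub_le hqs hG hD hTU ht
      (fun y hy => (hL.hasFDerivAt (hTb hy) ht).differentiableAt) hx hy
  · obtain ⟨c, -, hc⟩ := hD.tensor
    exact ⟨fun i => c i x, fun t ht => hc x (S.mesh.elem_subset_domain T hx) t ht⟩

theorem exists_dist_le_of_mem_cut {S : Slab d} {qs qt : ℕ} {K δU r : ℝ}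
    (hD : S.DiscreteAssumption qs qt K δU r) {T : Fin S.mesh.card} (hT : T ∈ S.cut) :
    ∃ t ∈ S.I, ∃ x ∈ S.mesh.elem T, ∃ y ∈ frontier (S.Ω t), dist x y ≤ max r 0 := by
  obtain ⟨t, ht, x, hx, hxT⟩ := hT
  obtain ⟨y, hy, hxy⟩ := hD.interface t ht x hx
  exact ⟨t, ht, x, hxT, y, hy, hxy.trans (le_max_left _ _)⟩

theorem continuousOn_φlin (S : Slab d) (t : ℝ) :
    ContinuousOn (fun x => S.φlin x t) S.mesh.domain := by
  have h1 : S.mesh.domain = ⋃ T, S.mesh.elem T := by simp [Mesh.domain, Mesh.region]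
  rw [h1]
  refine (locallyFinite_of_finite _).continuousOn_iUnion (fun T => S.mesh.isClosed_elem T)
    fun T => ?_
  have h2 : Continuous ((S.mesh.cell T).interp 1 fun y => S.φh y t) :=
    continuous_iff_continuousAt.2 fun x =>
      ((S.mesh.cell T).differentiableAt_interp 1 _ x).continuousAt
  exact h2.continuousOn.congr fun x hx => S.mesh.linInterp_eq T _ hx

theorem frontier_Ωlin_subset (S : Slab d) (t : ℝ) : frontier (S.Ωlin t) ⊆ S.mesh.domain :=
  frontier_subset_closure.trans (closure_minimal (fun _ h => h.1) S.mesh.isClosed_domain)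

theorem φlin_eq_zero {S : Slab d} {t : ℝ} {y : Pt d} (hy : y ∈ frontier (S.Ωlin t))
    (hint : y ∈ interior S.mesh.domain) : S.φlin y t = 0 := by
  have hnh : S.mesh.domain ∈ 𝓝 y := mem_interior_iff_mem_nhds.1 hint
  have hc : ContinuousAt (fun y => S.φlin y t) y := (S.continuousOn_φlin t).continuousAt hnh
  rcases lt_trichotomy (S.φlin y t) 0 with h | h | h
  · exfalso
    apply hy.2
    rw [mem_interior_iff_mem_nhds]
    filter_upwards [hnh, hc.eventually (gt_mem_nhds h)] with z h1 h2 using ⟨h1, h2⟩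
  · exact h
  · exfalso
    obtain ⟨z, hz, hz'⟩ := mem_closure_iff_nhds.1 hy.1 _ (hc.eventually (lt_mem_nhds h))
    exact absurd hz'.2 (not_lt.2 (le_of_lt hz))

/-- The piecewise linear interface is close to the exact one. -/
theorem exists_interface_close (d : ℕ) {K δΩ δU ρ ϑ : ℝ} (hK : 1 ≤ K) (hδΩ : 0 < δΩ)
    (hϑ : 0 < ϑ) (hϑm : ϑ ≤ ρ / 2) : ∃ η : ℝ, 0 < η ∧
    ∀ (S : Slab d) (qs qt m ℓ : ℕ) (r : ℝ) (b : Pt d → ℝ → ℝ), r < δΩ →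
      S.GeometryAssumption ℓ K δΩ δU → S.DiscreteAssumption qs qt K δU r →
      (∀ T ∈ S.cut, S.ActiveElem qs qt m K ρ b T) → S.h ≤ η → S.dt ^ (qt + 1) ≤ η * S.h →
      ∀ t ∈ S.I, ∀ y ∈ frontier (S.Ωlin t), ∃ z ∈ frontier (S.Ω t), dist y z ≤ ϑ := by
  obtain ⟨C, hC, H⟩ := exists_shift_le d K
  have hK0 : 0 < K := by linarith
  -- Displacements up to `a` move a point by at most `ϑ` and keep half of the slope. The threshold
  -- for `h` then makes `|φ|` on the linear interface smaller than the change of `φ` at the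
  -- displacements `± a / 2`, so `φ` changes its sign within distance `ϑ`.
  obtain ⟨a, ha⟩ : ∃ a, a = min ϑ (1 / 2) / K := ⟨_, rfl⟩
  have ha0 : 0 < a := by rw [ha]; positivity
  have haK : a * K = min ϑ (1 / 2) := by rw [ha]; exact div_mul_cancel₀ _ hK0.ne'
  have ha1 : a * K ≤ ϑ := haK.trans_le (min_le_left _ _)
  have ha2 : a * K ≤ 1 / 2 := haK.trans_le (min_le_right _ _)
  refine ⟨(2 * K ^ 2)⁻¹ * a / (12 * C), by positivity,
    fun S qs qt m ℓ r b hr hG hD hA hh1 hdt1 t ht y hy => ?_⟩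
  obtain ⟨T, hyT⟩ := S.mesh.mem_domain.1 (S.frontier_Ωlin_subset t hy)
  have AT := hA T ⟨t, ht, y, hy, hyT⟩
  have hh := AT.h_pos
  obtain ⟨y', hy', hyy'⟩ := hD.interface t ht y hy
  have h0 := φlin_eq_zero hy (ball_subset_interior hδΩ hG ht hy'
    (Metric.mem_ball.2 (hyy'.trans_lt hr)))
  have h1 := (H S qs qt m ρ b T AT t ht y hyT).1
  rw [h0, zero_sub, abs_neg] at h1
  have h2 := AT.sq_add_err₀_le hh1 hdt1
  have h3 : |S.φ y t| ≤ (2 * K ^ 2)⁻¹ * a / 4 := by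
    calc |S.φ y t| ≤ C * (S.h ^ 2 + S.err₀ qs qt) := h1
      _ ≤ C * (3 * ((2 * K ^ 2)⁻¹ * a / (12 * C)) * S.h) := by gcongr
      _ = (2 * K ^ 2)⁻¹ * a / 4 * S.h := by field_simp; norm_num
      _ ≤ (2 * K ^ 2)⁻¹ * a / 4 * 1 := by
          have := AT.h_le
          gcongr
      _ = _ := mul_one _
  have hyb : y ∈ Metric.ball (S.mesh.cell T 0) (ρ / 2) :=
    AT.nbhd_subset_half (AT.elem_subset_nbhd hyT)
  have haρ : a * K ≤ ρ / 2 := ha1.trans hϑm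
  have m0 : (0 : ℝ) ∈ Ioo (-a) a := ⟨by linarith, ha0⟩
  have m1 : a / 2 ∈ Ioo (-a) a := ⟨by linarith, by linarith⟩
  have m2 : -(a / 2) ∈ Ioo (-a) a := ⟨by linarith, by linarith⟩
  have s1 := AT.level.slope_mul_le haρ ha2 hyb ht m0 m1 (by linarith)
  have s2 := AT.level.slope_mul_le haρ ha2 hyb ht m2 m0 (by linarith)
  rw [zero_smul, add_zero] at s1 s2
  obtain ⟨h4, h5⟩ := abs_le.1 h3
  have hpos : 0 < (2 * K ^ 2)⁻¹ * a := by positivity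
  have hmem : ∀ α : ℝ, |α| = a / 2 →
      y + α • LevelSetOn.grad S.φ (y, t) ∈ Metric.ball y ϑ := fun α hα => by
    rw [mem_ball_iff_norm, add_sub_cancel_left, norm_smul, Real.norm_eq_abs, hα]
    have h6 := AT.level.norm_grad_le (AT.elem_subset hyT) ht
    calc _ ≤ a / 2 * K := by gcongr
      _ < ϑ := by nlinarith
  have hsub : Metric.ball y ϑ ⊆ S.mesh.domain := fun z hz => by
    refine AT.ball_subset ?_
    rw [Metric.mem_ball] at hz hyb ⊢
    have := dist_triangle z y (S.mesh.cell T 0)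
    linarith
  obtain ⟨z, hz, hzb⟩ := exists_frontier_mem_ball (S := S) (t := t) hsub
    (hmem (-(a / 2)) (by rw [abs_neg, abs_of_pos (by linarith)]))
    (hmem (a / 2) (abs_of_pos (by linarith))) (by linarith) (by linarith)
  exact ⟨z, hz, by rw [dist_comm]; exact (Metric.mem_ball.1 hzb).le⟩

theorem exists_small_time_step {K κ : ℝ} (hK : 0 < K) (hκ : 0 < κ) :
    ∃ η : ℝ, 0 < η ∧ ∀ s ≤ η, K * s < K⁻¹ * min K⁻¹ (κ / (2 * K)) := by
  have h1 : 0 < min K⁻¹ (κ / (2 * K)) := by positivity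
  refine ⟨K⁻¹ * (K⁻¹ * min K⁻¹ (κ / (2 * K))) / 2, by positivity, fun s hs => ?_⟩
  have h2 : 0 < K⁻¹ * min K⁻¹ (κ / (2 * K)) := by positivity
  calc K * s ≤ K * (K⁻¹ * (K⁻¹ * min K⁻¹ (κ / (2 * K))) / 2) := by gcongr
    _ = K⁻¹ * min K⁻¹ (κ / (2 * K)) / 2 := by field_simp
    _ < _ := by linarith

/-- The cut elements are active elements, for any blending function which is smooth where the
geometry lives. -/
theorem exists_activeElem_of_mem_cut {d qs qt m : ℕ} (hd : 1 ≤ d) (hqs : 1 ≤ qs) (hqt : 1 ≤ qt)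
    (hqsm : qs ≤ m) (hqtm : qt ≤ m) {K δΩ δU r : ℝ} (hK : 0 < K) (hδΩ : 0 < δΩ) (hδU : 0 < δU)
    (hr : r < min δΩ δU) : ∃ ρ η : ℝ, 0 < ρ ∧ 0 < η ∧
    ∀ S : Slab d, S.h ≤ η → S.dt ≤ η → S.dt ^ (qt + 1) ≤ S.h →
      S.GeometryAssumption (m + 2) K δΩ δU → S.DiscreteAssumption qs qt K δU r →
      ∀ T ∈ S.cut, 1 ≤ K ∧ S.ActiveElem qs qt m K ρ (fun _ _ => 0) T := by
  have hm : 0 < min δΩ δU := lt_min hδΩ hδU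
  -- The sign of `r` is not prescribed, so its nonnegative part serves as distance.
  have hr0 : max r 0 < min δΩ δU := max_lt hr hm
  obtain ⟨κ, hκ⟩ : ∃ κ, κ = (min δΩ δU - max r 0) / 2 := ⟨_, rfl⟩
  have hκ0 : 0 < κ := by rw [hκ]; linarith
  obtain ⟨η, hη, H⟩ := exists_small_time_step hK hκ0
  refine ⟨κ / 2, min η (min 1 (κ / 16)), by positivity, by positivity,
    fun S hh hdt hdth hG hD T hT => ?_⟩
  obtain ⟨t, ht, x, hx, y, hy, hxy⟩ := exists_dist_le_of_mem_cut hD hT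
  have h1 := hh.trans ((min_le_right _ _).trans (min_le_right _ _))
  exact activeElem_of_dist_le hd hqs hqt hqsm hqtm hK hδΩ hδU hG hD (le_max_right _ _) hκ0
    (by rw [hκ]; linarith) (H _ (hdt.trans (min_le_left _ _)))
    (hdt.trans ((min_le_right _ _).trans (min_le_left _ _)))
    (hh.trans ((min_le_right _ _).trans (min_le_left _ _))) (by linarith) hdth
    (fun B _ _ => BddDerivOn.const (0 : ℝ) (by simpa using hK.le)) (fun _ _ _ _ => by simp) ht hy hx hxy

/-- The elements on which the blending function is smaller than one are active elements. -/
theorem exists_activeElem_of_mem_unblended {d qs qt m : ℕ} (hd : 1 ≤ d) (hqs : 1 ≤ qs)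
    (hqt : 1 ≤ qt) (hqsm : qs ≤ m) (hqtm : qt ≤ m) {K δΩ δU r w : ℝ} (hK : 0 < K) (hδΩ : 0 < δΩ)
    (hδU : 0 < δU) (hr : r < min δΩ δU) (hw : 0 < w) (hwm : w < min δΩ δU) :
    ∃ ρ η : ℝ, 0 < ρ ∧ 0 < η ∧ ∀ (S : Slab d) (b : Pt d → ℝ → ℝ), S.h ≤ η → S.dt ≤ η →
      S.dt ^ (qt + 1) ≤ S.h → S.dt ^ (qt + 1) ≤ η * S.h →
      S.GeometryAssumption (m + 2) K δΩ δU → S.DiscreteAssumption qs qt K δU r →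
      S.BlendingAssumption (m + 2) K w b →
      ∀ T ∈ S.unblended b, 1 ≤ K ∧ S.ActiveElem qs qt m K ρ b T := by
  obtain ⟨ρ, η₁, hρ, hη₁, H₁⟩ := exists_activeElem_of_mem_cut hd hqs hqt hqsm hqtm hK hδΩ hδU hr
  obtain ⟨κ, hκ⟩ : ∃ κ, κ = (min δΩ δU - w) / 4 := ⟨_, rfl⟩
  have hκ0 : 0 < κ := by rw [hκ]; linarith
  obtain ⟨ϑ, hϑ⟩ : ∃ ϑ, ϑ = min κ (ρ / 2) := ⟨_, rfl⟩
  have hϑ0 : 0 < ϑ := by rw [hϑ]; positivity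
  obtain ⟨η₂, hη₂, H₂⟩ := exists_small_time_step hK hκ0
  -- That `K ≥ 1` is known only once an interface point exists. For `K < 1` the claim is void and
  -- any threshold will do.
  have hex : ∃ η₃ : ℝ, 0 < η₃ ∧ (1 ≤ K → ∀ (S : Slab d) (b : Pt d → ℝ → ℝ),
      S.GeometryAssumption (m + 2) K δΩ δU → S.DiscreteAssumption qs qt K δU r →
      (∀ T ∈ S.cut, S.ActiveElem qs qt m K ρ b T) → S.h ≤ η₃ → S.dt ^ (qt + 1) ≤ η₃ * S.h →
      ∀ t ∈ S.I, ∀ y ∈ frontier (S.Ωlin t), ∃ z ∈ frontier (S.Ω t), dist y z ≤ ϑ) := by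
    by_cases hK1 : 1 ≤ K
    · obtain ⟨η₃, h1, h2⟩ := exists_interface_close d (δU := δU) hK1 hδΩ hϑ0
        (hϑ ▸ min_le_right _ _)
      exact ⟨η₃, h1, fun _ S b hG hD hA hh hdt =>
        h2 S qs qt m _ r b (hr.trans_le (min_le_left _ _)) hG hD hA hh hdt⟩
    · exact ⟨1, one_pos, fun h => absurd h hK1⟩
  obtain ⟨η₃, hη₃, H₃⟩ := hex
  obtain ⟨η, hη⟩ : ∃ η, η = min (min η₁ η₂) (min η₃ (min 1 (κ / 16))) := ⟨_, rfl⟩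
  have l1 : η ≤ η₁ := hη ▸ (min_le_left _ _).trans (min_le_left _ _)
  have l2 : η ≤ η₂ := hη ▸ (min_le_left _ _).trans (min_le_right _ _)
  have l3 : η ≤ η₃ := hη ▸ (min_le_right _ _).trans (min_le_left _ _)
  have l4 : η ≤ 1 := hη ▸ (min_le_right _ _).trans ((min_le_right _ _).trans (min_le_left _ _))
  have l5 : η ≤ κ / 16 :=
    hη ▸ (min_le_right _ _).trans ((min_le_right _ _).trans (min_le_right _ _))
  refine ⟨κ / 2, η, by positivity, by rw [hη]; positivity,
    fun S b hh hdt hdth hdth' hG hD hB T hT => ?_⟩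
  have hh0 := h_pos hd T
  obtain ⟨t, ht, x, hx, hbx⟩ := hT
  obtain ⟨y, hy, hxy⟩ : ∃ y ∈ frontier (S.Ωlin t), dist x y ≤ w := by
    by_contra! h
    exact hbx.ne (hB.one_away t ht x (S.mesh.elem_subset_domain T hx) h)
  have hcut := H₁ S (hh.trans l1) (hdt.trans l1) hdth hG hD
  obtain ⟨T', hyT'⟩ := S.mesh.mem_domain.1 (S.frontier_Ωlin_subset t hy)
  have hK1 := (hcut T' ⟨t, ht, y, hy, hyT'⟩).1
  -- The blending width is measured from the linear interface, and `w + r` need not be below `min δΩ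
  -- δU`. The asymptotic distance `ϑ ≤ κ` between the interfaces replaces `r`; it leaves room
  -- because `w + 4 κ = min δΩ δU`.
  obtain ⟨z, hz, hyz⟩ := H₃ hK1 S _ hG hD (fun T hT => (hcut T hT).2) (hh.trans l3)
    (hdth'.trans (by gcongr)) t ht y hy
  have hϑκ : ϑ ≤ κ := hϑ ▸ min_le_left _ _
  refine activeElem_of_dist_le (δ := w + ϑ) hd hqs hqt hqsm hqtm hK hδΩ hδU hG hD (by positivity)
    hκ0 (by rw [hκ] at hϑκ ⊢; linarith) (H₂ _ (hdt.trans l2)) (hdt.trans l4) (hh.trans l4)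
    (by linarith) hdth (fun B hBo hBi => ?_) hB.range ht hz hx
    ((dist_triangle x y z).trans (add_le_add hxy hyz))
  have heq : B ×ˢ S.I = (interior S.mesh.domain ×ˢ S.I) ∩ B ×ˢ univ := by
    ext p
    exact ⟨fun hp => ⟨⟨hBi hp.1, hp.2⟩, hp.1, mem_univ _⟩, fun hp => ⟨hp.2.1, hp.1.2⟩⟩
  have hsub : B ×ˢ S.I ⊆ interior S.mesh.domain ×ˢ S.I := prod_mono_left hBi
  refine BddDerivOn.of_contDiffOn (hBo.uniqueDiffOn.prod S.uniqueDiffOn_I) (hB.smooth.mono hsub)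
    le_rfl fun k hk p hp => ?_
  rw [heq, iteratedFDerivWithin_inter_open (hBo.prod isOpen_univ)
    (mk_mem_prod hp.1 (mem_univ _))]
  exact hB.bounded k hk p (hsub hp)

end Slab

end ActiveGeometry

/-! ### Projections of a simplex to its faces -/

section Projection

open Set Filter Topology

set_option maxSynthPendingDepth 3

namespace Cell

variable {d : ℕ} (T : Cell d)

theorem coord_proj {ρ : Finset (Fin (d + 1))} {y : Pt d} (h : T.weight ρ y ≠ 0)
    (v : Fin (d + 1)) :
    T.coord v (T.proj ρ y) = if v ∈ ρ then (T.weight ρ y)⁻¹ * T.coord v y else 0 := by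
  have h1 : T.proj ρ y =
      ∑ v, (if v ∈ ρ then (T.weight ρ y)⁻¹ * T.coord v y else 0) • T v := by
    simp only [proj, Finset.smul_sum, smul_smul, ite_smul, zero_smul, Finset.sum_ite_mem,
      Finset.univ_inter]
  rw [h1, T.coord_sum_smul]
  rw [Finset.sum_ite_mem, Finset.univ_inter, ← Finset.mul_sum]
  exact inv_mul_cancel₀ h

theorem weight_proj {ρ : Finset (Fin (d + 1))} {y : Pt d} (h : T.weight ρ y ≠ 0)
    (σ : Finset (Fin (d + 1))) :
    T.weight σ (T.proj ρ y) = (T.weight ρ y)⁻¹ * T.weight (σ ∩ ρ) y := by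
  rw [weight, Finset.sum_congr rfl fun v _ => T.coord_proj h v, Finset.sum_ite_mem,
    ← Finset.mul_sum]
  rfl

/-- Projecting keeps the ratios of the remaining coordinates. So on a face `ρ` the contribution of a
face `σ` depends only on the common subface, which makes an induction over faces possible. -/
theorem proj_proj {ρ : Finset (Fin (d + 1))} {y : Pt d} (h : T.weight ρ y ≠ 0)
    (σ : Finset (Fin (d + 1))) : T.proj σ (T.proj ρ y) = T.proj (σ ∩ ρ) y := by
  rw [proj, T.weight_proj h]
  simp only [T.coord_proj h, ite_smul, zero_smul]
  rw [Finset.sum_ite_mem, mul_inv, inv_inv, proj]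
  simp only [mul_smul]
  rw [← Finset.smul_sum, smul_smul, smul_smul]
  congr 1
  field_simp

variable {T}

theorem weight_nonneg {y : Pt d} (hy : y ∈ T.body) (ρ : Finset (Fin (d + 1))) :
    0 ≤ T.weight ρ y := Finset.sum_nonneg fun v _ => T.mem_body.1 hy v

theorem weight_mono {y : Pt d} (hy : y ∈ T.body) {σ ρ : Finset (Fin (d + 1))} (h : σ ⊆ ρ) :
    T.weight σ y ≤ T.weight ρ y :=
  Finset.sum_le_sum_of_subset_of_nonneg h fun v _ _ => T.mem_body.1 hy v

theorem weight_univ (y : Pt d) : T.weight Finset.univ y = 1 := T.sum_coord y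

theorem weight_le_one {y : Pt d} (hy : y ∈ T.body) (ρ : Finset (Fin (d + 1))) :
    T.weight ρ y ≤ 1 := (weight_mono hy (Finset.subset_univ ρ)).trans (weight_univ y).le

theorem weight_pos {y : Pt d} (hy : y ∈ interior T.body) {ρ : Finset (Fin (d + 1))}
    (hρ : ρ.Nonempty) : 0 < T.weight ρ y :=
  Finset.sum_pos (fun v _ => T.mem_interior_body.1 hy v) hρ

theorem proj_univ (y : Pt d) : T.proj Finset.univ y = y := by
  rw [proj, weight_univ, inv_one, one_smul]
  exact T.linear_combination_coord_eq_self y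

theorem proj_mem_face {y : Pt d} (hy : y ∈ T.body) {ρ : Finset (Fin (d + 1))}
    (h : T.weight ρ y ≠ 0) : T.proj ρ y ∈ T.face ρ := by
  rw [mem_face]
  refine ⟨fun v => ?_, fun v hv => ?_⟩
  · rw [T.coord_proj h]
    split_ifs
    · exact mul_nonneg (inv_nonneg.2 (weight_nonneg hy ρ)) (T.mem_body.1 hy v)
    · exact le_rfl
  · rw [T.coord_proj h, if_neg hv]

theorem face_mono {σ ρ : Finset (Fin (d + 1))} (h : σ ⊆ ρ) : T.face σ ⊆ T.face ρ :=
  convexHull_mono (Set.image_mono (Finset.coe_subset.2 h))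

theorem hasFDerivAt_weight (ρ : Finset (Fin (d + 1))) (x : Pt d) :
    HasFDerivAt (T.weight ρ) (∑ v ∈ ρ, T.coordL v) x :=
  HasFDerivAt.fun_sum fun v _ => T.hasFDerivAt_coord v x

theorem hasFDerivAt_inv_weight {ρ : Finset (Fin (d + 1))} {x : Pt d} (h : T.weight ρ x ≠ 0) :
    HasFDerivAt (fun y => (T.weight ρ y)⁻¹) ((-(T.weight ρ x ^ 2)⁻¹) • ∑ v ∈ ρ, T.coordL v) x :=
  (hasDerivAt_inv h).comp_hasFDerivAt x (hasFDerivAt_weight ρ x)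

theorem Regular.norm_sum_coordL_le {h κ : ℝ} (hT : T.Regular h κ) (ρ : Finset (Fin (d + 1))) :
    ‖∑ v ∈ ρ, T.coordL v‖ ≤ (d + 1) * κ / h := by
  have hh := hT.pos
  have hκ := hT.kappa_nonneg
  refine (norm_sum_le_of_le _ fun v _ => hT.slope v).trans ?_
  rw [Finset.sum_const, nsmul_eq_mul]
  have h1 : (ρ.card : ℝ) ≤ d + 1 := by
    have := Finset.card_le_univ ρ
    rw [Fintype.card_fin] at this
    exact_mod_cast this
  calc _ ≤ ((d : ℝ) + 1) * (κ / h) := by gcongr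
    _ = _ := by ring

/-- Relative to the image point `z` of `x` the numerator vanishes at `x`, so the derivative of the
reciprocal weight drops out. What remains are vectors `T v - z` of length at most `h` times slopes
`κ / h`, divided by the weight. -/
theorem Regular.exists_hasFDerivAt_proj {h κ : ℝ} (hT : T.Regular h κ) {x : Pt d}
    (hx : x ∈ interior T.body) {ρ : Finset (Fin (d + 1))} (hρ : ρ.Nonempty) :
    ∃ Z : Pt d →L[ℝ] Pt d, HasFDerivAt (T.proj ρ) Z x ∧
      ‖Z‖ ≤ (d + 1) * κ / T.weight ρ x := by
  have hh := hT.pos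
  have hκ := hT.kappa_nonneg
  have hw := weight_pos hx hρ
  obtain ⟨z, hz⟩ : ∃ z, z = T.proj ρ x := ⟨_, rfl⟩
  obtain ⟨V, hV⟩ : ∃ V : Pt d → Pt d, V = fun y => ∑ v ∈ ρ, T.coord v y • (T v - z) := ⟨_, rfl⟩
  have h1 : ∀ y ∈ interior T.body, T.proj ρ y = z + (T.weight ρ y)⁻¹ • V y := fun y hy => by
    have hwy := (weight_pos hy hρ).ne'
    have h2 : V y = ∑ v ∈ ρ, T.coord v y • T v - T.weight ρ y • z := by
      rw [hV]
      simp only [smul_sub, Finset.sum_sub_distrib, ← Finset.sum_smul]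
      rfl
    rw [h2, smul_sub, smul_smul, inv_mul_cancel₀ hwy, one_smul, proj]
    abel
  have hVx : V x = 0 := by
    have h2 := h1 x hx
    rw [← hz, left_eq_add] at h2
    exact (smul_eq_zero.1 h2).resolve_left (inv_ne_zero hw.ne')
  have hV' : HasFDerivAt V (∑ v ∈ ρ, (T.coordL v).smulRight (T v - z)) x := by
    rw [hV]
    exact HasFDerivAt.fun_sum fun v _ => (T.hasFDerivAt_coord v x).smul_const _
  have h3 := ((hasFDerivAt_inv_weight hw.ne').smul hV').const_add z
  rw [hVx] at h3
  refine ⟨_, h3.congr_of_eventuallyEq ?_, ?_⟩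
  · filter_upwards [isOpen_interior.mem_nhds hx] with y hy using h1 y hy
  · have h4 : ∀ L : Pt d →L[ℝ] ℝ, L.smulRight (0 : Pt d) = 0 := fun L => by ext; simp
    rw [h4, add_zero, norm_smul, norm_inv, Real.norm_eq_abs, abs_of_pos hw]
    have hzb : z ∈ T.body := by
      rw [hz]
      exact T.face_subset_body ρ (proj_mem_face (interior_subset hx) hw.ne')
    have h5 : ‖∑ v ∈ ρ, (T.coordL v).smulRight (T v - z)‖ ≤ (d + 1) * κ := by
      refine (norm_sum_le_of_le (f := fun v => (T.coordL v).smulRight (T v - z)) ρ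
        (n := fun _ => κ) fun v _ => ?_).trans ?_
      · rw [ContinuousLinearMap.norm_smulRight_apply]
        calc _ ≤ κ / h * h := by
              gcongr
              · exact hT.slope v
              · exact hT.diam _ (T.vertex_mem_body v) _ hzb
          _ = κ := by field_simp
      · rw [Finset.sum_const, nsmul_eq_mul]
        have h6 : (ρ.card : ℝ) ≤ d + 1 := by
          have := Finset.card_le_univ ρ
          rw [Fintype.card_fin] at this
          exact_mod_cast this
        gcongr
    rw [inv_mul_eq_div]
    gcongr

/-- The relative weight of a subface. -/
theorem Regular.exists_hasFDerivAt_ratio {h κ : ℝ} (hT : T.Regular h κ) {x : Pt d}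
    (hx : x ∈ interior T.body) {τ ρ : Finset (Fin (d + 1))} (hρ : ρ.Nonempty) (hτ : τ ⊆ ρ) :
    ∃ s' : Pt d →L[ℝ] ℝ, HasFDerivAt (fun y => (T.weight ρ y)⁻¹ * T.weight τ y) s' x ∧
      ‖s'‖ ≤ 2 * ((d + 1) * κ / h) / T.weight ρ x := by
  have hw := weight_pos hx hρ
  refine ⟨_, (hasFDerivAt_inv_weight hw.ne').mul (hasFDerivAt_weight τ x), ?_⟩
  have h1 := hT.norm_sum_coordL_le ρ
  have h2 := hT.norm_sum_coordL_le τ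
  have h3 := weight_mono (interior_subset hx) hτ
  have h4 := weight_nonneg (interior_subset hx) τ
  refine (norm_add_le _ _).trans ?_
  rw [norm_smul, norm_smul, Real.norm_eq_abs, Real.norm_eq_abs, abs_inv, abs_of_pos hw,
    abs_of_nonneg h4]
  have h5 : ‖(-(T.weight ρ x ^ 2)⁻¹) • ∑ v ∈ ρ, T.coordL v‖ ≤
      (T.weight ρ x ^ 2)⁻¹ * ((d + 1) * κ / h) := by
    rw [norm_smul, norm_neg, norm_inv, norm_pow, Real.norm_eq_abs, abs_of_pos hw]
    gcongr
  have h6 := (norm_nonneg _).trans h1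
  calc _ ≤ (T.weight ρ x)⁻¹ * ((d + 1) * κ / h) +
        T.weight ρ x * ((T.weight ρ x ^ 2)⁻¹ * ((d + 1) * κ / h)) := by
        gcongr
    _ = _ := by
        field_simp
        ring

end Cell

end Projection

/-! ### Interpolation on faces -/

section FaceInterpolation

open Set Filter Topology

set_option maxSynthPendingDepth 3

namespace Cell

variable {d : ℕ} {F : Type} [NormedAddCommGroup F] [NormedSpace ℝ F]

theorem mem_piAntidiag_univ {σ : Finset (Fin (d + 1))} {l : ℕ} {α : Fin (d + 1) → ℕ}
    (hα : α ∈ σ.piAntidiag l) : α ∈ Finset.univ.piAntidiag l := by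
  classical
  rw [Finset.mem_piAntidiag] at hα ⊢
  refine ⟨?_, fun _ _ => Finset.mem_univ _⟩
  rw [← hα.1]
  refine (Finset.sum_subset (Finset.subset_univ σ) fun v _ hv => ?_).symm
  by_contra h
  exact hv (hα.2 v h)

theorem node_mem_face (T : Cell d) {σ : Finset (Fin (d + 1))} {l : ℕ} (hl : 1 ≤ l)
    {α : Fin (d + 1) → ℕ} (hα : α ∈ σ.piAntidiag l) : T.node l α ∈ T.face σ := by
  classical
  have h1 := mem_piAntidiag_univ hα
  rw [mem_face]
  refine ⟨fun v => T.mem_body.1 (T.node_mem_body hl h1) v, fun v hv => ?_⟩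
  rw [node, T.coord_sum_smul (sum_weights_node hl h1)]
  rw [Finset.mem_piAntidiag] at hα
  have h2 : α v = 0 := by
    by_contra h
    exact hv (hα.2 v h)
  simp [h2]

theorem differentiableAt_faceInterp (T : Cell d) (σ : Finset (Fin (d + 1))) (l : ℕ)
    (g : Pt d → F) (z : Pt d) : DifferentiableAt ℝ (T.faceInterp σ l g) z := by
  unfold faceInterp
  split_ifs
  · exact differentiableAt_const _
  · exact DifferentiableAt.fun_sum fun α _ =>
      (T.hasFDerivAt_shape l α z).differentiableAt.smul_const _

theorem Regular.exists_faceInterp_bound (d k : ℕ) (κ : ℝ) : ∃ C : ℝ, 1 ≤ C ∧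
    ∀ (F : Type) [NormedAddCommGroup F] [NormedSpace ℝ F] (T : Cell d) (h : ℝ), T.Regular h κ →
      ∀ (σ : Finset (Fin (d + 1))) (g : Pt d → F) (A : ℝ), (∀ y ∈ T.face σ, ‖g y‖ ≤ A) → 0 ≤ A →
        ∀ l ≤ k, ∀ z ∈ T.body, ‖T.faceInterp σ l g z‖ ≤ C * A ∧
          ‖fderiv ℝ (T.faceInterp σ l g) z‖ ≤ C * A / h := by
  choose C hC H using fun l => Regular.exists_shape_bound d l κ
  obtain ⟨N, hN⟩ : ∃ N : ℕ → ℝ, N = fun l =>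
    ((Finset.piAntidiag (Finset.univ : Finset (Fin (d + 1))) l).card : ℝ) := ⟨_, rfl⟩
  have hN0 : ∀ l, 0 ≤ N l * C l := fun l => by
    rw [hN]
    have := hC l
    positivity
  refine ⟨1 + ∑ l ∈ Finset.range (k + 1), N l * C l,
    le_add_of_nonneg_right (Finset.sum_nonneg fun l _ => hN0 l),
    fun F _ _ T h hT σ g A hg hA l hl z hz => ?_⟩
  have hh := hT.pos
  have hle : N l * C l ≤ 1 + ∑ l ∈ Finset.range (k + 1), N l * C l := by
    have := Finset.single_le_sum (f := fun l => N l * C l) (fun l _ => hN0 l)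
      (Finset.mem_range.2 (Nat.lt_succ_of_le hl))
    linarith
  obtain ⟨B, hB⟩ : ∃ B, B = 1 + ∑ l ∈ Finset.range (k + 1), N l * C l := ⟨_, rfl⟩
  rw [← hB] at hle ⊢
  have hB0 : 0 ≤ B := (hN0 l).trans hle
  rcases Nat.eq_zero_or_pos l with rfl | hl0
  · have h0 : T.faceInterp σ 0 g = fun _ => 0 := by
      funext y
      simp [faceInterp]
    rw [h0]
    constructor
    · rw [norm_zero]
      positivity
    · rw [fderiv_fun_const, Pi.zero_apply, norm_zero]
      positivity
  have h1 : T.faceInterp σ l g = fun y => ∑ α ∈ σ.piAntidiag l, T.shape l α y • g (T.node l α) := by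
    funext y
    rw [faceInterp, if_neg hl0.ne']
  have hcard : ((σ.piAntidiag l).card : ℝ) ≤ N l := by
    simp only [hN]
    exact_mod_cast Finset.card_le_card fun α hα => mem_piAntidiag_univ hα
  have hz' := T.body_subset_nbhd hh.le hz
  have hCl := hC l
  have h2 : ∀ α ∈ σ.piAntidiag l, ‖g (T.node l α)‖ ≤ A := fun α hα =>
    hg _ (T.node_mem_face hl0 hα)
  constructor
  · rw [h1]
    refine (norm_sum_le_of_le (n := fun _ => C l * A) _ fun α hα => ?_).trans ?_
    · rw [norm_smul, Real.norm_eq_abs]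
      have := (H l T h hT z hz' α (mem_piAntidiag_univ hα)).1
      have := h2 α hα
      gcongr
    · rw [Finset.sum_const, nsmul_eq_mul]
      calc _ ≤ N l * (C l * A) := by gcongr
        _ = N l * C l * A := by ring
        _ ≤ B * A := by gcongr
  · have h3 : HasFDerivAt (T.faceInterp σ l g)
        (∑ α ∈ σ.piAntidiag l, (fderiv ℝ (T.shape l α) z).smulRight (g (T.node l α))) z := by
      rw [h1]
      exact HasFDerivAt.fun_sum fun α _ =>
        (T.hasFDerivAt_shape l α z).differentiableAt.hasFDerivAt.smul_const _
    rw [h3.fderiv]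
    refine (norm_sum_le_of_le (n := fun _ => C l / h * A) _ fun α hα => ?_).trans ?_
    · rw [ContinuousLinearMap.norm_smulRight_apply]
      have := (H l T h hT z hz' α (mem_piAntidiag_univ hα)).2
      have := h2 α hα
      gcongr
    · rw [Finset.sum_const, nsmul_eq_mul]
      calc _ ≤ N l * (C l / h * A) := by gcongr
        _ = N l * C l * A / h := by ring
        _ ≤ B * A / h := by gcongr

end Cell

end FaceInterpolation

/-! ### The blended extension as a bounded combination of values -/

section Evaluation

open Set Filter Topology

set_option maxSynthPendingDepth 3

/-- Linear combinations, with weights of total size at most `C`, of the values at points of `P`. -/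
def IsEvaluation {X F : Type} [AddCommGroup F] [Module ℝ F] (P : Set X) (C : ℝ)
    (L : (X → F) → F) : Prop :=
  ∃ (ι : Type) (_ : Fintype ι) (y : ι → X) (c : ι → ℝ), (∀ i, y i ∈ P) ∧ ∑ i, |c i| ≤ C ∧
    ∀ w, L w = ∑ i, c i • w (y i)

namespace IsEvaluation

variable {X F : Type} [NormedAddCommGroup F] [NormedSpace ℝ F] {P : Set X} {C C₁ C₂ : ℝ}
  {L L₁ L₂ : (X → F) → F}

theorem zero : IsEvaluation P 0 (fun _ : X → F => (0 : F)) :=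
  ⟨Empty, inferInstance, Empty.elim, fun _ => 0, fun i => i.elim, by simp, fun w => by simp⟩

theorem apply {y : X} (hy : y ∈ P) : IsEvaluation P 1 (fun w : X → F => w y) :=
  ⟨Unit, inferInstance, fun _ => y, fun _ => 1, fun _ => hy, by simp, fun w => by simp⟩

theorem mono (h : IsEvaluation P C₁ L) (hC : C₁ ≤ C₂) : IsEvaluation P C₂ L := by
  obtain ⟨ι, _, y, c, h1, h2, h3⟩ := h
  exact ⟨ι, _, y, c, h1, h2.trans hC, h3⟩

theorem add (h₁ : IsEvaluation P C₁ L₁) (h₂ : IsEvaluation P C₂ L₂) :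
    IsEvaluation P (C₁ + C₂) fun w => L₁ w + L₂ w := by
  obtain ⟨ι₁, _, y₁, c₁, a1, a2, a3⟩ := h₁
  obtain ⟨ι₂, _, y₂, c₂, b1, b2, b3⟩ := h₂
  refine ⟨ι₁ ⊕ ι₂, inferInstance, Sum.elim y₁ y₂, Sum.elim c₁ c₂, ?_, ?_, fun w => ?_⟩
  · rintro (i | i)
    exacts [a1 i, b1 i]
  · rw [Fintype.sum_sum_type]
    exact add_le_add a2 b2
  · beta_reduce
    rw [Fintype.sum_sum_type, a3, b3]
    rfl

theorem smul (h : IsEvaluation P C L) {a B : ℝ} (ha : |a| ≤ B) :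
    IsEvaluation P (B * C) fun w => a • L w := by
  obtain ⟨ι, _, y, c, h1, h2, h3⟩ := h
  refine ⟨ι, inferInstance, y, fun i => a * c i, h1, ?_, fun w => ?_⟩
  · simp only [abs_mul, ← Finset.mul_sum]
    have := (abs_nonneg a).trans ha
    have : 0 ≤ ∑ i, |c i| := Finset.sum_nonneg fun i _ => abs_nonneg _
    gcongr
  · simp only [h3, Finset.smul_sum, smul_smul]

theorem sub (h₁ : IsEvaluation P C₁ L₁) (h₂ : IsEvaluation P C₂ L₂) :
    IsEvaluation P (C₁ + C₂) fun w => L₁ w - L₂ w := by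
  have h3 := h₁.add (h₂.smul (a := -1) (B := 1) (by simp))
  simpa [sub_eq_add_neg] using h3

theorem sum {ι : Type} {s : Finset ι} {M : ι → (X → F) → F} {C : ι → ℝ}
    (h : ∀ i ∈ s, IsEvaluation P (C i) (M i)) :
    IsEvaluation P (∑ i ∈ s, C i) fun w => ∑ i ∈ s, M i w := by
  classical
  induction s using Finset.induction_on with
  | empty => simpa using zero
  | insert i s hi ih =>
    simp only [Finset.sum_insert hi]
    exact (h i (Finset.mem_insert_self _ _)).add
      (ih fun j hj => h j (Finset.mem_insert_of_mem hj))

theorem norm_le (h : IsEvaluation P C L) {w : X → F} {A : ℝ} (hA : 0 ≤ A)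
    (hw : ∀ y ∈ P, ‖w y‖ ≤ A) : ‖L w‖ ≤ C * A := by
  obtain ⟨ι, _, y, c, h1, h2, h3⟩ := h
  rw [h3]
  refine (norm_sum_le_of_le _ (n := fun i => |c i| * A) fun i _ => ?_).trans ?_
  · rw [norm_smul, Real.norm_eq_abs]
    have := hw _ (h1 i)
    gcongr
  · rw [← Finset.sum_mul]
    gcongr

theorem map_sub (h : IsEvaluation P C L) (u w : X → F) :
    L (fun y => u y - w y) = L u - L w := by
  obtain ⟨ι, _, y, c, h1, h2, h3⟩ := h
  simp only [h3, smul_sub, Finset.sum_sub_distrib]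

/-- Points and weights do not depend on the function, hence not on time. Norm bounds, linearity and
time derivatives of the extension thus follow from one representation. -/
theorem hasDerivWithinAt (h : IsEvaluation P C L) {w : ℝ → X → F} {w' : X → F} {s : Set ℝ} {t : ℝ}
    (hw : ∀ y ∈ P, HasDerivWithinAt (fun t => w t y) (w' y) s t) :
    HasDerivWithinAt (fun t => L (w t)) (L w') s t := by
  obtain ⟨ι, _, y, c, h1, h2, h3⟩ := h
  simp only [h3]
  exact HasDerivWithinAt.fun_sum fun i _ => (hw _ (h1 i)).const_smul _

end IsEvaluation

namespace Cell

variable {d : ℕ} {F : Type} [NormedAddCommGroup F] [NormedSpace ℝ F]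

theorem Regular.exists_faceInterp_evaluation (d k : ℕ) (κ : ℝ) : ∃ B : ℝ, 1 ≤ B ∧
    ∀ (F : Type) [NormedAddCommGroup F] [NormedSpace ℝ F] (T : Cell d) (h : ℝ), T.Regular h κ →
      ∀ (P : Set (Pt d)) (C : ℝ) (σ : Finset (Fin (d + 1))) (G : (Pt d → F) → Pt d → F), 0 ≤ C →
        (∀ y ∈ T.face σ, IsEvaluation P C fun w => G w y) → ∀ l ≤ k, ∀ z ∈ T.body,
          IsEvaluation P (B * C) fun w => T.faceInterp σ l (G w) z := by
  choose C hC H using fun l => Regular.exists_shape_bound d l κ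
  obtain ⟨N, hN⟩ : ∃ N : ℕ → ℝ, N = fun l =>
    ((Finset.piAntidiag (Finset.univ : Finset (Fin (d + 1))) l).card : ℝ) := ⟨_, rfl⟩
  have hN0 : ∀ l, 0 ≤ N l * C l := fun l => by
    rw [hN]
    have := hC l
    positivity
  refine ⟨1 + ∑ l ∈ Finset.range (k + 1), N l * C l,
    le_add_of_nonneg_right (Finset.sum_nonneg fun l _ => hN0 l),
    fun F _ _ T h hT P c σ G hc hG l hl z hz => ?_⟩
  have hle : N l * C l ≤ 1 + ∑ l ∈ Finset.range (k + 1), N l * C l := by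
    have := Finset.single_le_sum (f := fun l => N l * C l) (fun l _ => hN0 l)
      (Finset.mem_range.2 (Nat.lt_succ_of_le hl))
    linarith
  rcases Nat.eq_zero_or_pos l with rfl | hl0
  · simp only [faceInterp, if_pos]
    exact IsEvaluation.zero.mono (mul_nonneg ((hN0 0).trans hle) hc)
  simp only [faceInterp, if_neg hl0.ne']
  refine (IsEvaluation.sum (C := fun _ => C l * c) fun α hα =>
    (hG _ (T.node_mem_face hl0 hα)).smul
      (H l T h hT z (T.body_subset_nbhd hT.pos.le hz) α (mem_piAntidiag_univ hα)).1).mono ?_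
  have hcard : ((σ.piAntidiag l).card : ℝ) ≤ N l := by
    simp only [hN]
    exact_mod_cast Finset.card_le_card fun α hα => mem_piAntidiag_univ hα
  rw [Finset.sum_const, nsmul_eq_mul]
  have hCl := hC l
  calc _ ≤ N l * (C l * c) := by gcongr
    _ = N l * C l * c := by ring
    _ ≤ _ := by gcongr

theorem Regular.exists_lift_evaluation (d k : ℕ) (κ : ℝ) : ∃ B : ℝ, 1 ≤ B ∧
    ∀ (F : Type) [NormedAddCommGroup F] [NormedSpace ℝ F] (T : Cell d) (h : ℝ), T.Regular h κ →
      ∀ (P : Set (Pt d)) (C : ℝ) (σ : Finset (Fin (d + 1))) (G : (Pt d → F) → Pt d → F), 0 ≤ C →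
        (∀ y ∈ T.face σ, IsEvaluation P C fun w => G w y) → ∀ x ∈ T.body,
          IsEvaluation P (B * C) fun w => T.lift k σ (G w) x := by
  obtain ⟨B, hB, H⟩ := Regular.exists_faceInterp_evaluation d k κ
  refine ⟨k * (1 * (B + B)) + 1 * (1 + B), by
    have : (0 : ℝ) ≤ k * (1 * (B + B)) := by positivity
    linarith, fun F _ _ T h hT P C σ G hC hG x hx => ?_⟩
  -- Where the weight vanishes the projection has only a default value, but every term carries a
  -- positive power of the weight.
  by_cases hw : T.weight σ x = 0
  · have h0 : ∀ g : Pt d → F, T.lift k σ g x = 0 := fun g => by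
      rw [lift, hw, zero_pow (by omega), zero_smul, add_zero]
      refine Finset.sum_eq_zero fun l hl => ?_
      rw [zero_pow (by have := (Finset.mem_Icc.1 hl).1; omega), zero_smul]
    simp only [h0]
    exact IsEvaluation.zero.mono (by positivity)
  have hz := proj_mem_face hx hw
  have hzb := T.face_subset_body σ hz
  have hw1 : ∀ l : ℕ, |T.weight σ x ^ l| ≤ 1 := fun l => by
    rw [abs_pow, abs_of_nonneg (weight_nonneg hx σ)]
    exact pow_le_one₀ (weight_nonneg hx σ) (weight_le_one hx σ)
  have hP : ∀ l ≤ k, _ := fun l hl => H F T h hT P C σ G hC hG l hl _ hzb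
  have h1 := (IsEvaluation.sum (s := Finset.Icc 1 k) (C := fun _ => 1 * (B * C + B * C))
    fun l hl => ((hP l (Finset.mem_Icc.1 hl).2).sub (hP (l - 1) (by
      have := (Finset.mem_Icc.1 hl).2
      omega))).smul (hw1 l)).add (((hG _ hz).sub (hP k le_rfl)).smul (hw1 (k + 1)))
  refine h1.mono (le_of_eq ?_)
  rw [Finset.sum_const, Nat.card_Icc, nsmul_eq_mul, Nat.add_sub_cancel]
  ring

open scoped Classical in
/-- The blended extension is a bounded combination of the given values. -/
theorem Regular.exists_blend_evaluation (d k : ℕ) (κ : ℝ) (j : ℕ) : ∃ C : ℝ, 1 ≤ C ∧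
    ∀ (F : Type) [NormedAddCommGroup F] [NormedSpace ℝ F] (T : Cell d) (h : ℝ), T.Regular h κ →
      ∀ (Γ : Set (Pt d)), ∀ x ∈ T.body,
        IsEvaluation Γ C fun w : Pt d → F => T.blend k Γ w j x := by
  obtain ⟨B, hB, H⟩ := Regular.exists_lift_evaluation d k κ
  induction j with
  | zero => exact ⟨1, le_rfl, fun F _ _ T h hT Γ x hx => IsEvaluation.zero.mono zero_le_one⟩
  | succ j ih =>
    obtain ⟨C, hC, HC⟩ := ih
    refine ⟨C + (Finset.univ : Finset (Finset (Fin (d + 1)))).card * (B * (1 + C)), by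
      have : 0 ≤ (Finset.univ : Finset (Finset (Fin (d + 1)))).card * (B * (1 + C)) := by positivity
      linarith, fun F _ _ T h hT Γ x hx => ?_⟩
    have h1 := (HC F T h hT Γ x hx).add (IsEvaluation.sum
      (s := (Finset.univ : Finset (Finset (Fin (d + 1)))).filter
        (fun σ => σ.card = j + 1 ∧ T.face σ ⊆ Γ)) (C := fun _ => B * (1 + C)) fun σ hσ =>
        H F T h hT Γ (1 + C) σ (fun w y => w y - T.blend k Γ w j y) (by positivity)
          (fun y hy => (IsEvaluation.apply ((Finset.mem_filter.1 hσ).2.2 hy)).sub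
            (HC F T h hT Γ y (T.face_subset_body σ hy))) x hx)
    refine IsEvaluation.mono h1 ?_
    rw [Finset.sum_const, nsmul_eq_mul]
    gcongr
    exact Finset.filter_subset _ _

end Cell

end Evaluation

/-! ### The gradient of the blended extension -/

section BlendGradient

open Set Filter Topology

set_option maxSynthPendingDepth 3

/-- Because `l ≥ 1`, the derivative of `u` keeps one factor `s x`. In the application `u'` grows
like the reciprocal of a weight, and this factor compensates it. -/
theorem HasFDerivAt.exists_pow_smul {E F : Type} [NormedAddCommGroup E] [NormedSpace ℝ E]
    [NormedAddCommGroup F] [NormedSpace ℝ F] {s : E → ℝ} {u : E → F} {s' : E →L[ℝ] ℝ}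
    {u' : E →L[ℝ] F} {x : E} (hs : HasFDerivAt s s' x) (hu : HasFDerivAt u u' x) (h0 : 0 ≤ s x)
    (h1 : s x ≤ 1) {l : ℕ} (hl : 1 ≤ l) : ∃ L : E →L[ℝ] F,
      HasFDerivAt (fun y => s y ^ l • u y) L x ∧ ‖L‖ ≤ s x * ‖u'‖ + l * (‖s'‖ * ‖u x‖) := by
  have h2 : HasFDerivAt (fun y => s y ^ l) ((l * s x ^ (l - 1)) • s') x :=
    (hasDerivAt_pow l (s x)).comp_hasFDerivAt x hs
  refine ⟨_, h2.smul hu, (norm_add_le _ _).trans ?_⟩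
  rw [norm_smul, ContinuousLinearMap.norm_smulRight_apply, norm_smul, Real.norm_eq_abs,
    Real.norm_eq_abs, abs_mul, abs_pow, abs_pow, abs_of_nonneg h0, Nat.abs_cast]
  have h3 : s x ^ l ≤ s x := pow_le_of_le_one h0 h1 (by omega)
  have h4 : s x ^ (l - 1) ≤ 1 := pow_le_one₀ h0 h1
  calc _ ≤ s x * ‖u'‖ + l * 1 * ‖s'‖ * ‖u x‖ := by gcongr
    _ = _ := by ring

namespace Cell

variable {d : ℕ} {F : Type} [NormedAddCommGroup F] [NormedSpace ℝ F]

/-- The lifting in terms of the projection to the common subface. -/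
theorem lift_proj (T : Cell d) (k : ℕ) {σ ρ : Finset (Fin (d + 1))} {y : Pt d}
    (h : T.weight ρ y ≠ 0) (g : Pt d → F) : T.lift k σ g (T.proj ρ y) =
      (∑ l ∈ Finset.Icc 1 k, ((T.weight ρ y)⁻¹ * T.weight (σ ∩ ρ) y) ^ l •
        (T.faceInterp σ l g (T.proj (σ ∩ ρ) y) - T.faceInterp σ (l - 1) g (T.proj (σ ∩ ρ) y))) +
      ((T.weight ρ y)⁻¹ * T.weight (σ ∩ ρ) y) ^ (k + 1) •
        (g (T.proj (σ ∩ ρ) y) - T.faceInterp σ k g (T.proj (σ ∩ ρ) y)) := by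
  rw [lift, T.weight_proj h, T.proj_proj h]

/-- On the face `ρ` the lifting is a polynomial in the ratio `s` of the weights of `σ ∩ ρ` and `ρ`,
with values at the projection to `σ ∩ ρ` as coefficients. Their derivatives grow like the reciprocal
weight of `σ ∩ ρ`; the factor `s` turns this into the reciprocal weight of `ρ`, so singularities do
not accumulate. -/
theorem Regular.exists_lift_deriv (d k : ℕ) (κ : ℝ) : ∃ C : ℝ, 1 ≤ C ∧
    ∀ (F : Type) [NormedAddCommGroup F] [NormedSpace ℝ F] (T : Cell d) (h : ℝ), T.Regular h κ →
      ∀ x ∈ interior T.body, ∀ σ ρ : Finset (Fin (d + 1)), (σ ∩ ρ).Nonempty →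
      ∀ (g : Pt d → F) (M : Pt d →L[ℝ] F),
        HasFDerivAt (fun y => g (T.proj (σ ∩ ρ) y)) M x →
        ∃ L : Pt d →L[ℝ] F, HasFDerivAt (fun y => T.lift k σ g (T.proj ρ y)) L x ∧
          ∀ A B : ℝ, 0 ≤ A → (∀ y ∈ T.face σ, ‖g y‖ ≤ A) → ‖M‖ ≤ B / T.weight (σ ∩ ρ) x →
            ‖L‖ ≤ C * (A / h + B) / T.weight ρ x := by
  obtain ⟨C, hC, H⟩ := Regular.exists_faceInterp_bound d k κ
  obtain ⟨c₁, hc₁⟩ : ∃ c₁, c₁ = ((d : ℝ) + 1) * κ := ⟨_, rfl⟩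
  refine ⟨1 + (k + 1) * ((2 * C) * |c₁| + (k + 1) * (2 * |c₁| * (2 * C))), by
    have : 0 ≤ (k + 1) * ((2 * C) * |c₁| + (k + 1) * (2 * |c₁| * (2 * C))) := by positivity
    linarith, fun F _ _ T h hT x hx σ ρ hτ g M hM => ?_⟩
  have hh := hT.pos
  have hκ := hT.kappa_nonneg
  have hc₁0 : 0 ≤ c₁ := by rw [hc₁]; positivity
  rw [abs_of_nonneg hc₁0]
  have hxb := interior_subset hx
  have hsub : σ ∩ ρ ⊆ ρ := Finset.inter_subset_right
  have hρ : ρ.Nonempty := hτ.mono hsub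
  have wρ := weight_pos hx hρ
  have wτ := weight_pos hx hτ
  obtain ⟨Z, hZ, hZb⟩ := hT.exists_hasFDerivAt_proj hx hτ
  obtain ⟨s', hs', hs'b⟩ := hT.exists_hasFDerivAt_ratio hx hρ hsub
  rw [← hc₁] at hZb hs'b
  obtain ⟨s, hs⟩ : ∃ s : Pt d → ℝ, s = fun y => (T.weight ρ y)⁻¹ * T.weight (σ ∩ ρ) y := ⟨_, rfl⟩
  have hsx : s x = T.weight (σ ∩ ρ) x / T.weight ρ x := by rw [hs]; exact inv_mul_eq_div _ _
  have hs0 : 0 ≤ s x := by rw [hsx]; positivity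
  have hs1 : s x ≤ 1 := by
    rw [hsx, div_le_one wρ]
    exact weight_mono hxb hsub
  rw [← hs] at hs'
  have hzb : T.proj (σ ∩ ρ) x ∈ T.face σ :=
    face_mono Finset.inter_subset_left (proj_mem_face hxb wτ.ne')
  obtain ⟨p, hp⟩ : ∃ p : ℕ → Pt d → F, p = fun l y => T.faceInterp σ l g (T.proj (σ ∩ ρ) y) :=
    ⟨_, rfl⟩
  obtain ⟨p', hp'⟩ : ∃ p' : ℕ → Pt d →L[ℝ] F,
    p' = fun l => (fderiv ℝ (T.faceInterp σ l g) (T.proj (σ ∩ ρ) x)).comp Z := ⟨_, rfl⟩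
  have hpd : ∀ l, HasFDerivAt (p l) (p' l) x := fun l => by
    rw [hp, hp']
    exact (T.differentiableAt_faceInterp σ l g _).hasFDerivAt.comp x hZ
  have hterm := fun l (hl : 1 ≤ l) =>
    hs'.exists_pow_smul ((hpd l).sub (hpd (l - 1))) hs0 hs1 hl
  choose! L hL hLb using hterm
  obtain ⟨L', hL', hLb'⟩ := hs'.exists_pow_smul (hM.sub (hpd k)) hs0 hs1 (l := k + 1) (by omega)
  refine ⟨∑ l ∈ Finset.Icc 1 k, L l + L', ?_, fun A B hA hg hMb => ?_⟩
  · refine ((HasFDerivAt.fun_sum fun l hl => hL l (Finset.mem_Icc.1 hl).1).add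
      hL').congr_of_eventuallyEq ?_
    filter_upwards [isOpen_interior.mem_nhds hx] with y hy
    rw [T.lift_proj k (weight_pos hy hρ).ne', hs, hp]
    rfl
  · have hp0 : ∀ l ≤ k, ‖p l x‖ ≤ C * A := fun l hl => by
      rw [hp]
      exact (H F T h hT σ g A hg hA l hl _ (T.face_subset_body σ hzb)).1
    have hp1 : ∀ l ≤ k, ‖p' l‖ ≤ C * A / h * (c₁ / T.weight (σ ∩ ρ) x) := fun l hl => by
      rw [hp']
      refine (ContinuousLinearMap.opNorm_comp_le _ _).trans ?_
      have := (H F T h hT σ g A hg hA l hl _ (T.face_subset_body σ hzb)).2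
      gcongr
    have hgz := hg _ hzb
    obtain ⟨R, hR⟩ : ∃ R, R = A / (h * T.weight ρ x) := ⟨_, rfl⟩
    have hR0 : 0 ≤ R := by rw [hR]; positivity
    have e1 : ∀ u' : Pt d →L[ℝ] F, ∀ b : ℝ, ‖u'‖ ≤ b / T.weight (σ ∩ ρ) x →
        s x * ‖u'‖ ≤ b / T.weight ρ x := fun u' b hu => by
      rw [hsx]
      calc _ ≤ T.weight (σ ∩ ρ) x / T.weight ρ x * (b / T.weight (σ ∩ ρ) x) := by gcongr
        _ = _ := by field_simp
    have e2 : ∀ l : ℕ, l ≤ k + 1 → ∀ v : F, ‖v‖ ≤ 2 * C * A →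
        l * (‖s'‖ * ‖v‖) ≤ (k + 1) * (2 * c₁ * (2 * C)) * R := fun l hl v hv => by
      have h1 : (l : ℝ) ≤ k + 1 := by exact_mod_cast hl
      calc _ ≤ ((k : ℝ) + 1) * ((2 * (c₁ / h) / T.weight ρ x) * (2 * C * A)) := by gcongr
        _ = _ := by
          rw [hR]
          field_simp
    have e3 : ∀ l ∈ Finset.Icc 1 k, ‖L l‖ ≤ ((2 * C) * c₁ + (k + 1) * (2 * c₁ * (2 * C))) * R := by
      intro l hl
      obtain ⟨hl1, hlk⟩ := Finset.mem_Icc.1 hl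
      have h1 : ‖p' l - p' (l - 1)‖ ≤ (2 * (C * A / h * c₁)) / T.weight (σ ∩ ρ) x := by
        refine (norm_sub_le _ _).trans ((add_le_add (hp1 l hlk) (hp1 (l - 1) (by omega))).trans
          (le_of_eq ?_))
        ring
      have h2 : ‖p l x - p (l - 1) x‖ ≤ 2 * C * A := by
        refine (norm_sub_le _ _).trans ((add_le_add (hp0 l hlk) (hp0 (l - 1) (by omega))).trans
          (le_of_eq ?_))
        ring
      refine (hLb l hl1).trans ((add_le_add (e1 _ _ h1) (e2 l (by omega) _ h2)).trans
        (le_of_eq ?_))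
      rw [hR]
      field_simp
    have e4 : ‖L'‖ ≤ B / T.weight ρ x +
        ((2 * C) * c₁ + (k + 1) * (2 * c₁ * (2 * C))) * R := by
      have h1 : ‖M - p' k‖ ≤ (B + C * A / h * c₁) / T.weight (σ ∩ ρ) x := by
        refine (norm_sub_le _ _).trans ((add_le_add hMb (hp1 k le_rfl)).trans (le_of_eq ?_))
        ring
      have h2 : ‖g (T.proj (σ ∩ ρ) x) - p k x‖ ≤ 2 * C * A := by
        refine (norm_sub_le _ _).trans ((add_le_add hgz (hp0 k le_rfl)).trans ?_)
        nlinarith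
      refine hLb'.trans ((add_le_add (e1 _ _ h1) (e2 (k + 1) le_rfl _ h2)).trans ?_)
      have h3 : (B + C * A / h * c₁) / T.weight ρ x = B / T.weight ρ x + C * c₁ * R := by
        rw [hR]
        field_simp
      have h4 : 0 ≤ C * c₁ * R := by positivity
      rw [h3]
      linarith
    have hB0 : 0 ≤ B / T.weight ρ x := by
      have h1 := (norm_nonneg _).trans hMb
      have h2 : 0 ≤ B := by
        by_contra! h3
        exact absurd h1 (not_le.2 (div_neg_of_neg_of_pos h3 wτ))
      positivity
    obtain ⟨Q, hQ⟩ : ∃ Q, Q = (2 * C) * c₁ + (k + 1) * (2 * c₁ * (2 * C)) := ⟨_, rfl⟩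
    have hQ0 : 0 ≤ Q := by rw [hQ]; positivity
    rw [← hQ] at e3 e4 ⊢
    have e5 := norm_sum_le_of_le _ e3
    rw [Finset.sum_const, Nat.card_Icc, nsmul_eq_mul, Nat.add_sub_cancel] at e5
    have e6 : (1 + (k + 1) * Q) * (A / h + B) / T.weight ρ x =
        (1 + (k + 1) * Q) * R + (1 + (k + 1) * Q) * (B / T.weight ρ x) := by
      rw [hR]
      field_simp
    rw [e6]
    refine (norm_add_le _ _).trans ((add_le_add e5 e4).trans ?_)
    have e7 : 0 ≤ (k + 1) * Q * (B / T.weight ρ x) := by positivity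
    nlinarith

open scoped Classical in
/-- The gradient of the blended extension, on the faces of the simplex. -/
theorem Regular.exists_blend_proj_deriv (d k : ℕ) (κ : ℝ) (j : ℕ) : ∃ C : ℝ, 1 ≤ C ∧
    ∀ (F : Type) [NormedAddCommGroup F] [NormedSpace ℝ F] (T : Cell d) (h : ℝ), T.Regular h κ →
      ∀ x ∈ interior T.body, ∀ (Γ : Set (Pt d)) (w : Pt d → F)
        (M : Finset (Fin (d + 1)) → Pt d →L[ℝ] F),
        (∀ τ, τ.Nonempty → T.face τ ⊆ Γ → HasFDerivAt (fun y => w (T.proj τ y)) (M τ) x) →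
        ∀ ρ : Finset (Fin (d + 1)), ρ.Nonempty → ∃ L : Pt d →L[ℝ] F,
          HasFDerivAt (fun y => T.blend k Γ w j (T.proj ρ y)) L x ∧
          ∀ A B : ℝ, 0 ≤ A → 0 ≤ B → (∀ y ∈ Γ, ‖w y‖ ≤ A) →
            (∀ τ, τ.Nonempty → T.face τ ⊆ Γ → ‖M τ‖ ≤ B / T.weight τ x) →
            ‖L‖ ≤ C * (A / h + B) / T.weight ρ x := by
  induction j with
  | zero =>
    refine ⟨1, le_rfl, fun F _ _ T h hT x hx Γ w M hM ρ hρ =>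
      ⟨0, hasFDerivAt_const (0 : F) x, fun A B hA hB _ _ => ?_⟩⟩
    have := hT.pos
    have := weight_pos hx hρ
    rw [norm_zero]
    positivity
  | succ j ih =>
    obtain ⟨C, hC, H⟩ := ih
    obtain ⟨C₁, hC₁, H₁⟩ := Regular.exists_lift_deriv d k κ
    obtain ⟨C₂, hC₂, H₂⟩ := Regular.exists_blend_evaluation d k κ j
    obtain ⟨N, hN⟩ : ∃ N : ℝ, N = (Finset.univ : Finset (Finset (Fin (d + 1)))).card := ⟨_, rfl⟩
    have hN0 : 0 ≤ N := by rw [hN]; positivity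
    refine ⟨C + N * (C₁ * (1 + C₂ + (1 + C))), by
      have : 0 ≤ N * (C₁ * (1 + C₂ + (1 + C))) := by positivity
      linarith, fun F _ _ T h hT x hx Γ w M hM ρ hρ => ?_⟩
    have hh := hT.pos
    have wρ := weight_pos hx hρ
    obtain ⟨s, hs⟩ : ∃ s, s = (Finset.univ : Finset (Finset (Fin (d + 1)))).filter
        (fun σ => σ.card = j + 1 ∧ T.face σ ⊆ Γ) := ⟨_, rfl⟩
    have hsN : (s.card : ℝ) ≤ N := by
      rw [hN, hs]
      exact_mod_cast Finset.card_filter_le _ _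
    have hsΓ : ∀ σ ∈ s, T.face σ ⊆ Γ := fun σ hσ => by
      rw [hs] at hσ
      exact (Finset.mem_filter.1 hσ).2.2
    obtain ⟨L₀, hL₀, hL₀b⟩ := H F T h hT x hx Γ w M hM ρ hρ
    have hlift : ∀ σ ∈ s, ∃ L : Pt d →L[ℝ] F,
        HasFDerivAt (fun y => T.lift k σ (fun z => w z - T.blend k Γ w j z) (T.proj ρ y)) L x ∧
        ∀ A B : ℝ, 0 ≤ A → 0 ≤ B → (∀ y ∈ Γ, ‖w y‖ ≤ A) →
            (∀ τ, τ.Nonempty → T.face τ ⊆ Γ → ‖M τ‖ ≤ B / T.weight τ x) →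
            ‖L‖ ≤ C₁ * (1 + C₂ + (1 + C)) * (A / h + B) / T.weight ρ x := fun σ hσ => by
      -- If the faces have no common vertex, the weight of `σ` vanishes on `ρ`, and so does the
      -- lifting.
      rcases (σ ∩ ρ).eq_empty_or_nonempty with hτ | hτ
      · refine ⟨0, (hasFDerivAt_const (0 : F) x).congr_of_eventuallyEq ?_,
          fun A B hA hB _ _ => ?_⟩
        · filter_upwards [isOpen_interior.mem_nhds hx] with y hy
          have h0 : T.weight σ (T.proj ρ y) = 0 := by
            rw [T.weight_proj (weight_pos hy hρ).ne', hτ]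
            simp [weight]
          rw [lift, h0, zero_pow (by omega), zero_smul, add_zero]
          refine Finset.sum_eq_zero fun l hl => ?_
          rw [zero_pow (by have := (Finset.mem_Icc.1 hl).1; omega), zero_smul]
        · rw [norm_zero]
          positivity
      · have hτΓ : T.face (σ ∩ ρ) ⊆ Γ := (face_mono Finset.inter_subset_left).trans (hsΓ σ hσ)
        -- The correction on `σ` involves the lower order blend on `σ ∩ ρ`; this is why the
        -- induction runs over statements for all faces at once.
        obtain ⟨L₁, hL₁, hL₁b⟩ := H F T h hT x hx Γ w M hM (σ ∩ ρ) hτ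
        obtain ⟨L, hL, hLb⟩ := H₁ F T h hT x hx σ ρ hτ (fun z => w z - T.blend k Γ w j z) _
          ((hM _ hτ hτΓ).sub hL₁)
        refine ⟨L, hL, fun A B hA hB hw hMb => ?_⟩
        have wτ := weight_pos hx hτ
        have e1 := hLb ((1 + C₂) * A) (B + C * (A / h + B)) (by positivity)
          (fun y hy => by
            refine (norm_sub_le _ _).trans ?_
            have h1 := hw y (hsΓ σ hσ hy)
            have h2 := (H₂ F T h hT Γ y (T.face_subset_body σ hy)).norm_le hA hw
            linarith) (by
            refine (norm_sub_le _ _).trans ((add_le_add (hMb _ hτ hτΓ)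
              (hL₁b A B hA hB hw hMb)).trans (le_of_eq ?_))
            ring)
        refine e1.trans ?_
        rw [mul_assoc C₁]
        gcongr
        have e2 : 0 ≤ A / h := by positivity
        have e3 : (1 + C₂) * A / h = (1 + C₂) * (A / h) := by ring
        rw [e3]
        nlinarith
    choose! L hL hLb using hlift
    refine ⟨L₀ + ∑ σ ∈ s, L σ, ?_, fun A B hA hB hw hMb => ?_⟩
    · have h1 := hL₀.add (HasFDerivAt.fun_sum hL)
      rw [hs] at h1
      rw [hs]
      exact h1
    · have e1 := hL₀b A B hA hB hw hMb
      have e2 := norm_sum_le_of_le s fun σ hσ => hLb σ hσ A B hA hB hw hMb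
      rw [Finset.sum_const, nsmul_eq_mul] at e2
      have e3 : 0 ≤ C₁ * (1 + C₂ + (1 + C)) * (A / h + B) / T.weight ρ x := by positivity
      calc _ ≤ C * (A / h + B) / T.weight ρ x +
            N * (C₁ * (1 + C₂ + (1 + C)) * (A / h + B) / T.weight ρ x) :=
            (norm_add_le _ _).trans (add_le_add e1 (e2.trans (by gcongr)))
        _ = _ := by ring

/-- The gradient of the blended extension in the interior of the simplex. -/
theorem Regular.exists_blend_deriv (d k : ℕ) (κ : ℝ) (j : ℕ) : ∃ C : ℝ, 1 ≤ C ∧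
    ∀ (F : Type) [NormedAddCommGroup F] [NormedSpace ℝ F] (T : Cell d) (h : ℝ), T.Regular h κ →
      ∀ x ∈ interior T.body, ∀ (Γ : Set (Pt d)) (w : Pt d → F)
        (M : Finset (Fin (d + 1)) → Pt d →L[ℝ] F),
        (∀ τ, τ.Nonempty → T.face τ ⊆ Γ → HasFDerivAt (fun y => w (T.proj τ y)) (M τ) x) →
        ∃ L : Pt d →L[ℝ] F, HasFDerivAt (T.blend k Γ w j) L x ∧
          ∀ A B : ℝ, 0 ≤ A → 0 ≤ B → (∀ y ∈ Γ, ‖w y‖ ≤ A) →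
            (∀ τ, τ.Nonempty → T.face τ ⊆ Γ → ‖M τ‖ ≤ B / T.weight τ x) →
            ‖L‖ ≤ C * (A / h + B) := by
  obtain ⟨C, hC, H⟩ := Regular.exists_blend_proj_deriv d k κ j
  refine ⟨C, hC, fun F _ _ T h hT x hx Γ w M hM => ?_⟩
  have h1 := H F T h hT x hx Γ w M hM Finset.univ Finset.univ_nonempty
  simpa only [proj_univ, weight_univ, div_one] using h1

end Cell

end BlendGradient

/-! ### From the active region to the whole domain -/

section GlobalError

open Set Filter Topology

set_option maxSynthPendingDepth 3

namespace Slab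

variable {d : ℕ}

/-- Two families of maps on the region of a set of elements which differ by `ε₀` in value, by
`ε₀ / Δt` in the time derivative, and by `ε₁` in the spatial derivatives. -/
structure RegionError (S : Slab d) (A : Set (Fin S.mesh.card)) (Θ Ψ : Pt d → ℝ → Pt d)
    (ε₀ ε₁ : ℝ) : Prop where
  nonneg : 0 ≤ ε₀
  nonneg' : 0 ≤ ε₁
  value : ∀ x ∈ S.mesh.region A, ∀ t ∈ S.I, ‖Θ x t - Ψ x t‖ ≤ ε₀
  time : ∀ x ∈ S.mesh.region A, ∀ t ∈ S.I, ∃ θ ψ : Pt d, HasDerivWithinAt (Θ x) θ S.I t ∧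
    HasDerivWithinAt (Ψ x) ψ S.I t ∧ S.dt * ‖θ - ψ‖ ≤ ε₀
  space : ∀ T ∈ A, ∀ t ∈ S.I, ∃ Θ' Ψ' : Pt d → Pt d, ∀ x ∈ S.mesh.elem T,
    Θ x t = Θ' x ∧ Ψ x t = Ψ' x ∧ ∃ L L' : Pt d →L[ℝ] Pt d, HasFDerivAt Θ' L x ∧
      HasFDerivAt Ψ' L' x ∧ ‖L - L'‖ ≤ ε₁

theorem supBound_of_forall {S : Slab d} {Θ Ψ : Pt d → ℝ → Pt d} {ε R : ℝ} (hε : 2 * ε ≤ R)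
    (h0 : ∀ x ∈ S.mesh.domain, ∀ t ∈ S.I, ‖Θ x t - Ψ x t‖ ≤ ε)
    (h1 : ∀ x ∈ S.mesh.domain, ∀ t ∈ S.I, ∃ θ ψ : Pt d, HasDerivWithinAt (Θ x) θ S.I t ∧
      HasDerivWithinAt (Ψ x) ψ S.I t ∧ S.dt * ‖θ - ψ‖ ≤ ε) : S.SupBound Θ Ψ R := by
  refine ⟨fun x hx t ht => ?_, fun x hx t ht y hy s hs => ?_⟩
  · obtain ⟨θ, ψ, h2, h3, -⟩ := h1 x hx t ht
    exact ⟨h2.differentiableWithinAt, h3.differentiableWithinAt⟩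
  · obtain ⟨θ, ψ, h2, h3, h4⟩ := h1 y hy s hs
    rw [h2.derivWithin (S.uniqueDiffOn_I s hs), h3.derivWithin (S.uniqueDiffOn_I s hs)]
    linarith [h0 x hx t ht]

theorem gradBound_of_forall {S : Slab d} {Θ Ψ : Pt d → ℝ → Pt d} {c R : ℝ}
    (h : ∀ t ∈ S.I, ∀ T, ∀ x ∈ interior (S.mesh.elem T), ∃ L L' : Pt d →L[ℝ] Pt d,
      HasFDerivAt (fun y => Θ y t) L x ∧ HasFDerivAt (fun y => Ψ y t) L' x ∧ c * ‖L - L'‖ ≤ R) :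
    S.GradBound c Θ Ψ R := fun t ht T x hx => by
  obtain ⟨L, L', h1, h2, h3⟩ := h t ht T x hx
  refine ⟨h1.differentiableAt, h2.differentiableAt, ?_⟩
  rwa [h1.fderiv, h2.fderiv]

theorem _root_.Mesh.mem_region {M : Mesh d} {A : Set (Fin M.card)} {x : Pt d} :
    x ∈ M.region A ↔ ∃ T ∈ A, x ∈ M.elem T := by
  simp [Mesh.region]

theorem _root_.Mesh.notMem_region_of_mem_interior {M : Mesh d} {A : Set (Fin M.card)}
    {T : Fin M.card} (hT : T ∉ A) {x : Pt d} (hx : x ∈ interior (M.elem T)) : x ∉ M.region A :=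
  fun h => by
    obtain ⟨T', hT', hx'⟩ := Mesh.mem_region.1 h
    exact hT (M.eq_of_mem_interior hx hx' ▸ hT')

namespace RegionError

variable {S : Slab d} {A : Set (Fin S.mesh.card)} {Θ Ψ : Pt d → ℝ → Pt d} {ε₀ ε₁ : ℝ}

/-- The spatial derivatives in the interior of an active element, for extensions of the maps. -/
theorem exists_hasFDerivAt (h : S.RegionError A Θ Ψ ε₀ ε₁) {T : Fin S.mesh.card} (hT : T ∈ A)
    {t : ℝ} (ht : t ∈ S.I) {x : Pt d} (hx : x ∈ interior (S.mesh.elem T)) {Θ' Ψ' : Pt d → Pt d}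
    (hΘ : ∀ y ∈ S.mesh.region A, Θ' y = Θ y t) (hΨ : ∀ y ∈ S.mesh.region A, Ψ' y = Ψ y t) :
    ∃ L L' : Pt d →L[ℝ] Pt d, HasFDerivAt Θ' L x ∧ HasFDerivAt Ψ' L' x ∧ ‖L - L'‖ ≤ ε₁ := by
  obtain ⟨f, g, hfg⟩ := h.space T hT t ht
  obtain ⟨-, -, L, L', h1, h2, h3⟩ := hfg x (interior_subset hx)
  have hreg : ∀ y ∈ interior (S.mesh.elem T), y ∈ S.mesh.region A := fun y hy =>
    Mesh.mem_region.2 ⟨T, hT, interior_subset hy⟩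
  refine ⟨L, L', h1.congr_of_eventuallyEq ?_, h2.congr_of_eventuallyEq ?_, h3⟩
  · filter_upwards [isOpen_interior.mem_nhds hx] with y hy
    rw [hΘ y (hreg y hy), (hfg y (interior_subset hy)).1]
  · filter_upwards [isOpen_interior.mem_nhds hx] with y hy
    rw [hΨ y (hreg y hy), (hfg y (interior_subset hy)).2.1]

theorem supBound_extendId (h : S.RegionError A Θ Ψ ε₀ ε₁) {R : ℝ} (hR : 2 * ε₀ ≤ R) :
    S.SupBound (fun x t => S.mesh.extendId A (fun y => Θ y t) x)
      (fun x t => S.mesh.extendId A (fun y => Ψ y t) x) R := by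
  refine supBound_of_forall hR (fun x _ t ht => ?_) fun x _ t ht => ?_
  · by_cases hx : x ∈ S.mesh.region A
    · simp only [Mesh.extendId, if_pos hx]
      exact h.value x hx t ht
    · simp only [Mesh.extendId, if_neg hx, sub_self, norm_zero]
      exact h.nonneg
  · by_cases hx : x ∈ S.mesh.region A
    · simp only [Mesh.extendId, if_pos hx]
      exact h.time x hx t ht
    · simp only [Mesh.extendId, if_neg hx]
      refine ⟨0, 0, hasDerivWithinAt_const _ _ _, hasDerivWithinAt_const _ _ _, ?_⟩
      rw [sub_self, norm_zero, mul_zero]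
      exact h.nonneg

theorem gradBound_extendId (h : S.RegionError A Θ Ψ ε₀ ε₁) {R : ℝ} (hR : ε₁ ≤ R) :
    S.GradBound 1 (fun x t => S.mesh.extendId A (fun y => Θ y t) x)
      (fun x t => S.mesh.extendId A (fun y => Ψ y t) x) R := by
  refine gradBound_of_forall fun t ht T x hx => ?_
  by_cases hT : T ∈ A
  · obtain ⟨L, L', h1, h2, h3⟩ := h.exists_hasFDerivAt hT ht hx
      (Θ' := fun y => S.mesh.extendId A (fun y => Θ y t) y)
      (Ψ' := fun y => S.mesh.extendId A (fun y => Ψ y t) y)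
      (fun y hy => by simp only [Mesh.extendId, if_pos hy])
      (fun y hy => by simp only [Mesh.extendId, if_pos hy])
    exact ⟨L, L', h1, h2, by linarith⟩
  · have h1 : ∀ P : Pt d → Pt d, HasFDerivAt (fun y => S.mesh.extendId A P y)
        (ContinuousLinearMap.id ℝ (Pt d)) x := fun P => by
      refine (hasFDerivAt_id x).congr_of_eventuallyEq ?_
      filter_upwards [isOpen_interior.mem_nhds hx] with y hy
      rw [Mesh.extendId, if_neg (Mesh.notMem_region_of_mem_interior hT hy)]
      rfl
    refine ⟨_, _, h1 _, h1 _, ?_⟩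
    rw [sub_self, norm_zero, mul_zero]
    exact h.nonneg'.trans hR

/-- Values and time derivatives of the blended extensions. -/
theorem exists_supBound_extendFE (d k : ℕ) (κ : ℝ) : ∃ C : ℝ, 1 ≤ C ∧
    ∀ (S : Slab d) (A : Set (Fin S.mesh.card)) (Θ Ψ : Pt d → ℝ → Pt d) (ε₀ ε₁ : ℝ),
      0 < S.dt → (∀ T, (S.mesh.cell T).Regular S.h κ) → S.RegionError A Θ Ψ ε₀ ε₁ →
      ∀ R, C * ε₀ ≤ R → S.SupBound (fun x t => S.mesh.extendFE k A (fun y => Θ y t) x)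
        (fun x t => S.mesh.extendFE k A (fun y => Ψ y t) x) R := by
  obtain ⟨C, hC, H⟩ := Cell.Regular.exists_blend_evaluation d k κ d
  refine ⟨2 * C, by linarith, fun S A Θ Ψ ε₀ ε₁ hdt hreg h R hR => ?_⟩
  have hε := h.nonneg
  have hle : ε₀ ≤ C * ε₀ := le_mul_of_one_le_left hε hC
  refine supBound_of_forall (ε := C * ε₀) (by linarith) (fun x hxd t ht => ?_)
    fun x hxd t ht => ?_
  · by_cases hx : x ∈ S.mesh.region A
    · simp only [Mesh.extendFE, if_pos hx]
      exact (h.value x hx t ht).trans hle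
    -- On a face shared by several inactive elements the chosen element is arbitrary, but it is the
    -- same for both maps, so their difference is the blend of one function.
    · have hex := S.mesh.mem_domain.1 hxd
      simp only [Mesh.extendFE, if_neg hx, dif_pos hex, add_sub_add_left_eq_sub]
      have E := H (Pt d) _ _ (hreg hex.choose) (S.mesh.region A) x hex.choose_spec
      rw [← E.map_sub]
      exact E.norm_le hε fun y hy => by
        rw [sub_sub_sub_cancel_right]
        exact h.value y hy t ht
  · by_cases hx : x ∈ S.mesh.region A
    · simp only [Mesh.extendFE, if_pos hx]
      obtain ⟨θ, ψ, h1, h2, h3⟩ := h.time x hx t ht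
      exact ⟨θ, ψ, h1, h2, h3.trans hle⟩
    · have hex := S.mesh.mem_domain.1 hxd
      simp only [Mesh.extendFE, if_neg hx, dif_pos hex]
      have E := H (Pt d) _ _ (hreg hex.choose) (S.mesh.region A) x hex.choose_spec
      choose! θ ψ h1 h2 h3 using fun y hy => h.time y hy t ht
      have e1 := E.hasDerivWithinAt (w := fun t y => Θ y t - y) (w' := θ) (s := S.I) (t := t)
        fun y hy => (h1 y hy).sub_const y
      have e2 := E.hasDerivWithinAt (w := fun t y => Ψ y t - y) (w' := ψ) (s := S.I) (t := t)
        fun y hy => (h2 y hy).sub_const y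
      refine ⟨_, _, e1.const_add x, e2.const_add x, ?_⟩
      rw [← E.map_sub]
      have e3 := E.norm_le (w := fun y => θ y - ψ y) (A := ε₀ / S.dt) (by positivity) fun y hy => by
        rw [le_div_iff₀ hdt, mul_comm]
        exact h3 y hy
      calc _ ≤ S.dt * (C * (ε₀ / S.dt)) := by gcongr
        _ = C * ε₀ := by field_simp

/-- Spatial derivatives of the blended extensions. -/
theorem exists_gradBound_extendFE (d k : ℕ) (κ : ℝ) : ∃ C : ℝ, 1 ≤ C ∧
    ∀ (S : Slab d) (A : Set (Fin S.mesh.card)) (Θ Ψ : Pt d → ℝ → Pt d) (ε₀ ε₁ : ℝ),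
      (∀ T, (S.mesh.cell T).Regular S.h κ) → S.RegionError A Θ Ψ ε₀ ε₁ →
      ∀ c R, 0 ≤ c → (0 < S.h → c * (C * (ε₀ / S.h + ε₁)) ≤ R) →
        S.GradBound c (fun x t => S.mesh.extendFE k A (fun y => Θ y t) x)
          (fun x t => S.mesh.extendFE k A (fun y => Ψ y t) x) R := by
  obtain ⟨C, hC, H⟩ := Cell.Regular.exists_blend_deriv d k κ d
  obtain ⟨C₁, hC₁, H₁⟩ := Cell.Regular.exists_blend_evaluation d k κ d
  obtain ⟨c₁, hc₁⟩ : ∃ c₁, c₁ = ((d : ℝ) + 1) * κ := ⟨_, rfl⟩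
  refine ⟨C * (1 + |c₁|), by nlinarith [abs_nonneg c₁],
    fun S A Θ Ψ ε₀ ε₁ hreg h c R hc hR => gradBound_of_forall fun t ht T x hx => ?_⟩
  have hh := (hreg T).pos
  have hκ := (hreg T).kappa_nonneg
  have hc₁0 : 0 ≤ c₁ := by rw [hc₁]; positivity
  have hε₀ := h.nonneg
  have hε₁ := h.nonneg'
  rw [abs_of_nonneg hc₁0] at hR
  have hq : 0 ≤ ε₀ / S.h := by positivity
  suffices hs : ∃ L L' : Pt d →L[ℝ] Pt d,
      HasFDerivAt (fun y => S.mesh.extendFE k A (fun y => Θ y t) y) L x ∧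
      HasFDerivAt (fun y => S.mesh.extendFE k A (fun y => Ψ y t) y) L' x ∧
      ‖L - L'‖ ≤ C * (1 + c₁) * (ε₀ / S.h + ε₁) by
    obtain ⟨L, L', h1, h2, h3⟩ := hs
    exact ⟨L, L', h1, h2, (mul_le_mul_of_nonneg_left h3 hc).trans (hR hh)⟩
  by_cases hT : T ∈ A
  · obtain ⟨L, L', h1, h2, h3⟩ := h.exists_hasFDerivAt hT ht hx
      (Θ' := fun y => S.mesh.extendFE k A (fun y => Θ y t) y)
      (Ψ' := fun y => S.mesh.extendFE k A (fun y => Ψ y t) y)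
      (fun y hy => by simp only [Mesh.extendFE, if_pos hy])
      (fun y hy => by simp only [Mesh.extendFE, if_pos hy])
    refine ⟨L, L', h1, h2, h3.trans ?_⟩
    have : 1 ≤ C * (1 + c₁) := by nlinarith
    calc ε₁ ≤ 1 * (ε₀ / S.h + ε₁) := by linarith
      _ ≤ _ := by gcongr
  · obtain ⟨Γ, hΓ⟩ : ∃ Γ, Γ = S.mesh.region A := ⟨_, rfl⟩
    have hext : ∀ P : Pt d → Pt d, ∀ y ∈ interior (S.mesh.elem T), S.mesh.extendFE k A P y =
        y + (S.mesh.cell T).blend k Γ (fun z => P z - z) d y := fun P y hy => by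
      -- In the interior of an element the choice is unique, so the extension is given by a single
      -- formula near `x`.
      have hex : ∃ T, y ∈ S.mesh.elem T := ⟨T, interior_subset hy⟩
      have h1 : hex.choose = T := (S.mesh.eq_of_mem_interior hy hex.choose_spec).symm
      rw [Mesh.extendFE, if_neg (Mesh.notMem_region_of_mem_interior hT hy), dif_pos hex, h1, hΓ]
    -- A face in the active region lies in a single active element `T'`, whose extended maps are
    -- composed with the projection to the face. The identity parts cancel in the difference,
    -- leaving `ε₁` times the derivative of the projection.
    have hM : ∀ τ : Finset (Fin (d + 1)), ∃ M M' : Pt d →L[ℝ] Pt d, τ.Nonempty →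
        (S.mesh.cell T).face τ ⊆ Γ →
          HasFDerivAt (fun y => Θ ((S.mesh.cell T).proj τ y) t - (S.mesh.cell T).proj τ y) M x ∧
          HasFDerivAt (fun y => Ψ ((S.mesh.cell T).proj τ y) t - (S.mesh.cell T).proj τ y) M' x ∧
          ‖M - M'‖ ≤ ε₁ * c₁ / (S.mesh.cell T).weight τ x := fun τ => by
      by_cases hτ : τ.Nonempty ∧ (S.mesh.cell T).face τ ⊆ Γ
      · obtain ⟨hτ1, hτ2⟩ := hτ
        rw [hΓ] at hτ2
        obtain ⟨T', hT', hface⟩ := S.mesh.exists_elem_of_face_subset hτ1 hτ2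
        obtain ⟨Z, hZ, hZb⟩ := (hreg T).exists_hasFDerivAt_proj hx hτ1
        have hmem : ∀ y ∈ interior (S.mesh.elem T), (S.mesh.cell T).proj τ y ∈ S.mesh.elem T' :=
          fun y hy => hface (Cell.proj_mem_face (interior_subset hy) (Cell.weight_pos hy hτ1).ne')
        obtain ⟨f, g, hfg⟩ := h.space T' hT' t ht
        obtain ⟨-, -, L, L', h1, h2, h3⟩ := hfg _ (hmem x hx)
        refine ⟨L.comp Z - Z, L'.comp Z - Z, fun _ _ => ⟨?_, ?_, ?_⟩⟩
        · refine ((h1.comp x hZ).sub hZ).congr_of_eventuallyEq ?_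
          filter_upwards [isOpen_interior.mem_nhds hx] with y hy
          rw [(hfg _ (hmem y hy)).1]
          rfl
        · refine ((h2.comp x hZ).sub hZ).congr_of_eventuallyEq ?_
          filter_upwards [isOpen_interior.mem_nhds hx] with y hy
          rw [(hfg _ (hmem y hy)).2.1]
          rfl
        · rw [sub_sub_sub_cancel_right, ← ContinuousLinearMap.sub_comp, mul_div_assoc, hc₁]
          refine (ContinuousLinearMap.opNorm_comp_le _ _).trans ?_
          gcongr
      · exact ⟨0, 0, fun h1 h2 => absurd ⟨h1, h2⟩ hτ⟩
    choose M M' hMM using hM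
    obtain ⟨w, hw⟩ : ∃ w : Pt d → Pt d, w = fun y => Θ y t - y := ⟨_, rfl⟩
    obtain ⟨w', hw'⟩ : ∃ w' : Pt d → Pt d, w' = fun y => Ψ y t - y := ⟨_, rfl⟩
    have m1 : ∀ τ : Finset (Fin (d + 1)), τ.Nonempty → (S.mesh.cell T).face τ ⊆ Γ →
        HasFDerivAt (fun y => w ((S.mesh.cell T).proj τ y)) (M τ) x := fun τ h1 h2 => by
      rw [hw]
      exact (hMM τ h1 h2).1
    have m2 : ∀ τ : Finset (Fin (d + 1)), τ.Nonempty → (S.mesh.cell T).face τ ⊆ Γ →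
        HasFDerivAt (fun y => w' ((S.mesh.cell T).proj τ y)) (M' τ) x := fun τ h1 h2 => by
      rw [hw']
      exact (hMM τ h1 h2).2.1
    obtain ⟨L₁, hL₁, -⟩ := H (Pt d) _ _ (hreg T) x hx Γ w M m1
    obtain ⟨L₂, hL₂, -⟩ := H (Pt d) _ _ (hreg T) x hx Γ w' M' m2
    obtain ⟨L₃, hL₃, hL₃b⟩ := H (Pt d) _ _ (hreg T) x hx Γ (fun y => w y - w' y)
      (fun τ => M τ - M' τ) fun τ h1 h2 => (m1 τ h1 h2).sub (m2 τ h1 h2)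
    have hL : L₁ - L₂ = L₃ := by
      refine ((hL₁.sub hL₂).congr_of_eventuallyEq ?_).unique hL₃
      filter_upwards [isOpen_interior.mem_nhds hx] with y hy
      exact (H₁ (Pt d) _ _ (hreg T) Γ y (interior_subset hy)).map_sub w w'
    refine ⟨ContinuousLinearMap.id ℝ (Pt d) + L₁, ContinuousLinearMap.id ℝ (Pt d) + L₂, ?_, ?_, ?_⟩
    · refine ((hasFDerivAt_id x).add hL₁).congr_of_eventuallyEq ?_
      filter_upwards [isOpen_interior.mem_nhds hx] with y hy
      rw [hext _ y hy, hw]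
      rfl
    · refine ((hasFDerivAt_id x).add hL₂).congr_of_eventuallyEq ?_
      filter_upwards [isOpen_interior.mem_nhds hx] with y hy
      rw [hext _ y hy, hw']
      rfl
    · rw [add_sub_add_left_eq_sub, hL]
      have h1 := hL₃b ε₀ (ε₁ * c₁) hε₀ (by positivity) (fun y hy => by
        rw [hw, hw', sub_sub_sub_cancel_right]
        exact h.value y (hΓ ▸ hy) t ht) fun τ h1 h2 => (hMM τ h1 h2).2.2
      refine h1.trans ?_
      rw [mul_assoc C]
      gcongr
      nlinarith

end RegionError

/-- The error estimates on the union of the active elements. -/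
theorem exists_regionError {qt : ℕ} (τ : Fin (qt + 1) → ℝ) (hτ : Function.Injective τ)
    (hτI : ∀ i, τ i ∈ Ioc (0 : ℝ) 1) (hqt : 1 ≤ qt) (d qs m : ℕ) (hqs : 1 ≤ qs) (hm : 1 ≤ m)
    (K : ℝ) {ρ : ℝ} (hρ : 0 < ρ) : ∃ C η : ℝ, 1 ≤ C ∧ 0 < η ∧
    ∀ (S : Slab d) (b : Pt d → ℝ → ℝ) (A : Set (Fin S.mesh.card)) (g : SearchDirection),
      0 ≤ S.err₀ qs qt → 0 ≤ S.err₁ qs qt →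
      (∀ T ∈ A, 1 ≤ K ∧ S.ActiveElem qs qt m K ρ b T) → S.h ≤ η → S.dt ^ (qt + 1) ≤ η * S.h →
      S.RegionError A (S.ΘΓ qs τ g A b) (S.ΨΓ b) (C * S.err₀ qs qt) (C * S.err₁ qs qt) := by
  by_cases hK : 1 ≤ K
  · obtain ⟨C, η, hC, hη, H⟩ := exists_element_error τ hτ hτI hqt d qs m hqs hm hK hρ
    refine ⟨C, η, hC, hη, fun S b A g e0 e1 hA hh hdt => ?_⟩
    have HA := H S b A g (fun T hT => (hA T hT).2) hh hdt
    refine ⟨by positivity, by positivity, fun x hx t ht => ?_, fun x hx t ht => ?_,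
      fun T hT t ht => ?_⟩
    · obtain ⟨T, hT, hxT⟩ := Mesh.mem_region.1 hx
      obtain ⟨Ψ, Θ, h⟩ := HA T hT
      obtain ⟨h1, h2, h3, -⟩ := h x hxT t ht
      rw [h1, h2]
      exact h3
    · obtain ⟨T, hT, hxT⟩ := Mesh.mem_region.1 hx
      obtain ⟨Ψ, Θ, h⟩ := HA T hT
      obtain ⟨h1, h2, -, ⟨θ, ψ, h3, h4, h5⟩, -⟩ := h x hxT t ht
      exact ⟨θ, ψ, h3.congr (fun s hs => (h x hxT s hs).2.1) h2,
        h4.congr (fun s hs => (h x hxT s hs).1) h1, h5⟩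
    · obtain ⟨Ψ, Θ, h⟩ := HA T hT
      refine ⟨fun y => Θ y t, fun y => Ψ y t, fun x hx => ?_⟩
      obtain ⟨h1, h2, -, -, L, L', h3, h4, h5⟩ := h x hx t ht
      exact ⟨h2, h1, L, L', h3, h4, h5⟩
  -- For `K < 1` there are no active elements, and all estimates on their union are void.
  · refine ⟨1, 1, le_rfl, one_pos, fun S b A g e0 e1 hA _ _ => ?_⟩
    have hA' : ∀ T, T ∉ A := fun T hT => hK (hA T hT).1
    have hr : ∀ x, x ∉ S.mesh.region A := fun x hx => by
      obtain ⟨T, hT, -⟩ := Mesh.mem_region.1 hx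
      exact hA' T hT
    exact ⟨by positivity, by positivity, fun x hx => absurd hx (hr x), fun x hx => absurd hx (hr x),
      fun T hT => absurd hT (hA' T)⟩

end Slab

end GlobalError

/-! ### The two kinds of blending -/

section MainTheorem

open Set

namespace Slab

theorem h_nonneg {d : ℕ} (S : Slab d) : 0 ≤ S.h :=
  Real.iSup_nonneg fun _ => Metric.diam_nonneg

theorem exists_smooth_blending_error {d qs qt : ℕ} (hd : 1 ≤ d) (hqs : 1 ≤ qs) (hqt : 1 ≤ qt)
    (τ : Fin (qt + 1) → ℝ) (hτ : Function.Injective τ) (hτI : ∀ i, τ i ∈ Set.Ioc (0 : ℝ) 1)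
    {K δΩ δU r : ℝ} (hK : 0 < K) (hδΩ : 0 < δΩ) (hδU : 0 < δU) (hr : r < min δΩ δU) {w ε : ℝ}
    (hw : 0 < w) (hwm : w < min δΩ δU) (hε : 0 < ε) :
    ∃ C η : ℝ, 0 < C ∧ 0 < η ∧ ∀ (S : Slab d) (b : Pt d → ℝ → ℝ) (g : SearchDirection),
      S.h ≤ η → S.dt ≤ η → S.dt ^ (qt + 1) ≤ K * S.h ^ (1 + ε) →
      S.GeometryAssumption (max qs qt + 2) K δΩ δU →
      S.DiscreteAssumption qs qt K δU r →
      S.BlendingAssumption (max qs qt + 2) K w b →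
      S.SupBound (S.ΘSmooth qs τ g b) (S.ΨSmooth b)
        (C * (S.h ^ (qs + 1) + S.dt ^ (qt + 1))) ∧
      S.GradBound 1 (S.ΘSmooth qs τ g b) (S.ΨSmooth b)
        (C * (S.h ^ qs + S.dt ^ (qt + 1))) := by
  obtain ⟨ρ, η₁, hρ, hη₁, H₁⟩ := exists_activeElem_of_mem_unblended hd hqs hqt
    (le_max_left qs qt) (le_max_right qs qt) hK hδΩ hδU hr hw hwm
  obtain ⟨C, η₂, hC, hη₂, H₂⟩ := exists_regionError τ hτ hτI hqt d qs (max qs qt) hqs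
    (hqs.trans (le_max_left _ _)) K hρ
  obtain ⟨θ, hθ⟩ : ∃ θ, θ = min 1 (min η₁ η₂) := ⟨_, rfl⟩
  have hθ0 : 0 < θ := by rw [hθ]; positivity
  have hθ1 : θ ≤ 1 := hθ ▸ min_le_left _ _
  have hθ2 : θ ≤ η₁ := hθ ▸ (min_le_right _ _).trans (min_le_left _ _)
  have hθ3 : θ ≤ η₂ := hθ ▸ (min_le_right _ _).trans (min_le_right _ _)
  -- The second bound on `h` gives `K h^ε ≤ θ`, so that `Δt^(qt+1) ≤ K h^(1+ε)` becomes `Δt^(qt+1) ≤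
  -- θ h`. The factor `2` accounts for the independent suprema of values and time derivatives.
  refine ⟨2 * C, min θ ((θ / K) ^ ε⁻¹), by linarith, by positivity,
    fun S b g hh hdt hdth hG hD hB => ?_⟩
  have hh0 := S.h_nonneg
  have hdt0 := dt_pos hG
  have hhθ := hh.trans (min_le_left _ _)
  have hdtθ := hdt.trans (min_le_left _ _)
  have h1 : S.dt ^ (qt + 1) ≤ θ * S.h := by
    calc S.dt ^ (qt + 1) ≤ K * S.h ^ (1 + ε) := hdth
      _ = K * S.h ^ ε * S.h := by
          rw [Real.rpow_add_of_nonneg hh0 zero_le_one hε.le, Real.rpow_one]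
          ring
      _ ≤ K * (((θ / K) ^ ε⁻¹) ^ ε) * S.h := by
          gcongr
          exact hh.trans (min_le_right _ _)
      _ = θ * S.h := by
          rw [Real.rpow_inv_rpow (by positivity) hε.ne']
          field_simp
  have h2 : S.dt ^ (qt + 1) ≤ S.h := h1.trans (mul_le_of_le_one_left hh0 hθ1)
  have hA := H₁ S b (hhθ.trans hθ2) (hdtθ.trans hθ2) h2 (h1.trans (by gcongr)) hG hD hB
  have e0 : 0 ≤ S.err₀ qs qt := by unfold err₀; positivity
  have e1 : 0 ≤ S.err₁ qs qt := by unfold err₁; positivity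
  have E := H₂ S b (S.unblended b) g e0 e1 hA (hhθ.trans hθ3) (h1.trans (by gcongr))
  refine ⟨E.supBound_extendId (le_of_eq (mul_assoc _ _ _).symm),
    E.gradBound_extendId (R := 2 * C * S.err₁ qs qt) ?_⟩
  have : 0 ≤ C * S.err₁ qs qt := by positivity
  linarith

theorem exists_fe_blending_error {d qs qt : ℕ} (hd : 1 ≤ d) (hqs : 1 ≤ qs) (hqt : 1 ≤ qt)
    (τ : Fin (qt + 1) → ℝ) (hτ : Function.Injective τ) (hτI : ∀ i, τ i ∈ Set.Ioc (0 : ℝ) 1)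
    {K δΩ δU r : ℝ} (hK : 0 < K) (hδΩ : 0 < δΩ) (hδU : 0 < δU) (hr : r < min δΩ δU) :
    ∃ C η : ℝ, 0 < C ∧ 0 < η ∧ ∀ (S : Slab d) (g : SearchDirection),
      S.h ≤ η → S.dt ≤ η → S.dt ≤ K * S.h →
      S.GeometryAssumption (qs + qt + 2) K δΩ δU →
      S.DiscreteAssumption qs qt K δU r →
      S.SupBound (S.ΘFE qs τ g) (S.ΨFE qs)
        (C * (S.h ^ (qs + 1) + S.dt ^ (qt + 1))) ∧
      S.GradBound S.h (S.ΘFE qs τ g) (S.ΨFE qs)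
        (C * (S.h ^ (qs + 1) + S.dt ^ (qt + 1))) ∧
      S.GradBound 1 (S.ΘFE qs τ g) (S.ΨFE qs)
        (C * (S.h ^ qs + S.dt ^ qt)) := by
  obtain ⟨ρ, η₁, hρ, hη₁, H₁⟩ := exists_activeElem_of_mem_cut hd hqs hqt
    (Nat.le_add_right qs qt) (Nat.le_add_left qt qs) hK hδΩ hδU hr
  obtain ⟨C, η₂, hC, hη₂, H₂⟩ := exists_regionError τ hτ hτI hqt d qs (qs + qt) hqs
    (by omega) K hρ
  obtain ⟨C₁, hC₁, HS⟩ := RegionError.exists_supBound_extendFE d qs (2 * K)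
  obtain ⟨C₂, hC₂, HG⟩ := RegionError.exists_gradBound_extendFE d qs (2 * K)
  obtain ⟨θ, hθ⟩ : ∃ θ, θ = min 1 (min η₁ η₂) := ⟨_, rfl⟩
  have hθ0 : 0 < θ := by rw [hθ]; positivity
  have hθ1 : θ ≤ 1 := hθ ▸ min_le_left _ _
  have hθ2 : θ ≤ η₁ := hθ ▸ (min_le_right _ _).trans (min_le_left _ _)
  have hθ3 : θ ≤ η₂ := hθ ▸ (min_le_right _ _).trans (min_le_right _ _)
  -- Here `Δt^(qt+1) ≤ Δt · K h ≤ θ h` because `Δt ≤ θ / K`.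
  refine ⟨C₁ * C + C₂ * C * (2 + K), min θ (θ / K), by positivity, by positivity,
    fun S g hh hdt hdth hG hD => ?_⟩
  have hh0 := S.h_nonneg
  have hdt0 := dt_pos hG
  have hhθ := hh.trans (min_le_left _ _)
  have hdtθ := hdt.trans (min_le_left _ _)
  have hh1 := hhθ.trans hθ1
  have hdt1 := hdtθ.trans hθ1
  have h1 : S.dt ^ (qt + 1) ≤ θ * S.h := by
    calc S.dt ^ (qt + 1) = S.dt ^ qt * S.dt := pow_succ _ _
      _ ≤ S.dt * (K * S.h) := by
          have := pow_le_of_le_one hdt0.le hdt1 (show qt ≠ 0 by omega)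
          gcongr
      _ ≤ θ / K * (K * S.h) := by
          gcongr
          exact hdt.trans (min_le_right _ _)
      _ = θ * S.h := by field_simp
  have h2 : S.dt ^ (qt + 1) ≤ S.h := h1.trans (mul_le_of_le_one_left hh0 hθ1)
  have hA := H₁ S (hhθ.trans hθ2) (hdtθ.trans hθ2) h2 hG hD
  have e0 : 0 ≤ S.err₀ qs qt := by unfold err₀; positivity
  have e1 : 0 ≤ S.err₁ qs qt := by unfold err₁; positivity
  have E := H₂ S _ S.cut g e0 e1 hA (hhθ.trans hθ3) (h1.trans (by gcongr))
  have hreg := regular hd hK hG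
  have p1 : 0 ≤ C₁ * C := by positivity
  have p2 : 0 ≤ C₂ * C := by positivity
  refine ⟨HS S S.cut _ _ _ _ hdt0 hreg E (_ * S.err₀ qs qt) ?_,
    HG S S.cut _ _ _ _ hreg E S.h (_ * S.err₀ qs qt) hh0 fun hh0 => ?_,
    HG S S.cut _ _ _ _ hreg E 1 _ zero_le_one fun hh0 => ?_⟩
  · have : 0 ≤ C₂ * C * (2 + K) * S.err₀ qs qt := by positivity
    linarith
  · have h3 : S.h * S.err₁ qs qt ≤ S.err₀ qs qt := by
      have h4 : S.h * S.dt ^ (qt + 1) ≤ S.dt ^ (qt + 1) := mul_le_of_le_one_left (by positivity) hh1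
      unfold err₀ err₁
      rw [mul_add, pow_succ' S.h qs]
      linarith
    calc S.h * (C₂ * (C * S.err₀ qs qt / S.h + C * S.err₁ qs qt))
        = C₂ * C * (S.err₀ qs qt + S.h * S.err₁ qs qt) := by field_simp
      _ ≤ C₂ * C * (S.err₀ qs qt + S.err₀ qs qt) := by gcongr
      _ ≤ (C₁ * C + C₂ * C * (2 + K)) * S.err₀ qs qt := by
          have : 0 ≤ C₁ * C * S.err₀ qs qt := by positivity
          have : 0 ≤ C₂ * C * K * S.err₀ qs qt := by positivity
          linarith
  · obtain ⟨e, he⟩ : ∃ e, e = S.h ^ qs + S.dt ^ qt := ⟨_, rfl⟩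
    have he0 : 0 ≤ e := by rw [he]; positivity
    have h3 : S.err₁ qs qt ≤ e := by
      rw [he]
      unfold err₁
      have := pow_le_pow_of_le_one hdt0.le hdt1 (Nat.le_succ qt)
      gcongr
    -- The division by `h` from the blending: `Δt^(qt+1) / h ≤ K Δt^qt` by `Δt ≤ K h`. This is the
    -- loss of one order in time.
    have h4 : S.err₀ qs qt / S.h ≤ (1 + K) * e := by
      rw [div_le_iff₀ hh0, he]
      unfold err₀
      have h5 : S.dt ^ (qt + 1) ≤ S.dt ^ qt * (K * S.h) := by
        rw [pow_succ]
        gcongr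
      have h6 : 0 ≤ K * S.h ^ qs * S.h := by positivity
      have h7 : 0 ≤ S.dt ^ qt * S.h := by positivity
      rw [pow_succ]
      linarith
    rw [← he]
    calc 1 * (C₂ * (C * S.err₀ qs qt / S.h + C * S.err₁ qs qt))
        = C₂ * C * (S.err₀ qs qt / S.h + S.err₁ qs qt) := by ring
      _ ≤ C₂ * C * ((1 + K) * e + e) := by gcongr
      _ ≤ (C₁ * C + C₂ * C * (2 + K)) * e := by
          have : 0 ≤ C₁ * C * e := by positivity
          linarith

end Slab

end MainTheorem

theorem mainTheorem1 (d qs qt : ℕ) (hd : 1 ≤ d) (hqs : 1 ≤ qs) (hqt : 1 ≤ qt)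
    (τ : Fin (qt + 1) → ℝ) (hτ : Function.Injective τ) (hτI : ∀ i, τ i ∈ Set.Ioc (0 : ℝ) 1)
    (K δΩ δU r : ℝ) (hK : 0 < K) (hδΩ : 0 < δΩ) (hδU : 0 < δU) (hr : r < min δΩ δU) :
    -- smooth blending
    (∀ w ε : ℝ, 0 < w → w < min δΩ δU → 0 < ε →
      ∃ C η : ℝ, 0 < C ∧ 0 < η ∧ ∀ (S : Slab d) (b : Pt d → ℝ → ℝ) (g : SearchDirection),
        S.h ≤ η → S.dt ≤ η → S.dt ^ (qt + 1) ≤ K * S.h ^ (1 + ε) →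
        S.GeometryAssumption (max qs qt + 2) K δΩ δU →
        S.DiscreteAssumption qs qt K δU r →
        S.BlendingAssumption (max qs qt + 2) K w b →
        S.SupBound (S.ΘSmooth qs τ g b) (S.ΨSmooth b)
          (C * (S.h ^ (qs + 1) + S.dt ^ (qt + 1))) ∧
        S.GradBound 1 (S.ΘSmooth qs τ g b) (S.ΨSmooth b)
          (C * (S.h ^ qs + S.dt ^ (qt + 1)))) ∧
    -- finite element blending
    (∃ C η : ℝ, 0 < C ∧ 0 < η ∧ ∀ (S : Slab d) (g : SearchDirection),
        S.h ≤ η → S.dt ≤ η → S.dt ≤ K * S.h →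
        S.GeometryAssumption (qs + qt + 2) K δΩ δU →
        S.DiscreteAssumption qs qt K δU r →
        S.SupBound (S.ΘFE qs τ g) (S.ΨFE qs)
          (C * (S.h ^ (qs + 1) + S.dt ^ (qt + 1))) ∧
        S.GradBound S.h (S.ΘFE qs τ g) (S.ΨFE qs)
          (C * (S.h ^ (qs + 1) + S.dt ^ (qt + 1))) ∧
        S.GradBound 1 (S.ΘFE qs τ g) (S.ΨFE qs)
          (C * (S.h ^ qs + S.dt ^ qt))) := by
  exact ⟨fun w ε hw hwm hε =>
    Slab.exists_smooth_blending_error hd hqs hqt τ hτ hτI hK hδΩ hδU hr hw hwm hε,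
    Slab.exists_fe_blending_error hd hqs hqt τ hτ hτI hK hδΩ hδU hr⟩
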